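/- Let $n\ge 1$ ($n=d-1$), write $x'\in\mathbb R^{n}$, $y\ge 0$, $\mathbb R^d_+=\mathbb R^{n}\times(0,\infty)$, let $\nabla_h$, $\nabla_h\cdot$ be the gradient and divergence in $x'$, and for a function $f(x',y)$ or $f(t,x',y)$ put $\|f\|(y)$, resp. $\|f\|(t,y)$, for its $L^2(\mathbb R^{n},dx')$ norm at fixed $y$, resp. $(t,y)$. Let $$\|f\|_{H^{m,k}}=\Big(\sum_{|\alpha|\le m,\,0\le i\le k}\|\partial_{x'}^\alpha\partial_y^i f\|_{L^2(\mathbb R^d_+)}^2\Big)^{1/2}$$ with weak derivatives. There are functions $M_0,M_1:[0,\infty)\to(0,\infty)$, depending only on $n$, such that the following holds. Let $U_h\in W^{2,\infty}(\mathbb R_+;\mathbb R^{n})$ (with its $C^1$ representative), and let $(u_h,u_d,\theta)$ be a classical solution (all functions and derivatives occurring in the equations exist and are continuous on $t\ge0$, $x'\in\mathbb R^{n}$, $y\ge0$), with $\theta\in L^2((0,T)\times\mathbb R^d_+)$ for every $T>0$, of $$\begin{cases}\partial_t u_h+(U_h(y)\cdot\nabla_h) u_h+u_d\,U_h'(y)=0,\\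 \partial_t\theta+U_h(y)\cdot\nabla_h\theta=\partial_y^2\theta,\\ \nabla_h\cdot u_h+\partial_y u_d=\partial_y^2\theta,\\ (u_d,\theta)|_{y=0}=0,\qquad (u_h,\theta)|_{t=0}=(u_{h0},\theta_0),\end{cases}$$ where the data satisfy the compatibility conditions $\theta_0|_{y=0}=0$, $(\partial_y^2\theta_0-U_h\cdot\nabla_h\theta_0)|_{y=0}=0$, and all norms and integrals of $\theta_0$ and $u_{h0}$ appearing below are finite (for every $y\ge0$). Write $M_0=M_0(\|U_h\|_{L^\infty(\mathbb R_+)})$ and $M_1=M_1(\|U_h\|_{W^{2,\infty}(\mathbb R_+)})$. Then for all $t\ge 0$ $$\|\theta(t,\cdot)\|_{L^2(\mathbb R^d_+)}\le\|\theta_0\|_{L^2(\mathbb R^d_+)},\qquad \|\nabla_h\theta(t,\cdot)\|_{L^2(\mathbb R^d_+)}\le\|\nabla_h\theta_0\|_{L^2(\mathbb R^d_+)},$$ both left-hand sides are non-increasing in $t$, and for all $t\ge0$, $y\ge0$ $$\begin{aligned} \|\theta\|(t,y)+\|\theta_y\|(t,y)&\le M_0\big(\|\theta_0\|_{H^{1,0}}+\|\theta_0\|_{H^{0,2}}\big),\\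 \|\nabla_h\theta\|(t,y)&\le M_0\big(\|\theta_0\|_{H^{2,0}}+\|\theta_0\|_{H^{1,2}}\big),\\ \|\partial_y^2\theta\|(t,y)&\le M_1\big(\|\theta_0\|_{H^{2,0}}+\|\theta_0\|_{H^{1,2}}+\|\theta_0\|_{H^{0,4}}\big),\\ \|u_h\|(t,y)&\le\|u_{h0}\|(y)+t|U_h'(y)|\int_0^y\|\nabla_h\cdot u_{h0}\|(z)\,dz+2\|\theta_0\|_{L^2(\mathbb R^d_+)}\big|\sqrt y\,U_h'(y)\big|,\\ \|u_d\|(t,y)&\le\int_0^y\|\nabla_h\cdot u_{h0}\|(z)\,dz+t\int_0^y|U_h(y)-U_h(z)|\,\|\nabla_h(\nabla_h\cdot u_{h0})\|(z)\,dz\\ &\quad+2\|\nabla_h\theta_0\|_{L^2(\mathbb R^d_+)}\Big(\int_0^y|U_h(y)-U_h(z)|^2dz\Big)^{1/2}+M_0\big(\|\theta_0\|_{H^{1,0}}+\|\theta_0\|_{H^{0,2}}\big). \end{aligned}$$ -/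

import Mathlib

open MeasureTheory Set
open scoped ENNReal NNReal ContDiff

noncomputable section

namespace ThermalLayer

/-- The tangential space `ℝⁿ`, `n = d - 1`, with its Euclidean norm. -/
abbrev Tan (n : ℕ) : Type := EuclideanSpace ℝ (Fin n)

variable {n : ℕ} {F : Type*} [NormedAddCommGroup F] [NormedSpace ℝ F]

/-! ### Domains -/

/-- The open half space `ℝ^d_+ = ℝⁿ × (0, ∞)`. -/
def halfSpace (n : ℕ) : Set (Tan n × ℝ) := univ ×ˢ Ioi 0

/-- The closed space-time domain `[0, ∞) × ℝⁿ × [0, ∞)`. -/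
def closedDomain (n : ℕ) : Set (ℝ × Tan n × ℝ) := Ici 0 ×ˢ univ ×ˢ Ici 0

/-- Continuity, on the closed space-time domain, of a function written in curried form. -/
def ContOnDomain {G : Type*} [TopologicalSpace G] (f : ℝ → Tan n → ℝ → G) : Prop :=
  ContinuousOn (fun p : ℝ × Tan n × ℝ => f p.1 p.2.1 p.2.2) (closedDomain n)

/-! ### Classical derivatives (one-sided at `t = 0` and at `y = 0`) -/

/-- The time derivative. -/
def dT (f : ℝ → Tan n → ℝ → F) (t : ℝ) (x : Tan n) (y : ℝ) : F :=
  derivWithin (fun s => f s x y) (Ici 0) t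

/-- The normal derivative `∂_y`. -/
def dY (f : Tan n → ℝ → F) (x : Tan n) (y : ℝ) : F :=
  derivWithin (fun z => f x z) (Ici 0) y

/-- The full tangential derivative (Jacobian in `x'`). -/
def dX (f : Tan n → ℝ → F) (x : Tan n) (y : ℝ) : Tan n →L[ℝ] F :=
  fderiv ℝ (fun x' => f x' y) x

/-- The tangential gradient `∇_h f` of a scalar function. -/
def gradH (f : Tan n → ℝ → ℝ) (x : Tan n) (y : ℝ) : Tan n :=
  gradient (fun x' => f x' y) x

/-- The tangential divergence `∇_h · u`. -/
def divH (u : Tan n → ℝ → Tan n) (x : Tan n) (y : ℝ) : ℝ :=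
  ∑ j : Fin n, (dX u x y (EuclideanSpace.single j 1)) j

/-- The derivative `U_h'` of the shear profile. -/
def dU (U : ℝ → Tan n) (y : ℝ) : Tan n := derivWithin U (Ici 0) y

/-! ### The linearized problem -/

/-- `(u, v, θ)`, standing for `(u_h, u_d, θ)`, is a classical solution, of finite energy, of the
linearized thermal layer problem at the shear flow `(U, 0, 1)` with initial data `(u₀, θ₀)`:
the functions and all derivatives that occur in the equations exist and are continuous on the
closed domain `t ≥ 0`, `x' ∈ ℝⁿ`, `y ≥ 0`, and `θ` is square integrable on `(0, T) × ℝ^d_+`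
for every `T`. -/
structure IsSolution (U : ℝ → Tan n) (u₀ : Tan n → ℝ → Tan n) (θ₀ : Tan n → ℝ → ℝ)
    (u : ℝ → Tan n → ℝ → Tan n) (v θ : ℝ → Tan n → ℝ → ℝ) : Prop where
  -- regularity of `u_h`
  u_cont : ContOnDomain u
  u_diff_t : ∀ t, 0 ≤ t → ∀ x y, 0 ≤ y →
    DifferentiableWithinAt ℝ (fun s => u s x y) (Ici 0) t
  u_diff_x : ∀ t, 0 ≤ t → ∀ x y, 0 ≤ y → DifferentiableAt ℝ (fun x' => u t x' y) x
  u_cont_t : ContOnDomain (dT u)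
  u_cont_x : ContOnDomain (fun t => dX (u t))
  -- regularity of `u_d`
  v_cont : ContOnDomain v
  v_diff_y : ∀ t, 0 ≤ t → ∀ x y, 0 ≤ y →
    DifferentiableWithinAt ℝ (fun z => v t x z) (Ici 0) y
  v_cont_y : ContOnDomain (fun t => dY (v t))
  -- regularity of `θ`
  θ_cont : ContOnDomain θ
  θ_diff_t : ∀ t, 0 ≤ t → ∀ x y, 0 ≤ y →
    DifferentiableWithinAt ℝ (fun s => θ s x y) (Ici 0) t
  θ_diff_x : ∀ t, 0 ≤ t → ∀ x y, 0 ≤ y → DifferentiableAt ℝ (fun x' => θ t x' y) x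
  θ_diff_y : ∀ t, 0 ≤ t → ∀ x y, 0 ≤ y →
    DifferentiableWithinAt ℝ (fun z => θ t x z) (Ici 0) y
  θ_diff_yy : ∀ t, 0 ≤ t → ∀ x y, 0 ≤ y →
    DifferentiableWithinAt ℝ (fun z => dY (θ t) x z) (Ici 0) y
  θ_cont_t : ContOnDomain (dT θ)
  θ_cont_x : ContOnDomain (fun t => dX (θ t))
  θ_cont_y : ContOnDomain (fun t => dY (θ t))
  θ_cont_yy : ContOnDomain (fun t => dY (dY (θ t)))
  -- finite energy
  θ_energy : ∀ T : ℝ, MemLp (fun p : ℝ × Tan n × ℝ => θ p.1 p.2.1 p.2.2) 2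
    (volume.restrict (Ioo 0 T ×ˢ halfSpace n))
  -- the three equations
  eq_u : ∀ t, 0 ≤ t → ∀ x y, 0 ≤ y →
    dT u t x y + dX (u t) x y (U y) + v t x y • dU U y = 0
  eq_θ : ∀ t, 0 ≤ t → ∀ x y, 0 ≤ y →
    dT θ t x y + dX (θ t) x y (U y) = dY (dY (θ t)) x y
  eq_div : ∀ t, 0 ≤ t → ∀ x y, 0 ≤ y →
    divH (u t) x y + dY (v t) x y = dY (dY (θ t)) x y
  -- boundary and initial conditions
  v_bdry : ∀ t, 0 ≤ t → ∀ x, v t x 0 = 0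
  θ_bdry : ∀ t, 0 ≤ t → ∀ x, θ t x 0 = 0
  u_init : ∀ x y, 0 ≤ y → u 0 x y = u₀ x y
  θ_init : ∀ x y, 0 ≤ y → θ 0 x y = θ₀ x y

/-- The compatibility conditions, of order zero and one, at the corner `t = 0`, `y = 0`. -/
def Compatible (U : ℝ → Tan n) (θ₀ : Tan n → ℝ → ℝ) : Prop :=
  ∀ x, θ₀ x 0 = 0 ∧ dY (dY θ₀) x 0 - dX θ₀ x 0 (U 0) = 0

/-! ### Lebesgue norms, with values in `[0, ∞]` -/

/-- `‖f‖_{L²(ℝ^d_+)}`. -/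
def normL2 (f : Tan n → ℝ → F) : ℝ≥0∞ :=
  eLpNorm (fun p : Tan n × ℝ => f p.1 p.2) 2 (volume.restrict (halfSpace n))

/-- `‖f‖(y) = (∫_{ℝⁿ} |f(x', y)|² dx')^{1/2}`. -/
def sliceNorm (f : Tan n → ℝ → F) (y : ℝ) : ℝ≥0∞ :=
  eLpNorm (fun x => f x y) 2 volume

/-- `‖U‖_{L^∞(ℝ_+)}`. -/
def normLinf (U : ℝ → F) : ℝ≥0∞ := eLpNorm U ⊤ (volume.restrict (Ioi 0))

/-! ### Weak derivatives and Sobolev norms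

The norm of a weak derivative is written as an infimum over all weak derivatives; these agree almost
everywhere, so this is the norm of the weak derivative if there is one, and `∞` otherwise. -/

/-- `g` is the `k`-th weak derivative of `f` on `(0, ∞)`. -/
def IsWeakDeriv (k : ℕ) (f g : ℝ → F) : Prop :=
  LocallyIntegrableOn f (Ioi 0) ∧ LocallyIntegrableOn g (Ioi 0) ∧
  ∀ φ : ℝ → ℝ, ContDiff ℝ ∞ φ → HasCompactSupport φ → tsupport φ ⊆ Ioi 0 →
    ∫ y in Ioi 0, iteratedDeriv k φ y • f y = (-1 : ℝ) ^ k • ∫ y in Ioi 0, φ y • g y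

/-- `‖U‖_{W^{2,∞}(ℝ_+)}`. -/
def normW2inf (U : ℝ → F) : ℝ≥0∞ :=
  ∑ k ∈ Finset.range 3, ⨅ (g : ℝ → F) (_ : IsWeakDeriv k U g), normLinf g

/-- `∂_{x_j} φ` for a smooth function on `ℝⁿ × ℝ`. -/
def testDX (j : Fin n) (φ : Tan n × ℝ → ℝ) : Tan n × ℝ → ℝ :=
  fun p => fderiv ℝ φ p (EuclideanSpace.single j 1, 0)

/-- `∂_y φ` for a smooth function on `ℝⁿ × ℝ`. -/
def testDY (φ : Tan n × ℝ → ℝ) : Tan n × ℝ → ℝ :=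
  fun p => fderiv ℝ φ p (0, 1)

/-- `∂_{x'}^α ∂_y^i φ` for a smooth function on `ℝⁿ × ℝ`. -/
def testDeriv (α : Fin n → ℕ) (i : ℕ) (φ : Tan n × ℝ → ℝ) : Tan n × ℝ → ℝ :=
  (List.finRange n).foldr (fun j ψ => (testDX j)^[α j] ψ) (testDY^[i] φ)

/-- `g` is the weak derivative `∂_{x'}^α ∂_y^i f` on the open half space. -/
def IsWeakPartial (α : Fin n → ℕ) (i : ℕ) (f g : Tan n × ℝ → ℝ) : Prop :=
  LocallyIntegrableOn f (halfSpace n) ∧ LocallyIntegrableOn g (halfSpace n) ∧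
  ∀ φ : Tan n × ℝ → ℝ, ContDiff ℝ ∞ φ → HasCompactSupport φ → tsupport φ ⊆ halfSpace n →
    ∫ p in halfSpace n, f p * testDeriv α i φ p =
      (-1 : ℝ) ^ (∑ j, α j + i) * ∫ p in halfSpace n, g p * φ p

/-- `‖∂_{x'}^α ∂_y^i f‖_{L²(ℝ^d_+)}`. -/
def weakPartialNorm (α : Fin n → ℕ) (i : ℕ) (f : Tan n → ℝ → ℝ) : ℝ≥0∞ :=
  ⨅ (g : Tan n × ℝ → ℝ) (_ : IsWeakPartial α i (fun p => f p.1 p.2) g),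
    eLpNorm g 2 (volume.restrict (halfSpace n))

/-- The anisotropic Sobolev norm `‖f‖_{H^{m,k}}`: all `∂_{x'}^α ∂_y^i f` with `|α| ≤ m`, `i ≤ k`. -/
def normH (m k : ℕ) (f : Tan n → ℝ → ℝ) : ℝ≥0∞ :=
  (∑ l ∈ Finset.range (m + 1), ∑ α ∈ Finset.piAntidiag (Finset.univ : Finset (Fin n)) l,
    ∑ i ∈ Finset.range (k + 1), weakPartialNorm α i f ^ 2) ^ (1 / 2 : ℝ)

/-- `G` is the weak gradient of `f` on `ℝⁿ`. -/
def IsWeakGrad (f : Tan n → ℝ) (G : Tan n → Tan n) : Prop :=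
  LocallyIntegrable f ∧ LocallyIntegrable G ∧
  ∀ φ : Tan n → ℝ, ContDiff ℝ ∞ φ → HasCompactSupport φ →
    ∫ x, f x • gradient φ x = - ∫ x, φ x • G x

/-- `‖∇_h f‖(y)`, with the weak gradient of `f(·, y)`. -/
def sliceGradNorm (f : Tan n → ℝ → ℝ) (y : ℝ) : ℝ≥0∞ :=
  ⨅ (G : Tan n → Tan n) (_ : IsWeakGrad (fun x => f x y) G), eLpNorm G 2 volume

/-! ### Quantities of the data that occur in the estimates of the velocity -/

/-- `∫_0^y ‖∇_h · u₀‖(z) dz`. -/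
def divIntegral (u₀ : Tan n → ℝ → Tan n) (y : ℝ) : ℝ≥0∞ :=
  ∫⁻ z in Ioo 0 y, sliceNorm (divH u₀) z

/-- `∫_0^y |U(y) - U(z)| ‖∇_h (∇_h · u₀)‖(z) dz`. -/
def gradDivIntegral (U : ℝ → Tan n) (u₀ : Tan n → ℝ → Tan n) (y : ℝ) : ℝ≥0∞ :=
  ∫⁻ z in Ioo 0 y, ‖U y - U z‖ₑ * sliceGradNorm (divH u₀) z

/-- `(∫_0^y |U(y) - U(z)|² dz)^{1/2}`. -/
def oscIntegral (U : ℝ → Tan n) (y : ℝ) : ℝ≥0∞ :=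
  (∫⁻ z in Ioo 0 y, ‖U y - U z‖ₑ ^ 2) ^ (1 / 2 : ℝ)

/-- All norms of the initial data that occur in the estimates are finite. -/
structure FiniteData (U : ℝ → Tan n) (u₀ : Tan n → ℝ → Tan n) (θ₀ : Tan n → ℝ → ℝ) : Prop where
  θ₀_H20 : normH 2 0 θ₀ < ⊤
  θ₀_H12 : normH 1 2 θ₀ < ⊤
  θ₀_H04 : normH 0 4 θ₀ < ⊤
  u₀_slice : ∀ y, 0 ≤ y → sliceNorm u₀ y < ⊤
  u₀_div : ∀ y, 0 ≤ y → divIntegral u₀ y < ⊤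
  u₀_gradDiv : ∀ y, 0 ≤ y → gradDivIntegral U u₀ y < ⊤

end ThermalLayer

end

noncomputable section

namespace ThermalLayer

/-! ### Measure-theoretic tools: Minkowski, Fatou, Fubini, and translations of the half space. -/

section

/-! ### Integral inequalities -/

section Tools

/-! The temperature equation does not see the velocity, and its coefficient depends on y alone. So
translates of a solution in t and in x' are again solutions, and so are their differences. All
bounds on θ come from one energy inequality applied to such differences. Derivatives are reached
through difference quotients and Fatou's lemma, because a classical solution need not have more
derivatives than the equation mentions.

Energy. After multiplication by 2w and a cutoff, transport is skew and diffusion has a good sign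
(`Reg.energy_le`); the cutoff errors cost an arbitrarily small multiple `lam` of the space-time
energy. Letting `lam` tend to zero gives monotone norms (`Reg.normL2_antitone`). Applied to w -
w(0), the inequality with source gives ‖w(r) - w(0)‖ ≤ 3r‖f‖, where f = ∂_y² w(0) - U·∇w(0) is the
initial rate (`Sol.initialIncrement`). Monotonicity carries this to all times and bounds ∂_t w; the
equation then bounds ∂_y² w. Cubic weights represent g(y) and g'(y) by g and g'' in a layer above y,
which turns these bounds into bounds on slices (`sliceNorm_le_of_repr`).

Second order. A slice bound for ∂_y² θ needs one for ∂_t θ, formally a solution with initial value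
f. This f vanishes on the boundary by compatibility, but two further derivatives of it exist only
weakly. It is approximated by smooth F_k whose boundary values tend to zero (`Datum.rateApprox`).
The energy inequality for θ - θ₀ - tF_k gives a remainder of order T² (`Sol.normL2_remainder_le`),
hence second time differences of order r², and a time average of first differences gives the slice
of ∂_t θ (`Sol.sliceNorm_wt_le`).

Weak against classical. The data are measured by weak derivatives. Convolution with kernels
supported in y < 0 only looks into the half space, so weak derivatives bound the mollified ones
without boundary terms (`IsKernel.nrm_testDeriv_le`), and limits bound the classical ones.

Velocity. Along characteristics u(t) = u₀(x' - tU) - U' η, where η(t) = ∫₀ᵗ v(s, x' - (t-s)U) ds. A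
direct estimate of v would lose a tangential derivative. But ∂_y² θ is the material derivative of θ,
and the terms with U'·∇v cancel in ∂_y η, leaving ∂_y η = θ(t) - θ₀(x' - tU) - t(∇·u₀)(x' - tU)
(`Vel.integral_layer`). This gives the bound on u. For v = ∂_y θ(y) - ∂_y θ(0) - ∫₀^y ∇·u, an
integration by parts in y turns U'(z)·∇∫₀^z into (U(y) - U(z))·∇, so the gradient falls on θ and on
∇·u₀ (`Vel.pairing_v`). These identities are proved against test functions in x', since ∇v need not
exist, and norms are recovered by duality (`eLpNorm_le_of_pairing`). -/

theorem eLpNorm_two_sq {α F : Type*} [MeasurableSpace α] [NormedAddCommGroup F] (f : α → F)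
    (μ : Measure α) : eLpNorm f 2 μ ^ 2 = ∫⁻ x, ‖f x‖ₑ ^ 2 ∂μ := by
  have h := eLpNorm_nnreal_pow_eq_lintegral (f := f) (μ := μ) (p := 2) two_ne_zero
  simpa using h

theorem eLpNorm_two_le_iff {α F : Type*} [MeasurableSpace α] [NormedAddCommGroup F] (f : α → F)
    (μ : Measure α) (C : ℝ≥0∞) : eLpNorm f 2 μ ≤ C ↔ ∫⁻ x, ‖f x‖ₑ ^ 2 ∂μ ≤ C ^ 2 := by
  rw [← eLpNorm_two_sq]
  exact (ENNReal.pow_le_pow_left_iff two_ne_zero).symm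

theorem sq_lintegral_mul_le {α : Type*} [MeasurableSpace α] (μ : Measure α) {f g : α → ℝ≥0∞}
    (hf : AEMeasurable f μ) (hg : AEMeasurable g μ) :
    (∫⁻ a, f a * g a ∂μ) ^ 2 ≤ (∫⁻ a, f a ^ 2 ∂μ) * ∫⁻ a, g a ^ 2 ∂μ := by
  have h := ENNReal.lintegral_mul_le_Lp_mul_Lq μ Real.HolderConjugate.two_two hf hg
  have h2 := pow_le_pow_left' h 2
  refine h2.trans (le_of_eq ?_)
  rw [mul_pow, ← ENNReal.rpow_natCast, ← ENNReal.rpow_natCast, ← ENNReal.rpow_mul,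
    ← ENNReal.rpow_mul]
  simp

/-- The weight is split into two square roots before Cauchy–Schwarz. In this form a kernel enters
only through its mass. -/
theorem sq_lintegral_weight_le {α : Type*} [MeasurableSpace α] (μ : Measure α) {k g : α → ℝ≥0∞}
    (hk : AEMeasurable k μ) (hg : AEMeasurable g μ) :
    (∫⁻ a, k a * g a ∂μ) ^ 2 ≤ (∫⁻ a, k a ∂μ) * ∫⁻ a, k a * g a ^ 2 ∂μ := by
  have hs : ∀ x : ℝ≥0∞, (x ^ (1 / 2 : ℝ)) ^ 2 = x := fun x => by
    rw [← ENNReal.rpow_natCast, ← ENNReal.rpow_mul]; simp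
  have h := sq_lintegral_mul_le μ (f := fun a => k a ^ (1 / 2 : ℝ))
    (g := fun a => k a ^ (1 / 2 : ℝ) * g a) (hk.pow_const _) ((hk.pow_const _).mul hg)
  simp only [mul_pow, hs, ← mul_assoc, ← sq] at h
  exact h

/-- Minkowski's integral inequality in `L²`, with a uniform bound on the slices. -/
theorem eLpNorm_integral_le {Y P F : Type*} [MeasurableSpace Y] [MeasurableSpace P]
    [NormedAddCommGroup F] [NormedSpace ℝ F] {ν : Measure Y} {μ : Measure P} [SFinite ν] [SFinite μ]
    {κ : Y → ℝ} {G : Y → P → F} (hκ : AEStronglyMeasurable κ ν)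
    (hG : AEStronglyMeasurable (Function.uncurry G) (ν.prod μ)) {N : ℝ≥0∞}
    (hN : ∀ᵐ y ∂ν, κ y ≠ 0 → eLpNorm (G y) 2 μ ≤ N) :
    eLpNorm (fun p => ∫ y, κ y • G y p ∂ν) 2 μ ≤ (∫⁻ y, ‖κ y‖ₑ ∂ν) * N := by
  rw [eLpNorm_two_le_iff]
  have hGe : AEMeasurable (fun z : Y × P => ‖κ z.1‖ₑ * ‖G z.1 z.2‖ₑ ^ 2) (ν.prod μ) :=
    (hκ.comp_fst.enorm).mul (hG.enorm.pow_const 2)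
  have hsec : ∀ᵐ p ∂μ, AEMeasurable (fun y => ‖G y p‖ₑ) ν := by
    have h2 : AEStronglyMeasurable (fun z : P × Y => G z.2 z.1) (μ.prod ν) := hG.prod_swap
    filter_upwards [h2.prodMk_left] with p hp using hp.enorm
  calc ∫⁻ p, ‖∫ y, κ y • G y p ∂ν‖ₑ ^ 2 ∂μ
      ≤ ∫⁻ p, (∫⁻ y, ‖κ y‖ₑ ∂ν) * ∫⁻ y, ‖κ y‖ₑ * ‖G y p‖ₑ ^ 2 ∂ν ∂μ := by
        refine lintegral_mono_ae ?_
        filter_upwards [hsec] with p hp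
        refine le_trans ?_ (sq_lintegral_weight_le ν hκ.enorm hp)
        -- No integrability is needed: a divergent Bochner integral has the default value 0, which
        -- only helps.
        refine pow_le_pow_left' ((enorm_integral_le_lintegral_enorm _).trans ?_) 2
        simp [enorm_smul]
    _ = (∫⁻ y, ‖κ y‖ₑ ∂ν) * ∫⁻ p, ∫⁻ y, ‖κ y‖ₑ * ‖G y p‖ₑ ^ 2 ∂ν ∂μ := by
        rw [lintegral_const_mul'']
        exact hGe.prod_swap.lintegral_prod_right'
    _ = (∫⁻ y, ‖κ y‖ₑ ∂ν) * ∫⁻ y, ‖κ y‖ₑ * ∫⁻ p, ‖G y p‖ₑ ^ 2 ∂μ ∂ν := by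
        rw [lintegral_lintegral_swap (by exact hGe.prod_swap)]
        congr 1
        refine lintegral_congr_ae ?_
        filter_upwards [hG.prodMk_left] with y hy
        exact lintegral_const_mul'' _ (hy.enorm.pow_const 2)
    _ ≤ (∫⁻ y, ‖κ y‖ₑ ∂ν) * ∫⁻ y, ‖κ y‖ₑ * N ^ 2 ∂ν := by
        refine mul_le_mul_right (lintegral_mono_ae ?_) _
        filter_upwards [hN] with y hy
        -- The slice bound is assumed only where the kernel is nonzero; elsewhere both sides vanish.
        -- Kernels with restricted support rely on this.
        by_cases h0 : κ y = 0
        · simp [h0]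
        · gcongr
          exact (eLpNorm_two_le_iff _ _ _).1 (hy h0)
    _ = ((∫⁻ y, ‖κ y‖ₑ ∂ν) * N) ^ 2 := by
        rw [lintegral_mul_const'' _ hκ.enorm]; ring

/-- Fatou's lemma for `L²` norms. -/
theorem eLpNorm_le_of_tendsto {α F : Type*} [MeasurableSpace α] [NormedAddCommGroup F]
    {μ : Measure α} {f : ℕ → α → F} {g : α → F} {C : ℝ≥0∞}
    (hf : ∀ k, AEStronglyMeasurable (f k) μ)
    (hlim : ∀ᵐ x ∂μ, Filter.Tendsto (fun k => f k x) Filter.atTop (nhds (g x)))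
    (hC : ∀ k, eLpNorm (f k) 2 μ ≤ C) : eLpNorm g 2 μ ≤ C := by
  refine (Lp.eLpNorm_lim_le_liminf_eLpNorm hf g hlim).trans ?_
  exact Filter.liminf_le_of_le (by isBoundedDefault)
    (fun b hb => by obtain ⟨k, hk⟩ := hb.exists; exact hk.trans (hC k))

/-- A version of Fatou's lemma with bounds that converge. -/
theorem eLpNorm_le_of_tendsto' {α F : Type*} [MeasurableSpace α] [NormedAddCommGroup F]
    {μ : Measure α} {f : ℕ → α → F} {g : α → F} {c : ℕ → ℝ≥0∞} {C : ℝ≥0∞}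
    (hf : ∀ k, AEStronglyMeasurable (f k) μ)
    (hlim : ∀ᵐ x ∂μ, Filter.Tendsto (fun k => f k x) Filter.atTop (nhds (g x)))
    (hc : ∀ k, eLpNorm (f k) 2 μ ≤ c k) (hcC : Filter.Tendsto c Filter.atTop (nhds C)) :
    eLpNorm g 2 μ ≤ C := by
  refine (Lp.eLpNorm_lim_le_liminf_eLpNorm hf g hlim).trans ?_
  rw [← hcC.liminf_eq]
  exact Filter.liminf_le_liminf (Filter.Eventually.of_forall hc)

/-! ### Fubini's theorem for continuous functions with compact support in the first variable -/

theorem integrable_prod_of_compact {X E : Type*} [TopologicalSpace X]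
    [SecondCountableTopology X] [T2Space X]
    [MeasurableSpace X] [BorelSpace X] {μ : Measure X} [SFinite μ] [IsFiniteMeasureOnCompacts μ]
    [NormedAddCommGroup E] {K : Set X} (hK : IsCompact K) {a b : ℝ}
    {G : X → ℝ → E} (hG : Continuous (Function.uncurry G))
    (hsupp : ∀ x, x ∉ K → ∀ s ∈ uIcc a b, G x s = 0) :
    Integrable (Function.uncurry G) (μ.prod (volume.restrict (uIoc a b))) := by
  have h1 : IntegrableOn (Function.uncurry G) (K ×ˢ uIcc a b) (μ.prod volume) :=
    hG.continuousOn.integrableOn_compact (hK.prod isCompact_uIcc)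
  have h2 : IntegrableOn (Function.uncurry G) (K ×ˢ uIoc a b) (μ.prod volume) :=
    h1.mono_set (prod_mono_right uIoc_subset_uIcc)
  have h3 : IntegrableOn (Function.uncurry G) (univ ×ˢ uIoc a b) (μ.prod volume) := by
    have hm : MeasurableSet ((univ : Set X) ×ˢ uIoc a b) :=
      MeasurableSet.univ.prod measurableSet_uIoc
    refine h2.of_forall_sdiff_eq_zero hm ?_
    rintro ⟨x, s⟩ ⟨⟨-, hs⟩, hn⟩
    refine hsupp x (fun hx => hn ⟨hx, hs⟩) s (uIoc_subset_uIcc hs)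
  rw [IntegrableOn, ← Measure.prod_restrict, Measure.restrict_univ] at h3
  exact h3

theorem integral_interval_swap {X E : Type*} [TopologicalSpace X]
    [SecondCountableTopology X] [T2Space X]
    [MeasurableSpace X] [BorelSpace X] {μ : Measure X} [SFinite μ] [IsFiniteMeasureOnCompacts μ]
    [NormedAddCommGroup E] [NormedSpace ℝ E] {K : Set X} (hK : IsCompact K) {a b : ℝ}
    {G : X → ℝ → E} (hG : Continuous (Function.uncurry G))
    (hsupp : ∀ x, x ∉ K → ∀ s ∈ uIcc a b, G x s = 0) :
    ∫ x, (∫ s in a..b, G x s) ∂μ = ∫ s in a..b, ∫ x, G x s ∂μ := by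
  rw [intervalIntegral_integral_swap (f := fun s x => G x s)]
  exact (integrable_prod_of_compact hK hG hsupp).swap

theorem continuous_integral_of_compact {P X E : Type*} [TopologicalSpace P]
    [TopologicalSpace X] [MeasurableSpace X] [OpensMeasurableSpace X] {μ : Measure X}
    [IsFiniteMeasureOnCompacts μ] [NormedAddCommGroup E] [NormedSpace ℝ E]
    {K : Set X} (hK : IsCompact K) {G : P → X → E} (hG : Continuous (Function.uncurry G))
    (hsupp : ∀ p x, x ∉ K → G p x = 0) : Continuous fun p => ∫ x, G p x ∂μ := by
  rw [← continuousOn_univ]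
  exact continuousOn_integral_of_compact_support hK hG.continuousOn (fun p x _ hx => hsupp p x hx)

end Tools

/-! ### The half space -/

section HalfSpace

variable {n : ℕ}

theorem measurableSet_halfSpace : MeasurableSet (halfSpace n) :=
  MeasurableSet.univ.prod measurableSet_Ioi

theorem restrict_halfSpace : (volume : Measure (Tan n × ℝ)).restrict (halfSpace n) =
    (volume : Measure (Tan n)).prod (volume.restrict (Ioi 0)) := by
  rw [halfSpace, Measure.volume_eq_prod, ← Measure.prod_restrict, Measure.restrict_univ]

instance isAddHaarMeasure_volume : (volume : Measure (Tan n × ℝ)).IsAddHaarMeasure := by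
  rw [Measure.volume_eq_prod]; infer_instance

instance isNegInvariant_volume : (volume : Measure (Tan n × ℝ)).IsNegInvariant := by
  constructor
  have h : (volume : Measure (Tan n × ℝ)).neg =
      Measure.map (Prod.map (fun x : Tan n => -x) (fun y : ℝ => -y)) volume := rfl
  rw [h, Measure.volume_eq_prod, ← Measure.map_prod_map _ _ measurable_neg measurable_neg,
    Measure.map_neg_eq_self, Measure.map_neg_eq_self]

/-- The `L²` norm over the half space. -/
abbrev nrm {F : Type*} [NormedAddCommGroup F] (f : Tan n × ℝ → F) : ℝ≥0∞ :=
  eLpNorm f 2 ((volume : Measure (Tan n × ℝ)).restrict (halfSpace n))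

theorem aesm_half {F : Type*} [NormedAddCommGroup F] {f : Tan n × ℝ → F}
    (hf : Continuous f) :
    AEStronglyMeasurable f ((volume : Measure (Tan n × ℝ)).restrict (halfSpace n)) :=
  hf.aestronglyMeasurable

/-- An inward translation maps the half space into itself, so the translated function sees only part
of the mass. It fails for outward directions, and for this reason every kernel below lives in
negative heights. -/
theorem nrm_translate_le {F : Type*} [NormedAddCommGroup F] {f : Tan n × ℝ → F}
    (hf : AEStronglyMeasurable f ((volume : Measure (Tan n × ℝ)).restrict (halfSpace n)))
    {v : Tan n × ℝ} (hv : 0 ≤ v.2) : nrm (fun p => f (p + v)) ≤ nrm f := by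
  have hmp : MeasurePreserving (fun p : Tan n × ℝ => p + v) volume volume :=
    measurePreserving_add_right volume v
  have h := eLpNorm_comp_measurePreserving (p := 2) hf
    (hmp.restrict_preimage measurableSet_halfSpace)
  refine le_trans ?_ h.le
  refine eLpNorm_mono_measure _ (Measure.restrict_mono (fun p hp => ?_) le_rfl)
  have hp2 : 0 < p.2 := hp.2
  exact ⟨mem_univ _, show 0 < p.2 + v.2 by linarith⟩

/-- The increment of a function in a direction that points into the half space is bounded by its
directional derivative. -/
theorem nrm_increment_le {f g : Tan n × ℝ → ℝ} (hf : Continuous f) (hg : Continuous g)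
    {v : Tan n × ℝ} (hv : 0 ≤ v.2)
    (hfg : ∀ p ∈ halfSpace n, HasDerivAt (fun s : ℝ => f (p + s • v)) (g p) 0) :
    nrm (fun p => f (p + v) - f p) ≤ nrm g := by
  have hmem : ∀ p ∈ halfSpace n, ∀ s : ℝ, 0 ≤ s → p + s • v ∈ halfSpace n := fun p hp s hs =>
    ⟨mem_univ _, show 0 < p.2 + s * v.2 by
      have hp2 : 0 < p.2 := hp.2
      have := mul_nonneg hs hv
      linarith⟩
  -- Fundamental theorem of calculus along the segment from p to p + v, which stays in the half
  -- space. Minkowski's inequality then bounds the increment by an average of translates of g.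
  have hrep : ∀ p ∈ halfSpace n,
      f (p + v) - f p = ∫ s, (1 : ℝ) • g (p + s • v) ∂(volume.restrict (Ioc (0 : ℝ) 1)) := by
    intro p hp
    have h := intervalIntegral.integral_eq_sub_of_hasDerivAt_of_le (zero_le_one' ℝ)
      (f := fun s : ℝ => f (p + s • v)) (f' := fun s => g (p + s • v))
      (by fun_prop) (fun s hs => by
        have h0 := hfg (p + s • v) (hmem p hp s hs.1.le)
        -- The hypothesis gives the derivative at parameter 0 only. The derivative at s is obtained
        -- by taking p + s • v as the base point and recentring.
        have h1 : HasDerivAt (fun r : ℝ => r - s) 1 s := (hasDerivAt_id s).sub_const s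
        have h2 := HasDerivAt.scomp (h := fun r : ℝ => r - s) s (by simpa using h0) h1
        refine (h2.congr_deriv (by simp)).congr_of_eventuallyEq ?_
        refine Filter.Eventually.of_forall fun r => ?_
        simp only [Function.comp_apply]
        congr 1
        module)
      ((by fun_prop : Continuous fun s : ℝ => g (p + s • v)).intervalIntegrable _ _)
    rw [intervalIntegral.integral_of_le zero_le_one] at h
    simp only [one_smul]
    rw [h]; simp
  have heq : nrm (fun p => f (p + v) - f p) = nrm (fun p =>
      ∫ s, (1 : ℝ) • g (p + s • v) ∂(volume.restrict (Ioc (0 : ℝ) 1))) :=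
    eLpNorm_congr_ae (by
      filter_upwards [ae_restrict_mem measurableSet_halfSpace] with p hp using hrep p hp)
  rw [heq]
  have hcont : Continuous (Function.uncurry fun (s : ℝ) (p : Tan n × ℝ) => g (p + s • v)) := by
    unfold Function.uncurry; fun_prop
  refine (eLpNorm_integral_le (κ := fun _ => (1 : ℝ)) (N := nrm g) aestronglyMeasurable_const
    hcont.aestronglyMeasurable ?_).trans ?_
  · filter_upwards [ae_restrict_mem measurableSet_Ioc] with s hs _
    exact nrm_translate_le (v := s • v) (aesm_half hg) (mul_nonneg hs.1.le hv)
  · simp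

end HalfSpace

end

/-! ### The energy method: localized inequality, monotonicity, increments. -/

section

/-! ### Cutoff functions -/

/-- Dilating a fixed bump by a factor r divides its gradient by r. A small gradient makes the error
that transport produces on the cutoff negligible. -/
theorem exists_cutoff (E : Type*) [NormedAddCommGroup E] [NormedSpace ℝ E] [FiniteDimensional ℝ E]
    (R : ℝ) {ε : ℝ} (hε : 0 < ε) :
    ∃ a : E → ℝ, ContDiff ℝ ∞ a ∧ HasCompactSupport a ∧ (∀ x, 0 ≤ a x) ∧ (∀ x, a x ≤ 1) ∧
      (∀ x, ‖x‖ ≤ R → a x = 1) ∧ ∀ x, ‖fderiv ℝ a x‖ ≤ ε := by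
  let φ : ContDiffBump (0 : E) := ⟨1, 2, one_pos, one_lt_two⟩
  have hφ : ContDiff ℝ ∞ φ := φ.contDiff
  obtain ⟨C, hC⟩ := (hφ.continuous_fderiv (by simp)).bounded_above_of_compact_support
    (φ.hasCompactSupport.fderiv ℝ)
  have hC0 : 0 ≤ C := (norm_nonneg _).trans (hC 0)
  -- R secures the plateau, C / ε the small gradient, and 1 keeps r positive.
  set r : ℝ := max (max R 1) (C / ε) with hr
  have hr1 : 1 ≤ r := (le_max_right R 1).trans (le_max_left _ _)
  have hr0 : 0 < r := one_pos.trans_le hr1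
  refine ⟨fun x => φ (r⁻¹ • x), hφ.comp (contDiff_const_smul _), ?_, fun x => φ.nonneg,
    fun x => φ.le_one, ?_, ?_⟩
  · exact φ.hasCompactSupport.comp_smul (inv_ne_zero hr0.ne')
  · intro x hx
    refine φ.one_of_mem_closedBall ?_
    rw [mem_closedBall_zero_iff, norm_smul, norm_inv, Real.norm_of_nonneg hr0.le]
    have : ‖x‖ ≤ r := hx.trans ((le_max_left R 1).trans (le_max_left _ _))
    show r⁻¹ * ‖x‖ ≤ 1
    rw [inv_mul_le_iff₀ hr0]; linarith
  · intro x
    have hd : HasFDerivAt (fun x : E => φ (r⁻¹ • x))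
        ((fderiv ℝ φ (r⁻¹ • x)).comp (r⁻¹ • ContinuousLinearMap.id ℝ E)) x :=
      ((hφ.differentiable (by simp)) _).hasFDerivAt.comp x ((hasFDerivAt_id x).const_smul r⁻¹)
    rw [hd.fderiv]
    refine (ContinuousLinearMap.opNorm_comp_le _ _).trans ?_
    have h1 : ‖r⁻¹ • ContinuousLinearMap.id ℝ E‖ ≤ r⁻¹ := by
      rw [norm_smul, norm_inv, Real.norm_of_nonneg hr0.le]
      exact mul_le_of_le_one_right (inv_nonneg.2 hr0.le) ContinuousLinearMap.norm_id_le
    calc _ ≤ C * r⁻¹ := mul_le_mul (hC _) h1 (norm_nonneg _) hC0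
      _ ≤ ε := by
        rw [← div_eq_mul_inv, div_le_iff₀ hr0]
        have := le_max_right (max R 1) (C / ε)
        rw [div_le_iff₀ hε] at this
        linarith

/-- Diffusion is integrated by parts twice, so the second derivative of the cutoff is the one that
must be small; the vanishing slope at 0 removes a boundary term. -/
theorem exists_cutoff_real (R : ℝ) (hR : 0 < R) {ε : ℝ} (hε : 0 < ε) :
    ∃ b : ℝ → ℝ, ContDiff ℝ ∞ b ∧ HasCompactSupport b ∧ (∀ x, 0 ≤ b x) ∧ (∀ x, b x ≤ 1) ∧
      (∀ x, ‖x‖ ≤ R → b x = 1) ∧ deriv b 0 = 0 ∧ ∀ x, |deriv (deriv b) x| ≤ ε := by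
  let φ : ContDiffBump (0 : ℝ) := ⟨1, 2, one_pos, one_lt_two⟩
  have hφ : ContDiff ℝ ∞ φ := φ.contDiff
  have hφ' : ContDiff ℝ ∞ (deriv φ) := (contDiff_infty_iff_deriv.1 hφ).2
  obtain ⟨C, hC⟩ := (hφ'.continuous_deriv (by simp)).bounded_above_of_compact_support
    (φ.hasCompactSupport.deriv.deriv)
  have hC0 : 0 ≤ C := (norm_nonneg _).trans (hC 0)
  set r : ℝ := max (max R 1) (C / ε) with hr
  have hr1 : 1 ≤ r := (le_max_right R 1).trans (le_max_left _ _)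
  have hr0 : 0 < r := one_pos.trans_le hr1
  have hone : ∀ x : ℝ, ‖x‖ ≤ R → φ (r⁻¹ * x) = 1 := by
    intro x hx
    refine φ.one_of_mem_closedBall ?_
    rw [mem_closedBall_zero_iff, norm_mul, norm_inv, Real.norm_of_nonneg hr0.le]
    have : ‖x‖ ≤ r := hx.trans ((le_max_left R 1).trans (le_max_left _ _))
    show r⁻¹ * ‖x‖ ≤ 1
    rw [inv_mul_le_iff₀ hr0]; linarith
  have hd : deriv (fun x : ℝ => φ (r⁻¹ * x)) = fun x => r⁻¹ * deriv φ (r⁻¹ * x) := by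
    funext x
    have := deriv_comp_mul_left r⁻¹ (φ : ℝ → ℝ) x
    simpa using this
  refine ⟨fun x => φ (r⁻¹ * x), hφ.comp (contDiff_const.mul contDiff_id), ?_, fun x => φ.nonneg,
    fun x => φ.le_one, hone, ?_, ?_⟩
  · have hk : HasCompactSupport fun x : ℝ => φ (r⁻¹ • x) :=
      φ.hasCompactSupport.comp_smul (inv_ne_zero hr0.ne')
    simpa only [smul_eq_mul] using hk
  · have h0 : (fun x : ℝ => φ (r⁻¹ * x)) =ᶠ[nhds 0] fun _ => 1 := by
      filter_upwards [Metric.ball_mem_nhds (0 : ℝ) hR] with x hx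
      exact hone x (by simpa using (mem_ball_zero_iff.1 hx).le)
    rw [h0.deriv_eq]; simp
  · intro x
    have hd2 : deriv (fun x => r⁻¹ * deriv φ (r⁻¹ * x)) x
        = r⁻¹ * (r⁻¹ * deriv (deriv φ) (r⁻¹ * x)) := by
      rw [deriv_const_mul_field]
      have := deriv_comp_mul_left r⁻¹ (deriv (φ : ℝ → ℝ)) x
      simp only [smul_eq_mul] at this
      rw [this]
    rw [hd, hd2, abs_mul, abs_mul, abs_of_pos (inv_pos.2 hr0)]
    -- The second derivative scales like r⁻²; since r ≥ 1, one of the two factors can be discarded.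
    have h1 : r⁻¹ ≤ 1 := inv_le_one_of_one_le₀ hr1
    have h2 : |deriv (deriv φ) (r⁻¹ * x)| ≤ C := hC _
    have h3 : r⁻¹ * C ≤ ε := by
      rw [inv_mul_le_iff₀ hr0]
      have := le_max_right (max R 1) (C / ε)
      rwa [div_le_iff₀ hε] at this
    calc r⁻¹ * (r⁻¹ * |deriv (deriv φ) (r⁻¹ * x)|) ≤ 1 * (r⁻¹ * C) := by
          gcongr
      _ ≤ ε := by linarith

/-! ### Regular functions on space-time and the energy inequality -/

variable {n : ℕ}

/-- `w` is continuous with continuous derivatives `wt`, `wx`, `wy`, `wyy`, which are the classical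
derivatives for `t > 0`, `y > 0`. -/
structure Reg (w wt : ℝ → Tan n → ℝ → ℝ) (wx : ℝ → Tan n → ℝ → (Tan n →L[ℝ] ℝ))
    (wy wyy : ℝ → Tan n → ℝ → ℝ) : Prop where
  c : Continuous fun p : ℝ × Tan n × ℝ => w p.1 p.2.1 p.2.2
  ct : Continuous fun p : ℝ × Tan n × ℝ => wt p.1 p.2.1 p.2.2
  cx : Continuous fun p : ℝ × Tan n × ℝ => wx p.1 p.2.1 p.2.2
  cy : Continuous fun p : ℝ × Tan n × ℝ => wy p.1 p.2.1 p.2.2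
  cyy : Continuous fun p : ℝ × Tan n × ℝ => wyy p.1 p.2.1 p.2.2
  ht : ∀ t x y, 0 < t → HasDerivAt (fun s => w s x y) (wt t x y) t
  hx : ∀ t x y, HasFDerivAt (fun x' => w t x' y) (wx t x y) x
  hy : ∀ t x y, 0 < y → HasDerivAt (fun z => w t x z) (wy t x y) y
  hyy : ∀ t x y, 0 < y → HasDerivAt (fun z => wy t x z) (wyy t x y) y

/-- The square of the `L²` norm over the half space. -/
def energy (f : Tan n → ℝ → ℝ) : ℝ≥0∞ :=
  ∫⁻ p, ‖f p.1 p.2‖ₑ ^ 2 ∂((volume : Measure (Tan n × ℝ)).restrict (halfSpace n))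

theorem energy_eq (f : Tan n → ℝ → ℝ) : energy f = normL2 f ^ 2 := (eLpNorm_two_sq _ _).symm

theorem integrable_half {G : Tan n × ℝ → ℝ} (hG : Continuous G) {K : Set (Tan n × ℝ)}
    (hK : IsCompact K) (h0 : ∀ p, p ∉ K → G p = 0) :
    Integrable G ((volume : Measure (Tan n × ℝ)).restrict (halfSpace n)) :=
  (hG.integrable_of_hasCompactSupport (HasCompactSupport.intro hK h0)).restrict

/-- Both orders of integration are used: diffusion is integrated by parts in y at fixed x',
transport in x' at fixed y. -/
theorem integral_half_eq {G : Tan n × ℝ → ℝ} (hG : Continuous G) {K : Set (Tan n)}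
    (hK : IsCompact K) {L : ℝ} (hL : 0 ≤ L) (h0 : ∀ x y, x ∉ K ∨ L ≤ |y| → G (x, y) = 0) :
    (∫ p, G p ∂((volume : Measure (Tan n × ℝ)).restrict (halfSpace n)) =
      ∫ x, ∫ y in (0 : ℝ)..L, G (x, y)) ∧
    (∫ p, G p ∂((volume : Measure (Tan n × ℝ)).restrict (halfSpace n)) =
      ∫ y in (0 : ℝ)..L, ∫ x, G (x, y)) := by
  have hint : Integrable G ((volume : Measure (Tan n × ℝ)).restrict (halfSpace n)) := by
    refine integrable_half hG (hK.prod (isCompact_Icc (a := -L) (b := L))) ?_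
    rintro ⟨x, y⟩ hp
    refine h0 x y ?_
    by_contra hcon
    push Not at hcon
    exact hp ⟨hcon.1, abs_le.1 hcon.2.le⟩
  have h1 : ∫ p, G p ∂((volume : Measure (Tan n × ℝ)).restrict (halfSpace n)) =
      ∫ x, ∫ y in (0 : ℝ)..L, G (x, y) := by
    rw [restrict_halfSpace] at hint ⊢
    rw [integral_prod _ hint]
    refine integral_congr_ae (Filter.Eventually.of_forall fun x => ?_)
    simp only
    rw [intervalIntegral.integral_of_le hL]
    refine setIntegral_eq_of_subset_of_forall_sdiff_eq_zero measurableSet_Ioi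
      Ioc_subset_Ioi_self ?_
    rintro y ⟨hy, hy2⟩
    refine h0 x y (Or.inr ?_)
    by_contra hcon
    push Not at hcon
    exact hy2 ⟨hy, (le_abs_self y).trans hcon.le⟩
  refine ⟨h1, h1.trans ?_⟩
  exact integral_interval_swap hK (G := fun x y => G (x, y)) hG (fun x hx y _ => h0 x y (Or.inl hx))

/-- Integrate the derivative of 2gg'b - g²b'. The dissipation 2bg'² has a good sign and is dropped,
everything vanishes at L, and only the boundary flux at 0 survives. That flux is kept because the
functions subtracted later need not vanish on the boundary. -/
theorem integral_mul_secondDeriv_le {g g' g'' b b' b'' : ℝ → ℝ} {L : ℝ} (hL : 0 ≤ L)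
    (cg : Continuous g) (cg' : Continuous g') (cg'' : Continuous g'')
    (cb'' : Continuous b'')
    (hg : ∀ y, 0 < y → HasDerivAt g (g' y) y) (hg' : ∀ y, 0 < y → HasDerivAt g' (g'' y) y)
    (hb : ∀ y, HasDerivAt b (b' y) y) (hb' : ∀ y, HasDerivAt b' (b'' y) y)
    (hb0 : ∀ y, 0 ≤ b y) (hbz : b 0 = 1) (hb'z : b' 0 = 0) (hbL : b L = 0) (hb'L : b' L = 0) :
    ∫ y in (0 : ℝ)..L, 2 * b y * g y * g'' y ≤
      (∫ y in (0 : ℝ)..L, b'' y * g y ^ 2) + 2 * |g 0| * |g' 0| := by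
  have cb : Continuous b := continuous_iff_continuousAt.2 fun y => (hb y).continuousAt
  have cb' : Continuous b' := continuous_iff_continuousAt.2 fun y => (hb' y).continuousAt
  have h := intervalIntegral.integral_eq_sub_of_hasDerivAt_of_le hL
    (f := fun y => 2 * g y * g' y * b y - g y ^ 2 * b' y)
    (f' := fun y => 2 * b y * g y * g'' y - (b'' y * g y ^ 2 - 2 * b y * g' y ^ 2))
    (by fun_prop) (fun y hy => by
      have h1 := hg y hy.1
      have h2 := hg' y hy.1
      have h3 := (((h1.const_mul 2).mul h2).mul (hb y)).sub ((h1.pow 2).mul (hb' y))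
      refine h3.congr_deriv ?_
      simp only [Pi.mul_apply, Pi.pow_apply]
      push_cast
      ring)
    ((by fun_prop : Continuous fun y => 2 * b y * g y * g'' y -
      (b'' y * g y ^ 2 - 2 * b y * g' y ^ 2)).intervalIntegrable _ _)
  rw [intervalIntegral.integral_sub
    ((by fun_prop : Continuous fun y => 2 * b y * g y * g'' y).intervalIntegrable _ _)
    ((by fun_prop : Continuous fun y => b'' y * g y ^ 2 - 2 * b y * g' y ^ 2).intervalIntegrable
      _ _)] at h
  have h2 : ∫ y in (0 : ℝ)..L, (b'' y * g y ^ 2 - 2 * b y * g' y ^ 2) ≤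
      ∫ y in (0 : ℝ)..L, b'' y * g y ^ 2 := by
    refine intervalIntegral.integral_mono_on hL
      ((by fun_prop : Continuous fun y => b'' y * g y ^ 2 - 2 * b y * g' y ^ 2).intervalIntegrable
      _ _) ((by fun_prop : Continuous fun y => b'' y * g y ^ 2).intervalIntegrable _ _) ?_
    intro y _
    have := mul_nonneg (hb0 y) (sq_nonneg (g' y))
    linarith
  have h3 : -(g 0 * g' 0) ≤ |g 0| * |g' 0| := by rw [← abs_mul]; exact neg_le_abs _
  simp only [hbz, hb'z, hbL, hb'L] at h
  nlinarith

end

section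

variable {n : ℕ} {w wt : ℝ → Tan n → ℝ → ℝ} {wx : ℝ → Tan n → ℝ → (Tan n →L[ℝ] ℝ)}
  {wy wyy : ℝ → Tan n → ℝ → ℝ}

/-- The source `∂_t w + U · ∇_h w - ∂_y² w`. -/
def src (U : ℝ → Tan n) (wt : ℝ → Tan n → ℝ → ℝ) (wx : ℝ → Tan n → ℝ → (Tan n →L[ℝ] ℝ))
    (wyy : ℝ → Tan n → ℝ → ℝ) (t : ℝ) (x : Tan n) (y : ℝ) : ℝ :=
  wt t x y + wx t x y (U y) - wyy t x y

theorem Reg.continuous_src (h : Reg w wt wx wy wyy) {U : ℝ → Tan n} (hU : Continuous U) :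
    Continuous fun p : ℝ × Tan n × ℝ => src U wt wx wyy p.1 p.2.1 p.2.2 := by
  have h1 := h.ct
  have h2 := h.cx
  have h3 := h.cyy
  unfold src
  fun_prop

theorem continuous_slice {F : Type*} [TopologicalSpace F] {f : ℝ → Tan n → ℝ → F}
    (hf : Continuous fun p : ℝ × Tan n × ℝ => f p.1 p.2.1 p.2.2) (t : ℝ) :
    Continuous fun p : Tan n × ℝ => f t p.1 p.2 := by
  have : Continuous fun p : Tan n × ℝ => (t, p) := by fun_prop
  exact hf.comp this

/-- The direction is constant in x', as U is at a fixed height, so no divergence of the field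
appears. -/
theorem integral_transport_eq {g a : Tan n → ℝ} {g' a' : Tan n → (Tan n →L[ℝ] ℝ)}
    (hg : ∀ x, HasFDerivAt g (g' x) x) (ha : ∀ x, HasFDerivAt a (a' x) x)
    (cg' : Continuous g') (ca' : Continuous a') (hc : HasCompactSupport a) (v : Tan n) :
    ∫ x, a x * (g' x v) = - ∫ x, a' x v * g x := by
  have cg : Continuous g := continuous_iff_continuousAt.2 fun x => (hg x).continuousAt
  have ca : Continuous a := continuous_iff_continuousAt.2 fun x => (ha x).continuousAt
  have ha'0 : ∀ x, x ∉ tsupport a → a' x = 0 := fun x hx => by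
    have : a =ᶠ[nhds x] fun _ => 0 := by
      filter_upwards [(isClosed_tsupport a).isOpen_compl.mem_nhds hx] with z hz
      exact image_eq_zero_of_notMem_tsupport hz
    rw [← (ha x).fderiv, this.fderiv_eq]; simp
  have i1 : Integrable (fun x => a' x v * g x) :=
    (by fun_prop : Continuous fun x => a' x v * g x).integrable_of_hasCompactSupport
      (HasCompactSupport.intro hc fun x hx => by simp [ha'0 x hx])
  have i2 : Integrable (fun x => a x * g' x v) :=
    (by fun_prop : Continuous fun x => a x * g' x v).integrable_of_hasCompactSupport
      (HasCompactSupport.intro hc fun x hx => by simp [image_eq_zero_of_notMem_tsupport hx])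
  have i3 : Integrable (fun x => a x * g x) :=
    (by fun_prop : Continuous fun x => a x * g x).integrable_of_hasCompactSupport
      (HasCompactSupport.intro hc fun x hx => by simp [image_eq_zero_of_notMem_tsupport hx])
  exact integral_bilinear_hasFDerivAt_right_eq_neg_left_of_integrable
    (B := ContinuousLinearMap.mul ℝ ℝ) (f := a) (f' := a') (g := g) (g' := g') (v := v) i1 i2 i3
    (fun x _ => ha x) (fun x _ => hg x)

/-- The energy inequality, localized by a cutoff function. -/
theorem Reg.energy_cutoff (h : Reg w wt wx wy wyy) {U : ℝ → Tan n} (hU : Continuous U) {m : ℝ}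
    (hm : ∀ y, ‖U y‖ ≤ m) {s t : ℝ} (hs : 0 ≤ s) (hst : s ≤ t) {lam : ℝ} (hlam : 0 < lam)
    {R : ℝ} (hR : 0 < R) :
    ∫⁻ p in Metric.closedBall 0 R, ‖w t p.1 p.2‖ₑ ^ 2
        ∂((volume : Measure (Tan n × ℝ)).restrict (halfSpace n)) ≤
      energy (w s) + ENNReal.ofReal lam * (∫⁻ τ in Ioc s t, energy (w τ)) +
      ENNReal.ofReal (2 / lam) * (∫⁻ τ in Ioc s t, energy (src U wt wx wyy τ)) +
      ∫⁻ τ in Ioc s t, ∫⁻ x, 2 * ‖w τ x 0‖ₑ * ‖wy τ x 0‖ₑ := by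
  have hm0 : 0 ≤ m := (norm_nonneg _).trans (hm 0)
  -- Chosen so that ε + ε m = lam / 2: the cutoff errors of diffusion and transport use half of the
  -- budget `lam`, and Young's inequality for the source uses the other half.
  set ε : ℝ := lam / (2 * (1 + m)) with hε
  have hε0 : 0 < ε := by positivity
  obtain ⟨a, sa, ka, a0, a1, aR, da⟩ := exists_cutoff (Tan n) R hε0
  obtain ⟨b, sb, kb, b0, b1, bR, db0, db⟩ := exists_cutoff_real R hR hε0
  obtain ⟨L', hL'⟩ := kb.isCompact.isBounded.subset_closedBall 0
  -- Strictly beyond the support of b, so that b and its derivatives vanish at L itself.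
  set L : ℝ := max L' 0 + 1 with hL
  have hL0 : 0 ≤ L := by positivity
  have hbL : ∀ y : ℝ, L ≤ |y| → y ∉ tsupport b := fun y hy hyb => by
    have h1 := hL' hyb
    rw [mem_closedBall_zero_iff, Real.norm_eq_abs] at h1
    have := le_max_left L' 0
    linarith
  have sb' : ContDiff ℝ ∞ (deriv b) := (contDiff_infty_iff_deriv.1 sb).2
  have hb : ∀ y, HasDerivAt b (deriv b y) y := fun y =>
    ((sb.differentiable (by simp)) y).hasDerivAt
  have hb' : ∀ y, HasDerivAt (deriv b) (deriv (deriv b) y) y := fun y =>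
    ((sb'.differentiable (by simp)) y).hasDerivAt
  have cb : Continuous b := sb.continuous
  have cb' : Continuous (deriv b) := sb'.continuous
  have cb'' : Continuous (deriv (deriv b)) := sb'.continuous_deriv (by simp)
  have ca : Continuous a := sa.continuous
  have ca' : Continuous (fderiv ℝ a) := sa.continuous_fderiv (by simp)
  have ha : ∀ x, HasFDerivAt a (fderiv ℝ a x) x := fun x =>
    ((sa.differentiable (by simp)) x).hasFDerivAt
  have zb : ∀ y : ℝ, L ≤ |y| → b y = 0 := fun y hy => image_eq_zero_of_notMem_tsupport (hbL y hy)
  have zb' : ∀ y : ℝ, L ≤ |y| → deriv b y = 0 := fun y hy => by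
    by_contra hne
    exact hbL y hy (support_deriv_subset hne)
  have zb'' : ∀ y : ℝ, L ≤ |y| → deriv (deriv b) y = 0 := fun y hy => by
    by_contra hne
    have h1 : y ∈ tsupport (deriv b) := support_deriv_subset hne
    exact hbL y hy (closure_minimal support_deriv_subset (isClosed_tsupport b) h1)
  have za : ∀ x, x ∉ tsupport a → a x = 0 := fun x hx => image_eq_zero_of_notMem_tsupport hx
  have za' : ∀ x, x ∉ tsupport a → fderiv ℝ a x = 0 := fun x hx => by
    by_contra hne
    exact hx (support_fderiv_subset ℝ hne)
  have cw := h.c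
  have cwt := h.ct
  have cwx := h.cx
  have cwy := h.cy
  have cwyy := h.cyy
  have csrc := h.continuous_src hU
  set μ := (volume : Measure (Tan n × ℝ)).restrict (halfSpace n) with hμ
  set K : Set (Tan n × ℝ) := tsupport a ×ˢ Icc (-L) L with hK
  have hKc : IsCompact K := ka.isCompact.prod isCompact_Icc
  have hKn : ∀ p : Tan n × ℝ, p ∉ K → p.1 ∉ tsupport a ∨ L ≤ |p.2| := fun p hp => by
    by_contra hcon
    push Not at hcon
    exact hp ⟨hcon.1, abs_le.1 hcon.2.le⟩
  -- the time increment of the localized energy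
  have hinc : (∫ p, a p.1 * b p.2 * w t p.1 p.2 ^ 2 ∂μ) - ∫ p, a p.1 * b p.2 * w s p.1 p.2 ^ 2 ∂μ =
      ∫ τ in s..t, ∫ p, a p.1 * b p.2 * (2 * w τ p.1 p.2 * wt τ p.1 p.2) ∂μ := by
    have hint : ∀ τ, Integrable (fun p : Tan n × ℝ => a p.1 * b p.2 * w τ p.1 p.2 ^ 2) μ := by
      intro τ
      have := continuous_slice cw τ
      refine integrable_half (by fun_prop) hKc fun p hp => ?_
      rcases hKn p hp with h1 | h1
      · simp [za _ h1]
      · simp [zb _ h1]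
    rw [← integral_sub (hint t) (hint s), ← integral_interval_swap hKc
      (G := fun (p : Tan n × ℝ) τ => a p.1 * b p.2 * (2 * w τ p.1 p.2 * wt τ p.1 p.2))]
    · refine integral_congr_ae (Filter.Eventually.of_forall fun p => ?_)
      simp only
      have h1 : Continuous fun τ => w τ p.1 p.2 := by
        exact cw.comp (by fun_prop : Continuous fun τ : ℝ => (τ, p))
      have h2 : Continuous fun τ => wt τ p.1 p.2 := by
        exact cwt.comp (by fun_prop : Continuous fun τ : ℝ => (τ, p))
      rw [intervalIntegral.integral_eq_sub_of_hasDerivAt_of_le hst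
        (f := fun τ => a p.1 * b p.2 * w τ p.1 p.2 ^ 2)]
      · fun_prop
      · intro τ hτ
        have := ((h.ht τ p.1 p.2 (hs.trans_lt hτ.1)).pow 2).const_mul (a p.1 * b p.2)
        refine this.congr_deriv ?_
        push_cast; ring
      · exact (by fun_prop : Continuous fun τ =>
          a p.1 * b p.2 * (2 * w τ p.1 p.2 * wt τ p.1 p.2)).intervalIntegrable _ _
    · have h1 : Continuous fun q : (Tan n × ℝ) × ℝ => w q.2 q.1.1 q.1.2 :=
        cw.comp (by fun_prop : Continuous fun q : (Tan n × ℝ) × ℝ => (q.2, q.1))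
      have h2 : Continuous fun q : (Tan n × ℝ) × ℝ => wt q.2 q.1.1 q.1.2 :=
        cwt.comp (by fun_prop : Continuous fun q : (Tan n × ℝ) × ℝ => (q.2, q.1))
      unfold Function.uncurry
      fun_prop
    · intro p hp τ _
      rcases hKn p hp with h1 | h1
      · simp [za _ h1]
      · simp [zb _ h1]
  -- the localized balance at a fixed time
  set f1 : ℝ → Tan n × ℝ → ℝ := fun τ p =>
    (a p.1 * deriv (deriv b) p.2 + b p.2 * fderiv ℝ a p.1 (U p.2)) * w τ p.1 p.2 ^ 2 +
      2 * (a p.1 * b p.2) * w τ p.1 p.2 * src U wt wx wyy τ p.1 p.2 with hf1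
  set f2 : ℝ → Tan n → ℝ := fun τ x => a x * (2 * |w τ x 0| * |wy τ x 0|) with hf2
  have hbal : ∀ τ, ∫ p, a p.1 * b p.2 * (2 * w τ p.1 p.2 * wt τ p.1 p.2) ∂μ ≤
      (∫ p, f1 τ p ∂μ) + ∫ x, f2 τ x := by
    intro τ
    have c1 := continuous_slice cw τ
    have c2 := continuous_slice cwx τ
    have c3 := continuous_slice cwy τ
    have c4 := continuous_slice cwyy τ
    have c5 := continuous_slice csrc τ
    set g1 : Tan n × ℝ → ℝ := fun p => a p.1 * (2 * b p.2 * w τ p.1 p.2 * wyy τ p.1 p.2) with hg1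
    set g2 : Tan n × ℝ → ℝ := fun p =>
      b p.2 * (a p.1 * (2 * w τ p.1 p.2 * wx τ p.1 p.2 (U p.2))) with hg2
    set g3 : Tan n × ℝ → ℝ := fun p =>
      2 * (a p.1 * b p.2) * w τ p.1 p.2 * src U wt wx wyy τ p.1 p.2 with hg3
    set g4 : Tan n × ℝ → ℝ := fun p => a p.1 * (deriv (deriv b) p.2 * w τ p.1 p.2 ^ 2) with hg4
    set g5 : Tan n × ℝ → ℝ := fun p => b p.2 * (fderiv ℝ a p.1 (U p.2) * w τ p.1 p.2 ^ 2) with hg5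
    have k1 : Continuous g1 := by fun_prop
    have k2 : Continuous g2 := by fun_prop
    have k3 : Continuous g3 := by fun_prop
    have k4 : Continuous g4 := by fun_prop
    have k5 : Continuous g5 := by fun_prop
    have z1 : ∀ x y, x ∉ tsupport a ∨ L ≤ |y| → g1 (x, y) = 0 := by
      rintro x y (hx | hy)
      · simp [hg1, za x hx]
      · simp [hg1, zb y hy]
    have z2 : ∀ x y, x ∉ tsupport a ∨ L ≤ |y| → g2 (x, y) = 0 := by
      rintro x y (hx | hy)
      · simp [hg2, za x hx]
      · simp [hg2, zb y hy]
    have z3 : ∀ x y, x ∉ tsupport a ∨ L ≤ |y| → g3 (x, y) = 0 := by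
      rintro x y (hx | hy)
      · simp [hg3, za x hx]
      · simp [hg3, zb y hy]
    have z4 : ∀ x y, x ∉ tsupport a ∨ L ≤ |y| → g4 (x, y) = 0 := by
      rintro x y (hx | hy)
      · simp [hg4, za x hx]
      · simp [hg4, zb'' y hy]
    have z5 : ∀ x y, x ∉ tsupport a ∨ L ≤ |y| → g5 (x, y) = 0 := by
      rintro x y (hx | hy)
      · simp [hg5, za' x hx]
      · simp [hg5, zb y hy]
    have i1 : Integrable g1 μ := integrable_half k1 hKc fun p hp => z1 _ _ (hKn p hp)
    have i2 : Integrable g2 μ := integrable_half k2 hKc fun p hp => z2 _ _ (hKn p hp)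
    have i3 : Integrable g3 μ := integrable_half k3 hKc fun p hp => z3 _ _ (hKn p hp)
    have i4 : Integrable g4 μ := integrable_half k4 hKc fun p hp => z4 _ _ (hKn p hp)
    have i5 : Integrable g5 μ := integrable_half k5 hKc fun p hp => z5 _ _ (hKn p hp)
    have e1 : ∫ p, a p.1 * b p.2 * (2 * w τ p.1 p.2 * wt τ p.1 p.2) ∂μ =
        (∫ p, g1 p ∂μ) - (∫ p, g2 p ∂μ) + ∫ p, g3 p ∂μ := by
      rw [← integral_sub i1 i2, ← integral_add (f := fun p => g1 p - g2 p) (i1.sub i2) i3]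
      refine integral_congr_ae (Filter.Eventually.of_forall fun p => ?_)
      simp only [hg1, hg2, hg3, src]
      ring
    have e2 : ∫ p, f1 τ p ∂μ = (∫ p, g4 p ∂μ) + (∫ p, g5 p ∂μ) + ∫ p, g3 p ∂μ := by
      rw [← integral_add i4 i5, ← integral_add (f := fun p => g4 p + g5 p) (i4.add i5) i3]
      refine integral_congr_ae (Filter.Eventually.of_forall fun p => ?_)
      simp only [hf1, hg3, hg4, hg5]
      ring
    -- At fixed y the field is constant and the transport term is a tangential derivative of w², so
    -- the derivative falls on the cutoff a.
    have e3 : ∫ p, g2 p ∂μ = - ∫ p, g5 p ∂μ := by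
      rw [(integral_half_eq k2 ka.isCompact hL0 z2).2, (integral_half_eq k5 ka.isCompact hL0 z5).2,
        ← intervalIntegral.integral_neg]
      refine intervalIntegral.integral_congr fun y _ => ?_
      simp only [hg2, hg5]
      rw [integral_const_mul, integral_const_mul, ← mul_neg]
      congr 1
      have cs : Continuous fun x => w τ x y :=
        c1.comp (by fun_prop : Continuous fun x : Tan n => (x, y))
      have cs' : Continuous fun x => wx τ x y :=
        c2.comp (by fun_prop : Continuous fun x : Tan n => (x, y))
      have := integral_transport_eq (g := fun x => w τ x y ^ 2) (a := a)
        (g' := fun x => (2 * w τ x y) • wx τ x y) (a' := fderiv ℝ a)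
        (fun x => by
          refine ((h.hx τ x y).pow 2).congr_fderiv ?_
          ext v
          simp) ha (by fun_prop) ca' ka (U y)
      simpa using this
    have e4 : ∫ p, g1 p ∂μ ≤ (∫ p, g4 p ∂μ) + ∫ x, f2 τ x := by
      rw [(integral_half_eq k1 ka.isCompact hL0 z1).1, (integral_half_eq k4 ka.isCompact hL0 z4).1]
      have hc1 : Continuous fun x => ∫ y in (0 : ℝ)..L, g1 (x, y) :=
        intervalIntegral.continuous_parametric_intervalIntegral_of_continuous' (by exact k1) _ _
      have hc4 : Continuous fun x => ∫ y in (0 : ℝ)..L, g4 (x, y) :=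
        intervalIntegral.continuous_parametric_intervalIntegral_of_continuous' (by exact k4) _ _
      have c10 : Continuous fun x => w τ x 0 :=
        c1.comp (by fun_prop : Continuous fun x : Tan n => (x, (0 : ℝ)))
      have c30 : Continuous fun x => wy τ x 0 :=
        c3.comp (by fun_prop : Continuous fun x : Tan n => (x, (0 : ℝ)))
      have j4 : Integrable fun x => ∫ y in (0 : ℝ)..L, g4 (x, y) :=
        hc4.integrable_of_hasCompactSupport (HasCompactSupport.intro ka fun x hx => by
          simp [hg4, za x hx])
      have j2 : Integrable (f2 τ) := by
        have : Continuous (f2 τ) := by fun_prop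
        exact this.integrable_of_hasCompactSupport (HasCompactSupport.intro ka fun x hx => by
          simp [hf2, za x hx])
      rw [← integral_add j4 j2]
      refine integral_mono (hc1.integrable_of_hasCompactSupport
        (HasCompactSupport.intro ka fun x hx => by simp [hg1, za x hx])) (j4.add j2) fun x => ?_
      simp only [hg1, hg4, hf2]
      rw [intervalIntegral.integral_const_mul, intervalIntegral.integral_const_mul, ← mul_add]
      refine mul_le_mul_of_nonneg_left ?_ (a0 x)
      refine integral_mul_secondDeriv_le hL0
        (c1.comp (by fun_prop : Continuous fun y : ℝ => (x, y)))
        (c3.comp (by fun_prop : Continuous fun y : ℝ => (x, y)))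
        (c4.comp (by fun_prop : Continuous fun y : ℝ => (x, y))) cb''
        (fun y hy => h.hy τ x y hy) (fun y hy => h.hyy τ x y hy) hb hb' b0
        (bR 0 (by simpa using hR.le)) db0 (zb L (le_abs_self L)) (zb' L (le_abs_self L))
    rw [e1, e2, e3]
    linarith
  have cf1 : Continuous fun τ => ∫ p, f1 τ p ∂μ := by
    refine continuous_integral_of_compact hKc ?_ ?_
    · have h1 : Continuous fun q : ℝ × Tan n × ℝ => src U wt wx wyy q.1 q.2.1 q.2.2 := csrc
      unfold Function.uncurry
      simp only [hf1]
      fun_prop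
    · intro τ p hp
      rcases hKn p hp with h1 | h1
      · simp [hf1, za _ h1, za' _ h1]
      · simp [hf1, zb _ h1, zb'' _ h1]
  have cf2 : Continuous fun τ => ∫ x, f2 τ x := by
    refine continuous_integral_of_compact ka.isCompact ?_ ?_
    · have h1 : Continuous fun q : ℝ × Tan n => w q.1 q.2 0 :=
        cw.comp (by fun_prop : Continuous fun q : ℝ × Tan n => (q.1, q.2, (0 : ℝ)))
      have h2 : Continuous fun q : ℝ × Tan n => wy q.1 q.2 0 :=
        cwy.comp (by fun_prop : Continuous fun q : ℝ × Tan n => (q.1, q.2, (0 : ℝ)))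
      unfold Function.uncurry
      simp only [hf2]
      fun_prop
    · intro τ x hx
      simp [hf2, za _ hx]
  have c0 : Continuous fun τ => ∫ p, a p.1 * b p.2 * (2 * w τ p.1 p.2 * wt τ p.1 p.2) ∂μ := by
    refine continuous_integral_of_compact hKc ?_ ?_
    · unfold Function.uncurry
      fun_prop
    · intro τ p hp
      rcases hKn p hp with h1 | h1
      · simp [za _ h1]
      · simp [zb _ h1]
  have hmain : ∫ p, a p.1 * b p.2 * w t p.1 p.2 ^ 2 ∂μ ≤
      (∫ p, a p.1 * b p.2 * w s p.1 p.2 ^ 2 ∂μ) + (∫ τ in s..t, ∫ p, f1 τ p ∂μ) +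
        ∫ τ in s..t, ∫ x, f2 τ x := by
    have h1 := intervalIntegral.integral_mono_on hst (c0.intervalIntegrable (μ := volume) s t)
      ((cf1.add cf2).intervalIntegrable (μ := volume) s t) (fun τ _ => hbal τ)
    have h2 := intervalIntegral.integral_add (cf1.intervalIntegrable (μ := volume) s t)
      (cf2.intervalIntegrable (μ := volume) s t)
    simp only [Pi.add_apply] at h1
    linarith
  -- passage to `[0, ∞]`
  have hab1 : ∀ p : Tan n × ℝ, a p.1 * b p.2 ≤ 1 := fun p =>
    mul_le_one₀ (a1 _) (b0 _) (b1 _)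
  have hab0 : ∀ p : Tan n × ℝ, 0 ≤ a p.1 * b p.2 := fun p => mul_nonneg (a0 _) (b0 _)
  have csl := fun τ => continuous_slice cw τ
  have hleft : ∫⁻ p in Metric.closedBall 0 R, ‖w t p.1 p.2‖ₑ ^ 2 ∂μ ≤
      ENNReal.ofReal (∫ p, a p.1 * b p.2 * w t p.1 p.2 ^ 2 ∂μ) := by
    have := csl t
    rw [ofReal_integral_eq_lintegral_ofReal]
    · rw [← lintegral_indicator Metric.isClosed_closedBall.measurableSet]
      refine lintegral_mono fun p => ?_
      by_cases hp : p ∈ Metric.closedBall (0 : Tan n × ℝ) R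
      · rw [indicator_of_mem hp]
        rw [mem_closedBall_zero_iff] at hp
        have e1 : a p.1 = 1 := aR _ ((norm_fst_le p).trans hp)
        have e2 : b p.2 = 1 := bR _ ((norm_snd_le p).trans hp)
        simp only
        rw [e1, e2, ← enorm_pow, Real.enorm_eq_ofReal (sq_nonneg _)]
        simp
      · rw [indicator_of_notMem hp]; exact zero_le
    · refine integrable_half (by fun_prop) hKc fun p hp => ?_
      rcases hKn p hp with h1 | h1
      · simp [za _ h1]
      · simp [zb _ h1]
    · exact Filter.Eventually.of_forall fun p => mul_nonneg (hab0 p) (sq_nonneg _)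
  have hright : ENNReal.ofReal (∫ p, a p.1 * b p.2 * w s p.1 p.2 ^ 2 ∂μ) ≤ energy (w s) := by
    refine (Real.ofReal_le_enorm _).trans ((enorm_integral_le_lintegral_enorm _).trans ?_)
    refine lintegral_mono fun p => ?_
    rw [← enorm_pow, Real.enorm_eq_ofReal (mul_nonneg (hab0 p) (sq_nonneg _)),
      Real.enorm_eq_ofReal (sq_nonneg _)]
    exact ENNReal.ofReal_le_ofReal (mul_le_of_le_one_left (sq_nonneg _) (hab1 p))
  have hmid : ENNReal.ofReal (∫ τ in s..t, ∫ p, f1 τ p ∂μ) ≤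
      ENNReal.ofReal lam * (∫⁻ τ in Ioc s t, energy (w τ)) +
      ENNReal.ofReal (2 / lam) * (∫⁻ τ in Ioc s t, energy (src U wt wx wyy τ)) := by
    have hpt : ∀ τ (p : Tan n × ℝ), ‖f1 τ p‖ₑ ≤ ENNReal.ofReal lam * ‖w τ p.1 p.2‖ₑ ^ 2 +
        ENNReal.ofReal (2 / lam) * ‖src U wt wx wyy τ p.1 p.2‖ₑ ^ 2 := by
      intro τ p
      rw [← enorm_pow, ← enorm_pow, Real.enorm_eq_ofReal (sq_nonneg (w τ p.1 p.2)),
        Real.enorm_eq_ofReal (sq_nonneg (src U wt wx wyy τ p.1 p.2)),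
        ← ENNReal.ofReal_mul hlam.le, ← ENNReal.ofReal_mul (by positivity),
        ← ENNReal.ofReal_add (by positivity) (by positivity), Real.enorm_eq_ofReal_abs]
      refine ENNReal.ofReal_le_ofReal ?_
      simp only [hf1]
      set W := w τ p.1 p.2
      set S := src U wt wx wyy τ p.1 p.2
      have q1 : |a p.1 * deriv (deriv b) p.2 + b p.2 * fderiv ℝ a p.1 (U p.2)| ≤ lam / 2 := by
        have r1 : |a p.1 * deriv (deriv b) p.2| ≤ ε := by
          rw [abs_mul, abs_of_nonneg (a0 _)]
          exact (mul_le_of_le_one_left (abs_nonneg _) (a1 _)).trans (db _)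
        have r2 : |b p.2 * fderiv ℝ a p.1 (U p.2)| ≤ ε * m := by
          rw [abs_mul, abs_of_nonneg (b0 _)]
          refine (mul_le_of_le_one_left (abs_nonneg _) (b1 _)).trans ?_
          refine ((fderiv ℝ a p.1).le_opNorm (U p.2)).trans ?_
          exact mul_le_mul (da _) (hm _) (norm_nonneg _) hε0.le
        have r3 : ε + ε * m = lam / 2 := by
          rw [hε]; field_simp
        linarith [abs_add_le (a p.1 * deriv (deriv b) p.2) (b p.2 * fderiv ℝ a p.1 (U p.2))]
      -- Young's inequality; the weights are those that make the difference of the two sides a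
      -- perfect square.
      have q2 : |2 * (a p.1 * b p.2) * W * S| ≤ lam / 2 * W ^ 2 + 2 / lam * S ^ 2 := by
        have r1 : |2 * (a p.1 * b p.2) * W * S| = (a p.1 * b p.2) * (2 * |W| * |S|) := by
          rw [abs_mul, abs_mul, abs_mul, abs_of_nonneg (hab0 p)]
          rw [abs_two]
          ring
        rw [r1]
        refine (mul_le_of_le_one_left (by positivity) (hab1 p)).trans ?_
        rw [← sq_abs W, ← sq_abs S]
        have r2 : lam / 2 * |W| ^ 2 + 2 / lam * |S| ^ 2 - 2 * |W| * |S| =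
            (lam * |W| - 2 * |S|) ^ 2 / (2 * lam) := by
          field_simp; ring
        have r3 : 0 ≤ (lam * |W| - 2 * |S|) ^ 2 / (2 * lam) := by positivity
        linarith
      calc _ ≤ |(a p.1 * deriv (deriv b) p.2 + b p.2 * fderiv ℝ a p.1 (U p.2)) * W ^ 2| +
            |2 * (a p.1 * b p.2) * W * S| := abs_add_le _ _
        _ ≤ lam / 2 * W ^ 2 + (lam / 2 * W ^ 2 + 2 / lam * S ^ 2) := by
          refine add_le_add ?_ q2
          rw [abs_mul, abs_of_nonneg (sq_nonneg W)]
          exact mul_le_mul_of_nonneg_right q1 (sq_nonneg W)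
        _ = _ := by ring
    have mE : ∀ f : ℝ → Tan n → ℝ → ℝ,
        (Continuous fun p : ℝ × Tan n × ℝ => f p.1 p.2.1 p.2.2) →
        Measurable fun τ => energy (f τ) := by
      intro f hf
      unfold energy
      exact Measurable.lintegral_prod_right' (f := fun q : ℝ × Tan n × ℝ => ‖f q.1 q.2.1 q.2.2‖ₑ ^ 2)
        (hf.enorm.measurable.pow_const 2)
    refine (Real.ofReal_le_enorm _).trans ?_
    rw [intervalIntegral.integral_of_le hst]
    refine (enorm_integral_le_lintegral_enorm _).trans ?_
    rw [← lintegral_const_mul _ (mE w cw), ← lintegral_const_mul _ (mE _ csrc), ← lintegral_add_left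
      ((mE w cw).const_mul _)]
    refine lintegral_mono fun τ => ?_
    refine (enorm_integral_le_lintegral_enorm _).trans ?_
    have m1 : Measurable fun p : Tan n × ℝ => ‖w τ p.1 p.2‖ₑ ^ 2 :=
      ((continuous_slice cw τ).enorm.measurable.pow_const 2)
    have m2 : Measurable fun p : Tan n × ℝ => ‖src U wt wx wyy τ p.1 p.2‖ₑ ^ 2 :=
      ((continuous_slice csrc τ).enorm.measurable.pow_const 2)
    simp only [energy]
    rw [← lintegral_const_mul _ m1, ← lintegral_const_mul _ m2, ← lintegral_add_left
      (m1.const_mul _)]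
    exact lintegral_mono fun p => hpt τ p
  have hbd : ENNReal.ofReal (∫ τ in s..t, ∫ x, f2 τ x) ≤
      ∫⁻ τ in Ioc s t, ∫⁻ x, 2 * ‖w τ x 0‖ₑ * ‖wy τ x 0‖ₑ := by
    refine (Real.ofReal_le_enorm _).trans ?_
    rw [intervalIntegral.integral_of_le hst]
    refine (enorm_integral_le_lintegral_enorm _).trans (lintegral_mono fun τ => ?_)
    refine (enorm_integral_le_lintegral_enorm _).trans (lintegral_mono fun x => ?_)
    simp only [hf2]
    rw [enorm_mul, enorm_mul, enorm_mul, Real.enorm_abs, Real.enorm_abs]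
    have e1 : ‖a x‖ₑ ≤ 1 := by
      rw [Real.enorm_eq_ofReal (a0 x)]
      exact ENNReal.ofReal_le_one.2 (a1 x)
    have e2 : ‖(2 : ℝ)‖ₑ = 2 := by
      rw [Real.enorm_eq_ofReal (by norm_num)]; simp
    rw [e2]
    exact mul_le_of_le_one_left zero_le e1
  calc _ ≤ ENNReal.ofReal (∫ p, a p.1 * b p.2 * w t p.1 p.2 ^ 2 ∂μ) := hleft
    _ ≤ ENNReal.ofReal ((∫ p, a p.1 * b p.2 * w s p.1 p.2 ^ 2 ∂μ) +
          (∫ τ in s..t, ∫ p, f1 τ p ∂μ) + ∫ τ in s..t, ∫ x, f2 τ x) :=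
        ENNReal.ofReal_le_ofReal hmain
    _ ≤ ENNReal.ofReal (∫ p, a p.1 * b p.2 * w s p.1 p.2 ^ 2 ∂μ) +
          ENNReal.ofReal (∫ τ in s..t, ∫ p, f1 τ p ∂μ) +
          ENNReal.ofReal (∫ τ in s..t, ∫ x, f2 τ x) :=
        ENNReal.ofReal_add_le.trans (add_le_add_left ENNReal.ofReal_add_le _)
    _ ≤ energy (w s) + (ENNReal.ofReal lam * (∫⁻ τ in Ioc s t, energy (w τ)) +
          ENNReal.ofReal (2 / lam) * (∫⁻ τ in Ioc s t, energy (src U wt wx wyy τ))) +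
          ∫⁻ τ in Ioc s t, ∫⁻ x, 2 * ‖w τ x 0‖ₑ * ‖wy τ x 0‖ₑ :=
        add_le_add (add_le_add hright hmid) hbd
    _ = _ := by rw [← add_assoc]

/-- The energy inequality. -/
theorem Reg.energy_le (h : Reg w wt wx wy wyy) {U : ℝ → Tan n} (hU : Continuous U) {m : ℝ}
    (hm : ∀ y, ‖U y‖ ≤ m) {s t : ℝ} (hs : 0 ≤ s) (hst : s ≤ t) {lam : ℝ} (hlam : 0 < lam) :
    energy (w t) ≤
      energy (w s) + ENNReal.ofReal lam * (∫⁻ τ in Ioc s t, energy (w τ)) +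
      ENNReal.ofReal (2 / lam) * (∫⁻ τ in Ioc s t, energy (src U wt wx wyy τ)) +
      ∫⁻ τ in Ioc s t, ∫⁻ x, 2 * ‖w τ x 0‖ₑ * ‖wy τ x 0‖ₑ := by
  have hun : ⋃ k : ℕ, Metric.closedBall (0 : Tan n × ℝ) (k + 1 : ℝ) = univ := by
    refine eq_univ_of_forall fun p => ?_
    obtain ⟨k, hk⟩ := exists_nat_ge ‖p‖
    exact mem_iUnion.2 ⟨k, by rw [mem_closedBall_zero_iff]; linarith⟩
  have hdir : Directed (· ⊆ ·) fun k : ℕ => Metric.closedBall (0 : Tan n × ℝ) (k + 1 : ℝ) :=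
    Monotone.directed_le (f := fun k : ℕ => Metric.closedBall (0 : Tan n × ℝ) (k + 1 : ℝ))
      fun i j hij => Metric.closedBall_subset_closedBall (by
        have : (i : ℝ) ≤ j := by exact_mod_cast hij
        linarith)
  unfold energy
  -- The localized bound does not depend on the radius, so the supremum over an exhaustion by balls
  -- gives the global one.
  rw [← setLIntegral_univ (μ := volume.restrict (halfSpace n)), ← hun,
    setLIntegral_iUnion_of_directed _ hdir]
  exact iSup_le fun k => h.energy_cutoff hU hm hs hst hlam (by positivity)

end

section

variable {n : ℕ} {w wt : ℝ → Tan n → ℝ → ℝ} {wx : ℝ → Tan n → ℝ → (Tan n →L[ℝ] ℝ)}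
  {wy wyy : ℝ → Tan n → ℝ → ℝ} {w' wt' : ℝ → Tan n → ℝ → ℝ}
  {wx' : ℝ → Tan n → ℝ → (Tan n →L[ℝ] ℝ)} {wy' wyy' : ℝ → Tan n → ℝ → ℝ} {U : ℝ → Tan n} {m : ℝ}

/-! ### Operations on regular functions -/

theorem Reg.sub (h : Reg w wt wx wy wyy) (h' : Reg w' wt' wx' wy' wyy') :
    Reg (fun t x y => w t x y - w' t x y) (fun t x y => wt t x y - wt' t x y)
      (fun t x y => wx t x y - wx' t x y) (fun t x y => wy t x y - wy' t x y)
      (fun t x y => wyy t x y - wyy' t x y) where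
  c := h.c.sub h'.c
  ct := h.ct.sub h'.ct
  cx := h.cx.sub h'.cx
  cy := h.cy.sub h'.cy
  cyy := h.cyy.sub h'.cyy
  ht t x y ht := (h.ht t x y ht).sub (h'.ht t x y ht)
  hx t x y := (h.hx t x y).sub (h'.hx t x y)
  hy t x y hy := (h.hy t x y hy).sub (h'.hy t x y hy)
  hyy t x y hy := (h.hyy t x y hy).sub (h'.hyy t x y hy)

theorem Reg.shiftTime (h : Reg w wt wx wy wyy) {r : ℝ} (hr : 0 ≤ r) :
    Reg (fun t x y => w (t + r) x y) (fun t x y => wt (t + r) x y)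
      (fun t x y => wx (t + r) x y) (fun t x y => wy (t + r) x y)
      (fun t x y => wyy (t + r) x y) where
  c := h.c.comp (by fun_prop : Continuous fun p : ℝ × Tan n × ℝ => (p.1 + r, p.2))
  ct := h.ct.comp (by fun_prop : Continuous fun p : ℝ × Tan n × ℝ => (p.1 + r, p.2))
  cx := h.cx.comp (by fun_prop : Continuous fun p : ℝ × Tan n × ℝ => (p.1 + r, p.2))
  cy := h.cy.comp (by fun_prop : Continuous fun p : ℝ × Tan n × ℝ => (p.1 + r, p.2))
  cyy := h.cyy.comp (by fun_prop : Continuous fun p : ℝ × Tan n × ℝ => (p.1 + r, p.2))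
  ht t x y ht := (h.ht (t + r) x y (by linarith)).comp_add_const t r
  hx t x y := h.hx (t + r) x y
  hy t x y hy := h.hy (t + r) x y hy
  hyy t x y hy := h.hyy (t + r) x y hy

theorem Reg.shiftSpace (h : Reg w wt wx wy wyy) (v : Tan n) :
    Reg (fun t x y => w t (x + v) y) (fun t x y => wt t (x + v) y)
      (fun t x y => wx t (x + v) y) (fun t x y => wy t (x + v) y)
      (fun t x y => wyy t (x + v) y) where
  c := h.c.comp (by fun_prop : Continuous fun p : ℝ × Tan n × ℝ => (p.1, p.2.1 + v, p.2.2))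
  ct := h.ct.comp (by fun_prop : Continuous fun p : ℝ × Tan n × ℝ => (p.1, p.2.1 + v, p.2.2))
  cx := h.cx.comp (by fun_prop : Continuous fun p : ℝ × Tan n × ℝ => (p.1, p.2.1 + v, p.2.2))
  cy := h.cy.comp (by fun_prop : Continuous fun p : ℝ × Tan n × ℝ => (p.1, p.2.1 + v, p.2.2))
  cyy := h.cyy.comp (by fun_prop : Continuous fun p : ℝ × Tan n × ℝ => (p.1, p.2.1 + v, p.2.2))
  ht t x y ht := h.ht t (x + v) y ht
  hx t x y := (hasFDerivAt_comp_add_right v).2 (h.hx t (x + v) y)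
  hy t x y hy := h.hy t (x + v) y hy
  hyy t x y hy := h.hyy t (x + v) y hy

/-- Lets the value at a fixed time be subtracted inside the class `Reg`, so that the difference
starts from zero. -/
theorem Reg.freeze (h : Reg w wt wx wy wyy) (r : ℝ) :
    Reg (fun _ x y => w r x y) (fun _ _ _ => 0)
      (fun _ x y => wx r x y) (fun _ x y => wy r x y) (fun _ x y => wyy r x y) where
  c := h.c.comp (by fun_prop : Continuous fun p : ℝ × Tan n × ℝ => (r, p.2))
  ct := continuous_const
  cx := h.cx.comp (by fun_prop : Continuous fun p : ℝ × Tan n × ℝ => (r, p.2))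
  cy := h.cy.comp (by fun_prop : Continuous fun p : ℝ × Tan n × ℝ => (r, p.2))
  cyy := h.cyy.comp (by fun_prop : Continuous fun p : ℝ × Tan n × ℝ => (r, p.2))
  ht t x y _ := hasDerivAt_const t _
  hx t x y := h.hx r x y
  hy t x y hy := h.hy r x y hy
  hyy t x y hy := h.hyy r x y hy

theorem Reg.continuous_at_time (h : Reg w wt wx wy wyy) (t : ℝ) :
    Continuous fun p : Tan n × ℝ => w t p.1 p.2 := continuous_slice h.c t

/-- Differentiability is only known at positive times. Continuity of w up to s = 0 is enough for the
fundamental theorem. -/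
theorem Reg.sub_eq_integral (h : Reg w wt wx wy wyy) {s t : ℝ} (hs : 0 ≤ s) (hst : s ≤ t)
    (x : Tan n) (y : ℝ) : w t x y - w s x y = ∫ τ in s..t, wt τ x y := by
  have h1 : Continuous fun τ => w τ x y :=
    h.c.comp (by fun_prop : Continuous fun τ : ℝ => (τ, x, y))
  have h2 : Continuous fun τ => wt τ x y :=
    h.ct.comp (by fun_prop : Continuous fun τ : ℝ => (τ, x, y))
  rw [intervalIntegral.integral_eq_sub_of_hasDerivAt_of_le hst (f := fun τ => w τ x y)
    h1.continuousOn (fun τ hτ => h.ht τ x y (hs.trans_lt hτ.1)) (h2.intervalIntegrable _ _)]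

theorem tendsto_inv_nat_smul {E : Type*} [NormedAddCommGroup E] [NormedSpace ℝ E] {f : ℝ → E}
    {f' : E} {t : ℝ} (h : HasDerivWithinAt f f' (Ici t) t) :
    Filter.Tendsto (fun k : ℕ => ((k : ℝ) + 1) • (f (t + 1 / ((k : ℝ) + 1)) - f t))
      Filter.atTop (nhds f') := by
  have h1 := (hasDerivWithinAt_iff_tendsto_slope' (by simp)).1 (h.Ioi_of_Ici)
  have h2 : Filter.Tendsto (fun k : ℕ => t + 1 / ((k : ℝ) + 1)) Filter.atTop
      (nhdsWithin t (Ioi t)) := by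
    refine tendsto_nhdsWithin_iff.2 ⟨?_, Filter.Eventually.of_forall fun k => ?_⟩
    · simpa using (tendsto_const_nhds (x := t)).add tendsto_one_div_add_atTop_nhds_zero_nat
    · have : (0 : ℝ) < 1 / ((k : ℝ) + 1) := by positivity
      simp only [mem_Ioi]; linarith
  refine (h1.comp h2).congr fun k => ?_
  simp only [Function.comp_apply, slope_def_module, add_sub_cancel_left, one_div, inv_inv]

/-- The quotient is an average of the continuous function `wt`, which covers t = 0 although `Reg`
asserts no derivative there. -/
theorem Reg.tendsto_timeQuotient (h : Reg w wt wx wy wyy) {t : ℝ} (ht : 0 ≤ t) (x : Tan n)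
    (y : ℝ) : Filter.Tendsto (fun k : ℕ => ((k : ℝ) + 1) * (w (t + 1 / ((k : ℝ) + 1)) x y - w t x y))
      Filter.atTop (nhds (wt t x y)) := by
  have h2 : Continuous fun τ => wt τ x y :=
    h.ct.comp (by fun_prop : Continuous fun τ : ℝ => (τ, x, y))
  have h3 : HasDerivAt (fun r => ∫ τ in t..r, wt τ x y) (wt t x y) t :=
    intervalIntegral.integral_hasDerivAt_right (h2.intervalIntegrable _ _)
      (h2.stronglyMeasurableAtFilter _ _) h2.continuousAt
  refine (tendsto_inv_nat_smul h3.hasDerivWithinAt).congr fun k => ?_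
  rw [h.sub_eq_integral ht (by
    have : (0 : ℝ) < 1 / ((k : ℝ) + 1) := by positivity
    linarith)]
  simp

/-! ### Consequences of the energy inequality -/

theorem energy_congr {f g : Tan n → ℝ → ℝ} (h : ∀ x y, 0 < y → f x y = g x y) :
    energy f = energy g :=
  lintegral_congr_ae (by
    filter_upwards [ae_restrict_mem measurableSet_halfSpace] with p hp
    rw [h p.1 p.2 hp.2])

theorem normL2_congr {F : Type*} [NormedAddCommGroup F] [NormedSpace ℝ F] {f g : Tan n → ℝ → F}
    (h : ∀ x y, 0 < y → f x y = g x y) : normL2 f = normL2 g :=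
  eLpNorm_congr_ae (by
    filter_upwards [ae_restrict_mem measurableSet_halfSpace] with p hp
    exact h p.1 p.2 hp.2)

theorem normL2_le_iff (f : Tan n → ℝ → ℝ) (C : ℝ≥0∞) : normL2 f ≤ C ↔ energy f ≤ C ^ 2 :=
  eLpNorm_two_le_iff _ _ _

/-- Source and boundary flux vanish, so the energy inequality leaves only `lam` times the space-time
energy. That energy is finite, and `lam` can tend to zero. -/
theorem Reg.normL2_antitone (h : Reg w wt wx wy wyy) (hU : Continuous U) (hm : ∀ y, ‖U y‖ ≤ m)
    (heq : ∀ t x y, 0 < t → 0 < y → src U wt wx wyy t x y = 0) (hb : ∀ t x, w t x 0 = 0)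
    (hfin : ∀ T, ∫⁻ τ in Ioc 0 T, energy (w τ) < ⊤) {s t : ℝ} (hs : 0 ≤ s) (hst : s ≤ t) :
    normL2 (w t) ≤ normL2 (w s) := by
  rw [normL2_le_iff, ← energy_eq]
  set I := ∫⁻ τ in Ioc s t, energy (w τ) with hI
  have hItop : I ≠ ⊤ := by
    refine ne_top_of_le_ne_top (hfin t).ne (lintegral_mono_set ?_)
    exact Ioc_subset_Ioc_left hs
  have key : ∀ lam : ℝ, 0 < lam → energy (w t) ≤ energy (w s) + ENNReal.ofReal lam * I := by
    intro lam hlam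
    have h1 := h.energy_le hU hm hs hst hlam
    have h2 : ∫⁻ τ in Ioc s t, energy (src U wt wx wyy τ) = 0 := by
      rw [setLIntegral_congr_fun measurableSet_Ioc (g := fun _ => 0)]
      · simp
      · intro τ hτ
        simp only
        rw [energy_congr (g := fun _ _ => 0) fun x y hy => heq τ x y (hs.trans_lt hτ.1) hy]
        simp [energy]
    have h3 : ∫⁻ τ in Ioc s t, ∫⁻ x, 2 * ‖w τ x 0‖ₑ * ‖wy τ x 0‖ₑ = 0 := by
      simp [hb]
    rw [h2, h3] at h1
    simpa using h1
  have hlim : Filter.Tendsto (fun lam : ℝ => energy (w s) + ENNReal.ofReal lam * I)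
      (nhdsWithin 0 (Ioi 0)) (nhds (energy (w s) + ENNReal.ofReal 0 * I)) := by
    refine tendsto_const_nhds.add (ENNReal.Tendsto.mul_const ?_ (Or.inr hItop))
    exact (ENNReal.continuous_ofReal.tendsto 0).mono_left nhdsWithin_le_nhds
  have := ge_of_tendsto hlim (by
    filter_upwards [self_mem_nhdsWithin] with lam hlam using key lam hlam)
  simpa using this

/-- The energy created by a source and by boundary values. -/
theorem Reg.energy_le_of_src (h : Reg w wt wx wy wyy) (hU : Continuous U) (hm : ∀ y, ‖U y‖ ≤ m)
    {T : ℝ} (hT : 0 < T) (h0 : ∀ x y, 0 < y → w 0 x y = 0)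
    (hfin : ∫⁻ τ in Ioc 0 T, energy (w τ) < ⊤) {S B : ℝ≥0∞}
    (hS : ∫⁻ τ in Ioc 0 T, energy (src U wt wx wyy τ) ≤ S)
    (hB : ∫⁻ τ in Ioc 0 T, ∫⁻ x, 2 * ‖w τ x 0‖ₑ * ‖wy τ x 0‖ₑ ≤ B) :
    energy (w T) ≤ 2 * (ENNReal.ofReal (4 * T) * S + B) := by
  set I := ∫⁻ τ in Ioc 0 T, energy (w τ) with hI
  set X := ENNReal.ofReal (4 * T) * S + B with hX
  have e0 : energy (w 0) = 0 := by
    rw [energy_congr (g := fun _ _ => 0) h0]; simp [energy]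
  have key : ∀ t ∈ Ioc 0 T, energy (w t) ≤ ENNReal.ofReal (1 / (2 * T)) * I + X := by
    intro t ht
    have hsub : Ioc 0 t ⊆ Ioc 0 T := Ioc_subset_Ioc_right ht.2
    -- This `lam` makes the integral over (0, T) of the absorbable term exactly half of I; the
    -- source then carries the factor 2 / lam = 4T.
    have h1 := h.energy_le hU hm le_rfl ht.1.le (lam := 1 / (2 * T)) (by positivity)
    rw [e0, zero_add, add_assoc] at h1
    refine h1.trans (add_le_add (mul_le_mul_right (lintegral_mono_set hsub) _) (add_le_add ?_ ?_))
    · have e1 : 2 / (1 / (2 * T)) = 4 * T := by field_simp; norm_num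
      rw [e1]
      exact mul_le_mul_right ((lintegral_mono_set hsub).trans hS) _
    · exact (lintegral_mono_set hsub).trans hB
  have hI2 : I ≤ ENNReal.ofReal T * (ENNReal.ofReal (1 / (2 * T)) * I + X) := by
    calc I ≤ ∫⁻ τ in Ioc 0 T, (ENNReal.ofReal (1 / (2 * T)) * I + X) :=
          setLIntegral_mono measurable_const key
      _ = _ := by
          rw [setLIntegral_const, Real.volume_Ioc, sub_zero, mul_comm]
  have hhalf : ENNReal.ofReal T * (ENNReal.ofReal (1 / (2 * T)) * I) = I / 2 := by
    rw [← mul_assoc, ← ENNReal.ofReal_mul hT.le]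
    have : T * (1 / (2 * T)) = 1 / 2 := by field_simp
    rw [this, ENNReal.div_eq_inv_mul, one_div, ENNReal.ofReal_inv_of_pos two_pos]
    simp
  -- Absorption: I ≤ I/2 + T X, and I/2 may be cancelled because it is finite.
  have hI3 : I / 2 ≤ ENNReal.ofReal T * X := by
    rw [mul_add, hhalf] at hI2
    have hne : I / 2 ≠ ⊤ := ENNReal.div_ne_top hfin.ne two_ne_zero
    refine (ENNReal.add_le_add_iff_left hne).1 ?_
    rwa [ENNReal.add_halves]
  have h4 : ENNReal.ofReal (1 / (2 * T)) * I ≤ X := by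
    have e : ENNReal.ofReal (1 / (2 * T)) * I = ENNReal.ofReal (1 / T) * (I / 2) := by
      rw [← hhalf, ← mul_assoc, ← ENNReal.ofReal_mul (by positivity)]
      have : 1 / T * T = 1 := by field_simp
      rw [this]; simp
    rw [e]
    calc _ ≤ ENNReal.ofReal (1 / T) * (ENNReal.ofReal T * X) := mul_le_mul_right hI3 _
      _ = X := by
        rw [← mul_assoc, ← ENNReal.ofReal_mul (by positivity)]
        have : 1 / T * T = 1 := by field_simp
        rw [this]; simp
  calc energy (w T) ≤ ENNReal.ofReal (1 / (2 * T)) * I + X := key T ⟨hT, le_rfl⟩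
    _ ≤ X + X := add_le_add_left h4 _
    _ = 2 * X := (two_mul X).symm

/-- A bounded solution of `∂_t w + U · ∇_h w = ∂_y² w` that vanishes on the boundary. -/
structure Sol (U : ℝ → Tan n) (w wt : ℝ → Tan n → ℝ → ℝ)
    (wx : ℝ → Tan n → ℝ → (Tan n →L[ℝ] ℝ)) (wy wyy : ℝ → Tan n → ℝ → ℝ) : Prop where
  reg : Reg w wt wx wy wyy
  eq : ∀ t x y, 0 < t → 0 < y → src U wt wx wyy t x y = 0
  bdry : ∀ t x, w t x 0 = 0
  bdd : ∃ C : ℝ≥0∞, C < ⊤ ∧ ∀ t, 0 ≤ t → normL2 (w t) ≤ C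

theorem normL2_sub_le {f g : Tan n → ℝ → ℝ} (hf : Continuous fun p : Tan n × ℝ => f p.1 p.2)
    (hg : Continuous fun p : Tan n × ℝ => g p.1 p.2) :
    normL2 (fun x y => f x y - g x y) ≤ normL2 f + normL2 g :=
  eLpNorm_sub_le (aesm_half hf) (aesm_half hg) (by norm_num)

theorem normL2_add_le {f g : Tan n → ℝ → ℝ} (hf : Continuous fun p : Tan n × ℝ => f p.1 p.2)
    (hg : Continuous fun p : Tan n × ℝ => g p.1 p.2) :
    normL2 (fun x y => f x y + g x y) ≤ normL2 f + normL2 g :=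
  eLpNorm_add_le (aesm_half hf) (aesm_half hg) (by norm_num)

theorem normL2_const_mul (r : ℝ) (f : Tan n → ℝ → ℝ) :
    normL2 (fun x y => r * f x y) = ‖r‖ₑ * normL2 f :=
  eLpNorm_const_smul r (fun p : Tan n × ℝ => f p.1 p.2) 2 _

theorem normL2_shift_le {f : Tan n → ℝ → ℝ} (hf : Continuous fun p : Tan n × ℝ => f p.1 p.2)
    (v : Tan n) : normL2 (fun x y => f (x + v) y) ≤ normL2 f := by
  have := nrm_translate_le (f := fun p : Tan n × ℝ => f p.1 p.2) (v := (v, 0)) (aesm_half hf) le_rfl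
  simpa [normL2] using this

theorem Sol.sub (h : Sol U w wt wx wy wyy) (h' : Sol U w' wt' wx' wy' wyy') :
    Sol U (fun t x y => w t x y - w' t x y) (fun t x y => wt t x y - wt' t x y)
      (fun t x y => wx t x y - wx' t x y) (fun t x y => wy t x y - wy' t x y)
      (fun t x y => wyy t x y - wyy' t x y) where
  reg := h.reg.sub h'.reg
  eq t x y ht hy := by
    have h1 := h.eq t x y ht hy
    have h2 := h'.eq t x y ht hy
    simp only [src, sub_apply] at h1 h2 ⊢
    linarith
  bdry t x := by simp [h.bdry, h'.bdry]
  bdd := by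
    obtain ⟨C, hC, h1⟩ := h.bdd
    obtain ⟨D, hD, h2⟩ := h'.bdd
    exact ⟨C + D, ENNReal.add_lt_top.2 ⟨hC, hD⟩, fun t ht =>
      (normL2_sub_le (continuous_slice h.reg.c t) (continuous_slice h'.reg.c t)).trans
        (add_le_add (h1 t ht) (h2 t ht))⟩

/-- The coefficients do not depend on t or x', so both kinds of translates stay in the class.
Differences of translates replace derivatives, which need not solve the equation classically. -/
theorem Sol.shiftTime (h : Sol U w wt wx wy wyy) {r : ℝ} (hr : 0 ≤ r) :
    Sol U (fun t x y => w (t + r) x y) (fun t x y => wt (t + r) x y)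
      (fun t x y => wx (t + r) x y) (fun t x y => wy (t + r) x y)
      (fun t x y => wyy (t + r) x y) where
  reg := h.reg.shiftTime hr
  eq t x y ht hy := h.eq (t + r) x y (by linarith) hy
  bdry t x := h.bdry _ x
  bdd := by
    obtain ⟨C, hC, h1⟩ := h.bdd
    exact ⟨C, hC, fun t ht => h1 (t + r) (by linarith)⟩

theorem Sol.shiftSpace (h : Sol U w wt wx wy wyy) (v : Tan n) :
    Sol U (fun t x y => w t (x + v) y) (fun t x y => wt t (x + v) y)
      (fun t x y => wx t (x + v) y) (fun t x y => wy t (x + v) y)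
      (fun t x y => wyy t (x + v) y) where
  reg := h.reg.shiftSpace v
  eq t x y ht hy := h.eq t (x + v) y ht hy
  bdry t x := h.bdry t _
  bdd := by
    obtain ⟨C, hC, h1⟩ := h.bdd
    exact ⟨C, hC, fun t ht => (normL2_shift_le (continuous_slice h.reg.c t) v).trans (h1 t ht)⟩

theorem lintegral_energy_lt_top {f : ℝ → Tan n → ℝ → ℝ} {C : ℝ≥0∞} (hC : C < ⊤) {T : ℝ}
    (h : ∀ t, 0 ≤ t → t ≤ T → normL2 (f t) ≤ C) : ∫⁻ τ in Ioc 0 T, energy (f τ) < ⊤ := by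
  have h1 : ∫⁻ τ in Ioc 0 T, energy (f τ) ≤ ∫⁻ τ in Ioc 0 T, C ^ 2 :=
    setLIntegral_mono measurable_const fun τ hτ => (normL2_le_iff _ _).1 (h τ hτ.1.le hτ.2)
  refine h1.trans_lt ?_
  rw [setLIntegral_const]
  exact ENNReal.mul_lt_top (ENNReal.pow_lt_top hC) (by simp)

theorem Sol.antitone (h : Sol U w wt wx wy wyy) (hU : Continuous U) (hm : ∀ y, ‖U y‖ ≤ m)
    {s t : ℝ} (hs : 0 ≤ s) (hst : s ≤ t) : normL2 (w t) ≤ normL2 (w s) := by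
  obtain ⟨C, hC, h1⟩ := h.bdd
  exact h.reg.normL2_antitone hU hm h.eq h.bdry
    (fun T => lintegral_energy_lt_top hC fun t ht _ => h1 t ht) hs hst

/-- The equation holds up to the initial time. -/
theorem Sol.eq_of_nonneg (h : Sol U w wt wx wy wyy) (hU : Continuous U) {t : ℝ} (ht : 0 ≤ t)
    (x : Tan n) {y : ℝ} (hy : 0 < y) : wyy t x y = wt t x y + wx t x y (U y) := by
  have hc : Continuous fun t => src U wt wx wyy t x y :=
    (h.reg.continuous_src hU).comp (by fun_prop : Continuous fun τ : ℝ => (τ, x, y))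
  have hz : src U wt wx wyy t x y = 0 := by
    have hcl : t ∈ closure (Ioi (0 : ℝ)) := by rwa [closure_Ioi]
    have hsub : closure (Ioi (0 : ℝ)) ⊆ {t | src U wt wx wyy t x y = 0} :=
      closure_minimal (fun r hr => h.eq r x y hr hy) (isClosed_eq hc continuous_const)
    exact hsub hcl
  unfold src at hz
  linarith

end

section

variable {n : ℕ} {w wt : ℝ → Tan n → ℝ → ℝ} {wx : ℝ → Tan n → ℝ → (Tan n →L[ℝ] ℝ)}
  {wy wyy : ℝ → Tan n → ℝ → ℝ} {U : ℝ → Tan n} {m : ℝ}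

/-- The coordinate vector `e_k`. -/
abbrev ev (k : Fin n) : Tan n := EuclideanSpace.single k 1

theorem clm_apply_eq_sum (L : Tan n →L[ℝ] ℝ) (v : Tan n) : L v = ∑ k, v k * L (ev k) := by
  conv_lhs => rw [← (EuclideanSpace.basisFun (Fin n) ℝ).sum_repr v]
  simp [map_sum]

theorem abs_coord_le (v : Tan n) (k : Fin n) : |v k| ≤ ‖v‖ := PiLp.norm_apply_le v k

/-- The sum of the `L²` norms of the partial derivatives. -/
def gradSum (g : Tan n → ℝ → (Tan n →L[ℝ] ℝ)) : ℝ≥0∞ :=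
  ∑ k, normL2 (fun x y => g x y (ev k))

theorem normL2_sum_le {ι : Type*} (s : Finset ι) {f : ι → Tan n → ℝ → ℝ}
    (hf : ∀ i ∈ s, Continuous fun p : Tan n × ℝ => f i p.1 p.2) :
    normL2 (fun x y => ∑ i ∈ s, f i x y) ≤ ∑ i ∈ s, normL2 (f i) := by
  have := eLpNorm_sum_le (p := 2) (μ := (volume : Measure (Tan n × ℝ)).restrict (halfSpace n))
    (f := fun i (p : Tan n × ℝ) => f i p.1 p.2) (s := s) (fun i hi => aesm_half (hf i hi))
    (by norm_num)
  refine le_trans (le_of_eq ?_) this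
  unfold normL2
  congr 1
  ext p
  simp

theorem normL2_mul_le {b : ℝ → ℝ} {m : ℝ} (hb : ∀ y, 0 < y → |b y| ≤ m) (f : Tan n → ℝ → ℝ) :
    normL2 (fun x y => b y * f x y) ≤ ENNReal.ofReal m * normL2 f := by
  have h := eLpNorm_le_mul_eLpNorm_of_ae_le_mul (p := 2)
    (μ := (volume : Measure (Tan n × ℝ)).restrict (halfSpace n)) (c := m)
    (f := fun p : Tan n × ℝ => b p.2 * f p.1 p.2) (g := fun p : Tan n × ℝ => f p.1 p.2) (by
      filter_upwards [ae_restrict_mem measurableSet_halfSpace] with p hp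
      rw [norm_mul]
      exact mul_le_mul_of_nonneg_right (hb p.2 hp.2) (norm_nonneg _))
  exact h

theorem normL2_transport_le {g : Tan n → ℝ → (Tan n →L[ℝ] ℝ)}
    (hg : Continuous fun p : Tan n × ℝ => g p.1 p.2) (hU : Continuous U) (hm : ∀ y, ‖U y‖ ≤ m) :
    normL2 (fun x y => g x y (U y)) ≤ ENNReal.ofReal m * gradSum g := by
  have h1 : (fun x y => g x y (U y)) = fun x y => ∑ k, U y k * g x y (ev k) := by
    funext x y; exact clm_apply_eq_sum _ _
  rw [h1, gradSum, Finset.mul_sum]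
  refine (normL2_sum_le _ fun k _ => ?_).trans (Finset.sum_le_sum fun k _ => ?_)
  · fun_prop
  · exact normL2_mul_le (fun y _ => (abs_coord_le _ k).trans (hm y)) _

/-- The value of `∂_t w` at the initial time, computed from the equation. -/
def initialRate (U : ℝ → Tan n) (g : Tan n → ℝ → (Tan n →L[ℝ] ℝ)) (f : Tan n → ℝ → ℝ)
    (x : Tan n) (y : ℝ) : ℝ := f x y - g x y (U y)

theorem normL2_initialRate_le {g : Tan n → ℝ → (Tan n →L[ℝ] ℝ)} {f : Tan n → ℝ → ℝ}
    (hg : Continuous fun p : Tan n × ℝ => g p.1 p.2) (hf : Continuous fun p : Tan n × ℝ => f p.1 p.2)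
    (hU : Continuous U) (hm : ∀ y, ‖U y‖ ≤ m) :
    normL2 (initialRate U g f) ≤ normL2 f + ENNReal.ofReal m * gradSum g :=
  (normL2_sub_le hf (by fun_prop)).trans (by
    gcongr
    exact normL2_transport_le hg hU hm)

/-! ### Time differences -/

/-- The difference w - w(0) vanishes at time 0 and on the boundary, and its source is the initial
rate, constant in time. The inequality with source yields 8r² times the energy of the rate, rounded
up to (3r)². -/
theorem Sol.initialIncrement (h : Sol U w wt wx wy wyy) (hU : Continuous U)
    (hm : ∀ y, ‖U y‖ ≤ m) {r : ℝ} (hr : 0 ≤ r) :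
    normL2 (fun x y => w r x y - w 0 x y) ≤
      ENNReal.ofReal (3 * r) * normL2 (initialRate U (wx 0) (wyy 0)) := by
  rcases hr.eq_or_lt with rfl | hr
  · simp [normL2]
  have hreg := h.reg.sub (h.reg.freeze 0)
  set f := initialRate U (wx 0) (wyy 0) with hf
  obtain ⟨C, hC, hbd⟩ := h.bdd
  have hfin : ∫⁻ τ in Ioc 0 r, energy (fun x y => w τ x y - w 0 x y) < ⊤ :=
    lintegral_energy_lt_top (C := C + C) (ENNReal.add_lt_top.2 ⟨hC, hC⟩) fun t ht _ =>
      (normL2_sub_le (continuous_slice h.reg.c t) (continuous_slice h.reg.c 0)).trans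
        (add_le_add (hbd t ht) (hbd 0 le_rfl))
  have hS : ∫⁻ τ in Ioc 0 r, energy (src U (fun t x y => wt t x y - 0)
      (fun t x y => wx t x y - wx 0 x y) (fun t x y => wyy t x y - wyy 0 x y) τ) ≤
      ENNReal.ofReal r * energy f := by
    rw [setLIntegral_congr_fun measurableSet_Ioc (g := fun _ => energy f)]
    · rw [setLIntegral_const, Real.volume_Ioc, sub_zero, mul_comm]
    · intro τ hτ
      refine energy_congr fun x y hy => ?_
      have h1 := h.eq τ x y hτ.1 hy
      simp only [src, sub_apply, hf, initialRate] at h1 ⊢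
      linarith
  have hB : ∫⁻ τ in Ioc 0 r, ∫⁻ x, 2 * ‖w τ x 0 - w 0 x 0‖ₑ * ‖wy τ x 0 - wy 0 x 0‖ₑ ≤ 0 := by
    simp [h.bdry]
  have := hreg.energy_le_of_src hU hm hr (fun x y _ => sub_self _) hfin hS hB
  rw [normL2_le_iff]
  refine this.trans ?_
  rw [energy_eq, mul_pow, add_zero, ← mul_assoc, ← mul_assoc, ← ENNReal.ofReal_pow (by positivity)]
  gcongr
  rw [show (2 : ℝ≥0∞) = ENNReal.ofReal 2 by simp, ← ENNReal.ofReal_mul (by norm_num),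
    ← ENNReal.ofReal_mul (by positivity)]
  refine ENNReal.ofReal_le_ofReal ?_
  nlinarith

/-- A time increment is itself a solution, so its norm is largest at the initial time. -/
theorem Sol.timeIncrement (h : Sol U w wt wx wy wyy) (hU : Continuous U)
    (hm : ∀ y, ‖U y‖ ≤ m) {t r : ℝ} (ht : 0 ≤ t) (hr : 0 ≤ r) :
    normL2 (fun x y => w (t + r) x y - w t x y) ≤
      ENNReal.ofReal (3 * r) * normL2 (initialRate U (wx 0) (wyy 0)) := by
  have h1 := ((h.shiftTime hr).sub h).antitone hU hm le_rfl ht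
  simp only [zero_add] at h1
  exact h1.trans (h.initialIncrement hU hm hr)

theorem Sol.normL2_wt_le (h : Sol U w wt wx wy wyy) (hU : Continuous U)
    (hm : ∀ y, ‖U y‖ ≤ m) {t : ℝ} (ht : 0 ≤ t) :
    normL2 (wt t) ≤ 3 * normL2 (initialRate U (wx 0) (wyy 0)) := by
  refine eLpNorm_le_of_tendsto
    (f := fun (k : ℕ) (p : Tan n × ℝ) =>
      ((k : ℝ) + 1) * (w (t + 1 / ((k : ℝ) + 1)) p.1 p.2 - w t p.1 p.2)) ?_ ?_ ?_
  · intro k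
    exact aesm_half (((continuous_slice h.reg.c _).sub (continuous_slice h.reg.c _)).const_mul _)
  · exact Filter.Eventually.of_forall fun p => h.reg.tendsto_timeQuotient ht p.1 p.2
  · intro k
    have h1 := h.timeIncrement hU hm ht (r := 1 / ((k : ℝ) + 1)) (by positivity)
    have h2 := normL2_const_mul ((k : ℝ) + 1)
      (fun x y => w (t + 1 / ((k : ℝ) + 1)) x y - w t x y)
    refine h2.le.trans ?_
    rw [Real.enorm_eq_ofReal (by positivity)]
    refine (mul_le_mul_right h1 _).trans (le_of_eq ?_)
    rw [← mul_assoc, ← ENNReal.ofReal_mul (by positivity)]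
    congr 1
    rw [show ((k : ℝ) + 1) * (3 * (1 / ((k : ℝ) + 1))) = 3 by field_simp]
    simp

/-! ### Tangential derivatives -/

theorem normL2_xIncrement_le {f : Tan n → ℝ → ℝ} {f' : Tan n → ℝ → (Tan n →L[ℝ] ℝ)}
    (hf : Continuous fun p : Tan n × ℝ => f p.1 p.2)
    (hf' : Continuous fun p : Tan n × ℝ => f' p.1 p.2)
    (hd : ∀ x y, HasFDerivAt (fun x' => f x' y) (f' x y) x) (v : Tan n) :
    normL2 (fun x y => f (x + v) y - f x y) ≤ normL2 (fun x y => f' x y v) := by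
  have h := nrm_increment_le (f := fun p : Tan n × ℝ => f p.1 p.2)
    (g := fun p : Tan n × ℝ => f' p.1 p.2 v) hf (by fun_prop) (v := (v, 0)) le_rfl (by
      intro p _
      have h1 : HasDerivAt (fun s : ℝ => p.1 + s • v) v 0 := by
        simpa using ((hasDerivAt_id (0 : ℝ)).smul_const v).const_add p.1
      have h2 := HasFDerivAt.comp_hasDerivAt (0 : ℝ) (l := fun x' => f x' p.2)
        (l' := f' p.1 p.2) (by simpa using hd p.1 p.2) h1
      simpa [Function.comp_def] using h2)
  simpa [normL2] using h

theorem tendsto_xQuotient {f : Tan n → ℝ} {f' : Tan n →L[ℝ] ℝ} {x : Tan n}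
    (hd : HasFDerivAt f f' x) (v : Tan n) :
    Filter.Tendsto (fun k : ℕ => ((k : ℝ) + 1) * (f (x + (1 / ((k : ℝ) + 1)) • v) - f x))
      Filter.atTop (nhds (f' v)) := by
  have h1 : HasDerivAt (fun s : ℝ => x + s • v) v 0 := by
    simpa using ((hasDerivAt_id (0 : ℝ)).smul_const v).const_add x
  have h2 := HasFDerivAt.comp_hasDerivAt (0 : ℝ) (l := f) (l' := f') (by simpa using hd) h1
  refine (tendsto_inv_nat_smul h2.hasDerivWithinAt).congr fun k => ?_
  simp

/-- Tangential difference quotients are solutions: at time t they are bounded by those at time s,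
and those by the derivative at s. Fatou closes the argument with constant 1, which the monotonicity
of the gradient norm requires. -/
theorem Sol.normL2_dir_le (h : Sol U w wt wx wy wyy) (hU : Continuous U)
    (hm : ∀ y, ‖U y‖ ≤ m) {s t : ℝ} (hs : 0 ≤ s) (hst : s ≤ t) (v : Tan n) :
    normL2 (fun x y => wx t x y v) ≤ normL2 (fun x y => wx s x y v) := by
  refine eLpNorm_le_of_tendsto
    (f := fun (k : ℕ) (p : Tan n × ℝ) =>
      ((k : ℝ) + 1) * (w t (p.1 + (1 / ((k : ℝ) + 1)) • v) p.2 - w t p.1 p.2)) ?_ ?_ ?_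
  · intro k
    have hc := ((h.reg.shiftSpace ((1 / ((k : ℝ) + 1)) • v)).sub h.reg).continuous_at_time t
    exact aesm_half (hc.const_mul _)
  · exact Filter.Eventually.of_forall fun p => tendsto_xQuotient (h.reg.hx t p.1 p.2) v
  · intro k
    have h1 := ((h.shiftSpace ((1 / ((k : ℝ) + 1)) • v)).sub h).antitone hU hm hs hst
    have h2 := normL2_xIncrement_le (continuous_slice h.reg.c s) (continuous_slice h.reg.cx s)
      (h.reg.hx s) ((1 / ((k : ℝ) + 1)) • v)
    have h3 := normL2_const_mul ((k : ℝ) + 1)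
      (fun x y => w t (x + (1 / ((k : ℝ) + 1)) • v) y - w t x y)
    refine h3.le.trans ((mul_le_mul_right (h1.trans h2) _).trans (le_of_eq ?_))
    rw [← normL2_const_mul]
    congr 1
    funext x y
    rw [map_smul, smul_eq_mul]
    field_simp

theorem Sol.gradSum_le (h : Sol U w wt wx wy wyy) (hU : Continuous U)
    (hm : ∀ y, ‖U y‖ ≤ m) {s t : ℝ} (hs : 0 ≤ s) (hst : s ≤ t) :
    gradSum (wx t) ≤ gradSum (wx s) :=
  Finset.sum_le_sum fun k _ => h.normL2_dir_le hU hm hs hst (ev k)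

/-- The equation trades ∂_y² w for ∂_t w + U·∇w. The gradient enters three times through the initial
rate and once through transport. -/
theorem Sol.normL2_wyy_le (h : Sol U w wt wx wy wyy) (hU : Continuous U)
    (hm : ∀ y, ‖U y‖ ≤ m) {t : ℝ} (ht : 0 ≤ t) :
    normL2 (wyy t) ≤ 3 * normL2 (wyy 0) + 4 * ENNReal.ofReal m * gradSum (wx 0) := by
  have h1 : normL2 (wyy t) = normL2 (fun x y => wt t x y + wx t x y (U y)) :=
    normL2_congr fun x y hy => h.eq_of_nonneg hU ht x hy
  have cx := continuous_slice h.reg.cx t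
  have cxU : Continuous fun p : Tan n × ℝ => wx t p.1 p.2 (U p.2) := by fun_prop
  rw [h1]
  calc _ ≤ normL2 (wt t) + normL2 (fun x y => wx t x y (U y)) :=
        normL2_add_le (continuous_slice h.reg.ct t) cxU
    _ ≤ 3 * (normL2 (wyy 0) + ENNReal.ofReal m * gradSum (wx 0)) +
        ENNReal.ofReal m * gradSum (wx 0) := by
        gcongr
        · refine (h.normL2_wt_le hU hm ht).trans ?_
          gcongr
          exact normL2_initialRate_le (continuous_slice h.reg.cx 0)
            (continuous_slice h.reg.cyy 0) hU hm
        · refine (normL2_transport_le cx hU hm).trans ?_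
          gcongr
          exact h.gradSum_le hU hm le_rfl ht
    _ = _ := by ring

end

/-! ### From norms over the half space to norms on slices. -/

section

variable {n : ℕ} {w wt : ℝ → Tan n → ℝ → ℝ} {wx : ℝ → Tan n → ℝ → (Tan n →L[ℝ] ℝ)}
  {wy wyy : ℝ → Tan n → ℝ → ℝ} {U : ℝ → Tan n} {m : ℝ}

/-! ### Norms on horizontal slices -/

/-- Integration by parts against a weight `ψ` with `ψ(ℓ) = ψ'(ℓ) = 0`. -/
theorem integral_weight_secondDeriv {g g' g'' ψ ψ' ψ'' : ℝ → ℝ} {y l : ℝ} (hy : 0 ≤ y) (hl : 0 ≤ l)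
    (cg : Continuous g) (cg' : Continuous g') (cg'' : Continuous g'') (cψ'' : Continuous ψ'')
    (hg : ∀ y, 0 < y → HasDerivAt g (g' y) y) (hg' : ∀ y, 0 < y → HasDerivAt g' (g'' y) y)
    (hψ : ∀ s, HasDerivAt ψ (ψ' s) s) (hψ' : ∀ s, HasDerivAt ψ' (ψ'' s) s)
    (h0 : ψ l = 0) (h0' : ψ' l = 0) :
    ∫ s in (0 : ℝ)..l, (ψ s * g'' (y + s) - ψ'' s * g (y + s)) = ψ' 0 * g y - ψ 0 * g' y := by
  have cψ : Continuous ψ := continuous_iff_continuousAt.2 fun y => (hψ y).continuousAt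
  have cψ' : Continuous ψ' := continuous_iff_continuousAt.2 fun y => (hψ' y).continuousAt
  have h := intervalIntegral.integral_eq_sub_of_hasDerivAt_of_le hl
    (f := fun s => ψ s * g' (y + s) - ψ' s * g (y + s))
    (f' := fun s => ψ s * g'' (y + s) - ψ'' s * g (y + s))
    (by fun_prop) (fun s hs => by
      have h1 := (hg (y + s) (by linarith [hs.1])).comp_const_add y s
      have h2 := (hg' (y + s) (by linarith [hs.1])).comp_const_add y s
      refine (((hψ s).mul h2).sub ((hψ' s).mul h1)).congr_deriv ?_
      ring)
    ((by fun_prop : Continuous fun s => ψ s * g'' (y + s) - ψ'' s * g (y + s)).intervalIntegrable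
      _ _)
  rw [h, h0, h0']
  simp only [zero_mul, sub_zero, add_zero]
  ring

/-- A function on `ℝⁿ` that is represented by weighted integrals over a layer of width `ℓ`. -/
theorem sliceNorm_le_of_repr {G : Tan n → ℝ} {g k : Tan n → ℝ → ℝ} {ψ χ : ℝ → ℝ} {y l A B : ℝ}
    (hy : 0 ≤ y) (hl : 0 ≤ l) (hA : 0 ≤ A) (hB : 0 ≤ B)
    (cg : Continuous fun p : Tan n × ℝ => g p.1 p.2)
    (ck : Continuous fun p : Tan n × ℝ => k p.1 p.2)
    (cψ : Continuous ψ) (cχ : Continuous χ)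
    (hψ : ∀ s ∈ Icc 0 l, |ψ s| ≤ A) (hχ : ∀ s ∈ Icc 0 l, |χ s| ≤ B)
    (hG : ∀ x, G x = ∫ s in (0 : ℝ)..l, (ψ s * k x (y + s) - χ s * g x (y + s))) :
    eLpNorm G 2 volume ≤
      ENNReal.ofReal (Real.sqrt (2 * l)) * (ENNReal.ofReal A * normL2 k + ENNReal.ofReal B * normL2 g) := by
  rw [eLpNorm_two_le_iff]
  have hpt : ∀ x s, s ∈ Ioc 0 l → ‖ψ s * k x (y + s) - χ s * g x (y + s)‖ₑ ^ 2 ≤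
      ENNReal.ofReal (2 * A ^ 2) * ‖k x (y + s)‖ₑ ^ 2 +
      ENNReal.ofReal (2 * B ^ 2) * ‖g x (y + s)‖ₑ ^ 2 := by
    intro x s hs
    have hs' : s ∈ Icc 0 l := Ioc_subset_Icc_self hs
    rw [← enorm_pow, ← enorm_pow, ← enorm_pow, Real.enorm_eq_ofReal (sq_nonneg _),
      Real.enorm_eq_ofReal (sq_nonneg _), Real.enorm_eq_ofReal (sq_nonneg _),
      ← ENNReal.ofReal_mul (by positivity), ← ENNReal.ofReal_mul (by positivity),
      ← ENNReal.ofReal_add (by positivity) (by positivity)]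
    refine ENNReal.ofReal_le_ofReal ?_
    have h1 : ψ s ^ 2 ≤ A ^ 2 := sq_le_sq' (abs_le.1 (hψ s hs')).1 (abs_le.1 (hψ s hs')).2
    have h2 : χ s ^ 2 ≤ B ^ 2 := sq_le_sq' (abs_le.1 (hχ s hs')).1 (abs_le.1 (hχ s hs')).2
    have h3 := mul_le_mul_of_nonneg_right h1 (sq_nonneg (k x (y + s)))
    have h4 := mul_le_mul_of_nonneg_right h2 (sq_nonneg (g x (y + s)))
    nlinarith [sq_nonneg (ψ s * k x (y + s) + χ s * g x (y + s))]
  -- Since y ≥ 0, the layer (y, y + l) lies in the half space.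
  have layer : ∀ f : Tan n → ℝ → ℝ, (Continuous fun p : Tan n × ℝ => f p.1 p.2) →
      ∫⁻ x, ∫⁻ s in Ioc 0 l, ‖f x (y + s)‖ₑ ^ 2 ≤ energy f := by
    intro f cf
    unfold energy
    rw [restrict_halfSpace, lintegral_prod _ (cf.enorm.measurable.pow_const 2).aemeasurable]
    refine lintegral_mono fun x => ?_
    simp only
    have hmp : MeasurePreserving (fun s : ℝ => y + s) volume volume :=
      measurePreserving_add_left volume y
    have cfx : Continuous fun z => f x z := cf.comp (by fun_prop : Continuous fun z : ℝ => (x, z))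
    have h1 := (hmp.restrict_preimage (measurableSet_Ioi (a := (0 : ℝ)))).lintegral_comp
      (cfx.enorm.measurable.pow_const 2)
    refine le_trans ?_ h1.le
    refine lintegral_mono_set fun s hs => ?_
    have : 0 < s := hs.1
    simp only [mem_preimage, mem_Ioi]; linarith
  have ck' : Continuous fun p : Tan n × ℝ => k p.1 (y + p.2) :=
    ck.comp (by fun_prop : Continuous fun p : Tan n × ℝ => (p.1, y + p.2))
  have cg' : Continuous fun p : Tan n × ℝ => g p.1 (y + p.2) :=
    cg.comp (by fun_prop : Continuous fun p : Tan n × ℝ => (p.1, y + p.2))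
  have hx : ∀ x, ‖G x‖ₑ ^ 2 ≤ ENNReal.ofReal l *
      (ENNReal.ofReal (2 * A ^ 2) * (∫⁻ s in Ioc 0 l, ‖k x (y + s)‖ₑ ^ 2) +
      ENNReal.ofReal (2 * B ^ 2) * ∫⁻ s in Ioc 0 l, ‖g x (y + s)‖ₑ ^ 2) := by
    intro x
    have ckx : Continuous fun s => k x (y + s) :=
      ck'.comp (by fun_prop : Continuous fun z : ℝ => (x, z))
    have cgx : Continuous fun s => g x (y + s) :=
      cg'.comp (by fun_prop : Continuous fun z : ℝ => (x, z))
    rw [hG, intervalIntegral.integral_of_le hl]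
    -- Cauchy–Schwarz against the weight 1 costs the length l of the layer; together with the 2 from
    -- squaring a difference this is the factor √(2l).
    have h1 : ‖∫ s in Ioc 0 l, (ψ s * k x (y + s) - χ s * g x (y + s))‖ₑ ^ 2 ≤
        (∫⁻ s in Ioc 0 l, 1 * ‖ψ s * k x (y + s) - χ s * g x (y + s)‖ₑ) ^ 2 := by
      refine pow_le_pow_left' ?_ 2
      simpa using enorm_integral_le_lintegral_enorm _
    have h2 := sq_lintegral_weight_le (volume.restrict (Ioc 0 l)) (k := fun _ => 1)
      (g := fun s => ‖ψ s * k x (y + s) - χ s * g x (y + s)‖ₑ) aemeasurable_const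
      ((by fun_prop : Continuous fun s =>
        ψ s * k x (y + s) - χ s * g x (y + s)).enorm.measurable.aemeasurable)
    refine (h1.trans h2).trans ?_
    rw [lintegral_one, Measure.restrict_apply_univ, Real.volume_Ioc, sub_zero]
    gcongr
    rw [← lintegral_const_mul _ (ckx.enorm.measurable.pow_const 2),
      ← lintegral_const_mul _ (cgx.enorm.measurable.pow_const 2),
      ← lintegral_add_left ((ckx.enorm.measurable.pow_const 2).const_mul _)]
    refine setLIntegral_mono_ae ?_ (Filter.Eventually.of_forall fun s hs => ?_)
    · exact (((ckx.enorm.measurable.pow_const 2).const_mul _).add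
        ((cgx.enorm.measurable.pow_const 2).const_mul _)).aemeasurable
    · simpa using hpt x s hs
  have mk' : Measurable fun x => ∫⁻ s in Ioc 0 l, ‖k x (y + s)‖ₑ ^ 2 :=
    Measurable.lintegral_prod_right' (f := fun q : Tan n × ℝ => ‖k q.1 (y + q.2)‖ₑ ^ 2)
      (ck'.enorm.measurable.pow_const 2)
  have mg' : Measurable fun x => ∫⁻ s in Ioc 0 l, ‖g x (y + s)‖ₑ ^ 2 :=
    Measurable.lintegral_prod_right' (f := fun q : Tan n × ℝ => ‖g q.1 (y + q.2)‖ₑ ^ 2)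
      (cg'.enorm.measurable.pow_const 2)
  calc ∫⁻ x, ‖G x‖ₑ ^ 2 ≤ ∫⁻ x, ENNReal.ofReal l *
      (ENNReal.ofReal (2 * A ^ 2) * (∫⁻ s in Ioc 0 l, ‖k x (y + s)‖ₑ ^ 2) +
      ENNReal.ofReal (2 * B ^ 2) * ∫⁻ s in Ioc 0 l, ‖g x (y + s)‖ₑ ^ 2) := lintegral_mono hx
    _ = ENNReal.ofReal l * (ENNReal.ofReal (2 * A ^ 2) *
          (∫⁻ x, ∫⁻ s in Ioc 0 l, ‖k x (y + s)‖ₑ ^ 2) +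
        ENNReal.ofReal (2 * B ^ 2) * ∫⁻ x, ∫⁻ s in Ioc 0 l, ‖g x (y + s)‖ₑ ^ 2) := by
        rw [lintegral_const_mul' _ _ ENNReal.ofReal_ne_top,
          lintegral_add_left (mk'.const_mul _), lintegral_const_mul _ mk',
          lintegral_const_mul _ mg']
    _ ≤ ENNReal.ofReal l * (ENNReal.ofReal (2 * A ^ 2) * energy k +
        ENNReal.ofReal (2 * B ^ 2) * energy g) := by
        gcongr
        · exact layer k ck
        · exact layer g cg
    _ = ENNReal.ofReal (Real.sqrt (2 * l)) ^ 2 * ((ENNReal.ofReal A * normL2 k) ^ 2 +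
          (ENNReal.ofReal B * normL2 g) ^ 2) := by
        rw [energy_eq, energy_eq, ← ENNReal.ofReal_pow (Real.sqrt_nonneg _),
          Real.sq_sqrt (by positivity), ENNReal.ofReal_mul (by norm_num : (0 : ℝ) ≤ 2),
          ENNReal.ofReal_mul (by norm_num : (0 : ℝ) ≤ 2),
          ENNReal.ofReal_mul (by norm_num : (0 : ℝ) ≤ 2), ENNReal.ofReal_pow hA,
          ENNReal.ofReal_pow hB]
        ring
    _ ≤ _ := by
        refine le_trans (mul_le_mul_right ?_ _) (mul_pow _ _ 2).ge
        rw [add_sq]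
        exact add_le_add_left le_self_add _

theorem hasDerivAt_cubic (a b c d s : ℝ) :
    HasDerivAt (fun s : ℝ => a + b * s + c * s ^ 2 + d * s ^ 3)
      (b + 2 * c * s + 3 * d * s ^ 2) s := by
  have h1 := ((hasDerivAt_id s).const_mul b).const_add a
  have h2 := ((hasDerivAt_id s).pow 2).const_mul c
  have h3 := ((hasDerivAt_id s).pow 3).const_mul d
  refine ((h1.add h2).add h3).congr_deriv ?_
  simp; ring

theorem hasDerivAt_quadratic (a b c s : ℝ) :
    HasDerivAt (fun s : ℝ => a + b * s + c * s ^ 2) (b + 2 * c * s) s := by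
  have := hasDerivAt_cubic a b c 0 s
  simpa using this

/-- The representation of `g(y)` by `g` and `g''` on `(y, y + ℓ)`. -/
theorem repr_value {g g' g'' : ℝ → ℝ} {y l : ℝ} (hy : 0 ≤ y) (hl : 0 < l)
    (cg : Continuous g) (cg' : Continuous g') (cg'' : Continuous g'')
    (hg : ∀ y, 0 < y → HasDerivAt g (g' y) y) (hg' : ∀ y, 0 < y → HasDerivAt g' (g'' y) y) :
    g y = ∫ s in (0 : ℝ)..l, ((0 + 1 * s + (-(2 / l)) * s ^ 2 + (1 / l ^ 2) * s ^ 3) * g'' (y + s) -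
      (2 * (-(2 / l)) + 2 * (3 * (1 / l ^ 2)) * s) * g (y + s)) := by
  -- The weight is s(1 - s/l)²: it vanishes at 0 with slope 1, which selects g(y), and to second
  -- order at l, which removes the upper end.
  have h := integral_weight_secondDeriv hy hl.le cg cg' cg'' (by fun_prop) hg hg'
    (hasDerivAt_cubic 0 1 (-(2 / l)) (1 / l ^ 2))
    (fun s => hasDerivAt_quadratic 1 (2 * (-(2 / l))) (3 * (1 / l ^ 2)) s)
    (by field_simp; ring) (by field_simp; ring)
  rw [h]; ring

/-- The representation of `g'(y)` by `g` and `g''` on `(y, y + 1)`. -/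
theorem repr_deriv {g g' g'' : ℝ → ℝ} {y : ℝ} (hy : 0 ≤ y)
    (cg : Continuous g) (cg' : Continuous g') (cg'' : Continuous g'')
    (hg : ∀ y, 0 < y → HasDerivAt g (g' y) y) (hg' : ∀ y, 0 < y → HasDerivAt g' (g'' y) y) :
    g' y = ∫ s in (0 : ℝ)..1, ((-1 + 0 * s + 3 * s ^ 2 + (-2) * s ^ 3) * g'' (y + s) -
      (2 * 3 + 2 * (3 * (-2)) * s) * g (y + s)) := by
  -- The weight is -(1 - s)²(1 + 2s): value -1 and slope 0 at the origin select g'(y), and it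
  -- vanishes to second order at 1.
  have h := integral_weight_secondDeriv hy zero_le_one cg cg' cg'' (by fun_prop) hg hg'
    (hasDerivAt_cubic (-1) 0 3 (-2))
    (fun s => hasDerivAt_quadratic 0 (2 * 3) (3 * (-2)) s)
    (by norm_num) (by norm_num)
  rw [h]; ring

theorem weight_value_le {l s : ℝ} (hl : 0 < l) (hs : s ∈ Icc 0 l) :
    |0 + 1 * s + (-(2 / l)) * s ^ 2 + (1 / l ^ 2) * s ^ 3| ≤ l ∧
    |2 * (-(2 / l)) + 2 * (3 * (1 / l ^ 2)) * s| ≤ 4 / l := by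
  obtain ⟨h0, h1⟩ := hs
  have e1 : 0 + 1 * s + (-(2 / l)) * s ^ 2 + (1 / l ^ 2) * s ^ 3 = s * (1 - s / l) ^ 2 := by
    field_simp; ring
  have h2 : s / l ≤ 1 := (div_le_one hl).2 h1
  have h3 : 0 ≤ s / l := by positivity
  constructor
  · rw [e1, abs_of_nonneg (by positivity)]
    have : (1 - s / l) ^ 2 ≤ 1 := by nlinarith
    nlinarith
  · have e2 : 2 * (-(2 / l)) + 2 * (3 * (1 / l ^ 2)) * s = (6 * (s / l) - 4) / l := by
      field_simp; ring
    rw [e2, abs_div, abs_of_pos hl]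
    gcongr
    rw [abs_le]
    constructor <;> linarith

theorem weight_deriv_le {s : ℝ} (hs : s ∈ Icc (0 : ℝ) 1) :
    |(-1 : ℝ) + 0 * s + 3 * s ^ 2 + (-2) * s ^ 3| ≤ 1 ∧
    |(2 : ℝ) * 3 + 2 * (3 * (-2)) * s| ≤ 6 := by
  obtain ⟨h0, h1⟩ := hs
  constructor
  · rw [abs_le]
    constructor
    · nlinarith [mul_nonneg (sq_nonneg s) (by linarith : 0 ≤ 3 - 2 * s)]
    · nlinarith [mul_nonneg (sq_nonneg (1 - s)) (by linarith : 0 ≤ 1 + 2 * s)]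
  · rw [abs_le]
    constructor <;> linarith

/-- Interpolation with a free layer width l. A small l later shows that the boundary values of the
approximations tend to zero, since the cost 4/l falls on the smaller norm. -/
theorem sliceNorm_le {g g' g'' : Tan n → ℝ → ℝ}
    (cg : Continuous fun p : Tan n × ℝ => g p.1 p.2)
    (cg' : Continuous fun p : Tan n × ℝ => g' p.1 p.2)
    (cg'' : Continuous fun p : Tan n × ℝ => g'' p.1 p.2)
    (hg : ∀ x y, 0 < y → HasDerivAt (g x) (g' x y) y)
    (hg' : ∀ x y, 0 < y → HasDerivAt (g' x) (g'' x y) y) {y l : ℝ} (hy : 0 ≤ y) (hl : 0 < l) :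
    sliceNorm g y ≤ ENNReal.ofReal (Real.sqrt (2 * l)) *
      (ENNReal.ofReal l * normL2 g'' + ENNReal.ofReal (4 / l) * normL2 g) := by
  refine sliceNorm_le_of_repr hy hl.le hl.le (by positivity) cg cg'' (by fun_prop) (by fun_prop)
    (fun s hs => (weight_value_le hl hs).1) (fun s hs => (weight_value_le hl hs).2) fun x => ?_
  exact repr_value hy hl (cg.comp (by fun_prop : Continuous fun z : ℝ => (x, z)))
    (cg'.comp (by fun_prop : Continuous fun z : ℝ => (x, z)))
    (cg''.comp (by fun_prop : Continuous fun z : ℝ => (x, z))) (hg x) (hg' x)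

theorem sqrt_two_le : ENNReal.ofReal (Real.sqrt (2 * 1)) ≤ 2 := by
  rw [show (2 : ℝ≥0∞) = ENNReal.ofReal 2 by simp]
  refine ENNReal.ofReal_le_ofReal ?_
  rw [Real.sqrt_le_left (by norm_num)]; norm_num

theorem sliceNorm_le_one {g g' g'' : Tan n → ℝ → ℝ}
    (cg : Continuous fun p : Tan n × ℝ => g p.1 p.2)
    (cg' : Continuous fun p : Tan n × ℝ => g' p.1 p.2)
    (cg'' : Continuous fun p : Tan n × ℝ => g'' p.1 p.2)
    (hg : ∀ x y, 0 < y → HasDerivAt (g x) (g' x y) y)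
    (hg' : ∀ x y, 0 < y → HasDerivAt (g' x) (g'' x y) y) {y : ℝ} (hy : 0 ≤ y) :
    sliceNorm g y ≤ 8 * (normL2 g + normL2 g'') := by
  refine (sliceNorm_le cg cg' cg'' hg hg' hy one_pos).trans ?_
  refine (mul_le_mul_left sqrt_two_le _).trans ?_
  rw [ENNReal.ofReal_one, one_mul, div_one, show ENNReal.ofReal 4 = 4 by simp]
  calc 2 * (normL2 g'' + 4 * normL2 g) = 2 * normL2 g'' + 8 * normL2 g := by ring
    _ ≤ 8 * normL2 g'' + 8 * normL2 g := by gcongr; norm_num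
    _ = _ := by ring

theorem sliceNorm_deriv_le {g g' g'' : Tan n → ℝ → ℝ}
    (cg : Continuous fun p : Tan n × ℝ => g p.1 p.2)
    (cg' : Continuous fun p : Tan n × ℝ => g' p.1 p.2)
    (cg'' : Continuous fun p : Tan n × ℝ => g'' p.1 p.2)
    (hg : ∀ x y, 0 < y → HasDerivAt (g x) (g' x y) y)
    (hg' : ∀ x y, 0 < y → HasDerivAt (g' x) (g'' x y) y) {y : ℝ} (hy : 0 ≤ y) :
    sliceNorm g' y ≤ 12 * (normL2 g + normL2 g'') := by
  have h := sliceNorm_le_of_repr (G := fun x => g' x y) (g := g) (k := g'')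
    (ψ := fun s => (-1 : ℝ) + 0 * s + 3 * s ^ 2 + (-2) * s ^ 3)
    (χ := fun s => (2 : ℝ) * 3 + 2 * (3 * (-2)) * s) (A := 1) (B := 6) hy zero_le_one zero_le_one
    (by norm_num) cg cg'' (by fun_prop) (by fun_prop)
    (fun s hs => (weight_deriv_le hs).1) (fun s hs => (weight_deriv_le hs).2) (fun x => by
      exact repr_deriv hy (cg.comp (by fun_prop : Continuous fun z : ℝ => (x, z)))
        (cg'.comp (by fun_prop : Continuous fun z : ℝ => (x, z)))
        (cg''.comp (by fun_prop : Continuous fun z : ℝ => (x, z))) (hg x) (hg' x))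
  refine h.trans ((mul_le_mul_left sqrt_two_le _).trans ?_)
  rw [ENNReal.ofReal_one, one_mul, show ENNReal.ofReal 6 = 6 by simp]
  calc 2 * (normL2 g'' + 6 * normL2 g) = 2 * normL2 g'' + 12 * normL2 g := by ring
    _ ≤ 12 * normL2 g'' + 12 * normL2 g := by gcongr; norm_num
    _ = _ := by ring

/-- Bounds on slices of a solution and of its normal derivative by the initial data. -/
theorem Sol.slice_le (h : Sol U w wt wx wy wyy) (hU : Continuous U)
    (hm : ∀ y, ‖U y‖ ≤ m) {t y : ℝ} (ht : 0 ≤ t) (hy : 0 ≤ y) :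
    sliceNorm (w t) y ≤
      8 * (normL2 (w 0) + (3 * normL2 (wyy 0) + 4 * ENNReal.ofReal m * gradSum (wx 0))) ∧
    sliceNorm (wy t) y ≤
      12 * (normL2 (w 0) + (3 * normL2 (wyy 0) + 4 * ENNReal.ofReal m * gradSum (wx 0))) := by
  have h1 := h.antitone hU hm le_rfl ht
  have h2 := h.normL2_wyy_le hU hm ht
  have c1 := continuous_slice h.reg.c t
  have c2 := continuous_slice h.reg.cy t
  have c3 := continuous_slice h.reg.cyy t
  constructor
  · refine (sliceNorm_le_one c1 c2 c3 (h.reg.hy t) (h.reg.hyy t) hy).trans ?_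
    gcongr
  · refine (sliceNorm_deriv_le c1 c2 c3 (h.reg.hy t) (h.reg.hyy t) hy).trans ?_
    gcongr

end

/-! ### Weak and classical derivatives compared by mollification. -/

section

variable {n : ℕ}

/-! ### Directional derivatives of smooth functions -/

/-- The derivative in the direction `v`. -/
def dirD (v : Tan n × ℝ) (φ : Tan n × ℝ → ℝ) : Tan n × ℝ → ℝ := fun p => fderiv ℝ φ p v

theorem contDiff_dirD {φ : Tan n × ℝ → ℝ} (hφ : ContDiff ℝ ∞ φ) (v : Tan n × ℝ) :
    ContDiff ℝ ∞ (dirD v φ) :=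
  (hφ.fderiv_right (m := ∞) (by simp)).clm_apply contDiff_const

theorem hasCompactSupport_dirD {φ : Tan n × ℝ → ℝ} (hφ : HasCompactSupport φ) (v : Tan n × ℝ) :
    HasCompactSupport (dirD v φ) := hφ.fderiv_apply ℝ v

theorem dirD_comm {φ : Tan n × ℝ → ℝ} (hφ : ContDiff ℝ ∞ φ) (u v : Tan n × ℝ) :
    dirD u (dirD v φ) = dirD v (dirD u φ) := by
  funext p
  have hd : DifferentiableAt ℝ (fderiv ℝ φ) p :=
    ((hφ.fderiv_right (m := ∞) (by simp)).differentiable (by simp)) p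
  have hs : IsSymmSndFDerivAt ℝ φ p := 
    (contDiff_infty.1 hφ 2).contDiffAt.isSymmSndFDerivAt (by simp)
  have e : ∀ a b, dirD a (dirD b φ) p = fderiv ℝ (fderiv ℝ φ) p a b := fun a b => by
    have h1 := (hd.hasFDerivAt.clm_apply (hasFDerivAt_const b p)).fderiv
    unfold dirD
    rw [h1]
    simp
  rw [e, e]
  exact hs.eq u v

theorem hasDerivAt_dirD {φ : Tan n × ℝ → ℝ} (hφ : ContDiff ℝ ∞ φ) (p v : Tan n × ℝ) :
    HasDerivAt (fun s : ℝ => φ (p + s • v)) (dirD v φ p) 0 := by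
  have h1 : HasDerivAt (fun s : ℝ => p + s • v) v 0 := by
    simpa using ((hasDerivAt_id (0 : ℝ)).smul_const v).const_add p
  have h2 := HasFDerivAt.comp_hasDerivAt (0 : ℝ) (l := φ) (l' := fderiv ℝ φ p)
    (by simpa using ((hφ.differentiable (by simp)) p).hasFDerivAt) h1
  exact h2

theorem testDY_eq : (testDY : (Tan n × ℝ → ℝ) → Tan n × ℝ → ℝ) = dirD (0, 1) := rfl

/-- An induction principle for `testDeriv`. -/
theorem testDeriv_rel (Rel : ℕ → (Tan n × ℝ → ℝ) → (Tan n × ℝ → ℝ) → Prop)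
    (hstep : ∀ k φ ψ v, Rel k φ ψ → Rel (k + 1) (dirD v φ) (dirD v ψ))
    {φ ψ : Tan n × ℝ → ℝ} (h0 : Rel 0 φ ψ) (α : Fin n → ℕ) (i : ℕ) :
    Rel (∑ j, α j + i) (testDeriv α i φ) (testDeriv α i ψ) := by
  -- The relation carries the number of derivatives already taken, so that signs (-1)^k can be
  -- tracked.
  have hit : ∀ (v : Tan n × ℝ) (a k : ℕ) (φ ψ : Tan n × ℝ → ℝ), Rel k φ ψ →
      Rel (k + a) ((dirD v)^[a] φ) ((dirD v)^[a] ψ) := by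
    intro v a
    induction a with
    | zero => intro k φ ψ h; exact h
    | succ a ih =>
      intro k φ ψ h
      rw [Function.iterate_succ_apply', Function.iterate_succ_apply', ← add_assoc]
      exact hstep _ _ _ _ (ih k φ ψ h)
  have hl : ∀ l : List (Fin n), Rel ((l.map α).sum + i)
      (l.foldr (fun j ψ => (testDX j)^[α j] ψ) (testDY^[i] φ))
      (l.foldr (fun j ψ => (testDX j)^[α j] ψ) (testDY^[i] ψ)) := by
    intro l
    induction l with
    | nil =>
      have := hit (0, 1) i 0 φ ψ h0
      simp only [List.map_nil, List.sum_nil, List.foldr_nil]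
      exact this
    | cons j l ih =>
      have := hit (ev j, 0) (α j) _ _ _ ih
      simp only [List.map_cons, List.sum_cons, List.foldr_cons]
      rw [show α j + (l.map α).sum + i = (l.map α).sum + i + α j by ring]
      exact this
  have := hl (List.finRange n)
  rwa [← Fin.sum_univ_def] at this

theorem contDiff_testDeriv {φ : Tan n × ℝ → ℝ} (hφ : ContDiff ℝ ∞ φ) (α : Fin n → ℕ) (i : ℕ) :
    ContDiff ℝ ∞ (testDeriv α i φ) :=
  testDeriv_rel (fun _ φ _ => ContDiff ℝ ∞ φ) (fun _ _ _ v h => contDiff_dirD h v)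
    (ψ := φ) hφ α i

theorem contDiff_iterate_dirD {φ : Tan n × ℝ → ℝ} (hφ : ContDiff ℝ ∞ φ) (v : Tan n × ℝ) (a : ℕ) :
    ContDiff ℝ ∞ ((dirD v)^[a] φ) := by
  induction a with
  | zero => exact hφ
  | succ a ih =>
    rw [Function.iterate_succ_apply']
    exact contDiff_dirD ih v

theorem dirD_iterate_comm {φ : Tan n × ℝ → ℝ} (hφ : ContDiff ℝ ∞ φ) (u v : Tan n × ℝ) (a : ℕ) :
    dirD u ((dirD v)^[a] φ) = (dirD v)^[a] (dirD u φ) := by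
  induction a with
  | zero => rfl
  | succ a ih =>
    rw [Function.iterate_succ_apply', Function.iterate_succ_apply',
      dirD_comm (contDiff_iterate_dirD hφ v a), ih]

theorem contDiff_foldr {φ : Tan n × ℝ → ℝ} (hφ : ContDiff ℝ ∞ φ) (α : Fin n → ℕ)
    (l : List (Fin n)) : ContDiff ℝ ∞ (l.foldr (fun j ψ => (testDX j)^[α j] ψ) φ) := by
  induction l with
  | nil => exact hφ
  | cons j l ih => exact contDiff_iterate_dirD ih _ _

theorem dirD_foldr_comm {φ : Tan n × ℝ → ℝ} (hφ : ContDiff ℝ ∞ φ) (v : Tan n × ℝ) (α : Fin n → ℕ)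
    (l : List (Fin n)) : dirD v (l.foldr (fun j ψ => (testDX j)^[α j] ψ) φ) =
      l.foldr (fun j ψ => (testDX j)^[α j] ψ) (dirD v φ) := by
  induction l with
  | nil => rfl
  | cons j l ih =>
    show dirD v ((dirD (ev j, 0))^[α j] (l.foldr (fun j ψ => (testDX j)^[α j] ψ) φ)) =
      (dirD (ev j, 0))^[α j] (l.foldr (fun j ψ => (testDX j)^[α j] ψ) (dirD v φ))
    rw [dirD_iterate_comm (contDiff_foldr hφ α l), ih]

/-- The normal derivatives are applied innermost, so the extra one must be commuted outwards through
all tangential ones. -/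
theorem testDeriv_succ {φ : Tan n × ℝ → ℝ} (hφ : ContDiff ℝ ∞ φ) (α : Fin n → ℕ) (i : ℕ) :
    testDeriv α (i + 1) φ = dirD (0, 1) (testDeriv α i φ) := by
  unfold testDeriv
  rw [testDY_eq, dirD_foldr_comm (contDiff_iterate_dirD hφ _ i), Function.iterate_succ_apply']

/-- The index j occurs exactly once in the list of coordinates. In the induction nothing changes
before j is met, one more derivative appears when it is met, and that derivative is commuted
outwards afterwards. -/
theorem testDeriv_add_single {φ : Tan n × ℝ → ℝ} (hφ : ContDiff ℝ ∞ φ) (α : Fin n → ℕ) (j : Fin n)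
    (i : ℕ) : testDeriv (α + Pi.single j 1) i φ = dirD (ev j, 0) (testDeriv α i φ) := by
  unfold testDeriv
  have hψ : ContDiff ℝ ∞ (testDY^[i] φ) := contDiff_iterate_dirD hφ _ i
  generalize testDY^[i] φ = ψ at hψ
  have hl : ∀ l : List (Fin n), l.Nodup →
      (j ∉ l → l.foldr (fun k χ => (testDX k)^[(α + Pi.single j 1 : Fin n → ℕ) k] χ) ψ =
        l.foldr (fun k χ => (testDX k)^[α k] χ) ψ) ∧
      (j ∈ l → l.foldr (fun k χ => (testDX k)^[(α + Pi.single j 1 : Fin n → ℕ) k] χ) ψ =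
        dirD (ev j, 0) (l.foldr (fun k χ => (testDX k)^[α k] χ) ψ)) := by
    intro l
    induction l with
    | nil => simp
    | cons k l ih =>
      intro hnd
      obtain ⟨hk, hnd'⟩ := List.nodup_cons.1 hnd
      obtain ⟨ih1, ih2⟩ := ih hnd'
      constructor
      · intro hj
        rw [List.mem_cons, not_or] at hj
        simp only [List.foldr_cons]
        rw [ih1 hj.2]
        simp [Pi.single_eq_of_ne (Ne.symm hj.1)]
      · intro hj
        simp only [List.foldr_cons]
        rcases eq_or_ne j k with rfl | hjk
        · rw [ih1 hk]
          simp only [Pi.add_apply, Pi.single_eq_same]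
          rw [Function.iterate_succ_apply']
          rfl
        · have hjl : j ∈ l := (List.mem_cons.1 hj).resolve_left hjk
          rw [ih2 hjl]
          simp only [Pi.add_apply, Pi.single_eq_of_ne hjk.symm, add_zero]
          exact (dirD_iterate_comm (contDiff_foldr hψ α l) _ _ _).symm
  exact (hl (List.finRange n) (List.nodup_finRange n)).2 (List.mem_finRange j)

theorem testDeriv_zero (i : ℕ) (φ : Tan n × ℝ → ℝ) :
    testDeriv (0 : Fin n → ℕ) i φ = (dirD (0, 1))^[i] φ := by
  unfold testDeriv
  have : ∀ l : List (Fin n), ∀ ψ : Tan n × ℝ → ℝ,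
      l.foldr (fun j ψ => (testDX j)^[(0 : Fin n → ℕ) j] ψ) ψ = ψ := by
    intro l ψ
    induction l with
    | nil => rfl
    | cons j l ih => simp
  exact this _ _

end

section

variable {n : ℕ}

/-! ### Mollification by kernels that look into the half space -/

/-- The convolution of `K` and `g`. -/
def conv (K g : Tan n × ℝ → ℝ) (q : Tan n × ℝ) : ℝ := ∫ p, K p * g (q - p)

theorem conv_eq_convolution (K g : Tan n × ℝ → ℝ) :
    conv K g = convolution K g (ContinuousLinearMap.lsmul ℝ ℝ) volume := by
  funext q; simp [conv, convolution]

theorem conv_eq_swap (K g : Tan n × ℝ → ℝ) (q : Tan n × ℝ) :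
    conv K g q = ∫ p, K (q - p) * g p := by
  rw [conv_eq_convolution, convolution_eq_swap]; simp

theorem contDiff_conv {K g : Tan n × ℝ → ℝ} (hK : ContDiff ℝ ∞ K) (hKc : HasCompactSupport K)
    (hg : Continuous g) : ContDiff ℝ ∞ (conv K g) := by
  rw [conv_eq_convolution]
  exact hKc.contDiff_convolution_left _ hK hg.locallyIntegrable

/-- Derivatives fall on the kernel, since g is only continuous here. -/
theorem dirD_conv {K g : Tan n × ℝ → ℝ} (hK : ContDiff ℝ ∞ K) (hKc : HasCompactSupport K)
    (hg : Continuous g) (v : Tan n × ℝ) : dirD v (conv K g) = conv (dirD v K) g := by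
  funext q
  have h1 := hKc.hasFDerivAt_convolution_left (μ := volume) (ContinuousLinearMap.lsmul ℝ ℝ)
    (by exact_mod_cast contDiff_infty.1 hK 1) hg.locallyIntegrable q
  unfold dirD
  rw [conv_eq_convolution, h1.fderiv, conv_eq_convolution]
  have h2 : ConvolutionExistsAt (fderiv ℝ K) g q
      (ContinuousLinearMap.precompL (Tan n × ℝ) (ContinuousLinearMap.lsmul ℝ ℝ)) volume :=
    (hKc.fderiv ℝ).convolutionExists_left _ (hK.continuous_fderiv (by simp)) hg.locallyIntegrable q
  simp only [convolution]
  rw [ContinuousLinearMap.integral_apply h2]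
  rfl

theorem testDeriv_conv {K g : Tan n × ℝ → ℝ} (hK : ContDiff ℝ ∞ K) (hKc : HasCompactSupport K)
    (hg : Continuous g) (α : Fin n → ℕ) (i : ℕ) :
    testDeriv α i (conv K g) = conv (testDeriv α i K) g := by
  have h := testDeriv_rel (fun _ φ ψ => ContDiff ℝ ∞ φ ∧ HasCompactSupport φ ∧ ψ = conv φ g)
    (fun k φ ψ v h => ⟨contDiff_dirD h.1 v, hasCompactSupport_dirD h.2.1 v, by
      rw [h.2.2, dirD_conv h.1 h.2.1 hg]⟩) (φ := K) (ψ := conv K g) ⟨hK, hKc, rfl⟩ α i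
  exact h.2.2

/-- Each derivative of the reflected kernel contributes a factor -1. These signs cancel the one in
the definition of a weak derivative. -/
theorem testDeriv_reflect {K : Tan n × ℝ → ℝ} (hK : ContDiff ℝ ∞ K) (q : Tan n × ℝ)
    (α : Fin n → ℕ) (i : ℕ) (p : Tan n × ℝ) :
    testDeriv α i (fun p => K (q - p)) p = (-1) ^ (∑ j, α j + i) * testDeriv α i K (q - p) := by
  have h := testDeriv_rel (fun k φ ψ => ContDiff ℝ ∞ φ ∧ ψ = fun p => (-1) ^ k * φ (q - p))
    (fun k φ ψ v h => ⟨contDiff_dirD h.1 v, by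
      rw [h.2]
      funext p
      have h1 : HasFDerivAt (fun p => q - p) (-ContinuousLinearMap.id ℝ (Tan n × ℝ)) p :=
        (hasFDerivAt_id p).const_sub q
      have h2 := (((h.1.differentiable (by simp)) (q - p)).hasFDerivAt.comp p h1).const_mul
        ((-1 : ℝ) ^ k)
      unfold dirD
      have h3 := h2.fderiv
      simp only [Function.comp_def] at h3
      rw [h3]
      simp [pow_succ]⟩) (φ := K) (ψ := fun p => K (q - p)) ⟨hK, by simp⟩ α i
  rw [h.2]

/-- A smooth probability density supported in `{|p| ≤ 3δ, p_y ≤ -δ}`. -/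
structure IsKernel (δ : ℝ) (K : Tan n × ℝ → ℝ) : Prop where
  pos : 0 < δ
  smooth : ContDiff ℝ ∞ K
  compact : HasCompactSupport K
  nonneg : ∀ p, 0 ≤ K p
  integral : ∫ p, K p = 1
  supp : ∀ p ∈ tsupport K, p.2 ≤ -δ ∧ ‖p‖ ≤ 3 * δ

/-- A bump of radius δ centred at height -2δ. For p in its support, q - p is at least δ higher than
q, so at points of the closed half space the convolution only sees interior values. -/
theorem exists_kernel {δ : ℝ} (hδ : 0 < δ) : ∃ K : Tan n × ℝ → ℝ, IsKernel δ K := by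
  let c : Tan n × ℝ := (0, -(2 * δ))
  let φ : ContDiffBump c := ⟨δ / 2, δ, by positivity, by linarith⟩
  refine ⟨φ.normed volume, hδ, φ.contDiff_normed, φ.hasCompactSupport_normed, φ.nonneg_normed,
    φ.integral_normed, fun p hp => ?_⟩
  rw [φ.tsupport_normed_eq, Metric.mem_closedBall, dist_eq_norm] at hp
  have h1 : ‖(p - c).2‖ ≤ δ := (norm_snd_le _).trans hp
  have h2 : ‖c‖ = 2 * δ := by
    simp [c, Prod.norm_def, abs_of_pos hδ, hδ.le]
  constructor
  · have : (p - c).2 = p.2 + 2 * δ := by simp [c]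
    rw [this, Real.norm_eq_abs, abs_le] at h1
    linarith [h1.2]
  · calc ‖p‖ = ‖(p - c) + c‖ := by simp
      _ ≤ ‖p - c‖ + ‖c‖ := norm_add_le _ _
      _ ≤ δ + 2 * δ := by
        rw [h2]
        exact add_le_add_left hp _
      _ = 3 * δ := by ring

section Kernel

variable {δ : ℝ} {K : Tan n × ℝ → ℝ}

theorem IsKernel.lintegral (hK : IsKernel δ K) : ∫⁻ p, ‖K p‖ₑ = 1 := by
  have hi : Integrable K := hK.smooth.continuous.integrable_of_hasCompactSupport hK.compact
  have h1 := ofReal_integral_eq_lintegral_ofReal hi (Filter.Eventually.of_forall hK.nonneg)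
  rw [hK.integral, ENNReal.ofReal_one] at h1
  rw [h1]
  exact lintegral_congr fun p => Real.enorm_eq_ofReal (hK.nonneg p)

/-- A weak derivative bounds the derivative of the mollified function. -/
theorem IsKernel.nrm_testDeriv_le (hK : IsKernel δ K) {g : Tan n × ℝ → ℝ} (hg : Continuous g)
    {f : Tan n → ℝ → ℝ} (hfg : ∀ p ∈ halfSpace n, g p = f p.1 p.2) (α : Fin n → ℕ) (i : ℕ) :
    nrm (testDeriv α i (conv K g)) ≤ weakPartialNorm α i f := by
  -- The weak norm is an infimum over all candidates G; if there is none it is infinite and nothing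
  -- is claimed.
  refine le_iInf fun G => le_iInf fun hG => ?_
  obtain ⟨-, hGloc, hGw⟩ := hG
  have hGm := hGloc.aestronglyMeasurable
  -- A strongly measurable representative, extended by zero, can be composed with (p, q) ↦ q - p
  -- without null-set problems.
  set G₁ := (halfSpace n).indicator (hGm.mk G) with hG₁
  have hG₁m : StronglyMeasurable G₁ := hGm.stronglyMeasurable_mk.indicator measurableSet_halfSpace
  have hG₁G : G₁ =ᵐ[volume.restrict (halfSpace n)] G := by
    filter_upwards [hGm.ae_eq_mk, ae_restrict_mem measurableSet_halfSpace] with p hp hp2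
    rw [hG₁, indicator_of_mem hp2, hp]
  -- For q in the half space the reflected kernel is an admissible test function: its support stays
  -- at height at least δ. The weak derivative therefore passes under the convolution with no
  -- boundary term.
  have key : ∀ q ∈ halfSpace n, testDeriv α i (conv K g) q = ∫ p, K p • G₁ (q - p) := by
    intro q hq
    have hq2 : 0 < q.2 := hq.2
    rw [testDeriv_conv hK.smooth hK.compact hg, conv_eq_swap]
    set φ : Tan n × ℝ → ℝ := fun p => K (q - p) with hφ
    have hφs : ContDiff ℝ ∞ φ := hK.smooth.comp (contDiff_const.sub contDiff_id)
    have hcl : tsupport φ ⊆ (fun p => q - p) ⁻¹' tsupport K := by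
      refine closure_minimal (fun p hp => subset_tsupport K hp) ?_
      exact (isClosed_tsupport K).preimage (by fun_prop)
    have hφc : HasCompactSupport φ := hK.compact.comp_homeomorph (Homeomorph.subLeft q)
    have hφh : tsupport φ ⊆ halfSpace n := fun p hp => by
      have h1 := (hK.supp _ (hcl hp)).1
      have h2 : q.2 - p.2 ≤ -δ := h1
      have := hK.pos
      exact ⟨mem_univ _, show 0 < p.2 by linarith⟩
    have hw := hGw φ hφs hφc hφh
    have hzero : ∀ p, p ∉ halfSpace n → testDeriv α i φ p = 0 := by
      intro p hp
      have hr := testDeriv_rel (fun _ ψ _ => tsupport ψ ⊆ tsupport φ)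
        (fun k ψ _ v h => (closure_minimal (fun x hx => by
          refine support_fderiv_subset ℝ (f := ψ) ?_
          rw [Function.mem_support]
          intro h0
          apply hx
          simp [dirD, h0]) (isClosed_tsupport ψ)).trans h) (φ := φ) (ψ := φ) subset_rfl α i
      by_contra hne
      exact hp (hφh (hr (subset_tsupport _ hne)))
    have e1 : ∫ p, testDeriv α i K (q - p) * g p =
        (-1 : ℝ) ^ (∑ j, α j + i) * ∫ p in halfSpace n, f p.1 p.2 * testDeriv α i φ p := by
      rw [← integral_const_mul, ← setIntegral_eq_integral_of_forall_compl_eq_zero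
        (s := halfSpace n)]
      · refine setIntegral_congr_fun measurableSet_halfSpace fun p hp => ?_
        rw [testDeriv_reflect hK.smooth, hfg p hp]
        rw [show ∀ a b c : ℝ, a * (b * (a * c)) = (a * a) * (c * b) by intros; ring]
        rw [← mul_pow]
        simp
      · intro p hp
        have h1 := hzero p hp
        rw [testDeriv_reflect hK.smooth] at h1
        have h2 : testDeriv α i K (q - p) = 0 := by
          rcases mul_eq_zero.1 h1 with h | h
          · exact absurd h (pow_ne_zero _ (by norm_num))
          · exact h
        rw [h2, zero_mul]
    rw [e1, hw, ← mul_assoc, ← mul_pow]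
    simp only [mul_neg, mul_one, neg_neg, one_pow, one_mul]
    have e2 : ∫ p in halfSpace n, G p * φ p = ∫ p in halfSpace n, φ p * G₁ p := by
      refine integral_congr_ae ?_
      filter_upwards [hG₁G] with p hp
      rw [hp, mul_comm]
    rw [e2, setIntegral_eq_integral_of_forall_compl_eq_zero]
    · have h3 := conv_eq_swap K G₁ q
      unfold conv at h3
      simp only [smul_eq_mul]
      rw [h3]
    · intro p hp
      rw [hG₁, indicator_of_notMem hp, mul_zero]
  have h1 : nrm (testDeriv α i (conv K g)) = nrm (fun q => ∫ p, K p • G₁ (q - p)) :=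
    eLpNorm_congr_ae (by
      filter_upwards [ae_restrict_mem measurableSet_halfSpace] with q hq using key q hq)
  rw [h1, ← eLpNorm_congr_ae hG₁G]
  refine (eLpNorm_integral_le (κ := K) (G := fun p q => G₁ (q - p)) (N := nrm G₁)
    hK.smooth.continuous.aestronglyMeasurable ?_ ?_).trans ?_
  · have hm : Measurable fun z : (Tan n × ℝ) × (Tan n × ℝ) => z.2 - z.1 := by fun_prop
    exact (hG₁m.comp_measurable hm).aestronglyMeasurable
  · refine Filter.Eventually.of_forall fun p hp => ?_
    have h2 := (hK.supp p (subset_tsupport K hp)).1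
    have h3 := nrm_translate_le (f := G₁) (v := -p) hG₁m.aestronglyMeasurable (by
      have := hK.pos
      show 0 ≤ -p.2
      linarith)
    simpa [sub_eq_add_neg] using h3
  · rw [hK.lintegral, one_mul]

/-- A directional derivative may be moved to the second factor. -/
theorem IsKernel.dirD_conv_eq (hK : IsKernel δ K) {g g' : Tan n × ℝ → ℝ} (hg : Continuous g)
    (hg' : Continuous g') (v : Tan n × ℝ)
    (hd : ∀ p ∈ halfSpace n, HasDerivAt (fun s : ℝ => g (p + s • v)) (g' p) 0)
    {q : Tan n × ℝ} (hq : -δ < q.2) : dirD v (conv K g) q = conv K g' q := by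
  have h1 := hasDerivAt_dirD (contDiff_conv hK.smooth hK.compact hg) q v
  -- The condition -δ < q.2 is open and contains a neighbourhood of the boundary, so the identity
  -- can be differentiated again at height 0.
  have hpos : ∀ᶠ s : ℝ in nhds 0, ∀ r ∈ uIcc 0 s, -δ < q.2 + r * v.2 := by
    have hc : ContinuousAt (fun r : ℝ => q.2 + r * v.2) 0 := by fun_prop
    have he : ∀ᶠ r : ℝ in nhds 0, -δ < q.2 + r * v.2 :=
      hc.eventually_const_lt (by simpa using hq)
    obtain ⟨ε, hε, hball⟩ := Metric.eventually_nhds_iff.1 he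
    refine Metric.eventually_nhds_iff.2 ⟨ε, hε, fun s hs r hr => hball ?_⟩
    rw [Real.dist_eq, sub_zero] at hs ⊢
    have := abs_sub_left_of_mem_uIcc hr
    simp only [sub_zero] at this
    exact this.trans_lt hs
  have hmem : ∀ p ∈ tsupport K, ∀ r : ℝ, -δ < q.2 + r * v.2 → q + r • v - p ∈ halfSpace n := by
    intro p hp r hr
    have := (hK.supp p hp).1
    exact ⟨mem_univ _, show 0 < q.2 + r * v.2 - p.2 by linarith⟩
  -- The identity is first integrated along the line, where the fundamental theorem applies under
  -- the convolution, and then differentiated at 0.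
  have hrep : ∀ᶠ s : ℝ in nhds 0,
      conv K g (q + s • v) = conv K g q + ∫ r in (0 : ℝ)..s, conv K g' (q + r • v) := by
    filter_upwards [hpos] with s hs
    unfold conv
    rw [← integral_interval_swap (K := tsupport K) hK.compact
      (G := fun p r => K p * g' (q + r • v - p))]
    · have hKcont := hK.smooth.continuous
      rw [← sub_eq_iff_eq_add', ← integral_sub]
      · refine integral_congr_ae (Filter.Eventually.of_forall fun p => ?_)
        simp only
        by_cases hp : p ∈ tsupport K
        · rw [intervalIntegral.integral_const_mul, ← mul_sub]
          congr 1
          rw [intervalIntegral.integral_eq_sub_of_hasDerivAt (f := fun r => g (q + r • v - p))]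
          · simp
          · intro r hr
            have h0 := hd _ (hmem p hp r (hs r hr))
            have h2 : HasDerivAt (fun z : ℝ => z - r) 1 r := (hasDerivAt_id r).sub_const r
            have h3 := HasDerivAt.scomp (h := fun z : ℝ => z - r) r (by simpa using h0) h2
            refine (h3.congr_deriv (by simp)).congr_of_eventuallyEq ?_
            refine Filter.Eventually.of_forall fun z => ?_
            simp only [Function.comp_apply]
            congr 1
            module
          · exact (by fun_prop : Continuous fun r : ℝ => g' (q + r • v - p)).intervalIntegrable _ _
        · simp [image_eq_zero_of_notMem_tsupport hp]
      · exact (by fun_prop : Continuous fun p => K p * g (q + s • v - p)).integrable_of_hasCompactSupport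
          hK.compact.mul_right
      · exact (by fun_prop : Continuous fun p => K p * g (q - p)).integrable_of_hasCompactSupport
          hK.compact.mul_right
    · have hKcont := hK.smooth.continuous
      unfold Function.uncurry
      fun_prop
    · intro p hp r _
      simp [image_eq_zero_of_notMem_tsupport hp]
  have hcc : Continuous fun r : ℝ => conv K g' (q + r • v) :=
    (contDiff_conv hK.smooth hK.compact hg').continuous.comp (by fun_prop)
  have h3 : HasDerivAt (fun s : ℝ => conv K g q + ∫ r in (0 : ℝ)..s, conv K g' (q + r • v))
      (conv K g' (q + (0 : ℝ) • v)) 0 :=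
    (intervalIntegral.integral_hasDerivAt_right (hcc.intervalIntegrable _ _)
      (hcc.stronglyMeasurableAtFilter _ _) hcc.continuousAt).const_add _
  have h4 := h3.congr_of_eventuallyEq hrep
  rw [h1.unique h4]
  simp

theorem tendsto_conv {δ : ℕ → ℝ} {K : ℕ → Tan n × ℝ → ℝ} (hK : ∀ k, IsKernel (δ k) (K k))
    (hδ : Filter.Tendsto δ Filter.atTop (nhds 0)) {g : Tan n × ℝ → ℝ} (hg : Continuous g)
    (q : Tan n × ℝ) :
    Filter.Tendsto (fun k => conv (K k) g q) Filter.atTop (nhds (g q)) := by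
  simp only [conv_eq_convolution]
  refine convolution_tendsto_right (φ := K) (g := fun _ => g) (k := fun _ => q) (x₀ := q)
    (Filter.Eventually.of_forall fun k => (hK k).nonneg)
    (Filter.Eventually.of_forall fun k => (hK k).integral) ?_
    (Filter.Eventually.of_forall fun k => hg.aestronglyMeasurable) ?_ tendsto_const_nhds
  · rw [Filter.tendsto_smallSets_iff]
    intro s hs
    obtain ⟨ε, hε, hball⟩ := Metric.mem_nhds_iff.1 hs
    have he : ∀ᶠ k in Filter.atTop, 3 * δ k < ε := by
      have : Filter.Tendsto (fun k => 3 * δ k) Filter.atTop (nhds (3 * 0)) := hδ.const_mul 3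
      exact this.eventually_lt_const (by simpa using hε)
    filter_upwards [he] with k hk p hp
    refine hball ?_
    rw [mem_ball_zero_iff]
    exact ((hK k).supp p (subset_tsupport _ hp)).2.trans_lt hk
  · exact (hg.tendsto q).comp Filter.tendsto_snd

/-- The mollification error is an average of increments in inward directions of length at most 3δ;
Minkowski's inequality does the rest. -/
theorem IsKernel.nrm_conv_sub_le (hK : IsKernel δ K) {g : Tan n × ℝ → ℝ} (hg : Continuous g)
    {N : ℝ≥0∞} (hN : ∀ v : Tan n × ℝ, 0 ≤ v.2 → ‖v‖ ≤ 3 * δ → nrm (fun p => g (p + v) - g p) ≤ N) :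
    nrm (fun q => conv K g q - g q) ≤ N := by
  have hKcont := hK.smooth.continuous
  have e : (fun q => conv K g q - g q) = fun q => ∫ p, K p • (g (q - p) - g q) := by
    funext q
    simp only [smul_eq_mul, mul_sub]
    rw [integral_sub, integral_mul_const, hK.integral, one_mul, conv]
    · exact (by fun_prop : Continuous fun p => K p * g (q - p)).integrable_of_hasCompactSupport
        hK.compact.mul_right
    · exact (by fun_prop : Continuous fun p => K p * g q).integrable_of_hasCompactSupport
        hK.compact.mul_right
  rw [e]
  refine (eLpNorm_integral_le (κ := K) (G := fun p q => g (q - p) - g q) (N := N)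
    hKcont.aestronglyMeasurable ?_ ?_).trans ?_
  · have : Continuous (Function.uncurry fun p q : Tan n × ℝ => g (q - p) - g q) := by
      unfold Function.uncurry; fun_prop
    exact this.aestronglyMeasurable
  · refine Filter.Eventually.of_forall fun p hp => ?_
    have h2 := hK.supp p (subset_tsupport K hp)
    have h3 := hN (-p) (by
      have := hK.pos
      have := h2.1
      show 0 ≤ -p.2
      linarith) (by rw [norm_neg]; exact h2.2)
    simpa [sub_eq_add_neg] using h3
  · rw [hK.lintegral, one_mul]

end Kernel

/-- Bounds increments of a limit by derivatives of its approximations, although the limit may have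
no classical derivative in that direction. -/
theorem nrm_increment_le_of_tendsto {f : Tan n × ℝ → ℝ} {F : ℕ → Tan n × ℝ → ℝ}
    (hF : ∀ k, ContDiff ℝ ∞ (F k))
    (hlim : ∀ p ∈ halfSpace n, Filter.Tendsto (fun k => F k p) Filter.atTop (nhds (f p)))
    {v : Tan n × ℝ} (hv : 0 ≤ v.2) {N : ℝ≥0∞} (hN : ∀ k, nrm (dirD v (F k)) ≤ N) :
    nrm (fun p => f (p + v) - f p) ≤ N := by
  refine eLpNorm_le_of_tendsto (f := fun k p => F k (p + v) - F k p) ?_ ?_ ?_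
  · intro k
    have := (hF k).continuous
    exact aesm_half (by fun_prop)
  · filter_upwards [ae_restrict_mem measurableSet_halfSpace] with p hp
    refine (hlim _ ?_).sub (hlim p hp)
    have hp2 : 0 < p.2 := hp.2
    exact ⟨mem_univ _, show 0 < p.2 + v.2 by linarith⟩
  · intro k
    exact (nrm_increment_le (hF k).continuous (contDiff_dirD (hF k) v).continuous hv
      fun p _ => hasDerivAt_dirD (hF k) p v).trans (hN k)

theorem nrm_le_of_tendsto {f : Tan n × ℝ → ℝ} {F : ℕ → Tan n × ℝ → ℝ}
    (hF : ∀ k, ContDiff ℝ ∞ (F k))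
    (hlim : ∀ p ∈ halfSpace n, Filter.Tendsto (fun k => F k p) Filter.atTop (nhds (f p)))
    {N : ℝ≥0∞} (hN : ∀ k, nrm (F k) ≤ N) : nrm f ≤ N :=
  eLpNorm_le_of_tendsto (fun k => aesm_half (hF k).continuous) (by
    filter_upwards [ae_restrict_mem measurableSet_halfSpace] with p hp using hlim p hp) hN

end

section

variable {n : ℕ}

/-! ### Initial data and their mollifications -/

theorem dirD_eq_sum {φ : Tan n × ℝ → ℝ} (v : Tan n × ℝ) (p : Tan n × ℝ) :
    dirD v φ p = ∑ j, v.1 j * dirD (ev j, 0) φ p + v.2 * dirD (0, 1) φ p := by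
  unfold dirD
  have h1 : v = (v.1, (0 : ℝ)) + v.2 • ((0 : Tan n), (1 : ℝ)) := by
    ext <;> simp
  conv_lhs => rw [h1]
  rw [map_add, map_smul, smul_eq_mul]
  congr 1
  exact clm_apply_eq_sum ((fderiv ℝ φ p).comp (ContinuousLinearMap.inl ℝ (Tan n) ℝ)) v.1

/-- The factor n + 1 counts the coordinate directions, each with coefficient at most r. -/
theorem nrm_dirD_testDeriv_le {φ : Tan n × ℝ → ℝ} (hφ : ContDiff ℝ ∞ φ) {α : Fin n → ℕ} {i : ℕ}
    {H : ℝ≥0∞} (hx : ∀ j, nrm (testDeriv (α + Pi.single j 1) i φ) ≤ H)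
    (hy : nrm (testDeriv α (i + 1) φ) ≤ H) {v : Tan n × ℝ} {r : ℝ} (hv : ‖v‖ ≤ r) :
    nrm (dirD v (testDeriv α i φ)) ≤ ENNReal.ofReal ((n + 1) * r) * H := by
  have hr : 0 ≤ r := (norm_nonneg v).trans hv
  have hs := contDiff_testDeriv hφ α i
  have e : dirD v (testDeriv α i φ) = (∑ j, v.1 j • testDeriv (α + Pi.single j 1) i φ) +
      v.2 • testDeriv α (i + 1) φ := by
    funext p
    rw [dirD_eq_sum]
    simp [testDeriv_add_single hφ, testDeriv_succ hφ]
  have hm : ∀ β k, AEStronglyMeasurable (testDeriv β k φ)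
      ((volume : Measure (Tan n × ℝ)).restrict (halfSpace n)) :=
    fun β k => aesm_half (contDiff_testDeriv hφ β k).continuous
  have hb : ∀ c : ℝ, |c| ≤ ‖v‖ → ∀ ψ : Tan n × ℝ → ℝ, nrm ψ ≤ H →
      nrm (c • ψ) ≤ ENNReal.ofReal r * H := by
    intro c hc ψ hψ
    unfold nrm
    rw [eLpNorm_const_smul]
    refine mul_le_mul' ?_ hψ
    rw [← ofReal_norm]
    exact ENNReal.ofReal_le_ofReal (hc.trans hv)
  rw [e]
  refine (eLpNorm_add_le (Finset.aestronglyMeasurable_sum _ fun j _ => (hm _ _).const_smul _)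
    ((hm _ _).const_smul _) (by norm_num)).trans ?_
  refine (add_le_add (eLpNorm_sum_le (fun j _ => (hm _ _).const_smul _) (by norm_num)) le_rfl).trans ?_
  have h1 : ∑ j, nrm (v.1 j • testDeriv (α + Pi.single j 1) i φ) ≤
      ∑ _j : Fin n, ENNReal.ofReal r * H :=
    Finset.sum_le_sum fun j _ => hb _ ((abs_coord_le _ j).trans (norm_fst_le v)) _ (hx j)
  have h2 : nrm (v.2 • testDeriv α (i + 1) φ) ≤ ENNReal.ofReal r * H := hb _ (norm_snd_le v) _ hy
  refine (add_le_add h1 h2).trans (le_of_eq ?_)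
  rw [Finset.sum_const, Finset.card_univ, Fintype.card_fin, nsmul_eq_mul,
    ENNReal.ofReal_mul (by positivity), ENNReal.ofReal_add (by positivity) zero_le_one]
  simp
  ring

/-- A function of `(x', y)` with its classical derivatives, continuous up to the boundary. -/
structure Static (g : Tan n → ℝ → ℝ) (gx : Tan n → ℝ → (Tan n →L[ℝ] ℝ))
    (gy gyy : Tan n → ℝ → ℝ) : Prop where
  c : Continuous fun p : Tan n × ℝ => g p.1 p.2
  cx : Continuous fun p : Tan n × ℝ => gx p.1 p.2
  cy : Continuous fun p : Tan n × ℝ => gy p.1 p.2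
  cyy : Continuous fun p : Tan n × ℝ => gyy p.1 p.2
  hx : ∀ x y, HasFDerivAt (fun x' => g x' y) (gx x y) x
  hy : ∀ x y, 0 < y → HasDerivAt (fun z => g x z) (gy x y) y
  hyy : ∀ x y, 0 < y → HasDerivAt (fun z => gy x z) (gyy x y) y

/-- The classical derivatives of a representative of an initial temperature. -/
structure Datum (θ₀ : Tan n → ℝ → ℝ) (g : Tan n → ℝ → ℝ) (gx : Tan n → ℝ → (Tan n →L[ℝ] ℝ))
    (gy gyy : Tan n → ℝ → ℝ) : Prop extends Static g gx gy gyy where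
  agree : ∀ x y, 0 < y → g x y = θ₀ x y

section Datum

variable {θ₀ g gy gyy : Tan n → ℝ → ℝ} {gx : Tan n → ℝ → (Tan n →L[ℝ] ℝ)} {δ : ℝ}
  {K : Tan n × ℝ → ℝ}

theorem Reg.datum {w wt wy wyy : ℝ → Tan n → ℝ → ℝ} {wx : ℝ → Tan n → ℝ → (Tan n →L[ℝ] ℝ)}
    (h : Reg w wt wx wy wyy) (h0 : ∀ x y, 0 < y → w 0 x y = θ₀ x y) :
    Datum θ₀ (w 0) (wx 0) (wy 0) (wyy 0) where
  c := continuous_slice h.c 0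
  cx := continuous_slice h.cx 0
  cy := continuous_slice h.cy 0
  cyy := continuous_slice h.cyy 0
  hx := h.hx 0
  hy := h.hy 0
  hyy := h.hyy 0
  agree := h0

theorem hasDerivAt_line_x {g : Tan n → ℝ → ℝ} {gx : Tan n →L[ℝ] ℝ} {p : Tan n × ℝ}
    (h : HasFDerivAt (fun x' => g x' p.2) gx p.1) (v : Tan n) :
    HasDerivAt (fun s : ℝ => (fun p : Tan n × ℝ => g p.1 p.2) (p + s • (v, (0 : ℝ)))) (gx v) 0 := by
  have h1 : HasDerivAt (fun s : ℝ => p.1 + s • v) v 0 := by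
    simpa using ((hasDerivAt_id (0 : ℝ)).smul_const v).const_add p.1
  have h2 := HasFDerivAt.comp_hasDerivAt (0 : ℝ) (l := fun x' => g x' p.2) (l' := gx)
    (by simpa using h) h1
  simpa [Function.comp_def] using h2

theorem hasDerivAt_line_y {g : Tan n → ℝ → ℝ} {g' : ℝ} {p : Tan n × ℝ}
    (h : HasDerivAt (fun z => g p.1 z) g' p.2) :
    HasDerivAt (fun s : ℝ => (fun p : Tan n × ℝ => g p.1 p.2) (p + s • ((0 : Tan n), (1 : ℝ)))) g' 0 := by
  have h1 : HasDerivAt (fun s : ℝ => p.2 + s) 1 0 := by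
    simpa using (hasDerivAt_id (0 : ℝ)).const_add p.2
  have h2 := HasDerivAt.comp (0 : ℝ) (h₂ := fun z => g p.1 z) (h₂' := g') (by simpa using h) h1
  simpa [Function.comp_def] using h2

theorem Datum.smooth (h : Datum θ₀ g gx gy gyy) (hK : IsKernel δ K) :
    ContDiff ℝ ∞ (conv K fun p => g p.1 p.2) := contDiff_conv hK.smooth hK.compact h.c

theorem Datum.testDeriv_x (h : Datum θ₀ g gx gy gyy) (hK : IsKernel δ K) (k : Fin n)
    {q : Tan n × ℝ} (hq : 0 ≤ q.2) :
    testDeriv (Pi.single k 1) 0 (conv K fun p => g p.1 p.2) q =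
      conv K (fun p => gx p.1 p.2 (ev k)) q := by
  have hcx := h.cx
  rw [← zero_add (Pi.single k 1), testDeriv_add_single (h.smooth hK), testDeriv_zero]
  exact hK.dirD_conv_eq h.c (by fun_prop) _ (fun p _ => hasDerivAt_line_x (h.hx p.1 p.2) _)
    (by linarith [hK.pos])

theorem Datum.testDeriv_yy (h : Datum θ₀ g gx gy gyy) (hK : IsKernel δ K)
    {q : Tan n × ℝ} (hq : 0 ≤ q.2) :
    testDeriv 0 2 (conv K fun p => g p.1 p.2) q = conv K (fun p => gyy p.1 p.2) q := by
  rw [testDeriv_zero]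
  have hopen : IsOpen {p : Tan n × ℝ | -δ < p.2} := isOpen_lt continuous_const continuous_snd
  have hmem : {p : Tan n × ℝ | -δ < p.2} ∈ nhds q := hopen.mem_nhds (by
    show -δ < q.2
    linarith [hK.pos])
  -- The first derivative is identified on a full neighbourhood of q, slightly negative heights
  -- included, before the second one is taken.
  have he : dirD (0, 1) (conv K fun p => g p.1 p.2) =ᶠ[nhds q] conv K fun p => gy p.1 p.2 := by
    filter_upwards [hmem] with p hp
    exact hK.dirD_conv_eq h.c h.cy _ (fun p hp => hasDerivAt_line_y (h.hy p.1 p.2 hp.2)) hp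
  show dirD (0, 1) (dirD (0, 1) (conv K fun p => g p.1 p.2)) q = _
  have e2 : dirD (0, 1) (dirD (0, 1) (conv K fun p => g p.1 p.2)) q =
      dirD (0, 1) (conv K fun p => gy p.1 p.2) q := by
    conv_lhs => rw [dirD]
    rw [he.fderiv_eq]
    rfl
  rw [e2]
  exact hK.dirD_conv_eq h.cy h.cyy _ (fun p hp => hasDerivAt_line_y (h.hyy p.1 p.2 hp.2))
    (by linarith [hK.pos])

theorem Datum.nrm_testDeriv_le (h : Datum θ₀ g gx gy gyy) (hK : IsKernel δ K) (α : Fin n → ℕ)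
    (i : ℕ) : nrm (testDeriv α i (conv K fun p => g p.1 p.2)) ≤ weakPartialNorm α i θ₀ :=
  hK.nrm_testDeriv_le h.c (fun p hp => h.agree p.1 p.2 hp.2) α i

/-- The scale of the `k`-th mollification. -/
def scale (k : ℕ) : ℝ := 1 / ((k : ℝ) + 1)

theorem scale_pos (k : ℕ) : 0 < scale k := by unfold scale; positivity

theorem tendsto_scale : Filter.Tendsto scale Filter.atTop (nhds 0) :=
  tendsto_one_div_add_atTop_nhds_zero_nat

theorem exists_kernels (n : ℕ) : ∃ K : ℕ → Tan n × ℝ → ℝ, ∀ k, IsKernel (scale k) (K k) :=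
  Classical.axiom_of_choice fun k => exists_kernel (scale_pos k)

theorem nrm_congr {f f' : Tan n × ℝ → ℝ} (h : ∀ p ∈ halfSpace n, f p = f' p) : nrm f = nrm f' :=
  eLpNorm_congr_ae (by filter_upwards [ae_restrict_mem measurableSet_halfSpace] with p hp using h p hp)

section Limit

variable {K : ℕ → Tan n × ℝ → ℝ} {α : Fin n → ℕ} {i : ℕ} {g' : Tan n → ℝ → ℝ}

/-- A classical derivative that is the limit of the derivatives of the mollifications. -/
structure IsLimitDeriv (K : ℕ → Tan n × ℝ → ℝ) (g : Tan n → ℝ → ℝ) (α : Fin n → ℕ) (i : ℕ)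
    (g' : Tan n → ℝ → ℝ) : Prop where
  cont : Continuous fun p : Tan n × ℝ => g' p.1 p.2
  eq : ∀ k (q : Tan n × ℝ), 0 ≤ q.2 →
    testDeriv α i (conv (K k) fun p => g p.1 p.2) q = conv (K k) (fun p => g' p.1 p.2) q

theorem IsLimitDeriv.tendsto (hL : IsLimitDeriv K g α i g') (hK : ∀ k, IsKernel (scale k) (K k))
    {q : Tan n × ℝ} (hq : 0 ≤ q.2) :
    Filter.Tendsto (fun k => testDeriv α i (conv (K k) fun p => g p.1 p.2) q) Filter.atTop
      (nhds (g' q.1 q.2)) :=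
  (tendsto_conv hK tendsto_scale hL.cont q).congr fun k => (hL.eq k q hq).symm

/-- The classical derivative is bounded by the weak norm without proof that it is a weak derivative:
the mollified derivatives are bounded and converge to it pointwise. -/
theorem IsLimitDeriv.nrm_le (hL : IsLimitDeriv K g α i g') (hK : ∀ k, IsKernel (scale k) (K k))
    (h : Datum θ₀ g gx gy gyy) : normL2 g' ≤ weakPartialNorm α i θ₀ :=
  nrm_le_of_tendsto (fun k => contDiff_testDeriv (h.smooth (hK k)) α i)
    (fun _ hp => hL.tendsto hK (le_of_lt hp.2)) fun k => h.nrm_testDeriv_le (hK k) α i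

/-- A linear rate of convergence. Increments of g' are controlled by derivatives of one order more,
which exist only weakly and are reached through the mollifications. -/
theorem IsLimitDeriv.nrm_sub_le (hL : IsLimitDeriv K g α i g')
    (hK : ∀ k, IsKernel (scale k) (K k)) (h : Datum θ₀ g gx gy gyy) {H : ℝ≥0∞}
    (hx : ∀ j, weakPartialNorm (α + Pi.single j 1) i θ₀ ≤ H)
    (hy : weakPartialNorm α (i + 1) θ₀ ≤ H) (k : ℕ) :
    nrm (fun q => testDeriv α i (conv (K k) fun p => g p.1 p.2) q - g' q.1 q.2) ≤
      ENNReal.ofReal ((n + 1) * (3 * scale k)) * H := by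
  rw [nrm_congr (f' := fun q => conv (K k) (fun p => g' p.1 p.2) q - g' q.1 q.2)
    fun p hp => by rw [hL.eq k p (le_of_lt hp.2)]]
  refine (hK k).nrm_conv_sub_le hL.cont fun v hv hv' => ?_
  refine nrm_increment_le_of_tendsto (f := fun q => g' q.1 q.2)
    (fun j => contDiff_testDeriv (h.smooth (hK j)) α i)
    (fun p hp => hL.tendsto hK (le_of_lt hp.2)) hv fun j => ?_
  exact nrm_dirD_testDeriv_le (h.smooth (hK j))
    (fun l => (h.nrm_testDeriv_le (hK j) _ _).trans (hx l))
    ((h.nrm_testDeriv_le (hK j) _ _).trans hy) hv'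

theorem Datum.isLimitDeriv_zero (h : Datum θ₀ g gx gy gyy) : IsLimitDeriv K g 0 0 g :=
  ⟨h.c, fun k q _ => by rw [testDeriv_zero]; rfl⟩

theorem Datum.isLimitDeriv_x (h : Datum θ₀ g gx gy gyy) (hK : ∀ k, IsKernel (scale k) (K k))
    (j : Fin n) : IsLimitDeriv K g (Pi.single j 1) 0 fun x y => gx x y (ev j) :=
  ⟨by have := h.cx; fun_prop, fun k _ hq => h.testDeriv_x (hK k) j hq⟩

theorem Datum.isLimitDeriv_yy (h : Datum θ₀ g gx gy gyy) (hK : ∀ k, IsKernel (scale k) (K k)) :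
    IsLimitDeriv K g 0 2 gyy :=
  ⟨h.cyy, fun k _ hq => h.testDeriv_yy (hK k) hq⟩

end Limit

theorem Datum.normL2_le (h : Datum θ₀ g gx gy gyy) : normL2 g ≤ weakPartialNorm 0 0 θ₀ := by
  obtain ⟨K, hK⟩ := exists_kernels n
  exact h.isLimitDeriv_zero.nrm_le hK h

theorem Datum.normL2_x_le (h : Datum θ₀ g gx gy gyy) (j : Fin n) :
    normL2 (fun x y => gx x y (ev j)) ≤ weakPartialNorm (Pi.single j 1) 0 θ₀ := by
  obtain ⟨K, hK⟩ := exists_kernels n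
  exact (h.isLimitDeriv_x hK j).nrm_le hK h

theorem Datum.normL2_yy_le (h : Datum θ₀ g gx gy gyy) :
    normL2 gyy ≤ weakPartialNorm 0 2 θ₀ := by
  obtain ⟨K, hK⟩ := exists_kernels n
  exact (h.isLimitDeriv_yy hK).nrm_le hK h

/-- Tangential increments of a derivative. -/
theorem IsLimitDeriv.normL2_increment_le {K : ℕ → Tan n × ℝ → ℝ} {α : Fin n → ℕ} {i : ℕ}
    {g' : Tan n → ℝ → ℝ} (hL : IsLimitDeriv K g α i g')
    (hK : ∀ k, IsKernel (scale k) (K k)) (h : Datum θ₀ g gx gy gyy) (j : Fin n) {r : ℝ}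
    (hr : 0 ≤ r) :
    normL2 (fun x y => g' (x + r • ev j) y - g' x y) ≤
      ENNReal.ofReal r * weakPartialNorm (α + Pi.single j 1) i θ₀ := by
  have h1 := nrm_increment_le_of_tendsto (f := fun q => g' q.1 q.2) (v := (r • ev j, (0 : ℝ)))
    (fun k => contDiff_testDeriv (h.smooth (hK k)) α i)
    (fun p hp => hL.tendsto hK (le_of_lt hp.2)) le_rfl
    (N := ENNReal.ofReal r * weakPartialNorm (α + Pi.single j 1) i θ₀) fun k => by
      have e : dirD (r • ev j, (0 : ℝ)) (testDeriv α i (conv (K k) fun p => g p.1 p.2)) =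
          r • testDeriv (α + Pi.single j 1) i (conv (K k) fun p => g p.1 p.2) := by
        funext p
        rw [testDeriv_add_single (h.smooth (hK k))]
        simp only [dirD, Pi.smul_apply, ← map_smul, Prod.smul_mk, smul_zero]
      rw [e]
      unfold nrm
      rw [eLpNorm_const_smul, Real.enorm_eq_ofReal hr]
      exact mul_le_mul' le_rfl (h.nrm_testDeriv_le (hK k) _ _)
  simpa [normL2] using h1

end Datum

/-! ### The Sobolev norms -/

theorem weakPartialNorm_le_normH {θ₀ : Tan n → ℝ → ℝ} {α : Fin n → ℕ} {i m k : ℕ}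
    (hα : ∑ j, α j ≤ m) (hi : i ≤ k) : weakPartialNorm α i θ₀ ≤ normH m k θ₀ := by
  have h1 : weakPartialNorm α i θ₀ ^ 2 ≤ ∑ l ∈ Finset.range (m + 1),
      ∑ α ∈ Finset.piAntidiag (Finset.univ : Finset (Fin n)) l,
        ∑ i ∈ Finset.range (k + 1), weakPartialNorm α i θ₀ ^ 2 := by
    refine le_trans ?_ (Finset.single_le_sum (f := fun l =>
      ∑ α ∈ Finset.piAntidiag (Finset.univ : Finset (Fin n)) l,
        ∑ i ∈ Finset.range (k + 1), weakPartialNorm α i θ₀ ^ 2) (fun _ _ => zero_le)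
      (Finset.mem_range.2 (Nat.lt_succ_of_le hα)))
    refine le_trans ?_ (Finset.single_le_sum (f := fun α =>
        ∑ i ∈ Finset.range (k + 1), weakPartialNorm α i θ₀ ^ 2) (fun _ _ => zero_le)
      (Finset.mem_piAntidiag.2 ⟨rfl, fun _ _ => Finset.mem_univ _⟩ : α ∈ _))
    exact Finset.single_le_sum (f := fun i => weakPartialNorm α i θ₀ ^ 2) (fun _ _ => zero_le)
      (Finset.mem_range.2 (Nat.lt_succ_of_le hi))
  have h2 := ENNReal.rpow_le_rpow h1 (by norm_num : (0 : ℝ) ≤ 1 / 2)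
  rwa [← ENNReal.rpow_natCast, ← ENNReal.rpow_mul, show ((2 : ℕ) : ℝ) * (1 / 2) = 1 by norm_num,
    ENNReal.rpow_one] at h2

end

section

/-! ### Mollification of the shear profile -/

/-- A smooth probability density supported in `[-3δ, -δ]`. -/
structure IsKernel₁ (δ : ℝ) (κ : ℝ → ℝ) : Prop where
  pos : 0 < δ
  smooth : ContDiff ℝ ∞ κ
  compact : HasCompactSupport κ
  nonneg : ∀ p, 0 ≤ κ p
  integral : ∫ p, κ p = 1
  supp : ∀ p ∈ tsupport κ, p ≤ -δ ∧ -(3 * δ) ≤ p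

theorem exists_kernel₁ {δ : ℝ} (hδ : 0 < δ) : ∃ κ : ℝ → ℝ, IsKernel₁ δ κ := by
  let φ : ContDiffBump (-(2 * δ)) := ⟨δ / 2, δ, by positivity, by linarith⟩
  refine ⟨φ.normed volume, hδ, φ.contDiff_normed, φ.hasCompactSupport_normed, φ.nonneg_normed,
    φ.integral_normed, fun p hp => ?_⟩
  rw [φ.tsupport_normed_eq, Metric.mem_closedBall, Real.dist_eq, abs_le] at hp
  have h1 : -δ ≤ p - -(2 * δ) := hp.1
  have h2 : p - -(2 * δ) ≤ δ := hp.2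
  constructor <;> linarith

section

variable {n : ℕ} {δ : ℝ} {κ : ℝ → ℝ}

theorem IsKernel₁.lintegral (hκ : IsKernel₁ δ κ) : ∫⁻ p, ‖κ p‖ₑ = 1 := by
  have hi : Integrable κ := hκ.smooth.continuous.integrable_of_hasCompactSupport hκ.compact
  have h1 := ofReal_integral_eq_lintegral_ofReal hi (Filter.Eventually.of_forall hκ.nonneg)
  rw [hκ.integral, ENNReal.ofReal_one] at h1
  rw [h1]
  exact lintegral_congr fun p => Real.enorm_eq_ofReal (hκ.nonneg p)

/-- The `i`-th derivative of the mollified profile. -/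
def profile (κ : ℝ → ℝ) (W : ℝ → Tan n) (i : ℕ) (y : ℝ) : Tan n :=
  ∫ z, iteratedDeriv i κ (y - z) • W z

theorem profile_eq_convolution (κ : ℝ → ℝ) (W : ℝ → Tan n) (i : ℕ) :
    profile κ W i =
      convolution (iteratedDeriv i κ) W (ContinuousLinearMap.lsmul ℝ ℝ) volume := by
  funext y
  rw [convolution_eq_swap]
  rfl

theorem IsKernel₁.contDiff_iteratedDeriv (hκ : IsKernel₁ δ κ) (i : ℕ) :
    ContDiff ℝ ∞ (iteratedDeriv i κ) ∧ HasCompactSupport (iteratedDeriv i κ) := by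
  induction i with
  | zero => simpa using ⟨hκ.smooth, hκ.compact⟩
  | succ i ih =>
    rw [iteratedDeriv_succ]
    exact ⟨(contDiff_infty_iff_deriv.1 ih.1).2, ih.2.deriv⟩

theorem IsKernel₁.hasDerivAt_profile (hκ : IsKernel₁ δ κ) {W : ℝ → Tan n} (hW : Continuous W)
    (i : ℕ) (y : ℝ) : HasDerivAt (profile κ W i) (profile κ W (i + 1) y) y := by
  rw [profile_eq_convolution, profile_eq_convolution, iteratedDeriv_succ]
  have h := hκ.contDiff_iteratedDeriv i
  exact h.2.hasDerivAt_convolution_left _ (contDiff_infty.1 h.1 1) hW.locallyIntegrable y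

theorem IsKernel₁.continuous_profile (hκ : IsKernel₁ δ κ) {W : ℝ → Tan n} (hW : Continuous W)
    (i : ℕ) : Continuous (profile κ W i) :=
  continuous_iff_continuousAt.2 fun y => (hκ.hasDerivAt_profile hW i y).continuousAt

/-- The reflected kernel is supported in positive heights even when y = 0, hence is a test function
for the weak derivative. Being a probability density, it does not increase the supremum. -/
theorem IsKernel₁.enorm_profile_le (hκ : IsKernel₁ δ κ) {W U : ℝ → Tan n}
    (hWU : ∀ y, 0 < y → W y = U y) (i : ℕ) {y : ℝ} (hy : 0 ≤ y) {g : ℝ → Tan n}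
    (hg : IsWeakDeriv i U g) : ‖profile κ W i y‖ₑ ≤ normLinf g := by
  obtain ⟨-, hgl, hgw⟩ := hg
  have hpos := hκ.pos
  set φ : ℝ → ℝ := fun z => κ (y - z) with hφ
  have hφs : ContDiff ℝ ∞ φ := hκ.smooth.comp (contDiff_const.sub contDiff_id)
  have hφc : HasCompactSupport φ := hκ.compact.comp_homeomorph (Homeomorph.subLeft y)
  have hcl : tsupport φ ⊆ (fun p => y - p) ⁻¹' tsupport κ := by
    refine closure_minimal (fun p hp => subset_tsupport κ hp) ?_
    exact (isClosed_tsupport κ).preimage (by fun_prop)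
  have hφh : tsupport φ ⊆ Ioi 0 := fun p hp => by
    have h1 : y - p ≤ -δ := (hκ.supp _ (hcl hp)).1
    show 0 < p
    linarith
  have hφi : ∀ z, iteratedDeriv i φ z = (-1 : ℝ) ^ i * iteratedDeriv i κ (y - z) := by
    intro z
    rw [hφ, iteratedDeriv_comp_const_sub]
    simp
  have hw := hgw φ hφs hφc hφh
  have hzero : ∀ z, z ∉ Ioi (0 : ℝ) → iteratedDeriv i φ z = 0 := by
    intro z hz
    by_contra hne
    refine hz (hφh ?_)
    have hs : ∀ j, tsupport (iteratedDeriv j φ) ⊆ tsupport φ := by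
      intro j
      induction j with
      | zero => simp
      | succ j ih =>
        rw [iteratedDeriv_succ]
        exact (closure_minimal support_deriv_subset (isClosed_tsupport _)).trans ih
    exact hs i (subset_tsupport _ hne)
  have e1 : profile κ W i y = (-1 : ℝ) ^ i • ∫ z in Ioi 0, iteratedDeriv i φ z • U z := by
    rw [← integral_smul, profile, ← setIntegral_eq_integral_of_forall_compl_eq_zero (s := Ioi 0)]
    · refine setIntegral_congr_fun measurableSet_Ioi fun z hz => ?_
      simp only [hφi, smul_smul, ← mul_assoc, ← mul_pow]
      rw [hWU z hz]
      simp
    · intro z hz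
      have h1 := hzero z hz
      rw [hφi] at h1
      rw [(mul_eq_zero.1 h1).resolve_left (pow_ne_zero _ (by norm_num)), zero_smul]
  have e2 : profile κ W i y = ∫ z in Ioi 0, φ z • g z := by
    rw [e1, hw, smul_smul, ← mul_pow]
    simp
  rw [e2]
  refine (enorm_integral_le_lintegral_enorm _).trans ?_
  have h3 : ∀ᵐ z ∂(volume.restrict (Ioi (0 : ℝ))), ‖φ z • g z‖ₑ ≤ ‖φ z‖ₑ * normLinf g := by
    filter_upwards [ae_le_eLpNormEssSup (f := g) (μ := volume.restrict (Ioi (0 : ℝ)))] with z hz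
    rw [enorm_smul]
    refine mul_le_mul' le_rfl ?_
    rw [normLinf, eLpNorm_exponent_top]
    exact hz
  refine (lintegral_mono_ae h3).trans ?_
  have hm : Measurable fun z => ‖φ z‖ₑ := hφs.continuous.enorm.measurable
  rw [lintegral_mul_const _ hm]
  have h4 : ∫⁻ z in Ioi 0, ‖φ z‖ₑ ≤ 1 := by
    refine (setLIntegral_le_lintegral _ _).trans ?_
    rw [lintegral_sub_left_eq_self (fun z => ‖κ z‖ₑ) y, hκ.lintegral]
  exact (mul_le_mul' h4 le_rfl).trans (by rw [one_mul])

theorem IsKernel₁.profile_sub_le (hκ : IsKernel₁ δ κ) {W : ℝ → Tan n} (hW : Continuous W) {y A : ℝ}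
    (hA : ∀ s, δ ≤ s → s ≤ 3 * δ → ‖W (y + s) - W y‖ ≤ A) : ‖profile κ W 0 y - W y‖ ≤ A := by
  have hκc := hκ.smooth.continuous
  have hcs : HasCompactSupport fun z => κ (y - z) :=
    hκ.compact.comp_homeomorph (Homeomorph.subLeft y)
  have hint : ∀ f : ℝ → Tan n, Continuous f → Integrable fun z => κ (y - z) • f z := by
    intro f hf
    have hc : Continuous fun z => κ (y - z) • f z := by fun_prop
    exact hc.integrable_of_hasCompactSupport (hcs.smul_right (f' := f))
  have h1 : ∫ z, κ (y - z) = 1 := by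
    rw [integral_sub_left_eq_self (fun z => κ z) volume y, hκ.integral]
  have e : profile κ W 0 y - W y = ∫ z, κ (y - z) • (W z - W y) := by
    simp only [smul_sub]
    rw [integral_sub (hint W hW) (hint _ continuous_const), integral_smul_const, h1, one_smul]
    simp [profile]
  have hi1 : Integrable fun z => κ (y - z) * A :=
    ((by fun_prop : Continuous fun z => κ (y - z)).integrable_of_hasCompactSupport
      hcs).mul_const A
  rw [e]
  calc _ ≤ ∫ z, κ (y - z) * A := by
        refine norm_integral_le_of_norm_le hi1 (Filter.Eventually.of_forall fun z => ?_)
        rw [norm_smul, Real.norm_of_nonneg (hκ.nonneg _)]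
        by_cases hz : κ (y - z) = 0
        · simp [hz]
        · have h2 := hκ.supp _ (subset_tsupport κ hz)
          refine mul_le_mul_of_nonneg_left ?_ (hκ.nonneg _)
          have := hA (z - y) (by linarith [h2.1]) (by linarith [h2.2])
          simpa using this
    _ = A := by rw [integral_mul_const, h1, one_mul]

theorem tendsto_profile {κ : ℕ → ℝ → ℝ} (hκ : ∀ k, IsKernel₁ (scale k) (κ k)) {W : ℝ → Tan n}
    (hW : Continuous W) (y : ℝ) :
    Filter.Tendsto (fun k => profile (κ k) W 0 y) Filter.atTop (nhds (W y)) := by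
  rw [Metric.tendsto_atTop]
  intro ε hε
  obtain ⟨r, hr, hWr⟩ := Metric.continuousAt_iff.1 hW.continuousAt (ε / 2) (half_pos hε)
  have he : ∀ᶠ k in Filter.atTop, 3 * scale k < r := by
    have : Filter.Tendsto (fun k => 3 * scale k) Filter.atTop (nhds (3 * 0)) :=
      tendsto_scale.const_mul 3
    exact this.eventually_lt_const (by simpa using hr)
  obtain ⟨N, hN⟩ := Filter.eventually_atTop.1 he
  refine ⟨N, fun k hk => ?_⟩
  rw [dist_eq_norm]
  refine ((hκ k).profile_sub_le hW (A := ε / 2) fun s h1 h2 => ?_).trans_lt (half_lt_self hε)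
  rw [← dist_eq_norm]
  refine (hWr ?_).le
  have := scale_pos k
  have := hN k hk
  simp only [dist_self_add_left, Real.norm_eq_abs]
  rw [abs_of_nonneg] <;> linarith

theorem exists_kernels₁ : ∃ κ : ℕ → ℝ → ℝ, ∀ k, IsKernel₁ (scale k) (κ k) :=
  Classical.axiom_of_choice fun k => exists_kernel₁ (scale_pos k)

variable {U W : ℝ → Tan n}

/-- Order zero of the previous bound, in the limit of vanishing scale: an essential bound holds
everywhere, boundary included, for a continuous representative. -/
theorem enorm_le_of_isWeakDeriv (hW : Continuous W) (hWU : ∀ y, 0 < y → W y = U y) {g : ℝ → Tan n}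
    (hg : IsWeakDeriv 0 U g) {y : ℝ} (hy : 0 ≤ y) : ‖W y‖ₑ ≤ normLinf g := by
  obtain ⟨κ, hκ⟩ := exists_kernels₁
  exact le_of_tendsto (tendsto_profile hκ hW y).enorm
    (Filter.Eventually.of_forall fun k => (hκ k).enorm_profile_le hWU 0 hy hg)

theorem normLinf_congr (hWU : ∀ y, 0 < y → W y = U y) : normLinf W = normLinf U :=
  eLpNorm_congr_ae (by filter_upwards [ae_restrict_mem measurableSet_Ioi] with y hy using hWU y hy)

theorem enorm_le_normLinf (hW : Continuous W) (hWU : ∀ y, 0 < y → W y = U y) {y : ℝ}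
    (hy : 0 ≤ y) : ‖W y‖ₑ ≤ normLinf U := by
  rw [← normLinf_congr hWU]
  refine enorm_le_of_isWeakDeriv hW (fun _ _ => rfl) ⟨hW.locallyIntegrable.locallyIntegrableOn _,
    hW.locallyIntegrable.locallyIntegrableOn _, fun φ _ _ _ => by simp⟩ hy

theorem weakDerivNorm_le_normW2inf (U : ℝ → Tan n) {k : ℕ} (hk : k < 3) :
    (⨅ (g : ℝ → Tan n) (_ : IsWeakDeriv k U g), normLinf g) ≤ normW2inf U :=
  Finset.single_le_sum (f := fun k => ⨅ (g : ℝ → Tan n) (_ : IsWeakDeriv k U g), normLinf g)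
    (fun _ _ => zero_le) (Finset.mem_range.2 hk)

theorem normLinf_le_normW2inf (hW : Continuous W) (hWU : ∀ y, 0 < y → W y = U y) :
    normLinf U ≤ normW2inf U := by
  refine le_trans ?_ (weakDerivNorm_le_normW2inf U (k := 0) (by norm_num))
  refine le_iInf fun g => le_iInf fun hg => ?_
  rw [← normLinf_congr hWU, normLinf, eLpNorm_exponent_top]
  refine essSup_le_of_ae_le _ ?_
  filter_upwards [ae_restrict_mem measurableSet_Ioi] with y hy
  exact enorm_le_of_isWeakDeriv hW hWU hg (le_of_lt hy)

theorem norm_le_toReal_of_enorm {E : Type*} [NormedAddCommGroup E] {v : E} {a : ℝ≥0∞} (ha : a < ⊤)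
    (h : ‖v‖ₑ ≤ a) : ‖v‖ ≤ a.toReal := by
  rw [← toReal_enorm]
  exact ENNReal.toReal_mono ha.ne h

theorem IsKernel₁.norm_profile_le (hκ : IsKernel₁ δ κ) (hWU : ∀ y, 0 < y → W y = U y)
    (hfin : normW2inf U < ⊤) {i : ℕ} (hi : i < 3) {y : ℝ} (hy : 0 ≤ y) :
    ‖profile κ W i y‖ ≤ (normW2inf U).toReal := by
  refine norm_le_toReal_of_enorm hfin (le_trans ?_ (weakDerivNorm_le_normW2inf U hi))
  refine le_iInf fun g => le_iInf fun hg => ?_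
  exact hκ.enorm_profile_le hWU i hy hg

/-- The mollified profiles have derivatives bounded by the weak norm. The mean value inequality for
them passes to the limit and gives a Lipschitz bound. -/
theorem norm_increment_le (hW : Continuous W) (hWU : ∀ y, 0 < y → W y = U y)
    (hfin : normW2inf U < ⊤) {y s : ℝ} (hy : 0 ≤ y) (hs : 0 ≤ s) :
    ‖W (y + s) - W y‖ ≤ (normW2inf U).toReal * s := by
  obtain ⟨κ, hκ⟩ := exists_kernels₁
  refine le_of_tendsto ((tendsto_profile hκ hW (y + s)).sub (tendsto_profile hκ hW y)).norm
    (Filter.Eventually.of_forall fun k => ?_)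
  have h := (convex_Ici (0 : ℝ)).norm_image_sub_le_of_norm_hasDerivWithin_le
    (f := profile (κ k) W 0) (f' := profile (κ k) W 1) (C := (normW2inf U).toReal) (x := y)
    (y := y + s) (fun z _ => ((hκ k).hasDerivAt_profile hW 0 z).hasDerivWithinAt)
    (fun z hz => (hκ k).norm_profile_le hWU hfin (by norm_num) hz) hy (by
      show 0 ≤ y + s
      linarith)
  simpa [abs_of_nonneg hs] using h

theorem IsKernel₁.norm_profile_sub_le (hκ : IsKernel₁ δ κ) (hW : Continuous W)
    (hWU : ∀ y, 0 < y → W y = U y) (hfin : normW2inf U < ⊤) {y : ℝ} (hy : 0 ≤ y) :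
    ‖profile κ W 0 y - W y‖ ≤ (normW2inf U).toReal * (3 * δ) :=
  hκ.profile_sub_le hW fun s h1 h2 =>
    (norm_increment_le hW hWU hfin hy (by linarith [hκ.pos])).trans (by gcongr)

end

end

/-! ### Second order behaviour in time and the slice bound for ∂_y². -/

section

variable {n : ℕ} {w wt wy wyy : ℝ → Tan n → ℝ → ℝ} {wx : ℝ → Tan n → ℝ → (Tan n →L[ℝ] ℝ)}
  {U : ℝ → Tan n} {m : ℝ}

/-! ### Second order expansion at the initial time -/

/-- The first order Taylor term in time. Its source is F plus t times U·∇F - ∂_y² F. -/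
theorem Static.reg_linear {F Fy Fyy : Tan n → ℝ → ℝ} {Fx : Tan n → ℝ → (Tan n →L[ℝ] ℝ)}
    (h : Static F Fx Fy Fyy) :
    Reg (fun t x y => t * F x y) (fun _ x y => F x y) (fun t x y => t • Fx x y)
      (fun t x y => t * Fy x y) (fun t x y => t * Fyy x y) where
  c := continuous_fst.mul (h.c.comp continuous_snd)
  ct := h.c.comp continuous_snd
  cx := continuous_fst.smul (h.cx.comp continuous_snd)
  cy := continuous_fst.mul (h.cy.comp continuous_snd)
  cyy := continuous_fst.mul (h.cyy.comp continuous_snd)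
  ht t x y _ := by simpa using (hasDerivAt_id t).mul_const (F x y)
  hx t x y := (h.hx x y).const_mul t
  hy t x y hy := (h.hy x y hy).const_mul t
  hyy t x y hy := (h.hyy x y hy).const_mul t

theorem continuous_at_height {g : Tan n → ℝ → ℝ} (hg : Continuous fun p : Tan n × ℝ => g p.1 p.2)
    (y : ℝ) : Continuous fun x => g x y :=
  hg.comp (by fun_prop : Continuous fun x : Tan n => (x, y))

theorem sliceNorm_sub_le {f g : Tan n → ℝ → ℝ} (hf : Continuous fun p : Tan n × ℝ => f p.1 p.2)
    (hg : Continuous fun p : Tan n × ℝ => g p.1 p.2) (y : ℝ) :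
    sliceNorm (fun x y => f x y - g x y) y ≤ sliceNorm f y + sliceNorm g y :=
  eLpNorm_sub_le (continuous_at_height hf y).aestronglyMeasurable
    (continuous_at_height hg y).aestronglyMeasurable (by norm_num)

theorem sliceNorm_const_mul (r : ℝ) (f : Tan n → ℝ → ℝ) (y : ℝ) :
    sliceNorm (fun x y => r * f x y) y = ‖r‖ₑ * sliceNorm f y :=
  eLpNorm_const_smul r (fun x => f x y) 2 _

theorem lintegral_mul_le_sliceNorm {f g : Tan n → ℝ → ℝ}
    (hf : Continuous fun p : Tan n × ℝ => f p.1 p.2)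
    (hg : Continuous fun p : Tan n × ℝ => g p.1 p.2) (y : ℝ) :
    ∫⁻ x, 2 * ‖f x y‖ₑ * ‖g x y‖ₑ ≤ 2 * sliceNorm f y * sliceNorm g y := by
  have cf := (continuous_at_height hf y).enorm.measurable
  have cg := (continuous_at_height hg y).enorm.measurable
  simp only [mul_assoc]
  rw [lintegral_const_mul 2 (f := fun x => ‖f x y‖ₑ * ‖g x y‖ₑ) (cf.mul cg)]
  refine mul_le_mul' le_rfl ?_
  rw [← ENNReal.pow_le_pow_left_iff two_ne_zero, mul_pow]
  unfold sliceNorm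
  rw [eLpNorm_two_sq, eLpNorm_two_sq]
  exact sq_lintegral_mul_le _ cf.aemeasurable cg.aemeasurable

/-- The bound for the energy of the remainder of the first order expansion. -/
def remainderBound (T : ℝ) (K c A b : ℝ≥0∞) : ℝ≥0∞ :=
  2 * (ENNReal.ofReal (4 * T) * (ENNReal.ofReal T * (A + ENNReal.ofReal T * K) ^ 2) +
    ENNReal.ofReal T * (2 * (ENNReal.ofReal T * b) * (c + c + ENNReal.ofReal T * c)))

theorem tendsto_remainderBound {T : ℝ} {K c : ℝ≥0∞} {a b : ℕ → ℝ≥0∞}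
    (hat : Filter.Tendsto a Filter.atTop (nhds 0)) (hbt : Filter.Tendsto b Filter.atTop (nhds 0))
    (hc : c < ⊤) : Filter.Tendsto (fun k => remainderBound T K c (a k) (b k)) Filter.atTop
      (nhds (remainderBound T K c 0 0)) := by
  have hD : c + c + ENNReal.ofReal T * c ≠ ⊤ :=
    (ENNReal.add_lt_top.2 ⟨ENNReal.add_lt_top.2 ⟨hc, hc⟩,
      ENNReal.mul_lt_top ENNReal.ofReal_lt_top hc⟩).ne
  have h1 := ENNReal.Tendsto.const_mul (ENNReal.Tendsto.const_mul (ENNReal.Tendsto.pow (n := 2)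
    (hat.add_const (ENNReal.ofReal T * K))) (Or.inr (ENNReal.ofReal_ne_top (r := T))))
    (Or.inr (ENNReal.ofReal_ne_top (r := 4 * T)))
  have h2 := ENNReal.Tendsto.const_mul (ENNReal.Tendsto.mul_const (ENNReal.Tendsto.const_mul
    (ENNReal.Tendsto.const_mul hbt (Or.inr (ENNReal.ofReal_ne_top (r := T))))
    (Or.inr (ENNReal.ofNat_ne_top (n := 2)))) (Or.inr hD)) (Or.inr (ENNReal.ofReal_ne_top (r := T)))
  exact ENNReal.Tendsto.const_mul (h1.add h2) (Or.inr (ENNReal.ofNat_ne_top (n := 2)))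

theorem remainderBound_zero_le {T : ℝ} (hT : 0 < T) (K c : ℝ≥0∞) :
    remainderBound T K c 0 0 ≤ (ENNReal.ofReal (3 * T ^ 2) * K) ^ 2 := by
  unfold remainderBound
  simp only [zero_add, mul_zero, zero_mul, add_zero]
  rw [mul_pow, mul_pow, ← ENNReal.ofReal_pow hT.le, ← ENNReal.ofReal_pow (by positivity),
    ← mul_assoc, ← mul_assoc, ← mul_assoc]
  gcongr
  rw [show (2 : ℝ≥0∞) = ENNReal.ofReal 2 by simp, ← ENNReal.ofReal_mul (by norm_num),
    ← ENNReal.ofReal_mul (by positivity), ← ENNReal.ofReal_mul (by positivity)]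
  refine ENNReal.ofReal_le_ofReal ?_
  nlinarith [pow_pos hT 4]

/-- The remainder after the subtraction of an approximation to the first order term. -/
theorem Sol.energy_remainder_le (h : Sol U w wt wx wy wyy) (hU : Continuous U)
    (hm : ∀ y, ‖U y‖ ≤ m) {F Fy Fyy : Tan n → ℝ → ℝ} {Fx : Tan n → ℝ → (Tan n →L[ℝ] ℝ)}
    (hF : Static F Fx Fy Fyy) {T : ℝ} (hT : 0 < T) {A K b c : ℝ≥0∞} (hFfin : normL2 F < ⊤)
    (hA : normL2 (fun x y => initialRate U (wx 0) (wyy 0) x y - F x y) ≤ A)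
    (hK : normL2 (fun x y => Fyy x y - Fx x y (U y)) ≤ K) (hb : sliceNorm F 0 ≤ b)
    (hc : ∀ t, 0 ≤ t → sliceNorm (wy t) 0 ≤ c) (hc' : sliceNorm Fy 0 ≤ c) :
    energy (fun x y => w T x y - w 0 x y - T * F x y) ≤ remainderBound T K c A b := by
  have hreg := (h.reg.sub (h.reg.freeze 0)).sub hF.reg_linear
  obtain ⟨C, hC, hbd⟩ := h.bdd
  have hc0 := h.reg.continuous_at_time
  have cyt := fun t => continuous_slice h.reg.cy t
  have cx0 := continuous_slice h.reg.cx 0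
  have cyy0 := continuous_slice h.reg.cyy 0
  have hFc := hF.c
  have hFcx := hF.cx
  have hFcy := hF.cy
  have hFcyy := hF.cyy
  have en : ∀ t : ℝ, t ∈ Icc 0 T → ‖t‖ₑ ≤ ENNReal.ofReal T := fun t ht => by
    rw [Real.enorm_eq_ofReal ht.1]
    exact ENNReal.ofReal_le_ofReal ht.2
  refine hreg.energy_le_of_src hU hm hT (fun x y _ => by simp) ?_ ?_ ?_
  · refine lintegral_energy_lt_top (C := C + C + ENNReal.ofReal T * normL2 F) ?_ fun t ht hT' => ?_
    · exact ENNReal.add_lt_top.2 ⟨ENNReal.add_lt_top.2 ⟨hC, hC⟩,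
        ENNReal.mul_lt_top ENNReal.ofReal_lt_top hFfin⟩
    · refine (normL2_sub_le ((hc0 t).sub (hc0 0)) (hFc.const_mul t)).trans
        (add_le_add ((normL2_sub_le (hc0 t) (hc0 0)).trans
          (add_le_add (hbd t ht) (hbd 0 le_rfl))) ?_)
      rw [normL2_const_mul]
      exact mul_le_mul' (en t ⟨ht, hT'⟩) le_rfl
  · refine (setLIntegral_mono (g := fun _ => (A + ENNReal.ofReal T * K) ^ 2) measurable_const
      fun τ hτ => ?_).trans (le_of_eq ?_)
    · rw [← normL2_le_iff]
      -- The source of the remainder w - w(0) - tF: the approximation error of the rate, plus a term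
      -- linear in time that K controls.
      rw [normL2_congr (g := fun x y => (initialRate U (wx 0) (wyy 0) x y - F x y) +
        τ * (Fyy x y - Fx x y (U y)))]
      · refine (normL2_add_le ?_ ?_).trans (add_le_add hA ?_)
        · unfold initialRate
          fun_prop
        · fun_prop
        · rw [normL2_const_mul]
          exact mul_le_mul' (en τ ⟨hτ.1.le, hτ.2⟩) hK
      · intro x y hy
        have h1 := h.eq τ x y hτ.1 hy
        simp only [src, sub_apply, smul_apply, initialRate, smul_eq_mul] at h1 ⊢
        linarith
    · rw [setLIntegral_const, Real.volume_Ioc, sub_zero, mul_comm]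
  · refine (setLIntegral_mono (g := fun _ => 2 * (ENNReal.ofReal T * b) *
      (c + c + ENNReal.ofReal T * c)) measurable_const fun τ hτ => ?_).trans (le_of_eq ?_)
    · have hτ' : τ ∈ Icc 0 T := ⟨hτ.1.le, hτ.2⟩
      refine (lintegral_mul_le_sliceNorm
        (f := fun x y => w τ x y - w 0 x y - τ * F x y)
        (g := fun x y => wy τ x y - wy 0 x y - τ * Fy x y)
        (((hc0 τ).sub (hc0 0)).sub (hFc.const_mul τ))
        (((cyt τ).sub (cyt 0)).sub (hFcy.const_mul τ)) 0).trans ?_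
      refine mul_le_mul' (mul_le_mul' le_rfl ?_) ?_
      -- On the boundary w vanishes, so the remainder is -τF there and the flux is proportional to
      -- the small quantity b.
      · have e : sliceNorm (fun x y => w τ x y - w 0 x y - τ * F x y) 0 =
            ‖-τ‖ₑ * sliceNorm F 0 := by
          rw [← sliceNorm_const_mul]
          unfold sliceNorm
          simp [h.bdry]
        rw [e, enorm_neg]
        exact mul_le_mul' (en τ hτ') hb
      · refine (sliceNorm_sub_le ((cyt τ).sub (cyt 0)) (hFcy.const_mul τ) 0).trans ?_
        refine add_le_add ((sliceNorm_sub_le (cyt τ) (cyt 0) 0).trans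
          (add_le_add (hc τ hτ.1.le) (hc 0 le_rfl))) ?_
        rw [sliceNorm_const_mul]
        exact mul_le_mul' (en τ hτ') hc'
    · rw [setLIntegral_const, Real.volume_Ioc, sub_zero, mul_comm]

/-- Smooth functions that approximate the initial rate of change and whose boundary values tend
to zero. -/
structure RateApprox (U : ℝ → Tan n) (f : Tan n → ℝ → ℝ) (K c : ℝ≥0∞) : Prop where
  exists_approx : ∃ (F Fy Fyy : ℕ → Tan n → ℝ → ℝ) (Fx : ℕ → Tan n → ℝ → (Tan n →L[ℝ] ℝ))
    (a b : ℕ → ℝ≥0∞), (∀ k, Static (F k) (Fx k) (Fy k) (Fyy k)) ∧ (∀ k, normL2 (F k) < ⊤) ∧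
    (∀ k, normL2 (fun x y => f x y - F k x y) ≤ a k) ∧
    (∀ k, normL2 (fun x y => Fyy k x y - Fx k x y (U y)) ≤ K) ∧
    (∀ k, sliceNorm (F k) 0 ≤ b k) ∧ (∀ k, sliceNorm (Fy k) 0 ≤ c) ∧
    Filter.Tendsto a Filter.atTop (nhds 0) ∧ Filter.Tendsto b Filter.atTop (nhds 0) ∧
    ∀ x y, 0 < y → Filter.Tendsto (fun k => F k x y) Filter.atTop (nhds (f x y))

/-- The rate itself is not smooth enough to be subtracted, so its approximations are. Their errors
and boundary values tend to zero while c stays bounded, which leaves 8T⁴K² ≤ (3T²K)². -/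
theorem Sol.normL2_remainder_le (h : Sol U w wt wx wy wyy) (hU : Continuous U)
    (hm : ∀ y, ‖U y‖ ≤ m) {K c : ℝ≥0∞} (hc : c < ⊤)
    (hwy : ∀ t, 0 ≤ t → sliceNorm (wy t) 0 ≤ c)
    (happ : RateApprox U (initialRate U (wx 0) (wyy 0)) K c) {T : ℝ} (hT : 0 < T) :
    normL2 (fun x y => w T x y - w 0 x y - T * initialRate U (wx 0) (wyy 0) x y) ≤
      ENNReal.ofReal (3 * T ^ 2) * K := by
  obtain ⟨F, Fy, Fyy, Fx, a, b, hF, hfin, ha, hK', hb, hc', hat, hbt, hlim⟩ := happ.exists_approx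
  have hc0 := h.reg.continuous_at_time
  have hXt := tendsto_remainderBound hat hbt hc (T := T) (K := K)
  have hbound : ∀ k, normL2 (fun x y => w T x y - w 0 x y - T * F k x y) ≤
      remainderBound T K c (a k) (b k) ^ (1 / 2 : ℝ) := by
    intro k
    rw [normL2_le_iff, ← ENNReal.rpow_natCast, ← ENNReal.rpow_mul,
      show (1 / 2 : ℝ) * ((2 : ℕ) : ℝ) = 1 by norm_num, ENNReal.rpow_one]
    exact h.energy_remainder_le hU hm (hF k) hT (hfin k) (ha k) (hK' k) (hb k) hwy (hc' k)
  have hXt' := (ENNReal.continuous_rpow_const (y := 1 / 2)).continuousAt.tendsto.comp hXt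
  have hfinal : normL2 (fun x y => w T x y - w 0 x y - T * initialRate U (wx 0) (wyy 0) x y) ≤
      remainderBound T K c 0 0 ^ (1 / 2 : ℝ) := by
    refine eLpNorm_le_of_tendsto'
      (f := fun k (p : Tan n × ℝ) => w T p.1 p.2 - w 0 p.1 p.2 - T * F k p.1 p.2) ?_ ?_ hbound hXt'
    · intro k
      exact aesm_half (((hc0 T).sub (hc0 0)).sub ((hF k).c.const_mul T))
    · filter_upwards [ae_restrict_mem measurableSet_halfSpace] with p hp
      have h1 := (hlim p.1 p.2 hp.2).const_mul T
      exact h1.const_sub _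
  refine hfinal.trans ?_
  refine (ENNReal.rpow_le_rpow (remainderBound_zero_le hT K c)
    (by norm_num : (0 : ℝ) ≤ 1 / 2)).trans (le_of_eq ?_)
  rw [← ENNReal.rpow_natCast, ← ENNReal.rpow_mul, show ((2 : ℕ) : ℝ) * (1 / 2 : ℝ) = 1 by norm_num,
    ENNReal.rpow_one]

/-- Second time differences. -/
theorem Sol.normL2_secondDifference_le (h : Sol U w wt wx wy wyy) (hU : Continuous U)
    (hm : ∀ y, ‖U y‖ ≤ m) {K c : ℝ≥0∞} (hc : c < ⊤)
    (hwy : ∀ t, 0 ≤ t → sliceNorm (wy t) 0 ≤ c)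
    (happ : RateApprox U (initialRate U (wx 0) (wyy 0)) K c) {t r : ℝ} (ht : 0 ≤ t) (hr : 0 < r) :
    normL2 (fun x y => w (t + r + r) x y - w (t + r) x y - (w (t + r) x y - w t x y)) ≤
      ENNReal.ofReal (18 * r ^ 2) * K := by
  have hz := (h.shiftTime hr.le).sub h
  have h1 := ((hz.shiftTime hr.le).sub hz).antitone hU hm le_rfl ht
  simp only [zero_add] at h1
  refine h1.trans ?_
  have hc0 := h.reg.continuous_at_time
  have cx0 := continuous_slice h.reg.cx 0
  have cyy0 := continuous_slice h.reg.cyy 0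
  have hf : Continuous fun p : Tan n × ℝ => initialRate U (wx 0) (wyy 0) p.1 p.2 := by
    unfold initialRate
    fun_prop
  have hcR : ∀ T : ℝ, Continuous fun p : Tan n × ℝ =>
      w T p.1 p.2 - w 0 p.1 p.2 - T * initialRate U (wx 0) (wyy 0) p.1 p.2 :=
    fun T => ((hc0 T).sub (hc0 0)).sub (hf.const_mul T)
  -- The linear terms cancel in the second difference. The remainders at 2r and r contribute 12 +
  -- 2·3 = 18.
  have e : (fun x y => w (r + r) x y - w r x y - (w r x y - w 0 x y)) = fun x y =>
      (w (r + r) x y - w 0 x y - (r + r) * initialRate U (wx 0) (wyy 0) x y) -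
        2 * (w r x y - w 0 x y - r * initialRate U (wx 0) (wyy 0) x y) := by
    funext x y; ring
  rw [e]
  refine (normL2_sub_le (hcR (r + r)) ((hcR r).const_mul 2)).trans ?_
  rw [normL2_const_mul]
  have h2 := h.normL2_remainder_le hU hm hc hwy happ (T := r + r) (by positivity)
  have h3 := h.normL2_remainder_le hU hm hc hwy happ hr
  refine (add_le_add h2 (mul_le_mul' le_rfl h3)).trans (le_of_eq ?_)
  rw [Real.enorm_eq_ofReal (by norm_num), ← mul_assoc, ← ENNReal.ofReal_mul (by norm_num),
    ← add_mul, ← ENNReal.ofReal_add (by positivity) (by positivity)]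
  congr 2
  ring

/-- Time increments of the tangential derivatives. -/
theorem Sol.normL2_dir_timeIncrement_le (h : Sol U w wt wx wy wyy) (hU : Continuous U)
    (hm : ∀ y, ‖U y‖ ≤ m) {v : Tan n} {L : ℝ≥0∞}
    (hL : ∀ r : ℝ, 0 ≤ r → normL2 (fun x y => initialRate U (wx 0) (wyy 0) (x + r • v) y -
      initialRate U (wx 0) (wyy 0) x y) ≤ ENNReal.ofReal r * L) {t r : ℝ} (ht : 0 ≤ t) (hr : 0 ≤ r) :
    normL2 (fun x y => wx (t + r) x y v - wx t x y v) ≤ ENNReal.ofReal (3 * r) * L := by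
  refine eLpNorm_le_of_tendsto
    (f := fun (k : ℕ) (p : Tan n × ℝ) =>
      ((k : ℝ) + 1) * (w (t + r) (p.1 + (1 / ((k : ℝ) + 1)) • v) p.2 - w (t + r) p.1 p.2) -
      ((k : ℝ) + 1) * (w t (p.1 + (1 / ((k : ℝ) + 1)) • v) p.2 - w t p.1 p.2)) ?_ ?_ ?_
  · intro k
    have hc := ((h.reg.shiftSpace ((1 / ((k : ℝ) + 1)) • v)).sub h.reg).continuous_at_time
    exact aesm_half (((hc _).const_mul _).sub ((hc _).const_mul _))
  · refine Filter.Eventually.of_forall fun p => ?_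
    have h1 := tendsto_xQuotient (h.reg.hx (t + r) p.1 p.2) v
    have h2 := tendsto_xQuotient (h.reg.hx t p.1 p.2) v
    exact h1.sub h2
  · intro k
    have hk : (0 : ℝ) < (k : ℝ) + 1 := by positivity
    have h1 := ((h.shiftSpace ((1 / ((k : ℝ) + 1)) • v)).sub h).timeIncrement hU hm ht hr
    -- The initial rate is linear in the data and commutes with tangential shifts, so the rate of a
    -- tangential increment is the increment of the rate.
    have e1 : initialRate U (fun x y => wx 0 (x + (1 / ((k : ℝ) + 1)) • v) y - wx 0 x y)
        (fun x y => wyy 0 (x + (1 / ((k : ℝ) + 1)) • v) y - wyy 0 x y) = fun x y =>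
        initialRate U (wx 0) (wyy 0) (x + (1 / ((k : ℝ) + 1)) • v) y -
          initialRate U (wx 0) (wyy 0) x y := by
      funext x y
      simp only [initialRate, sub_apply]
      ring
    rw [e1] at h1
    have h2 := h1.trans (mul_le_mul' le_rfl (hL _ (by positivity)))
    have e2 : (fun p : Tan n × ℝ =>
      ((k : ℝ) + 1) * (w (t + r) (p.1 + (1 / ((k : ℝ) + 1)) • v) p.2 - w (t + r) p.1 p.2) -
      ((k : ℝ) + 1) * (w t (p.1 + (1 / ((k : ℝ) + 1)) • v) p.2 - w t p.1 p.2)) =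
      fun p : Tan n × ℝ => (fun x y => ((k : ℝ) + 1) *
        (w (t + r) (x + (1 / ((k : ℝ) + 1)) • v) y - w (t + r) x y -
        (w t (x + (1 / ((k : ℝ) + 1)) • v) y - w t x y))) p.1 p.2 := by
      funext p; ring
    have h3 := normL2_const_mul ((k : ℝ) + 1) (fun x y =>
        w (t + r) (x + (1 / ((k : ℝ) + 1)) • v) y - w (t + r) x y -
        (w t (x + (1 / ((k : ℝ) + 1)) • v) y - w t x y))
    rw [Real.enorm_eq_ofReal hk.le] at h3
    rw [e2]
    refine h3.le.trans ?_
    refine (mul_le_mul' le_rfl h2).trans (le_of_eq ?_)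
    rw [← mul_assoc, ← mul_assoc, ← ENNReal.ofReal_mul hk.le, ← ENNReal.ofReal_mul (by positivity)]
    congr 2
    field_simp

end

section

variable {n : ℕ} {w wt wy wyy : ℝ → Tan n → ℝ → ℝ} {wx : ℝ → Tan n → ℝ → (Tan n →L[ℝ] ℝ)}
  {U : ℝ → Tan n} {m : ℝ}

/-! ### Slice norms of first and second derivatives -/

theorem Sol.eq_closure (h : Sol U w wt wx wy wyy) (hU : Continuous U) {t : ℝ} (ht : 0 ≤ t)
    (x : Tan n) {y : ℝ} (hy : 0 ≤ y) : wyy t x y = wt t x y + wx t x y (U y) := by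
  have c1 : Continuous fun y => wyy t x y :=
    h.reg.cyy.comp (by fun_prop : Continuous fun y : ℝ => (t, x, y))
  have c2 : Continuous fun y => wt t x y :=
    h.reg.ct.comp (by fun_prop : Continuous fun y : ℝ => (t, x, y))
  have c3 : Continuous fun y => wx t x y :=
    h.reg.cx.comp (by fun_prop : Continuous fun y : ℝ => (t, x, y))
  have hcl : y ∈ closure (Ioi (0 : ℝ)) := by rwa [closure_Ioi]
  have hsub : closure (Ioi (0 : ℝ)) ⊆ {y | wyy t x y = wt t x y + wx t x y (U y)} :=
    closure_minimal (fun r hr => h.eq_of_nonneg hU ht x hr)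
      (isClosed_eq c1 (c2.add (c3.clm_apply hU)))
  exact hsub hcl

theorem continuous_timeIntegral {f : ℝ → Tan n → ℝ → ℝ}
    (hf : Continuous fun p : ℝ × Tan n × ℝ => f p.1 p.2.1 p.2.2) (a b : ℝ) :
    Continuous fun p : Tan n × ℝ => ∫ τ in a..b, f τ p.1 p.2 :=
  intervalIntegral.continuous_parametric_intervalIntegral_of_continuous'
    (f := fun (p : Tan n × ℝ) τ => f τ p.1 p.2)
    (hf.comp (by fun_prop : Continuous fun q : (Tan n × ℝ) × ℝ => (q.2, q.1.1, q.1.2))) a b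

theorem normL2_timeIntegral_le {f : ℝ → Tan n → ℝ → ℝ}
    (hf : Continuous fun p : ℝ × Tan n × ℝ => f p.1 p.2.1 p.2.2) {a b : ℝ} (hab : a ≤ b)
    {A : ℝ≥0∞} (hA : ∀ τ, a ≤ τ → τ ≤ b → normL2 (f τ) ≤ A) :
    normL2 (fun x y => ∫ τ in a..b, f τ x y) ≤ ENNReal.ofReal (b - a) * A := by
  have h := eLpNorm_integral_le (ν := volume.restrict (Ioc a b))
    (μ := (volume : Measure (Tan n × ℝ)).restrict (halfSpace n)) (κ := fun _ => (1 : ℝ))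
    (G := fun τ (p : Tan n × ℝ) => f τ p.1 p.2) (N := A) aestronglyMeasurable_const
    (Continuous.aestronglyMeasurable hf) (by
      filter_upwards [ae_restrict_mem measurableSet_Ioc] with τ hτ _ using hA τ hτ.1.le hτ.2)
  simp only [one_smul, enorm_one, lintegral_const, Measure.restrict_apply_univ, Real.volume_Ioc,
    one_mul] at h
  simpa only [normL2, intervalIntegral.integral_of_le hab] using h

theorem normL2_profile_sum_le {b : ℝ → Tan n} (hb : Continuous b) {m : ℝ}
    (hm : ∀ y, 0 < y → ‖b y‖ ≤ m) {f : Fin n → Tan n → ℝ → ℝ} {L : ℝ≥0∞}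
    (hf : ∀ k, Continuous fun p : Tan n × ℝ => f k p.1 p.2) (hL : ∀ k, normL2 (f k) ≤ L) :
    normL2 (fun x y => ∑ k, b y k * f k x y) ≤ n * (ENNReal.ofReal m * L) := by
  refine (normL2_sum_le _ fun k _ => ?_).trans ?_
  · have := hf k
    fun_prop
  · refine (Finset.sum_le_sum (g := fun _ => ENNReal.ofReal m * L) fun k _ => ?_).trans ?_
    · exact (normL2_mul_le (fun y hy => (abs_coord_le _ k).trans (hm y hy)) _).trans
        (mul_le_mul' le_rfl (hL k))
    · simp

/-- The cubic representation with width 1 is integrated in time and the integrals are exchanged;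
this avoids differentiating a time integral in y. -/
theorem Reg.timeIntegral_repr (h : Reg w wt wx wy wyy) (x : Tan n) {y a b : ℝ} (hy : 0 ≤ y) :
    ∫ τ in a..b, w τ x y = ∫ s in (0 : ℝ)..1,
      ((0 + 1 * s + (-(2 / (1 : ℝ))) * s ^ 2 + (1 / (1 : ℝ) ^ 2) * s ^ 3) *
        (∫ τ in a..b, wyy τ x (y + s)) -
      (2 * (-(2 / (1 : ℝ))) + 2 * (3 * (1 / (1 : ℝ) ^ 2)) * s) * ∫ τ in a..b, w τ x (y + s)) := by
  have cw : Continuous fun q : ℝ × ℝ => w q.1 x (y + q.2) :=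
    h.c.comp (by fun_prop : Continuous fun q : ℝ × ℝ => (q.1, x, y + q.2))
  have cwyy : Continuous fun q : ℝ × ℝ => wyy q.1 x (y + q.2) :=
    h.cyy.comp (by fun_prop : Continuous fun q : ℝ × ℝ => (q.1, x, y + q.2))
  have hl : ∀ τ : ℝ, Continuous fun z : ℝ => (τ, x, z) := fun τ => by fun_prop
  rw [intervalIntegral.integral_congr fun τ _ => repr_value (g := w τ x) (g' := wy τ x) (g'' := wyy τ x) hy
    one_pos (h.c.comp (hl τ)) (h.cy.comp (hl τ)) (h.cyy.comp (hl τ)) (h.hy τ x) (h.hyy τ x)]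
  rw [intervalIntegral_intervalIntegral_swap]
  · refine intervalIntegral.integral_congr fun s hs => ?_
    have d1 : Continuous fun τ => w τ x (y + s) :=
      cw.comp (by fun_prop : Continuous fun τ : ℝ => (τ, s))
    have d2 : Continuous fun τ => wyy τ x (y + s) :=
      cwyy.comp (by fun_prop : Continuous fun τ : ℝ => (τ, s))
    rw [intervalIntegral.integral_sub ((d2.const_mul _).intervalIntegrable _ _)
      ((d1.const_mul _).intervalIntegrable _ _), intervalIntegral.integral_const_mul,
      intervalIntegral.integral_const_mul]
  · have hcont : Continuous (Function.uncurry fun τ s : ℝ =>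
        (0 + 1 * s + (-(2 / (1 : ℝ))) * s ^ 2 + (1 / (1 : ℝ) ^ 2) * s ^ 3) * wyy τ x (y + s) -
        (2 * (-(2 / (1 : ℝ))) + 2 * (3 * (1 / (1 : ℝ) ^ 2)) * s) * w τ x (y + s)) := by
      have p1 : Continuous fun p : ℝ × ℝ =>
          0 + 1 * p.2 + (-(2 / (1 : ℝ))) * p.2 ^ 2 + (1 / (1 : ℝ) ^ 2) * p.2 ^ 3 := by fun_prop
      have p2 : Continuous fun p : ℝ × ℝ =>
          2 * (-(2 / (1 : ℝ))) + 2 * (3 * (1 / (1 : ℝ) ^ 2)) * p.2 := by fun_prop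
      exact (p1.mul cwyy).sub (p2.mul cw)
    exact (hcont.continuousOn.integrableOn_compact (isCompact_uIcc.prod isCompact_uIcc)).mono_set
      (prod_mono uIoc_subset_uIcc uIoc_subset_uIcc)

/-- The slice norm of a time integral of a solution, without the time derivative. -/
theorem Sol.sliceNorm_timeIntegral_le (h : Sol U w wt wx wy wyy) (hU : Continuous U)
    (hm : ∀ y, ‖U y‖ ≤ m) {t r : ℝ} (ht : 0 ≤ t) (hr : 0 ≤ r) {A B L : ℝ≥0∞}
    (hA : ∀ τ, 0 ≤ τ → normL2 (w τ) ≤ A)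
    (hB : normL2 (fun x y => w (t + r) x y - w t x y) ≤ B)
    (hL : ∀ τ, 0 ≤ τ → ∀ k, normL2 (fun x y => wx τ x y (ev k)) ≤ L) {y : ℝ} (hy : 0 ≤ y) :
    sliceNorm (fun x y => ∫ τ in t..t + r, w τ x y) y ≤
      2 * ((B + n * (ENNReal.ofReal m * (ENNReal.ofReal r * L))) + 4 * (ENNReal.ofReal r * A)) := by
  have htr : t ≤ t + r := by linarith
  have cg := continuous_timeIntegral h.reg.c t (t + r)
  have hcx := h.reg.cx
  have cxk : ∀ k : Fin n, Continuous fun p : ℝ × Tan n × ℝ => wx p.1 p.2.1 p.2.2 (ev k) := by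
    intro k
    fun_prop
  have cgx : ∀ k : Fin n, Continuous fun p : Tan n × ℝ => ∫ τ in t..t + r, wx τ p.1 p.2 (ev k) :=
    fun k => continuous_timeIntegral (f := fun τ x y => wx τ x y (ev k)) (cxk k) t (t + r)
  have hc0 := h.reg.continuous_at_time
  have cs : Continuous fun p : Tan n × ℝ =>
      ∑ k, U p.2 k * ∫ τ in t..t + r, wx τ p.1 p.2 (ev k) :=
    continuous_finsetSum _ fun k _ => by
      have := cgx k
      fun_prop
  -- The time integral of ∂_y² w as the equation gives it: ∂_t w integrates to an increment, so no
  -- bound on ∂_t w is needed.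
  set kk : Tan n → ℝ → ℝ := fun x y => (w (t + r) x y - w t x y) +
    ∑ k, U y k * ∫ τ in t..t + r, wx τ x y (ev k) with hkk
  have ck : Continuous fun p : Tan n × ℝ => kk p.1 p.2 := ((hc0 _).sub (hc0 _)).add cs
  have hkint : ∀ x y, 0 ≤ y → ∫ τ in t..t + r, wyy τ x y = kk x y := by
    intro x y hy
    have hline : Continuous fun τ : ℝ => (τ, x, y) := by fun_prop
    have i1 : Continuous fun τ => wt τ x y := h.reg.ct.comp hline
    have i2 : ∀ k, Continuous fun τ => wx τ x y (ev k) := fun k => (cxk k).comp hline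
    rw [intervalIntegral.integral_congr (g := fun τ => wt τ x y + ∑ k, U y k * wx τ x y (ev k))]
    · rw [intervalIntegral.integral_add (i1.intervalIntegrable _ _)
        (Continuous.intervalIntegrable (by fun_prop) _ _), ← h.reg.sub_eq_integral ht htr,
        intervalIntegral.integral_finsetSum fun k _ =>
          ((i2 k).const_mul _).intervalIntegrable _ _]
      simp only [intervalIntegral.integral_const_mul, hkk]
    · intro τ hτ
      rw [uIcc_of_le htr] at hτ
      show wyy τ x y = _
      rw [h.eq_closure hU (ht.trans hτ.1) x hy, clm_apply_eq_sum]
  have key := sliceNorm_le_of_repr (G := fun x => ∫ τ in t..t + r, w τ x y)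
    (g := fun x y => ∫ τ in t..t + r, w τ x y) (k := kk) hy zero_le_one zero_le_one
    (by norm_num : (0 : ℝ) ≤ 4 / 1) cg ck
    (ψ := fun s : ℝ => 0 + 1 * s + (-(2 / (1 : ℝ))) * s ^ 2 + (1 / (1 : ℝ) ^ 2) * s ^ 3)
    (χ := fun s : ℝ => 2 * (-(2 / (1 : ℝ))) + 2 * (3 * (1 / (1 : ℝ) ^ 2)) * s)
    (by fun_prop) (by fun_prop) (fun s hs => (weight_value_le one_pos hs).1)
    (fun s hs => (weight_value_le one_pos hs).2) (fun x => by
      rw [h.reg.timeIntegral_repr x hy]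
      refine intervalIntegral.integral_congr fun s hs => ?_
      rw [uIcc_of_le zero_le_one] at hs
      rw [hkint x (y + s) (by linarith [hs.1])])
  refine le_trans key ?_
  refine mul_le_mul' sqrt_two_le (add_le_add ?_ ?_)
  · rw [ENNReal.ofReal_one, one_mul]
    refine (normL2_add_le ((hc0 _).sub (hc0 _)) cs).trans (add_le_add hB ?_)
    refine normL2_profile_sum_le hU (fun y _ => hm y) cgx fun k => ?_
    refine (normL2_timeIntegral_le (f := fun τ x y => wx τ x y (ev k)) (cxk k) htr
      fun τ h1 _ => hL τ (ht.trans h1) k).trans (le_of_eq ?_)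
    rw [add_sub_cancel_left]
  · refine mul_le_mul' (by simp) ?_
    refine (normL2_timeIntegral_le h.reg.c htr fun τ h1 _ => hA τ (ht.trans h1)).trans (le_of_eq ?_)
    rw [add_sub_cancel_left]

/-- The expression is a double average of `wt` over times between t and t + 2r; continuity of `wt`
suffices, also at t = 0. -/
theorem Reg.tendsto_secondQuotient (h : Reg w wt wx wy wyy) {t : ℝ} (ht : 0 ≤ t) (x : Tan n)
    (y : ℝ) : Filter.Tendsto (fun k => (1 / scale k ^ 2) *
      ∫ τ in t..t + scale k, (w (τ + scale k) x y - w τ x y)) Filter.atTop (nhds (wt t x y)) := by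
  have hline : Continuous fun τ : ℝ => (τ, x, y) := by fun_prop
  have cw : Continuous fun τ => w τ x y := h.c.comp hline
  have ct : Continuous fun τ => wt τ x y := h.ct.comp hline
  rw [Metric.tendsto_atTop]
  intro ε hε
  obtain ⟨d, hd, hball⟩ := Metric.continuousAt_iff.1 (ct.continuousAt (x := t)) (ε / 2) (half_pos hε)
  have he : ∀ᶠ k in Filter.atTop, 2 * scale k < d := by
    have : Filter.Tendsto (fun k => 2 * scale k) Filter.atTop (nhds (2 * 0)) :=
      tendsto_scale.const_mul 2
    exact this.eventually_lt_const (by simpa using hd)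
  obtain ⟨N, hN⟩ := Filter.eventually_atTop.1 he
  refine ⟨N, fun k hk => ?_⟩
  have hr := scale_pos k
  have hr2 := hN k hk
  set r := scale k
  have hin : ∀ τ ∈ uIoc t (t + r), ‖w (τ + r) x y - w τ x y - r * wt t x y‖ ≤ ε / 2 * r := by
    intro τ hτ
    rw [uIoc_of_le (by linarith)] at hτ
    have hle : τ ≤ τ + r := by linarith
    rw [h.sub_eq_integral (ht.trans hτ.1.le) hle]
    have e : ∫ σ in τ..τ + r, wt σ x y - wt t x y = (∫ σ in τ..τ + r, wt σ x y) - r * wt t x y := by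
      rw [intervalIntegral.integral_sub (ct.intervalIntegrable _ _) intervalIntegrable_const,
        intervalIntegral.integral_const, add_sub_cancel_left, smul_eq_mul]
    rw [← e]
    have := intervalIntegral.norm_integral_le_of_norm_le_const (a := τ) (b := τ + r) (C := ε / 2)
      (f := fun σ => wt σ x y - wt t x y) fun σ hσ => by
        rw [uIoc_of_le hle] at hσ
        rw [← dist_eq_norm]
        refine (hball ?_).le
        rw [Real.dist_eq, abs_lt]
        constructor <;> linarith [hσ.1, hσ.2, hτ.1, hτ.2]
    simpa [abs_of_pos hr] using this
  have h2 := intervalIntegral.norm_integral_le_of_norm_le_const hin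
  rw [intervalIntegral.integral_sub (Continuous.intervalIntegrable (by fun_prop) _ _)
    intervalIntegrable_const, intervalIntegral.integral_const, add_sub_cancel_left, smul_eq_mul,
    abs_of_pos hr] at h2
  rw [Real.dist_eq]
  rw [Real.norm_eq_abs] at h2
  have e3 : 1 / r ^ 2 * (∫ τ in t..t + r, (w (τ + r) x y - w τ x y)) - wt t x y =
      ((∫ τ in t..t + r, (w (τ + r) x y - w τ x y)) - r * (r * wt t x y)) / r ^ 2 := by
    field_simp
  rw [e3, abs_div, abs_of_pos (by positivity : (0 : ℝ) < r ^ 2), div_lt_iff₀ (by positivity)]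
  nlinarith [pow_pos hr 2]

/-- The slice norm of the time derivative. -/
theorem Sol.sliceNorm_wt_le (h : Sol U w wt wx wy wyy) (hU : Continuous U)
    (hm : ∀ y, ‖U y‖ ≤ m) {K c L : ℝ≥0∞} (hc : c < ⊤)
    (hwy : ∀ t, 0 ≤ t → sliceNorm (wy t) 0 ≤ c)
    (happ : RateApprox U (initialRate U (wx 0) (wyy 0)) K c)
    (hL : ∀ k, ∀ r : ℝ, 0 ≤ r → normL2 (fun x y => initialRate U (wx 0) (wyy 0) (x + r • ev k) y -
      initialRate U (wx 0) (wyy 0) x y) ≤ ENNReal.ofReal r * L) {t y : ℝ} (ht : 0 ≤ t) (hy : 0 ≤ y) :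
    sliceNorm (wt t) y ≤ 2 * ((18 * K + n * (ENNReal.ofReal m * (3 * L))) +
      4 * (3 * normL2 (initialRate U (wx 0) (wyy 0)))) := by
  refine eLpNorm_le_of_tendsto (f := fun k x => (1 / scale k ^ 2) *
      ∫ τ in t..t + scale k, (w (τ + scale k) x y - w τ x y)) ?_ ?_ ?_
  · intro k
    have hz := (h.shiftTime (scale_pos k).le).sub h
    have := continuous_at_height (g := fun x y =>
      ∫ τ in t..t + scale k, (w (τ + scale k) x y - w τ x y))
      (continuous_timeIntegral (f := fun τ x y => w (τ + scale k) x y - w τ x y) hz.reg.c t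
        (t + scale k)) y
    exact (this.const_mul _).aestronglyMeasurable
  · exact Filter.Eventually.of_forall fun x => h.reg.tendsto_secondQuotient ht x y
  · intro k
    have hr := scale_pos k
    set r := scale k
    have hz := (h.shiftTime hr.le).sub h
    -- For z = w(· + r) - w, the increment of z, the integral of z and that of ∇z are all of order
    -- r², which cancels the prefactor 1/r². Without the time average one would need ∂_t z in L².
    have h1 := hz.sliceNorm_timeIntegral_le hU hm ht hr.le
      (fun τ hτ => h.timeIncrement hU hm hτ hr.le)
      (h.normL2_secondDifference_le hU hm hc hwy happ ht hr)
      (fun τ hτ k => h.normL2_dir_timeIncrement_le hU hm (hL k) hτ hr.le) hy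
    have h2 := sliceNorm_const_mul (1 / r ^ 2)
      (fun x y => ∫ τ in t..t + r, (w (τ + r) x y - w τ x y)) y
    refine h2.le.trans ((mul_le_mul' le_rfl h1).trans (le_of_eq ?_))
    rw [Real.enorm_eq_ofReal (by positivity)]
    have e1 : ∀ a : ℝ, 0 ≤ a → ENNReal.ofReal (a * r ^ 2) = ENNReal.ofReal (r ^ 2) * ENNReal.ofReal a :=
      fun a _ => by rw [mul_comm, ENNReal.ofReal_mul (by positivity)]
    have e2 : ∀ X : ℝ≥0∞, ENNReal.ofReal r * (ENNReal.ofReal (3 * r) * X) =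
        ENNReal.ofReal (r ^ 2) * (3 * X) := fun X => by
      rw [← mul_assoc, ← ENNReal.ofReal_mul hr.le, show r * (3 * r) = r ^ 2 * 3 by ring,
        ENNReal.ofReal_mul (by positivity), mul_assoc]
      simp
    rw [e1 18 (by norm_num), e2, e2]
    have e3 : ∀ X Y Z : ℝ≥0∞, 2 * (ENNReal.ofReal (r ^ 2) * ENNReal.ofReal 18 * X +
        n * (ENNReal.ofReal m * (ENNReal.ofReal (r ^ 2) * Y)) + 4 * (ENNReal.ofReal (r ^ 2) * Z)) =
        ENNReal.ofReal (r ^ 2) * (2 * (18 * X + n * (ENNReal.ofReal m * Y) + 4 * Z)) := fun X Y Z => by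
      rw [show ENNReal.ofReal 18 = 18 by simp]
      ring
    rw [e3, ← mul_assoc, ← ENNReal.ofReal_mul (by positivity), one_div,
      inv_mul_cancel₀ (by positivity), ENNReal.ofReal_one, one_mul]

/-- The slice norm of a tangential derivative. -/
theorem Sol.sliceNorm_dir_le (h : Sol U w wt wx wy wyy) (hU : Continuous U)
    (hm : ∀ y, ‖U y‖ ≤ m) {v : Tan n} {N : ℝ≥0∞}
    (h0 : ∀ r : ℝ, 0 ≤ r → normL2 (fun x y => w 0 (x + r • v) y - w 0 x y) ≤ ENNReal.ofReal r * N)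
    (h2 : ∀ r : ℝ, 0 ≤ r →
      normL2 (fun x y => wyy 0 (x + r • v) y - wyy 0 x y) ≤ ENNReal.ofReal r * N)
    (h1 : ∀ r : ℝ, 0 ≤ r → ∀ k, normL2 (fun x y => wx 0 (x + r • v) y (ev k) - wx 0 x y (ev k)) ≤
      ENNReal.ofReal r * N) {t y : ℝ} (ht : 0 ≤ t) (hy : 0 ≤ y) :
    sliceNorm (fun x y => wx t x y v) y ≤ 8 * (4 + 4 * ENNReal.ofReal m * n) * N := by
  refine eLpNorm_le_of_tendsto (f := fun (k : ℕ) x =>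
      ((k : ℝ) + 1) * (w t (x + (1 / ((k : ℝ) + 1)) • v) y - w t x y)) ?_ ?_ ?_
  · intro k
    have hc := ((h.reg.shiftSpace ((1 / ((k : ℝ) + 1)) • v)).sub h.reg).continuous_at_time t
    exact ((continuous_at_height
      (g := fun x y => w t (x + (1 / ((k : ℝ) + 1)) • v) y - w t x y) hc y).const_mul
      _).aestronglyMeasurable
  · exact Filter.Eventually.of_forall fun x => tendsto_xQuotient (h.reg.hx t x y) v
  · intro k
    have hk : (0 : ℝ) < (k : ℝ) + 1 := by positivity
    have hr : (0 : ℝ) < 1 / ((k : ℝ) + 1) := by positivity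
    have hkr : ((k : ℝ) + 1) * (1 / ((k : ℝ) + 1)) = 1 := by field_simp
    generalize 1 / ((k : ℝ) + 1) = r at hr hkr
    -- The slice bound is applied to a tangential increment; its initial norms are all of order r.
    have hs := (((h.shiftSpace (r • v)).sub h).slice_le hU hm ht hy).1
    have e1 := sliceNorm_const_mul ((k : ℝ) + 1) (fun x y => w t (x + r • v) y - w t x y) y
    refine e1.le.trans ((mul_le_mul' le_rfl hs).trans ?_)
    rw [Real.enorm_eq_ofReal hk.le]
    have hg : gradSum (fun x y => wx 0 (x + r • v) y - wx 0 x y) ≤ n * (ENNReal.ofReal r * N) := by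
      unfold gradSum
      refine (Finset.sum_le_sum (g := fun _ => ENNReal.ofReal r * N) fun k _ => ?_).trans (by simp)
      simpa only [sub_apply] using h1 r hr.le k
    calc _ ≤ ENNReal.ofReal ((k : ℝ) + 1) * (8 * (ENNReal.ofReal r * N +
          (3 * (ENNReal.ofReal r * N) + 4 * ENNReal.ofReal m * (n * (ENNReal.ofReal r * N))))) := by
          gcongr
          · exact h0 r hr.le
          · exact h2 r hr.le
      _ = (ENNReal.ofReal ((k : ℝ) + 1) * ENNReal.ofReal r) *
          (8 * (4 + 4 * ENNReal.ofReal m * n) * N) := by ring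
      _ = _ := by rw [← ENNReal.ofReal_mul hk.le, hkr, ENNReal.ofReal_one, one_mul]

theorem Sol.sliceNorm_wyy_le (h : Sol U w wt wx wy wyy) (hU : Continuous U)
    (hm : ∀ y, ‖U y‖ ≤ m) {t y : ℝ} (ht : 0 ≤ t) (hy : 0 ≤ y) {A N : ℝ≥0∞}
    (hA : sliceNorm (wt t) y ≤ A) (hN : ∀ k, sliceNorm (fun x y => wx t x y (ev k)) y ≤ N) :
    sliceNorm (wyy t) y ≤ A + n * (ENNReal.ofReal m * N) := by
  have c1 := continuous_at_height (continuous_slice h.reg.ct t) y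
  have c2 := fun k : Fin n => continuous_at_height (g := fun x y => wx t x y (ev k))
    ((continuous_slice h.reg.cx t).clm_apply (continuous_const (y := ev k))) y
  have e : (fun x => wyy t x y) = (fun x => wt t x y) +
      ∑ k : Fin n, (U y k) • fun x => wx t x y (ev k) := by
    funext x
    rw [h.eq_closure hU ht x hy, clm_apply_eq_sum]
    simp
  unfold sliceNorm at hA hN ⊢
  rw [e]
  refine (eLpNorm_add_le c1.aestronglyMeasurable (Finset.aestronglyMeasurable_sum _ fun k _ =>
    (c2 k).aestronglyMeasurable.const_smul _) (by norm_num)).trans (add_le_add hA ?_)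
  refine (eLpNorm_sum_le (fun k _ => (c2 k).aestronglyMeasurable.const_smul _)
    (by norm_num)).trans ?_
  refine (Finset.sum_le_sum (g := fun _ => ENNReal.ofReal m * N) fun k _ => ?_).trans (by simp)
  rw [eLpNorm_const_smul]
  refine mul_le_mul' ?_ (hN k)
  rw [← ofReal_norm]
  exact ENNReal.ofReal_le_ofReal ((abs_coord_le _ k).trans (hm y))

end

/-! ### Construction of the approximations to the initial rate. -/

section

variable {n : ℕ}

/-! ### Smooth approximation of the initial rate of change -/

theorem Static.sub {g gy gyy g' gy' gyy' : Tan n → ℝ → ℝ} {gx gx' : Tan n → ℝ → (Tan n →L[ℝ] ℝ)}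
    (h : Static g gx gy gyy) (h' : Static g' gx' gy' gyy') :
    Static (fun x y => g x y - g' x y) (fun x y => gx x y - gx' x y)
      (fun x y => gy x y - gy' x y) (fun x y => gyy x y - gyy' x y) where
  c := h.c.sub h'.c
  cx := h.cx.sub h'.cx
  cy := h.cy.sub h'.cy
  cyy := h.cyy.sub h'.cyy
  hx x y := (h.hx x y).sub (h'.hx x y)
  hy x y hy := (h.hy x y hy).sub (h'.hy x y hy)
  hyy x y hy := (h.hyy x y hy).sub (h'.hyy x y hy)

theorem Static.sum {ι : Type*} (s : Finset ι) {g gy gyy : ι → Tan n → ℝ → ℝ}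
    {gx : ι → Tan n → ℝ → (Tan n →L[ℝ] ℝ)} (h : ∀ i ∈ s, Static (g i) (gx i) (gy i) (gyy i)) :
    Static (fun x y => ∑ i ∈ s, g i x y) (fun x y => ∑ i ∈ s, gx i x y)
      (fun x y => ∑ i ∈ s, gy i x y) (fun x y => ∑ i ∈ s, gyy i x y) where
  c := continuous_finsetSum _ fun i hi => (h i hi).c
  cx := continuous_finsetSum _ fun i hi => (h i hi).cx
  cy := continuous_finsetSum _ fun i hi => (h i hi).cy
  cyy := continuous_finsetSum _ fun i hi => (h i hi).cyy
  hx x y := HasFDerivAt.fun_sum fun i hi => (h i hi).hx x y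
  hy x y hy := HasDerivAt.fun_sum fun i hi => (h i hi).hy x y hy
  hyy x y hy := HasDerivAt.fun_sum fun i hi => (h i hi).hyy x y hy

theorem Static.profile_mul {g gy gyy : Tan n → ℝ → ℝ} {gx : Tan n → ℝ → (Tan n →L[ℝ] ℝ)}
    (h : Static g gx gy gyy) {b b' b'' : ℝ → ℝ} (cb : Continuous b) (cb' : Continuous b')
    (cb'' : Continuous b'') (hb : ∀ y, HasDerivAt b (b' y) y) (hb' : ∀ y, HasDerivAt b' (b'' y) y) :
    Static (fun x y => b y * g x y) (fun x y => b y • gx x y)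
      (fun x y => b' y * g x y + b y * gy x y)
      (fun x y => b'' y * g x y + b' y * gy x y + (b' y * gy x y + b y * gyy x y)) where
  c := (cb.comp continuous_snd).mul h.c
  cx := (cb.comp continuous_snd).smul h.cx
  cy := ((cb'.comp continuous_snd).mul h.c).add ((cb.comp continuous_snd).mul h.cy)
  cyy := (((cb''.comp continuous_snd).mul h.c).add ((cb'.comp continuous_snd).mul h.cy)).add
    (((cb'.comp continuous_snd).mul h.cy).add ((cb.comp continuous_snd).mul h.cyy))
  hx x y := (h.hx x y).const_mul (b y)
  hy x y hy := (hb y).mul (h.hy x y hy)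
  hyy x y hy := ((hb' y).mul (h.hy x y hy)).add ((hb y).mul (h.hyy x y hy))

theorem static_of_contDiff {φ : Tan n × ℝ → ℝ} (hφ : ContDiff ℝ ∞ φ) :
    Static (fun x y => φ (x, y))
      (fun x y => (fderiv ℝ φ (x, y)).comp (ContinuousLinearMap.inl ℝ (Tan n) ℝ))
      (fun x y => dirD (0, 1) φ (x, y)) (fun x y => dirD (0, 1) (dirD (0, 1) φ) (x, y)) := by
  have hy : ∀ ψ : Tan n × ℝ → ℝ, ContDiff ℝ ∞ ψ → ∀ (x : Tan n) (y : ℝ),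
      HasDerivAt (fun z => ψ (x, z)) (dirD (0, 1) ψ (x, y)) y := by
    intro ψ hψ x y
    have h1 : HasDerivAt (fun z : ℝ => (x, z)) ((0 : Tan n), (1 : ℝ)) y :=
      (hasDerivAt_const y x).prodMk (hasDerivAt_id y)
    exact (((hψ.differentiable (by simp)) (x, y)).hasFDerivAt).comp_hasDerivAt y h1
  have h1 := contDiff_dirD hφ (0, 1)
  have h2 := contDiff_dirD h1 (0, 1)
  refine ⟨hφ.continuous, ?_, h1.continuous, h2.continuous, ?_, fun x y _ => hy φ hφ x y,
    fun x y _ => hy _ h1 x y⟩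
  · exact (hφ.continuous_fderiv (by simp)).clm_comp continuous_const
  · intro x y
    have h3 := ((hφ.differentiable (by simp)) (x, y)).hasFDerivAt
    exact h3.comp x (hasFDerivAt_prodMk_left x y)

/-- The boundary values of approximations of a function that vanishes on the boundary. -/
theorem sliceNorm_zero_le_of_approx {f : Tan n → ℝ → ℝ} {F Fy Fyy : ℕ → Tan n → ℝ → ℝ}
    {Fx : ℕ → Tan n → ℝ → (Tan n →L[ℝ] ℝ)} {a : ℕ → ℝ≥0∞} {K : ℝ≥0∞}
    (hf : Continuous fun p : Tan n × ℝ => f p.1 p.2)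
    (hF : ∀ k, Static (F k) (Fx k) (Fy k) (Fyy k)) (hK : ∀ k, normL2 (Fyy k) ≤ K)
    (ha : ∀ k, normL2 (fun x y => f x y - F k x y) ≤ a k)
    (hat : Filter.Tendsto a Filter.atTop (nhds 0))
    (h0 : ∀ x, Filter.Tendsto (fun k => F k x 0) Filter.atTop (nhds 0)) (k : ℕ) {l : ℝ}
    (hl : 0 < l) :
    sliceNorm (F k) 0 ≤ ENNReal.ofReal (Real.sqrt (2 * l)) *
      (ENNReal.ofReal l * (K + K) + ENNReal.ofReal (4 / l) * a k) := by
  -- The limit f cannot enter the interpolation, since it lacks normal derivatives. Two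
  -- approximations are compared instead, and the second tends to zero on the boundary.
  have hj : ∀ j, sliceNorm (fun x y => F k x y - F j x y) 0 ≤ ENNReal.ofReal (Real.sqrt (2 * l)) *
      (ENNReal.ofReal l * (K + K) + ENNReal.ofReal (4 / l) * (a k + a j)) := by
    intro j
    have hs := (hF k).sub (hF j)
    refine (sliceNorm_le hs.c hs.cy hs.cyy hs.hy hs.hyy le_rfl hl).trans ?_
    gcongr
    · exact (normL2_sub_le (hF k).cyy (hF j).cyy).trans (add_le_add (hK k) (hK j))
    · have e : (fun x y => F k x y - F j x y) =
          fun x y => (f x y - F j x y) - (f x y - F k x y) := by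
        funext x y; ring
      rw [e, add_comm]
      exact (normL2_sub_le (hf.sub (hF j).c) (hf.sub (hF k).c)).trans (add_le_add (ha j) (ha k))
  have hbt : Filter.Tendsto (fun j => ENNReal.ofReal (Real.sqrt (2 * l)) *
      (ENNReal.ofReal l * (K + K) + ENNReal.ofReal (4 / l) * (a k + a j))) Filter.atTop
      (nhds (ENNReal.ofReal (Real.sqrt (2 * l)) *
      (ENNReal.ofReal l * (K + K) + ENNReal.ofReal (4 / l) * (a k + 0)))) := by
    have h1 := ENNReal.Tendsto.const_mul (hat.const_add (a k))
      (Or.inr (ENNReal.ofReal_ne_top (r := 4 / l)))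
    exact ENNReal.Tendsto.const_mul (h1.const_add _) (Or.inr ENNReal.ofReal_ne_top)
  rw [add_zero] at hbt
  refine eLpNorm_le_of_tendsto' (f := fun j x => F k x 0 - F j x 0) ?_ ?_ hj hbt
  · intro j
    exact ((continuous_at_height (hF k).c 0).sub
      (continuous_at_height (hF j).c 0)).aestronglyMeasurable
  · exact Filter.Eventually.of_forall fun x => by simpa using (h0 x).const_sub (F k x 0)

section Approx

variable {θ₀ g gy gyy : Tan n → ℝ → ℝ} {gx : Tan n → ℝ → (Tan n →L[ℝ] ℝ)}
  {K : ℕ → Tan n × ℝ → ℝ} {κ : ℕ → ℝ → ℝ} {U W : ℝ → Tan n}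

/-- The derivative `∂_{x'}^α ∂_y^i` of the mollified datum. -/
abbrev mollDeriv (K : Tan n × ℝ → ℝ) (g : Tan n → ℝ → ℝ) (α : Fin n → ℕ) (i : ℕ) :
    Tan n × ℝ → ℝ := testDeriv α i (conv K fun p => g p.1 p.2)

/-- The mollified initial rate of change. -/
def rate (K : Tan n × ℝ → ℝ) (κ : ℝ → ℝ) (g : Tan n → ℝ → ℝ) (W : ℝ → Tan n) (x : Tan n) (y : ℝ) :
    ℝ := mollDeriv K g 0 2 (x, y) -
      ∑ j, profile κ W 0 y j * mollDeriv K g (Pi.single j 1) 0 (x, y)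

theorem hasDerivAt_coord {b : ℝ → Tan n} {b' : Tan n} {y : ℝ} (h : HasDerivAt b b' y) (j : Fin n) :
    HasDerivAt (fun y => b y j) (b' j) y := by
  have := (EuclideanSpace.proj (𝕜 := ℝ) j).hasFDerivAt.comp_hasDerivAt y h
  simpa [Function.comp_def] using this

/-- The derivatives are given explicitly as products of a profile derivative of order at most 2 with
a mollified derivative of the datum, each bounded by a weak norm uniformly in the scale. -/
theorem exists_static_rate {K : Tan n × ℝ → ℝ} {κ : ℝ → ℝ} {δ : ℝ} (hK : IsKernel δ K)
    (hκ : IsKernel₁ δ κ) (h : Datum θ₀ g gx gy gyy) (hW : Continuous W) :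
    ∃ (Fx : Tan n → ℝ → (Tan n →L[ℝ] ℝ)) (Fy Fyy : Tan n → ℝ → ℝ),
      Static (rate K κ g W) Fx Fy Fyy ∧
      (∀ x y l, Fx x y (ev l) = mollDeriv K g (0 + Pi.single l 1) 2 (x, y) -
        ∑ j, profile κ W 0 y j * mollDeriv K g (Pi.single j 1 + Pi.single l 1) 0 (x, y)) ∧
      ∀ x y, Fyy x y = mollDeriv K g 0 4 (x, y) - (∑ j, profile κ W 2 y j *
        mollDeriv K g (Pi.single j 1) 0 (x, y) + ∑ j, profile κ W 1 y j *
        mollDeriv K g (Pi.single j 1) 1 (x, y) + (∑ j, profile κ W 1 y j *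
        mollDeriv K g (Pi.single j 1) 1 (x, y) + ∑ j, profile κ W 0 y j *
        mollDeriv K g (Pi.single j 1) 2 (x, y))) := by
  have hs := h.smooth hK
  have hP : ∀ i, Continuous (profile κ W i) := hκ.continuous_profile hW
  have hc : ∀ i (j : Fin n), Continuous fun y => profile κ W i y j := fun i j => by
    have := hP i
    fun_prop
  have hd : ∀ i (j : Fin n) y, HasDerivAt (fun y => profile κ W i y j) (profile κ W (i + 1) y j) y :=
    fun i j y => hasDerivAt_coord (hκ.hasDerivAt_profile hW i y) j
  have h1 := static_of_contDiff (contDiff_testDeriv hs 0 2)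
  have h2 := fun j : Fin n => (static_of_contDiff
    (contDiff_testDeriv hs (Pi.single j 1) 0)).profile_mul (hc 0 j) (hc 1 j) (hc 2 j)
    (hd 0 j) (hd 1 j)
  refine ⟨_, _, _, h1.sub (Static.sum Finset.univ fun j _ => h2 j), ?_, ?_⟩
  · intro x y l
    have e : ∀ φ : Tan n × ℝ → ℝ, ((fderiv ℝ φ (x, y)).comp
        (ContinuousLinearMap.inl ℝ (Tan n) ℝ)) (ev l) = dirD (ev l, 0) φ (x, y) := fun φ => rfl
    simp only [sub_apply, sum_apply, smul_apply, e, smul_eq_mul,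
      mollDeriv, testDeriv_add_single hs]
  · intro x y
    simp only [mollDeriv, testDeriv_succ hs, Finset.sum_add_distrib]

/-- All the weak derivatives used by the second order estimate are bounded by `H`. -/
structure WeakBound (θ₀ : Tan n → ℝ → ℝ) (H : ℝ≥0∞) : Prop where
  zero : ∀ i, i ≤ 4 → weakPartialNorm 0 i θ₀ ≤ H
  single : ∀ j i, i ≤ 2 → weakPartialNorm (Pi.single j 1) i θ₀ ≤ H
  double : ∀ j l, weakPartialNorm (Pi.single j 1 + Pi.single l 1) 0 θ₀ ≤ H

theorem weakBound_normH (θ₀ : Tan n → ℝ → ℝ) :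
    WeakBound θ₀ (normH 2 0 θ₀ + normH 1 2 θ₀ + normH 0 4 θ₀) where
  zero i hi := (weakPartialNorm_le_normH (by simp) hi).trans le_add_self
  single j i hi := (weakPartialNorm_le_normH (by simp) hi).trans (le_add_self.trans le_self_add)
  double j l := (weakPartialNorm_le_normH (by simp [Finset.sum_add_distrib]) le_rfl).trans
    (le_self_add.trans le_self_add)

/-- Datum and profile are mollified at the same scale. Applying ∂_y² - U·∇ to the mollified rate
involves exactly the weak derivatives in `WeakBound`, with U, U', U'' as coefficients. The rate
itself needs one derivative less, which leaves room for a linear rate of convergence. Since the true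
rate vanishes on the boundary, interpolation makes the approximate boundary values small. -/
theorem Datum.rateApprox (h : Datum θ₀ g gx gy gyy) (hW : Continuous W)
    (hWU : ∀ y, 0 < y → W y = U y) (hfin : normW2inf U < ⊤) {m : ℝ}
    (hm : (normW2inf U).toReal ≤ m) (hWm : ∀ y, ‖W y‖ ≤ m)
    {H : ℝ≥0∞} (hH : WeakBound θ₀ H) (hHfin : H < ⊤)
    (hbd : ∀ x, initialRate W gx gyy x 0 = 0) {c : ℝ≥0∞}
    (hc : 12 * ((H + n * (ENNReal.ofReal m * H)) + (H + 4 * (n * (ENNReal.ofReal m * H)))) ≤ c) :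
    RateApprox W (initialRate W gx gyy) ((H + 4 * (n * (ENNReal.ofReal m * H))) +
      n * (ENNReal.ofReal m * (H + n * (ENNReal.ofReal m * H)))) c := by
  obtain ⟨K, hK⟩ := exists_kernels n
  obtain ⟨κ, hκ⟩ := exists_kernels₁
  set P : ℝ≥0∞ := n * (ENNReal.ofReal m * H) with hP
  have hPfin : P < ⊤ :=
    ENNReal.mul_lt_top (by simp) (ENNReal.mul_lt_top ENNReal.ofReal_lt_top hHfin)
  have hcT : ∀ k α i, Continuous (mollDeriv (K k) g α i) :=
    fun k α i => (contDiff_testDeriv (h.smooth (hK k)) α i).continuous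
  have hT : ∀ k α i, nrm (mollDeriv (K k) g α i) ≤ weakPartialNorm α i θ₀ :=
    fun k α i => h.nrm_testDeriv_le (hK k) α i
  have hprof : ∀ k i, i < 3 → ∀ y, 0 < y → ‖profile (κ k) W i y‖ ≤ m :=
    fun k i hi y hy => ((hκ k).norm_profile_le hWU hfin hi hy.le).trans hm
  have hcP : ∀ k i, Continuous (profile (κ k) W i) := fun k i => (hκ k).continuous_profile hW i
  have hsum : ∀ k i, i < 3 → ∀ (α : Fin n → Fin n → ℕ) (s : ℕ),
      (∀ j, weakPartialNorm (α j) s θ₀ ≤ H) →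
      normL2 (fun x y => ∑ j, profile (κ k) W i y j * mollDeriv (K k) g (α j) s (x, y)) ≤ P :=
    fun k i hi α s hα => normL2_profile_sum_le (hcP k i) (hprof k i hi) (fun j => hcT k _ _)
      fun j => (hT k _ _).trans (hα j)
  have hcsum : ∀ k i (α : Fin n → Fin n → ℕ) (s : ℕ), Continuous fun p : Tan n × ℝ =>
      ∑ j, profile (κ k) W i p.2 j * mollDeriv (K k) g (α j) s (p.1, p.2) := by
    intro k i α s
    refine continuous_finsetSum _ fun j _ => ?_
    have h1 := hcP k i
    have h2 := hcT k (α j) s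
    fun_prop
  choose Fx Fy Fyy hstat hFx hFyy using fun k => exists_static_rate (hK k) (hκ k) h hW
  have hF : ∀ k, normL2 (rate (K k) (κ k) g W) ≤ H + P := fun k =>
    (normL2_sub_le (hcT k 0 2) (hcsum k 0 _ 0)).trans (add_le_add
      ((hT k 0 2).trans (hH.zero 2 (by norm_num)))
      (hsum k 0 (by norm_num) _ 0 fun j => hH.single j 0 (by norm_num)))
  have hFyyb : ∀ k, normL2 (Fyy k) ≤ H + 4 * P := by
    intro k
    rw [funext fun x => funext fun y => hFyy k x y]
    refine (normL2_sub_le (hcT k 0 4) (((hcsum k 2 _ 0).add (hcsum k 1 _ 1)).add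
      ((hcsum k 1 _ 1).add (hcsum k 0 _ 2)))).trans (add_le_add
      ((hT k 0 4).trans (hH.zero 4 le_rfl)) ?_)
    have s1 := hsum k 2 (by norm_num) (fun j => Pi.single j 1) 0 fun j => hH.single j 0 (by norm_num)
    have s2 := hsum k 1 (by norm_num) (fun j => Pi.single j 1) 1 fun j => hH.single j 1 (by norm_num)
    have s3 := hsum k 0 (by norm_num) (fun j => Pi.single j 1) 2 fun j => hH.single j 2 le_rfl
    refine (normL2_add_le ((hcsum k 2 _ 0).add (hcsum k 1 _ 1))
      ((hcsum k 1 _ 1).add (hcsum k 0 _ 2))).trans ((add_le_add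
      ((normL2_add_le (hcsum k 2 _ 0) (hcsum k 1 _ 1)).trans (add_le_add s1 s2))
      ((normL2_add_le (hcsum k 1 _ 1) (hcsum k 0 _ 2)).trans (add_le_add s2 s3))).trans
      (le_of_eq ?_))
    ring
  have hFxb : ∀ k, normL2 (fun x y => Fx k x y (W y)) ≤ n * (ENNReal.ofReal m * (H + P)) := by
    intro k
    have hFxc := (hstat k).cx
    have e : (fun x y => Fx k x y (W y)) = fun x y => ∑ l, W y l * Fx k x y (ev l) := by
      funext x y
      exact clm_apply_eq_sum _ _
    rw [e]
    refine normL2_profile_sum_le hW (fun y _ => hWm y) (fun l => by fun_prop) fun l => ?_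
    rw [funext fun x => funext fun y => hFx k x y l]
    refine (normL2_sub_le (hcT k _ 2) (hcsum k 0 _ 0)).trans (add_le_add ?_ ?_)
    · refine (hT k _ 2).trans ?_
      rw [zero_add]
      exact hH.single l 2 le_rfl
    · exact hsum k 0 (by norm_num) _ 0 fun j => hH.double j l
  -- The first term collects the errors from mollifying ∂_y² and ∇_h of the datum; the second is the
  -- Lipschitz error of the profile over a distance 3 · scale.
  set C : ℝ≥0∞ := ENNReal.ofReal ((n + 1) * 3) * (H + P) + n * (ENNReal.ofReal (m * 3) * H) with hC
  have hCfin : C < ⊤ := ENNReal.add_lt_top.2 ⟨ENNReal.mul_lt_top ENNReal.ofReal_lt_top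
    (ENNReal.add_lt_top.2 ⟨hHfin, hPfin⟩),
    ENNReal.mul_lt_top (by simp) (ENNReal.mul_lt_top ENNReal.ofReal_lt_top hHfin)⟩
  have hcx := h.cx
  have hcyy := h.cyy
  have hcf : Continuous fun p : Tan n × ℝ => initialRate W gx gyy p.1 p.2 := by
    unfold initialRate
    fun_prop
  have ha : ∀ k, normL2 (fun x y => initialRate W gx gyy x y - rate (K k) (κ k) g W x y) ≤
      ENNReal.ofReal (scale k) * C := by
    intro k
    have hsc := scale_pos k
    have e : (fun x y => initialRate W gx gyy x y - rate (K k) (κ k) g W x y) = fun x y =>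
        (∑ j, W y j * (mollDeriv (K k) g (Pi.single j 1) 0 (x, y) - gx x y (ev j)) +
          ∑ j, (profile (κ k) W 0 y - W y) j * mollDeriv (K k) g (Pi.single j 1) 0 (x, y)) -
        (mollDeriv (K k) g 0 2 (x, y) - gyy x y) := by
      funext x y
      simp only [initialRate, rate, clm_apply_eq_sum (gx x y) (W y), PiLp.sub_apply, sub_mul, mul_sub,
        Finset.sum_sub_distrib]
      ring
    have c1 : ∀ j : Fin n, Continuous fun p : Tan n × ℝ =>
        mollDeriv (K k) g (Pi.single j 1) 0 (p.1, p.2) - gx p.1 p.2 (ev j) := fun j => by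
      have := hcT k (Pi.single j 1) 0
      fun_prop
    have c2 : Continuous fun p : Tan n × ℝ => ∑ j, W p.2 j *
        (mollDeriv (K k) g (Pi.single j 1) 0 (p.1, p.2) - gx p.1 p.2 (ev j)) :=
      continuous_finsetSum _ fun j _ => by
        have := c1 j
        fun_prop
    have c3 : Continuous fun p : Tan n × ℝ => ∑ j, (profile (κ k) W 0 p.2 - W p.2) j *
        mollDeriv (K k) g (Pi.single j 1) 0 (p.1, p.2) :=
      continuous_finsetSum _ fun j _ => by
        have := hcT k (Pi.single j 1) 0
        have := hcP k 0
        fun_prop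
    have c4 : Continuous fun p : Tan n × ℝ => mollDeriv (K k) g 0 2 (p.1, p.2) - gyy p.1 p.2 :=
      (hcT k 0 2).sub hcyy
    rw [e]
    have b1 := normL2_profile_sum_le (b := W) (m := m) hW (fun y _ => hWm y)
      (f := fun j x y => mollDeriv (K k) g (Pi.single j 1) 0 (x, y) - gx x y (ev j)) c1
      (L := ENNReal.ofReal ((n + 1) * (3 * scale k)) * H) fun j =>
        (h.isLimitDeriv_x hK j).nrm_sub_le hK h (fun l => hH.double j l)
          (hH.single j 1 (by norm_num)) k
    have b2 := normL2_profile_sum_le (b := fun y => profile (κ k) W 0 y - W y)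
      (m := m * (3 * scale k)) ((hcP k 0).sub hW) (fun y hy =>
        ((hκ k).norm_profile_sub_le hW hWU hfin hy.le).trans (by gcongr))
      (f := fun j x y => mollDeriv (K k) g (Pi.single j 1) 0 (x, y)) (fun j => hcT k _ 0)
      (L := H) fun j => (hT k _ 0).trans (hH.single j 0 (by norm_num))
    have b3 : normL2 (fun x y => mollDeriv (K k) g 0 2 (x, y) - gyy x y) ≤
        ENNReal.ofReal ((n + 1) * (3 * scale k)) * H :=
      (h.isLimitDeriv_yy hK).nrm_sub_le hK h (fun l => by
        rw [zero_add]; exact hH.single l 2 le_rfl) (hH.zero 3 (by norm_num)) k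
    refine (normL2_sub_le (c2.add c3) c4).trans ((add_le_add
      ((normL2_add_le c2 c3).trans (add_le_add b1 b2)) b3).trans (le_of_eq ?_))
    rw [show ((n : ℝ) + 1) * (3 * scale k) = scale k * ((n + 1) * 3) by ring,
      show m * (3 * scale k) = scale k * (m * 3) by ring, ENNReal.ofReal_mul hsc.le,
      ENNReal.ofReal_mul hsc.le, hC, hP]
    ring
  have hscale0 : Filter.Tendsto (fun k => ENNReal.ofReal (scale k)) Filter.atTop (nhds 0) := by
    simpa using ENNReal.tendsto_ofReal tendsto_scale
  have hat : Filter.Tendsto (fun k => ENNReal.ofReal (scale k) * C) Filter.atTop (nhds 0) := by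
    simpa using ENNReal.Tendsto.mul_const hscale0 (Or.inr hCfin.ne)
  have hlim : ∀ x y, 0 ≤ y → Filter.Tendsto (fun k => rate (K k) (κ k) g W x y) Filter.atTop
      (nhds (initialRate W gx gyy x y)) := by
    intro x y hy
    unfold rate initialRate
    refine ((h.isLimitDeriv_yy hK).tendsto hK (q := (x, y)) hy).sub ?_
    rw [clm_apply_eq_sum]
    refine tendsto_finsetSum _ fun j _ => Filter.Tendsto.mul ?_
      ((h.isLimitDeriv_x hK j).tendsto hK (q := (x, y)) hy)
    have := (EuclideanSpace.proj (𝕜 := ℝ) j).continuous.continuousAt.tendsto.comp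
      (tendsto_profile hκ hW y)
    simpa [Function.comp_def] using this
  have hb : ∀ k, sliceNorm (rate (K k) (κ k) g W) 0 ≤ ENNReal.ofReal (Real.sqrt (scale k)) *
      (2 * ((H + 4 * P + (H + 4 * P)) + 4 * C)) := by
    intro k
    have hsc := scale_pos k
    have hl : 0 < Real.sqrt (scale k) := Real.sqrt_pos.2 hsc
    -- The width √scale balances the two terms of the interpolation: l and scale / l are both of
    -- order √scale.
    have h1 := sliceNorm_zero_le_of_approx hcf hstat hFyyb ha hat
      (fun x => by simpa only [hbd x] using hlim x 0 le_rfl) k hl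
    refine h1.trans ?_
    have hle : Real.sqrt (scale k) ≤ 1 := by
      refine Real.sqrt_le_one.2 ?_
      unfold scale
      rw [div_le_one (by positivity)]
      linarith [(Nat.cast_nonneg k : (0 : ℝ) ≤ k)]
    have h2 : ENNReal.ofReal (Real.sqrt (2 * Real.sqrt (scale k))) ≤ 2 :=
      (ENNReal.ofReal_le_ofReal (Real.sqrt_le_sqrt (by linarith))).trans sqrt_two_le
    have h3 : ENNReal.ofReal (4 / Real.sqrt (scale k)) * (ENNReal.ofReal (scale k) * C) =
        ENNReal.ofReal (Real.sqrt (scale k)) * (4 * C) := by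
      rw [← mul_assoc, ← ENNReal.ofReal_mul (by positivity)]
      have : 4 / Real.sqrt (scale k) * scale k = Real.sqrt (scale k) * 4 := by
        rw [div_mul_eq_mul_div, div_eq_iff hl.ne', mul_right_comm, Real.mul_self_sqrt hsc.le]
        ring
      rw [this, ENNReal.ofReal_mul hl.le, mul_assoc]
      simp
    rw [h3, ← mul_add, mul_left_comm]
    exact mul_le_mul' le_rfl (mul_le_mul' h2 le_rfl)
  have hbt : Filter.Tendsto (fun k => ENNReal.ofReal (Real.sqrt (scale k)) *
      (2 * ((H + 4 * P + (H + 4 * P)) + 4 * C))) Filter.atTop (nhds 0) := by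
    have h4 : H + 4 * P < ⊤ := ENNReal.add_lt_top.2 ⟨hHfin, ENNReal.mul_lt_top (by simp) hPfin⟩
    have h5 : 2 * ((H + 4 * P + (H + 4 * P)) + 4 * C) < ⊤ :=
      ENNReal.mul_lt_top (by simp) (ENNReal.add_lt_top.2 ⟨ENNReal.add_lt_top.2 ⟨h4, h4⟩,
        ENNReal.mul_lt_top (by simp) hCfin⟩)
    have h6 : Filter.Tendsto (fun k => ENNReal.ofReal (Real.sqrt (scale k))) Filter.atTop (nhds 0) := by
      have := ENNReal.tendsto_ofReal ((Real.continuous_sqrt.tendsto 0).comp tendsto_scale)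
      simpa using this
    simpa using ENNReal.Tendsto.mul_const h6 (Or.inr h5.ne)
  refine ⟨fun k => rate (K k) (κ k) g W, Fy, Fyy, Fx, _, _, hstat,
    fun k => (hF k).trans_lt (ENNReal.add_lt_top.2 ⟨hHfin, hPfin⟩), ha, fun k => ?_, hb, fun k => ?_,
    hat, hbt, fun x y hy => hlim x y hy.le⟩
  · have hFxc := (hstat k).cx
    exact (normL2_sub_le (hstat k).cyy (by fun_prop)).trans (add_le_add (hFyyb k) (hFxb k))
  · have hs := hstat k
    exact (sliceNorm_deriv_le hs.c hs.cy hs.cyy hs.hy hs.hyy le_rfl).trans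
      ((mul_le_mul' le_rfl (add_le_add (hF k) (hFyyb k))).trans hc)

end Approx

end

/-! ### The classical solution: estimates of the temperature. -/

section

variable {n : ℕ}

/-! ### Extension of the solution to all times and heights -/

/-- Freezing t and y at 0 once they become negative yields functions continuous on the whole space.
Their derivatives in t and y are only claimed at positive arguments, where nothing has changed. -/
theorem ContOnDomain.continuous_clamp {G : Type*} [TopologicalSpace G] {f : ℝ → Tan n → ℝ → G}
    (hf : ContOnDomain f) :
    Continuous fun p : ℝ × Tan n × ℝ => f (max p.1 0) p.2.1 (max p.2.2 0) :=
  ContinuousOn.comp_continuous (g := fun p : ℝ × Tan n × ℝ => f p.1 p.2.1 p.2.2)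
    (f := fun p : ℝ × Tan n × ℝ => (max p.1 0, p.2.1, max p.2.2 0)) hf (by fun_prop)
    fun p => ⟨le_max_right p.1 0, mem_univ _, le_max_right p.2.2 0⟩

theorem hasDerivAt_clamp {F : Type*} [NormedAddCommGroup F] [NormedSpace ℝ F] {f : ℝ → F} {t : ℝ}
    (ht : 0 < t) (hf : DifferentiableWithinAt ℝ f (Ici 0) t) :
    HasDerivAt (fun s => f (max s 0)) (derivWithin f (Ici 0) (max t 0)) t := by
  rw [max_eq_left ht.le]
  refine (hf.hasDerivWithinAt.hasDerivAt (Ici_mem_nhds ht)).congr_of_eventuallyEq ?_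
  filter_upwards [Ioi_mem_nhds ht] with s hs
  rw [max_eq_left (le_of_lt hs)]

section Solution

variable {U : ℝ → Tan n} {u₀ : Tan n → ℝ → Tan n} {θ₀ : Tan n → ℝ → ℝ}
  {u : ℝ → Tan n → ℝ → Tan n} {v θ : ℝ → Tan n → ℝ → ℝ}

/-- The shear profile, extended by a constant to negative heights. -/
def clampU (U : ℝ → Tan n) (y : ℝ) : Tan n := U (max y 0)

theorem continuous_clampU (hU : ContDiffOn ℝ 1 U (Ici 0)) : Continuous (clampU U) :=
  hU.continuousOn.comp_continuous (by fun_prop) fun y => le_max_right y 0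

theorem clampU_of_nonneg (U : ℝ → Tan n) {y : ℝ} (hy : 0 ≤ y) : clampU U y = U y := by
  rw [clampU, max_eq_left hy]

theorem norm_clampU_le_normLinf (hU : ContDiffOn ℝ 1 U (Ici 0)) (hfin : normLinf U < ⊤) (y : ℝ) :
    ‖clampU U y‖ ≤ (normLinf U).toReal := by
  have h := enorm_le_normLinf (U := U) (continuous_clampU hU)
    (fun y hy => clampU_of_nonneg U hy.le) (le_max_right y 0)
  have e : clampU U (max y 0) = clampU U y := by simp [clampU]
  rw [e] at h
  exact norm_le_toReal_of_enorm hfin h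

theorem IsSolution.reg (h : IsSolution U u₀ θ₀ u v θ) :
    Reg (fun t x y => θ (max t 0) x (max y 0)) (fun t x y => dT θ (max t 0) x (max y 0))
      (fun t x y => dX (θ (max t 0)) x (max y 0)) (fun t x y => dY (θ (max t 0)) x (max y 0))
      (fun t x y => dY (dY (θ (max t 0))) x (max y 0)) where
  c := h.θ_cont.continuous_clamp
  ct := h.θ_cont_t.continuous_clamp
  cx := h.θ_cont_x.continuous_clamp
  cy := h.θ_cont_y.continuous_clamp
  cyy := h.θ_cont_yy.continuous_clamp
  ht t x y ht := hasDerivAt_clamp (f := fun s => θ s x (max y 0)) ht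
    (h.θ_diff_t t ht.le x _ (le_max_right _ _))
  hx _ x _ := (h.θ_diff_x _ (le_max_right _ _) x _ (le_max_right _ _)).hasFDerivAt
  hy t x y hy := hasDerivAt_clamp (f := fun z => θ (max t 0) x z) hy
    (h.θ_diff_y _ (le_max_right _ _) x y hy.le)
  hyy t x y hy := hasDerivAt_clamp (f := fun z => dY (θ (max t 0)) x z) hy
    (h.θ_diff_yy _ (le_max_right _ _) x y hy.le)

theorem IsSolution.lintegral_energy_lt_top (h : IsSolution U u₀ θ₀ u v θ) (T : ℝ) :
    ∫⁻ τ in Ioc 0 T, energy (fun x y => θ (max τ 0) x (max y 0)) < ⊤ := by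
  have h1 := (h.θ_energy T).2
  have h2 : eLpNorm (fun p : ℝ × Tan n × ℝ => θ p.1 p.2.1 p.2.2) 2
      (volume.restrict (Ioo 0 T ×ˢ halfSpace n)) ^ 2 < ⊤ := ENNReal.pow_lt_top h1
  rw [eLpNorm_two_sq] at h2
  refine lt_of_le_of_lt (le_of_eq ?_) h2
  have hms : MeasurableSet (Ioo 0 T ×ˢ halfSpace n) := measurableSet_Ioo.prod measurableSet_halfSpace
  rw [setLIntegral_congr_fun hms (g := fun p : ℝ × Tan n × ℝ =>
    ‖θ (max p.1 0) p.2.1 (max p.2.2 0)‖ₑ ^ 2)]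
  · rw [Measure.volume_eq_prod, ← Measure.prod_restrict, lintegral_prod _
      (h.reg.c.enorm.measurable.pow_const 2).aemeasurable]
    rw [setLIntegral_congr Ioo_ae_eq_Ioc]
    rfl
  · intro p hp
    have h3 : 0 < p.1 := hp.1.1
    have h4 : 0 < p.2.2 := hp.2.2
    simp only [max_eq_left h3.le, max_eq_left h4.le]

theorem IsSolution.datum (h : IsSolution U u₀ θ₀ u v θ) :
    Datum θ₀ (fun x y => θ (max 0 0) x (max y 0)) (fun x y => dX (θ (max 0 0)) x (max y 0))
      (fun x y => dY (θ (max 0 0)) x (max y 0)) (fun x y => dY (dY (θ (max 0 0))) x (max y 0)) :=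
  h.reg.datum fun x y hy => by
    rw [max_self, max_eq_left hy.le]
    exact h.θ_init x y hy.le

/-- A bound uniform in time is not assumed. The finite space-time energy allows the monotonicity
argument, and monotonicity then yields the uniform bound. -/
theorem IsSolution.sol (h : IsSolution U u₀ θ₀ u v θ) (hU : ContDiffOn ℝ 1 U (Ici 0)) {m : ℝ}
    (hm : ∀ y, ‖clampU U y‖ ≤ m) (hfin : weakPartialNorm 0 0 θ₀ < ⊤) :
    Sol (clampU U) (fun t x y => θ (max t 0) x (max y 0)) (fun t x y => dT θ (max t 0) x (max y 0))
      (fun t x y => dX (θ (max t 0)) x (max y 0)) (fun t x y => dY (θ (max t 0)) x (max y 0))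
      (fun t x y => dY (dY (θ (max t 0))) x (max y 0)) := by
  have heq : ∀ t x y, 0 < t → 0 < y → src (clampU U) (fun t x y => dT θ (max t 0) x (max y 0))
      (fun t x y => dX (θ (max t 0)) x (max y 0)) (fun t x y => dY (dY (θ (max t 0))) x (max y 0))
      t x y = 0 := by
    intro t x y ht hy
    have := h.eq_θ t ht.le x y hy.le
    simp only [src, clampU, max_eq_left ht.le, max_eq_left hy.le]
    linarith
  have hb : ∀ t x, θ (max t 0) x (max 0 0) = 0 := fun t x => by
    rw [max_self]
    exact h.θ_bdry _ (le_max_right _ _) x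
  refine ⟨h.reg, heq, hb, weakPartialNorm 0 0 θ₀, hfin, fun t ht => ?_⟩
  exact (h.reg.normL2_antitone (continuous_clampU hU) hm heq hb h.lintegral_energy_lt_top le_rfl
    ht).trans h.datum.normL2_le

/-! ### The tangential gradient -/

theorem gradient_apply_coord (f : Tan n → ℝ) (x : Tan n) (k : Fin n) :
    gradient f x k = fderiv ℝ f x (ev k) := by
  have h1 : inner ℝ (ev k) (gradient f x) = gradient f x k := by
    rw [ev, EuclideanSpace.inner_single_left]
    simp
  have h2 : inner ℝ (gradient f x) (ev k) = fderiv ℝ f x (ev k) := by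
    rw [gradient, InnerProductSpace.toDual_symm_apply]
  rw [← h1, real_inner_comm, h2]

theorem enorm_sq_eq_sum (z : Tan n) : ‖z‖ₑ ^ 2 = ∑ k, ‖z k‖ₑ ^ 2 := by
  have h := EuclideanSpace.real_norm_sq_eq z
  rw [← ofReal_norm, ← ENNReal.ofReal_pow (norm_nonneg _), h,
    ENNReal.ofReal_sum_of_nonneg fun _ _ => sq_nonneg _]
  refine Finset.sum_congr rfl fun k _ => ?_
  rw [← ofReal_norm, ← ENNReal.ofReal_pow (norm_nonneg _), Real.norm_eq_abs, sq_abs]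

theorem eLpNorm_sq_eq_sum {X : Type*} [MeasurableSpace X] {μ : Measure X} {F : X → Tan n}
    (hF : ∀ k, AEMeasurable (fun p => F p k) μ) :
    eLpNorm F 2 μ ^ 2 = ∑ k, eLpNorm (fun p => F p k) 2 μ ^ 2 := by
  rw [eLpNorm_two_sq]
  simp only [enorm_sq_eq_sum, eLpNorm_two_sq]
  rw [lintegral_finsetSum' _ fun k _ => (hF k).enorm.pow_const 2]

theorem gradH_coord (f : Tan n → ℝ → ℝ) (x : Tan n) (y : ℝ) (k : Fin n) :
    gradH f x y k = dX f x y (ev k) := gradient_apply_coord _ _ _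

theorem IsSolution.continuous_dX (h : IsSolution U u₀ θ₀ u v θ) {t : ℝ} (ht : 0 ≤ t) (k : Fin n) :
    Continuous fun p : Tan n × ℝ => dX (θ t) p.1 (max p.2 0) (ev k) := by
  have := continuous_slice (f := fun t x y => dX (θ (max t 0)) x (max y 0)) h.reg.cx t
  rw [max_eq_left ht] at this
  fun_prop

theorem IsSolution.normL2_gradH_sq (h : IsSolution U u₀ θ₀ u v θ) {t : ℝ} (ht : 0 ≤ t) :
    normL2 (gradH (θ t)) ^ 2 =
      ∑ k, normL2 (fun x y => dX (θ (max t 0)) x (max y 0) (ev k)) ^ 2 := by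
  rw [normL2_congr (g := fun x y => gradH (θ t) x (max y 0)) fun x y hy => by rw [max_eq_left hy.le]]
  unfold normL2
  rw [eLpNorm_sq_eq_sum fun k => ?_]
  · simp only [gradH_coord, max_eq_left ht]
  · simp only [gradH_coord]
    exact (h.continuous_dX ht k).measurable.aemeasurable

/-- The squared gradient norm is the sum over coordinate directions, each of which is monotone;
summing squares loses no constant. -/
theorem IsSolution.normL2_gradH_antitone (h : IsSolution U u₀ θ₀ u v θ)
    (hU : ContDiffOn ℝ 1 U (Ici 0)) {m : ℝ}
    (hm : ∀ y, ‖clampU U y‖ ≤ m) (hfin : weakPartialNorm 0 0 θ₀ < ⊤) {s t : ℝ} (hs : 0 ≤ s)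
    (hst : s ≤ t) : normL2 (gradH (θ t)) ≤ normL2 (gradH (θ s)) := by
  rw [← ENNReal.pow_le_pow_left_iff two_ne_zero, h.normL2_gradH_sq hs,
    h.normL2_gradH_sq (hs.trans hst)]
  exact Finset.sum_le_sum fun k _ => pow_le_pow_left'
    ((h.sol hU hm hfin).normL2_dir_le (continuous_clampU hU) hm hs hst (ev k)) 2

theorem IsSolution.normL2_antitone (h : IsSolution U u₀ θ₀ u v θ)
    (hU : ContDiffOn ℝ 1 U (Ici 0)) {m : ℝ}
    (hm : ∀ y, ‖clampU U y‖ ≤ m) (hfin : weakPartialNorm 0 0 θ₀ < ⊤) {s t : ℝ} (hs : 0 ≤ s)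
    (hst : s ≤ t) : normL2 (θ t) ≤ normL2 (θ s) := by
  have h1 := (h.sol hU hm hfin).antitone (continuous_clampU hU) hm hs hst
  simp only [max_eq_left hs, max_eq_left (hs.trans hst)] at h1
  rw [normL2_congr (f := θ t) (g := fun x y => θ t x (max y 0)) fun x y hy => by rw [max_eq_left hy.le],
    normL2_congr (f := θ s) (g := fun x y => θ s x (max y 0)) fun x y hy => by rw [max_eq_left hy.le]]
  exact h1

theorem IsSolution.normL2_init (h : IsSolution U u₀ θ₀ u v θ) : normL2 (θ 0) = normL2 θ₀ :=
  normL2_congr fun x y hy => h.θ_init x y hy.le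

theorem IsSolution.gradH_init (h : IsSolution U u₀ θ₀ u v θ) (x : Tan n) {y : ℝ} (hy : 0 ≤ y) :
    gradH (θ 0) x y = gradH θ₀ x y := by
  unfold gradH
  congr 1
  funext x'
  exact h.θ_init x' y hy

theorem IsSolution.normL2_gradH_init (h : IsSolution U u₀ θ₀ u v θ) :
    normL2 (gradH (θ 0)) = normL2 (gradH θ₀) :=
  normL2_congr fun x _ hy => h.gradH_init x hy.le

end Solution

end

section

variable {n : ℕ} {U : ℝ → Tan n} {u₀ : Tan n → ℝ → Tan n} {θ₀ : Tan n → ℝ → ℝ}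
  {u : ℝ → Tan n → ℝ → Tan n} {v θ : ℝ → Tan n → ℝ → ℝ}

/-! ### Pointwise in `y` estimates of the temperature -/

theorem sliceNorm_clamp {F : Type*} [NormedAddCommGroup F] [NormedSpace ℝ F] (f : Tan n → ℝ → F)
    {y : ℝ} (hy : 0 ≤ y) : sliceNorm (fun x y => f x (max y 0)) y = sliceNorm f y := by
  simp only [sliceNorm, max_eq_left hy]

/-- The constant of the estimates that involve only the size of the shear profile. -/
def constZero (n : ℕ) (r : ℝ≥0) : ℝ≥0 := (24 + 8 * n) * (4 + 4 * r * n)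

/-- The constant of the estimate of `∂_y² θ`. -/
def constOne (n : ℕ) (r : ℝ≥0) : ℝ≥0 :=
  2 * (18 * ((1 + 4 * (n * r)) + n * r * (1 + n * r)) + n * r * (3 * (1 + n * r)) +
    4 * (3 * (1 + n * r))) + n * r * (8 * (4 + 4 * r * n))

theorem constZero_pos (n : ℕ) (r : ℝ≥0) : 0 < constZero n r := by
  unfold constZero; positivity

theorem constOne_pos (n : ℕ) (r : ℝ≥0) : 0 < constOne n r := by
  unfold constOne; positivity

theorem IsSolution.gradSum_le (h : IsSolution U u₀ θ₀ u v θ) {H : ℝ≥0∞}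
    (hH : ∀ j, weakPartialNorm (Pi.single j 1) 0 θ₀ ≤ H) :
    gradSum (fun x y => dX (θ (max 0 0)) x (max y 0)) ≤ n * H := by
  refine (Finset.sum_le_sum (g := fun _ => H) fun k _ => ?_).trans (by simp)
  exact (h.datum.normL2_x_le k).trans (hH k)

theorem IsSolution.sliceNorm_theta_le (h : IsSolution U u₀ θ₀ u v θ)
    (hU : ContDiffOn ℝ 1 U (Ici 0)) {r : ℝ≥0} (hm : ∀ y, ‖clampU U y‖ ≤ r)
    (hfin : weakPartialNorm 0 0 θ₀ < ⊤) {t y : ℝ} (ht : 0 ≤ t) (hy : 0 ≤ y) :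
    sliceNorm (θ t) y ≤ 8 * (4 + 4 * r * n) * (normH 1 0 θ₀ + normH 0 2 θ₀) ∧
    sliceNorm (dY (θ t)) y ≤ 12 * (4 + 4 * r * n) * (normH 1 0 θ₀ + normH 0 2 θ₀) := by
  have h1 := (h.sol hU hm hfin).slice_le (continuous_clampU hU) hm ht hy
  rw [sliceNorm_clamp (θ (max t 0)) hy, sliceNorm_clamp (dY (θ (max t 0))) hy, max_eq_left ht] at h1
  set H := normH 1 0 θ₀ + normH 0 2 θ₀ with hH
  have b0 : normL2 (fun x y => θ (max 0 0) x (max y 0)) ≤ H :=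
    h.datum.normL2_le.trans ((weakPartialNorm_le_normH (by simp) le_rfl).trans le_self_add)
  have b2 : normL2 (fun x y => dY (dY (θ (max 0 0))) x (max y 0)) ≤ H :=
    h.datum.normL2_yy_le.trans ((weakPartialNorm_le_normH (by simp) le_rfl).trans le_add_self)
  have b1 : gradSum (fun x y => dX (θ (max 0 0)) x (max y 0)) ≤ n * H :=
    h.gradSum_le fun j => (weakPartialNorm_le_normH (by simp) le_rfl).trans le_self_add
  have hb : normL2 (fun x y => θ (max 0 0) x (max y 0)) +
      (3 * normL2 (fun x y => dY (dY (θ (max 0 0))) x (max y 0)) +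
        4 * ENNReal.ofReal r * gradSum (fun x y => dX (θ (max 0 0)) x (max y 0))) ≤
      (4 + 4 * r * n) * H := by
    calc _ ≤ H + (3 * H + 4 * ENNReal.ofReal r * (n * H)) := by gcongr
      _ = (4 + 4 * r * n) * H := by rw [ENNReal.ofReal_coe_nnreal]; ring
  constructor
  · rw [mul_assoc]
    exact h1.1.trans (mul_le_mul' le_rfl hb)
  · rw [mul_assoc]
    exact h1.2.trans (mul_le_mul' le_rfl hb)

theorem IsSolution.sliceNorm_dX_le (h : IsSolution U u₀ θ₀ u v θ)
    (hU : ContDiffOn ℝ 1 U (Ici 0)) {r : ℝ≥0} (hm : ∀ y, ‖clampU U y‖ ≤ r)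
    (hfin : weakPartialNorm 0 0 θ₀ < ⊤) {N : ℝ≥0∞}
    (h0 : ∀ j, weakPartialNorm (Pi.single j 1) 0 θ₀ ≤ N)
    (h2 : ∀ j, weakPartialNorm (Pi.single j 1) 2 θ₀ ≤ N)
    (h1 : ∀ j l, weakPartialNorm (Pi.single j 1 + Pi.single l 1) 0 θ₀ ≤ N)
    {t y : ℝ} (ht : 0 ≤ t) (hy : 0 ≤ y) (k : Fin n) :
    sliceNorm (fun x y => dX (θ (max t 0)) x (max y 0) (ev k)) y ≤ 8 * (4 + 4 * r * n) * N := by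
  obtain ⟨K, hK⟩ := exists_kernels n
  have hd := h.datum
  have key := (h.sol hU hm hfin).sliceNorm_dir_le (continuous_clampU hU) hm (v := ev k) (N := N)
    (fun r hr => (hd.isLimitDeriv_zero.normL2_increment_le hK hd k hr).trans
      (mul_le_mul' le_rfl (by rw [zero_add]; exact h0 k)))
    (fun r hr => ((hd.isLimitDeriv_yy hK).normL2_increment_le hK hd k hr).trans
      (mul_le_mul' le_rfl (by rw [zero_add]; exact h2 k)))
    (fun r hr j => ((hd.isLimitDeriv_x hK j).normL2_increment_le hK hd k hr).trans
      (mul_le_mul' le_rfl (h1 j k))) ht hy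
  rwa [ENNReal.ofReal_coe_nnreal] at key

theorem sliceNorm_gradH_le {f : Tan n → ℝ → ℝ} {y : ℝ} {N : ℝ≥0∞}
    (hc : ∀ k, Continuous fun x => dX f x y (ev k))
    (hN : ∀ k, sliceNorm (fun x y => dX f x y (ev k)) y ≤ N) : sliceNorm (gradH f) y ≤ n * N := by
  rw [← ENNReal.pow_le_pow_left_iff two_ne_zero]
  unfold sliceNorm at hN ⊢
  rw [eLpNorm_sq_eq_sum fun k => by
    simp only [gradH_coord]
    exact (hc k).measurable.aemeasurable]
  simp only [gradH_coord]
  refine (Finset.sum_le_sum (g := fun _ => N ^ 2) fun k _ => pow_le_pow_left' (hN k) 2).trans ?_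
  rw [Finset.sum_const, Finset.card_univ, Fintype.card_fin, nsmul_eq_mul, mul_pow]
  gcongr
  -- Summing squares gives the factor √n; it is replaced by n to keep the constant free of roots.
  exact_mod_cast Nat.le_self_pow two_ne_zero n

theorem IsSolution.sliceNorm_gradH_le (h : IsSolution U u₀ θ₀ u v θ)
    (hU : ContDiffOn ℝ 1 U (Ici 0)) {r : ℝ≥0} (hm : ∀ y, ‖clampU U y‖ ≤ r)
    (hfin : weakPartialNorm 0 0 θ₀ < ⊤) {t y : ℝ} (ht : 0 ≤ t) (hy : 0 ≤ y) :
    sliceNorm (gradH (θ t)) y ≤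
      n * (8 * (4 + 4 * r * n) * (normH 2 0 θ₀ + normH 1 2 θ₀)) := by
  refine ThermalLayer.sliceNorm_gradH_le (fun k => ?_) fun k => ?_
  · have := continuous_at_height (g := fun x y => dX (θ t) x (max y 0) (ev k))
      (h.continuous_dX ht k) y
    simpa only [max_eq_left hy] using this
  · have := h.sliceNorm_dX_le hU hm hfin (N := normH 2 0 θ₀ + normH 1 2 θ₀)
      (fun j => (weakPartialNorm_le_normH (by simp) le_rfl).trans le_self_add)
      (fun j => (weakPartialNorm_le_normH (by simp) le_rfl).trans le_add_self)
      (fun j l => (weakPartialNorm_le_normH (by simp [Finset.sum_add_distrib]) le_rfl).trans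
        le_self_add) ht hy k
    rw [max_eq_left ht] at this
    rwa [sliceNorm_clamp (fun x y => dX (θ t) x y (ev k)) hy] at this

/-- The normal derivatives are one-sided on [0, ∞), hence determined by values there, where θ₀ and
the solution at time 0 agree. The first order compatibility condition therefore transfers. -/
theorem IsSolution.initialRate_zero (h : IsSolution U u₀ θ₀ u v θ) (hc : Compatible U θ₀)
    (x : Tan n) : initialRate (clampU U) (fun x y => dX (θ (max 0 0)) x (max y 0))
      (fun x y => dY (dY (θ (max 0 0))) x (max y 0)) x 0 = 0 := by
  have h1 := (hc x).2
  have hw : ∀ x', ∀ z, 0 ≤ z → θ 0 x' z = θ₀ x' z := fun x' z hz => h.θ_init x' z hz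
  have e1 : ∀ z, 0 ≤ z → dY (θ 0) x z = dY θ₀ x z := fun z hz =>
    derivWithin_congr (fun y hy => hw x y hy) (hw x z hz)
  have e2 : dY (dY (θ 0)) x 0 = dY (dY θ₀) x 0 :=
    derivWithin_congr (fun y hy => e1 y hy) (e1 0 le_rfl)
  have e3 : dX (θ 0) x 0 = dX θ₀ x 0 := by
    unfold dX
    congr 1
    funext x'
    exact hw x' 0 le_rfl
  simp only [initialRate, clampU, max_self]
  rw [e2, e3]
  exact h1

theorem IsSolution.normL2_rate_increment_le (h : IsSolution U u₀ θ₀ u v θ)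
    (hU : ContDiffOn ℝ 1 U (Ici 0)) {r : ℝ≥0} (hm : ∀ y, ‖clampU U y‖ ≤ r)
    {H : ℝ≥0∞} (hH : WeakBound θ₀ H) (k : Fin n) {s : ℝ} (hs : 0 ≤ s) :
    normL2 (fun x y => initialRate (clampU U) (fun x y => dX (θ (max 0 0)) x (max y 0))
        (fun x y => dY (dY (θ (max 0 0))) x (max y 0)) (x + s • ev k) y -
      initialRate (clampU U) (fun x y => dX (θ (max 0 0)) x (max y 0))
        (fun x y => dY (dY (θ (max 0 0))) x (max y 0)) x y) ≤
      ENNReal.ofReal s * (H + n * (r * H)) := by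
  obtain ⟨K, hK⟩ := exists_kernels n
  have hd := h.datum
  have hW := continuous_clampU hU
  have hcx := hd.cx
  have hcyy := hd.cyy
  have e : (fun x y => initialRate (clampU U) (fun x y => dX (θ (max 0 0)) x (max y 0))
        (fun x y => dY (dY (θ (max 0 0))) x (max y 0)) (x + s • ev k) y -
      initialRate (clampU U) (fun x y => dX (θ (max 0 0)) x (max y 0))
        (fun x y => dY (dY (θ (max 0 0))) x (max y 0)) x y) = fun x y =>
      (dY (dY (θ (max 0 0))) (x + s • ev k) (max y 0) - dY (dY (θ (max 0 0))) x (max y 0)) -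
      ∑ j, clampU U y j * (dX (θ (max 0 0)) (x + s • ev k) (max y 0) (ev j) -
        dX (θ (max 0 0)) x (max y 0) (ev j)) := by
    funext x y
    simp only [initialRate, clm_apply_eq_sum _ (clampU U y), mul_sub, Finset.sum_sub_distrib]
    ring
  have hsh : Continuous fun p : Tan n × ℝ => (p.1 + s • ev k, p.2) := by fun_prop
  have c1 : Continuous fun p : Tan n × ℝ =>
      dY (dY (θ (max 0 0))) (p.1 + s • ev k) (max p.2 0) - dY (dY (θ (max 0 0))) p.1 (max p.2 0) :=
    (hcyy.comp hsh).sub hcyy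
  have c2 : ∀ j : Fin n, Continuous fun p : Tan n × ℝ =>
      dX (θ (max 0 0)) (p.1 + s • ev k) (max p.2 0) (ev j) -
        dX (θ (max 0 0)) p.1 (max p.2 0) (ev j) := fun j =>
    ((hcx.comp hsh).clm_apply continuous_const).sub (hcx.clm_apply continuous_const)
  have c3 : Continuous fun p : Tan n × ℝ => ∑ j, clampU U p.2 j *
      (dX (θ (max 0 0)) (p.1 + s • ev k) (max p.2 0) (ev j) -
        dX (θ (max 0 0)) p.1 (max p.2 0) (ev j)) :=
    continuous_finsetSum _ fun j _ => by
      have := c2 j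
      fun_prop
  rw [e]
  have b1 := ((hd.isLimitDeriv_yy hK).normL2_increment_le hK hd k hs).trans
    (mul_le_mul' le_rfl (by rw [zero_add]; exact hH.single k 2 le_rfl) : _ ≤ ENNReal.ofReal s * H)
  have b2 := normL2_profile_sum_le hW (fun y _ => hm y) c2 (L := ENNReal.ofReal s * H) fun j =>
    ((hd.isLimitDeriv_x hK j).normL2_increment_le hK hd k hs).trans
      (mul_le_mul' le_rfl (hH.double j k))
  refine (normL2_sub_le c1 c3).trans ((add_le_add b1 b2).trans (le_of_eq ?_))
  rw [ENNReal.ofReal_coe_nnreal]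
  ring

theorem IsSolution.sliceNorm_dYY_le (h : IsSolution U u₀ θ₀ u v θ)
    (hU : ContDiffOn ℝ 1 U (Ici 0)) (hc : Compatible U θ₀) (hUfin : normW2inf U < ⊤)
    (hm : ∀ y, ‖clampU U y‖ ≤ (normW2inf U).toNNReal)
    {H : ℝ≥0∞} (hH : WeakBound θ₀ H) (hHfin : H < ⊤) {t y : ℝ} (ht : 0 ≤ t) (hy : 0 ≤ y) :
    sliceNorm (dY (dY (θ t))) y ≤ constOne n (normW2inf U).toNNReal * H := by
  set r := (normW2inf U).toNNReal with hr
  have hW := continuous_clampU hU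
  have hfin : weakPartialNorm 0 0 θ₀ < ⊤ := (hH.zero 0 (by norm_num)).trans_lt hHfin
  have hs := h.sol hU hm hfin
  have hd := h.datum
  have hnr : (n : ℝ≥0∞) * (r * H) < ⊤ :=
    ENNReal.mul_lt_top (by simp) (ENNReal.mul_lt_top (by simp) hHfin)
  -- A common bound for the boundary slope of the approximations (first summand) and of the solution
  -- (second). Only its finiteness matters: it drops out in the limit.
  set c : ℝ≥0∞ := 12 * ((H + n * (ENNReal.ofReal r * H)) + (H + 4 * (n * (ENNReal.ofReal r * H)))) +
    12 * (H + (3 * H + 4 * ENNReal.ofReal r * (n * H))) with hcdef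
  have hcfin : c < ⊤ := by
    have hor : ENNReal.ofReal r < ⊤ := ENNReal.ofReal_lt_top
    have hn : (n : ℝ≥0∞) < ⊤ := by simp
    have h1 : (n : ℝ≥0∞) * (ENNReal.ofReal r * H) < ⊤ := ENNReal.mul_lt_top hn (ENNReal.mul_lt_top hor hHfin)
    have h2 : 4 * ENNReal.ofReal r * (n * H) < ⊤ :=
      ENNReal.mul_lt_top (ENNReal.mul_lt_top (by simp) hor) (ENNReal.mul_lt_top hn hHfin)
    have h3 : ∀ k : ℕ, ∀ a : ℝ≥0∞, a < ⊤ → (k : ℝ≥0∞) * a < ⊤ := fun k a ha =>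
      ENNReal.mul_lt_top (by simp) ha
    exact ENNReal.add_lt_top.2 ⟨h3 12 _ (ENNReal.add_lt_top.2 ⟨ENNReal.add_lt_top.2 ⟨hHfin, h1⟩,
      ENNReal.add_lt_top.2 ⟨hHfin, h3 4 _ h1⟩⟩), h3 12 _ (ENNReal.add_lt_top.2 ⟨hHfin,
      ENNReal.add_lt_top.2 ⟨h3 3 _ hHfin, h2⟩⟩)⟩
  have hwy : ∀ t, 0 ≤ t → sliceNorm (fun x y => dY (θ (max t 0)) x (max y 0)) 0 ≤ c := by
    intro t ht
    refine ((hs.slice_le hW hm ht le_rfl).2.trans ?_).trans le_add_self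
    gcongr
    · exact hd.normL2_le.trans (hH.zero 0 (by norm_num))
    · exact hd.normL2_yy_le.trans (hH.zero 2 (by norm_num))
    · exact h.gradSum_le fun j => hH.single j 0 (by norm_num)
  have happ := hd.rateApprox (c := c) hW (fun y hy => clampU_of_nonneg U hy.le) hUfin
    (m := r) le_rfl hm hH hHfin (h.initialRate_zero hc) le_self_add
  have hF : normL2 (initialRate (clampU U) (fun x y => dX (θ (max 0 0)) x (max y 0))
      (fun x y => dY (dY (θ (max 0 0))) x (max y 0))) ≤ H + ENNReal.ofReal r * (n * H) :=
    (normL2_initialRate_le hd.cx hd.cyy hW hm).trans (add_le_add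
      (hd.normL2_yy_le.trans (hH.zero 2 (by norm_num)))
      (mul_le_mul' le_rfl (h.gradSum_le fun j => hH.single j 0 (by norm_num))))
  have h1 := hs.sliceNorm_wt_le hW hm hcfin hwy happ
    (fun k s hs' => h.normL2_rate_increment_le hU hm hH k hs') ht hy
  have h2 := hs.sliceNorm_wyy_le hW hm ht hy h1 fun k =>
    h.sliceNorm_dX_le hU hm hfin (fun j => hH.single j 0 (by norm_num))
      (fun j => hH.single j 2 le_rfl) (fun j l => hH.double j l) ht hy k
  rw [sliceNorm_clamp (dY (dY (θ (max t 0)))) hy, max_eq_left ht] at h2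
  refine h2.trans ((add_le_add (mul_le_mul' le_rfl (add_le_add le_rfl (mul_le_mul' le_rfl
    (mul_le_mul' le_rfl hF)))) le_rfl).trans (le_of_eq ?_))
  rw [ENNReal.ofReal_coe_nnreal, constOne]
  push_cast
  ring

end

/-! ### Velocity: duality and weak formulas. -/

section

variable {n : ℕ}

/-! ### Duality and weak formulation of transport -/

theorem enorm_integral_mul_le {X : Type*} [MeasurableSpace X] {μ : Measure X} {f g : X → ℝ}
    (hf : AEStronglyMeasurable f μ) (hg : AEStronglyMeasurable g μ) :
    ‖∫ x, f x * g x ∂μ‖ₑ ≤ eLpNorm f 2 μ * eLpNorm g 2 μ := by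
  refine (enorm_integral_le_lintegral_enorm _).trans ?_
  simp only [enorm_mul]
  rw [← ENNReal.pow_le_pow_left_iff two_ne_zero, mul_pow, eLpNorm_two_sq, eLpNorm_two_sq]
  exact sq_lintegral_mul_le _ hf.enorm hg.enorm

/-- A continuous function is bounded in `L²` by its pairings with test functions. -/
theorem eLpNorm_le_of_pairing {h : Tan n → ℝ} (hh : Continuous h) {C : ℝ≥0∞}
    (hC : ∀ φ : Tan n → ℝ, ContDiff ℝ ∞ φ → HasCompactSupport φ → eLpNorm φ 2 volume ≠ 0 →
      ‖∫ x, h x * φ x‖ₑ ≤ C * eLpNorm φ 2 volume) : eLpNorm h 2 volume ≤ C := by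
  rcases eq_or_ne C ⊤ with rfl | hCtop
  · exact le_top
  have hC' : ∀ φ : Tan n → ℝ, ContDiff ℝ ∞ φ → HasCompactSupport φ →
      ‖∫ x, h x * φ x‖ₑ ≤ C * eLpNorm φ 2 volume := by
    intro φ hφ hφc
    by_cases h0 : eLpNorm φ 2 volume = 0
    · have hz := (eLpNorm_eq_zero_iff hφ.continuous.aestronglyMeasurable two_ne_zero).1 h0
      have : ∫ x, h x * φ x = 0 := by
        rw [integral_congr_ae (g := fun _ => 0)]
        · simp
        · filter_upwards [hz] with x hx
          simp [hx]
      simp [this]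
    · exact hC φ hφ hφc h0
  -- h is not known to be square integrable, so it is cut off first. The product is then tested
  -- against smooth approximations of itself, and the bound does not depend on the cutoff.
  choose χ hχs hχc hχ0 hχ1 hχR _ using fun k : ℕ => exists_cutoff (Tan n) (k : ℝ) one_pos
  have hstep : ∀ k, eLpNorm (fun x => χ k x * h x) 2 volume ≤ C := by
    intro k
    have hgc : Continuous fun x => χ k x * h x := (hχs k).continuous.mul hh
    have hgs : HasCompactSupport fun x => χ k x * h x := (hχc k).mul_right
    have hgm : MemLp (fun x => χ k x * h x) 2 volume := hgc.memLp_of_hasCompactSupport hgs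
    set g := fun x => χ k x * h x with hg
    set A := eLpNorm g 2 volume with hA
    have hAtop : A ≠ ⊤ := hgm.2.ne
    have hsq : A ^ 2 = ‖∫ x, g x * g x‖ₑ := by
      have h1 := ofReal_integral_eq_lintegral_ofReal (μ := volume) (f := fun x => g x * g x)
        ((hgc.mul hgc).integrable_of_hasCompactSupport hgs.mul_right)
        (Filter.Eventually.of_forall fun x => mul_self_nonneg _)
      rw [Real.enorm_eq_ofReal (integral_nonneg fun x => mul_self_nonneg _), h1, hA, eLpNorm_two_sq]
      refine lintegral_congr fun x => ?_
      rw [← Real.enorm_eq_ofReal (mul_self_nonneg _), sq, ← enorm_mul]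
    have hε : ∀ j, A ^ 2 ≤ A * ENNReal.ofReal (scale j) + C * (A + ENNReal.ofReal (scale j)) := by
      intro j
      obtain ⟨φ, hφc, hφs, hφ⟩ := hgs.exist_eLpNorm_sub_le_of_continuous (p := 2) volume
        (scale_pos j) hgc
      have hcφ := hφs.continuous
      have e : ∫ x, g x * g x = (∫ x, g x * (g - φ) x) + ∫ x, h x * (χ k x * φ x) := by
        rw [← integral_add]
        · refine integral_congr_ae (Filter.Eventually.of_forall fun x => ?_)
          simp only [Pi.sub_apply, hg]
          ring
        · exact (hgc.mul (hgc.sub hcφ)).integrable_of_hasCompactSupport hgs.mul_right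
        · exact (hh.mul ((hχs k).continuous.mul hcφ)).integrable_of_hasCompactSupport
            (hφc.mul_left.mul_left)
      rw [hsq, e]
      refine (enorm_add_le _ _).trans (add_le_add ?_ ?_)
      · exact (enorm_integral_mul_le hgc.aestronglyMeasurable
          (hgc.sub hcφ).aestronglyMeasurable).trans (mul_le_mul' le_rfl hφ)
      · refine (hC' _ ((hχs k).mul hφs) hφc.mul_left).trans (mul_le_mul' le_rfl ?_)
        have h1 : eLpNorm (fun x => χ k x * φ x) 2 volume ≤ eLpNorm φ 2 volume :=
          eLpNorm_mono fun x => by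
            rw [norm_mul]
            refine mul_le_of_le_one_left (norm_nonneg _) ?_
            rw [Real.norm_of_nonneg (hχ0 k x)]
            exact hχ1 k x
        refine h1.trans ?_
        have e2 : φ = g - (g - φ) := by simp
        rw [e2]
        refine (eLpNorm_sub_le hgc.aestronglyMeasurable (hgc.sub hcφ).aestronglyMeasurable
          (by norm_num)).trans (add_le_add le_rfl hφ)
    have hlim : A ^ 2 ≤ A * 0 + C * (A + 0) := by
      have hs0 : Filter.Tendsto (fun k => ENNReal.ofReal (scale k)) Filter.atTop (nhds 0) := by
        simpa using ENNReal.tendsto_ofReal tendsto_scale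
      exact ge_of_tendsto' ((ENNReal.Tendsto.const_mul hs0 (Or.inr hAtop)).add
        (ENNReal.Tendsto.const_mul (hs0.const_add A) (Or.inr hCtop))) hε
    rw [mul_zero, zero_add, add_zero, sq] at hlim
    rcases eq_or_ne A 0 with h0 | h0
    · rw [h0]; exact zero_le
    · exact (ENNReal.mul_le_mul_iff_left h0 hAtop).1 hlim
  refine eLpNorm_le_of_tendsto (f := fun k x => χ k x * h x)
    (fun k => ((hχs k).continuous.mul hh).aestronglyMeasurable)
    (Filter.Eventually.of_forall fun x => ?_) hstep
  refine tendsto_const_nhds.congr' ?_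
  filter_upwards [Filter.eventually_ge_atTop ⌈‖x‖⌉₊] with k hk
  rw [hχR k x (Nat.ceil_le.1 hk), one_mul]

/-- `∫₀^y f' ∫₀^z X = ∫₀^y (f(y) - f) X`. -/
theorem integral_deriv_mul_primitive {f f' X : ℝ → ℝ} {y : ℝ} (hy : 0 ≤ y) (cf : Continuous f)
    (cf' : Continuous f') (cX : Continuous X) (hf : ∀ z, 0 < z → HasDerivAt f (f' z) z) :
    ∫ z in (0 : ℝ)..y, f' z * (∫ s in (0 : ℝ)..z, X s) = ∫ z in (0 : ℝ)..y, (f y - f z) * X z := by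
  have hp : ∀ z, HasDerivAt (fun z => ∫ s in (0 : ℝ)..z, X s) (X z) z := fun z =>
    intervalIntegral.integral_hasDerivAt_right (cX.intervalIntegrable _ _)
      (cX.stronglyMeasurableAtFilter _ _) cX.continuousAt
  have cp : Continuous fun z => ∫ s in (0 : ℝ)..z, X s :=
    continuous_iff_continuousAt.2 fun z => (hp z).continuousAt
  have h1 := intervalIntegral.integral_eq_sub_of_hasDerivAt_of_le hy
    -- Normalized to vanish at both ends: the first factor at y, the primitive at 0.
    (f := fun z => (f z - f y) * ∫ s in (0 : ℝ)..z, X s)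
    (f' := fun z => f' z * (∫ s in (0 : ℝ)..z, X s) + (f z - f y) * X z)
    (by fun_prop) (fun z hz => ((hf z hz.1).sub_const _).mul (hp z))
    (Continuous.intervalIntegrable (by fun_prop) _ _)
  rw [intervalIntegral.integral_add (Continuous.intervalIntegrable (by fun_prop) _ _)
    (Continuous.intervalIntegrable (by fun_prop) _ _)] at h1
  simp only [sub_self, zero_mul, intervalIntegral.integral_same, mul_zero] at h1
  rw [eq_neg_of_add_eq_zero_left h1, ← intervalIntegral.integral_neg]
  refine intervalIntegral.integral_congr fun z _ => ?_
  ring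

/-- A test function on the tangential space. -/
structure IsTest (φ : Tan n → ℝ) : Prop where
  smooth : ContDiff ℝ ∞ φ
  compact : HasCompactSupport φ

namespace IsTest

variable {φ : Tan n → ℝ}

theorem shift (h : IsTest φ) (c : Tan n) : IsTest fun x => φ (x + c) where
  smooth := h.smooth.comp (contDiff_id.add contDiff_const)
  compact := h.compact.comp_homeomorph (Homeomorph.addRight c)

theorem dir (h : IsTest φ) (c : Tan n) : IsTest fun x => fderiv ℝ φ x c where
  smooth := (h.smooth.fderiv_right (m := ∞) (by simp)).clm_apply contDiff_const
  compact := h.compact.fderiv_apply ℝ c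

theorem continuous (h : IsTest φ) : Continuous φ := h.smooth.continuous

theorem hasFDerivAt (h : IsTest φ) (x : Tan n) : HasFDerivAt φ (fderiv ℝ φ x) x :=
  ((h.smooth.differentiable (by simp)) x).hasFDerivAt

theorem continuous_fderiv (h : IsTest φ) : Continuous (fderiv ℝ φ) :=
  h.smooth.continuous_fderiv (by simp)

theorem fderiv_shift (c x : Tan n) : fderiv ℝ (fun x => φ (x + c)) x = fderiv ℝ φ (x + c) :=
  fderiv_comp_add_right c

/-- A ball outside of which small translates of the function and of its derivative vanish. -/
theorem exists_ball (h : IsTest φ) (r : ℝ) : ∃ R : ℝ, ∀ x c : Tan n, ‖c‖ ≤ r →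
    x ∉ Metric.closedBall (0 : Tan n) R → φ (x + c) = 0 ∧ fderiv ℝ φ (x + c) = 0 := by
  obtain ⟨R, hR⟩ := h.compact.isBounded.subset_closedBall (0 : Tan n)
  refine ⟨R + r, fun x c hc hx => ?_⟩
  have hnot : x + c ∉ tsupport φ := fun hm => by
    have h1 := hR hm
    rw [mem_closedBall_zero_iff] at h1 hx
    apply hx
    calc ‖x‖ = ‖(x + c) - c‖ := by simp
      _ ≤ ‖x + c‖ + ‖c‖ := norm_sub_le _ _
      _ ≤ R + r := add_le_add h1 hc
  refine ⟨image_eq_zero_of_notMem_tsupport hnot, ?_⟩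
  by_contra hne
  exact hnot (support_fderiv_subset ℝ hne)

theorem integrable_mul (h : IsTest φ) {f : Tan n → ℝ} (hf : Continuous f) :
    Integrable fun x => f x * φ x :=
  (hf.mul h.continuous).integrable_of_hasCompactSupport h.compact.mul_left

end IsTest

/-- Tangential integration by parts. -/
theorem integral_fderiv_mul {φ : Tan n → ℝ} (hφ : IsTest φ) {f : Tan n → ℝ}
    {f' : Tan n → (Tan n →L[ℝ] ℝ)} (hf : ∀ x, HasFDerivAt f (f' x) x) (cf' : Continuous f')
    (c : Tan n) : ∫ x, f x * fderiv ℝ φ x c = - ∫ x, f' x c * φ x := by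
  have h := integral_transport_eq hf hφ.hasFDerivAt cf' hφ.continuous_fderiv hφ.compact c
  simp only [mul_comm (f' _ c), h, neg_neg, mul_comm (f _)]

/-- The shift may be unbounded over the parameter space, so a common compact support is available
only near each parameter; continuity is local. -/
theorem continuous_pairing {P : Type*} [TopologicalSpace P] {φ : Tan n → ℝ} (hφ : IsTest φ)
    {f : P → Tan n → ℝ} {c : P → Tan n} (hf : Continuous (Function.uncurry f)) (hc : Continuous c) :
    Continuous fun p => ∫ x, f p x * φ (x + c p) := by
  refine continuous_iff_continuousAt.2 fun p₀ => ?_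
  obtain ⟨R, hR⟩ := hφ.exists_ball (‖c p₀‖ + 1)
  have hopen : IsOpen {p | ‖c p‖ < ‖c p₀‖ + 1} := isOpen_lt hc.norm continuous_const
  have hon : ContinuousOn (fun p => ∫ x, f p x * φ (x + c p)) {p | ‖c p‖ < ‖c p₀‖ + 1} := by
    refine continuousOn_integral_of_compact_support (isCompact_closedBall (0 : Tan n) R)
      (f := fun p x => f p x * φ (x + c p)) ?_ fun p x hp hx => by
        rw [(hR x (c p) (le_of_lt hp) hx).1, mul_zero]
    have := hφ.continuous
    have h2 : Continuous fun q : P × Tan n => φ (q.2 + c q.1) := by fun_prop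
    exact (hf.mul h2).continuousOn
  exact hon.continuousAt (hopen.mem_nhds (by simp))

/-- The weak form of the transport equation along `c`. -/
theorem integral_transport {φ : Tan n → ℝ} (hφ : IsTest φ) {q qt : ℝ → Tan n → ℝ}
    {qx : ℝ → Tan n → (Tan n →L[ℝ] ℝ)} (cq : Continuous (Function.uncurry q))
    (cqt : Continuous (Function.uncurry qt)) (cqx : Continuous (Function.uncurry qx))
    (ht : ∀ s x, 0 < s → HasDerivAt (fun s => q s x) (qt s x) s)
    (hx : ∀ s x, HasFDerivAt (q s) (qx s x) x) (c : Tan n) {t : ℝ} (h0 : 0 ≤ t) :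
    ∫ x, q t x * φ x = (∫ x, q 0 x * φ (x + t • c)) +
      ∫ s in (0 : ℝ)..t, ∫ x, (qt s x + qx s x c) * φ (x + (t - s) • c) := by
  have cφ := hφ.continuous
  have cφ' := hφ.continuous_fderiv
  obtain ⟨R, hR⟩ := hφ.exists_ball (t * ‖c‖)
  have hsupp : ∀ x, x ∉ Metric.closedBall (0 : Tan n) R → ∀ s ∈ uIcc 0 t,
      φ (x + (t - s) • c) = 0 ∧ fderiv ℝ φ (x + (t - s) • c) = 0 := by
    intro x hx s hs
    rw [uIcc_of_le h0] at hs
    refine hR x _ ?_ hx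
    rw [norm_smul, Real.norm_of_nonneg (by linarith [hs.2])]
    exact mul_le_mul_of_nonneg_right (by linarith [hs.1]) (norm_nonneg _)
  have cc : ∀ s, Continuous (q s) := fun s => cq.comp (by fun_prop : Continuous fun x => (s, x))
  -- The test function is carried backwards along the flow, so its derivative in s produces
  -- transport with the opposite sign. A tangential integration by parts moves it onto q.
  have hftc : ∀ x, q t x * φ x - q 0 x * φ (x + t • c) = ∫ s in (0 : ℝ)..t,
      (qt s x * φ (x + (t - s) • c) - q s x * fderiv ℝ φ (x + (t - s) • c) c) := by
    intro x
    have c1 : Continuous fun s => q s x := cq.comp (by fun_prop : Continuous fun s => (s, x))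
    have c2 : Continuous fun s => qt s x := cqt.comp (by fun_prop : Continuous fun s => (s, x))
    rw [intervalIntegral.integral_eq_sub_of_hasDerivAt_of_le h0
      (f := fun s => q s x * φ (x + (t - s) • c))]
    · simp
    · exact (by fun_prop : Continuous fun s => q s x * φ (x + (t - s) • c)).continuousOn
    · intro s hs
      have h1 : HasDerivAt (fun s : ℝ => x + (t - s) • c) (-c) s := by
        simpa using (((hasDerivAt_id s).const_sub t).smul_const c).const_add x
      have h2 := (hφ.hasFDerivAt (x + (t - s) • c)).comp_hasDerivAt s h1
      refine ((ht s x hs.1).mul h2).congr_deriv ?_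
      simp
      ring
    · exact Continuous.intervalIntegrable (by fun_prop) _ _
  have hi1 : Integrable fun x => q t x * φ x := hφ.integrable_mul (cc t)
  have hi2 : Integrable fun x => q 0 x * φ (x + t • c) := (hφ.shift (t • c)).integrable_mul (cc 0)
  rw [← sub_eq_iff_eq_add', ← integral_sub hi1 hi2, integral_congr_ae
    (Filter.Eventually.of_forall hftc)]
  rw [integral_interval_swap (isCompact_closedBall (0 : Tan n) R)
    (G := fun x s => qt s x * φ (x + (t - s) • c) - q s x * fderiv ℝ φ (x + (t - s) • c) c)]
  · refine intervalIntegral.integral_congr fun s _ => ?_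
    have cqts : Continuous (qt s) := cqt.comp (by fun_prop : Continuous fun x => (s, x))
    have cqxs : Continuous (qx s) := cqx.comp (by fun_prop : Continuous fun x => (s, x))
    have hφs := hφ.shift ((t - s) • c)
    have hibp := integral_fderiv_mul hφs (hx s) cqxs c
    simp only [IsTest.fderiv_shift] at hibp
    simp only [add_mul]
    have j1 := hφs.integrable_mul cqts
    have j2 : Integrable fun x => q s x * fderiv ℝ φ (x + (t - s) • c) c :=
      ((hφ.dir c).shift ((t - s) • c)).integrable_mul (cc s)
    have j3 : Integrable fun x => qx s x c * φ (x + (t - s) • c) :=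
      hφs.integrable_mul (cqxs.clm_apply continuous_const)
    rw [integral_sub j1 j2, integral_add j1 j3, hibp, sub_neg_eq_add]
  · have g1 : Continuous fun p : Tan n × ℝ => q p.2 p.1 :=
      cq.comp (by fun_prop : Continuous fun p : Tan n × ℝ => (p.2, p.1))
    have g2 : Continuous fun p : Tan n × ℝ => qt p.2 p.1 :=
      cqt.comp (by fun_prop : Continuous fun p : Tan n × ℝ => (p.2, p.1))
    have g3 : Continuous fun p : Tan n × ℝ => φ (p.1 + (t - p.2) • c) := by fun_prop
    have g4 : Continuous fun p : Tan n × ℝ => fderiv ℝ φ (p.1 + (t - p.2) • c) c := by fun_prop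
    exact (g2.mul g3).sub (g1.mul g4)
  · intro x hx s hs
    rw [(hsupp x hx s hs).1, (hsupp x hx s hs).2]
    simp

end

section

variable {n : ℕ}

/-! ### Weak formulas for the velocity -/

/-- A classical solution of the velocity equations, extended to all times and heights. -/
structure Vel (W W' : ℝ → Tan n) (u ut : ℝ → Tan n → ℝ → Tan n)
    (ux : ℝ → Tan n → ℝ → (Tan n →L[ℝ] Tan n)) (v vy θ θt : ℝ → Tan n → ℝ → ℝ)
    (θx : ℝ → Tan n → ℝ → (Tan n →L[ℝ] ℝ)) (θy θyy : ℝ → Tan n → ℝ → ℝ) : Prop where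
  cW : Continuous W
  cW' : Continuous W'
  hW : ∀ y, 0 < y → HasDerivAt W (W' y) y
  bddW : ∃ m, ∀ y, ‖W y‖ ≤ m
  reg : Reg θ θt θx θy θyy
  cu : Continuous fun p : ℝ × Tan n × ℝ => u p.1 p.2.1 p.2.2
  cut : Continuous fun p : ℝ × Tan n × ℝ => ut p.1 p.2.1 p.2.2
  cux : Continuous fun p : ℝ × Tan n × ℝ => ux p.1 p.2.1 p.2.2
  hut : ∀ t x y, 0 < t → HasDerivAt (fun s => u s x y) (ut t x y) t
  hux : ∀ t x y, HasFDerivAt (fun x' => u t x' y) (ux t x y) x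
  cv : Continuous fun p : ℝ × Tan n × ℝ => v p.1 p.2.1 p.2.2
  cvy : Continuous fun p : ℝ × Tan n × ℝ => vy p.1 p.2.1 p.2.2
  hvy : ∀ t x y, 0 < y → HasDerivAt (fun z => v t x z) (vy t x y) y
  v_zero : ∀ t x, v t x 0 = 0
  eq_u : ∀ t x y, ut t x y + ux t x y (W y) + v t x y • W' y = 0
  eq_θ : ∀ t x y, θt t x y + θx t x y (W y) = θyy t x y
  eq_div : ∀ t x y, ∑ j, ux t x y (ev j) j + vy t x y = θyy t x y

/-- The divergence of the tangential velocity. -/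
def trace (ux : ℝ → Tan n → ℝ → (Tan n →L[ℝ] Tan n)) (t : ℝ) (x : Tan n) (y : ℝ) : ℝ :=
  ∑ j, ux t x y (ev j) j

/-- The pairing of `∫₀ᵗ v(s, x - (t - s) W(y), y) ds` with a test function. -/
def duhamel (W : ℝ → Tan n) (v : ℝ → Tan n → ℝ → ℝ) (t y : ℝ) (φ : Tan n → ℝ) : ℝ :=
  ∫ s in (0 : ℝ)..t, ∫ x, v s x y * φ (x + (t - s) • W y)

/-- The integrand of the formula for `duhamel`. -/
def layer (W : ℝ → Tan n) (ux : ℝ → Tan n → ℝ → (Tan n →L[ℝ] Tan n)) (θ : ℝ → Tan n → ℝ → ℝ)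
    (t : ℝ) (φ : Tan n → ℝ) (z : ℝ) : ℝ :=
  (∫ x, θ t x z * φ x) - (∫ x, θ 0 x z * φ (x + t • W z)) -
    t * ∫ x, trace ux 0 x z * φ (x + t • W z)

section

variable {W W' : ℝ → Tan n} {u ut : ℝ → Tan n → ℝ → Tan n}
  {ux : ℝ → Tan n → ℝ → (Tan n →L[ℝ] Tan n)} {v vy θ θt : ℝ → Tan n → ℝ → ℝ}
  {θx : ℝ → Tan n → ℝ → (Tan n →L[ℝ] ℝ)} {θy θyy : ℝ → Tan n → ℝ → ℝ}
  {φ : Tan n → ℝ}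

theorem fderiv_eq_sum (φ : Tan n → ℝ) (x w : Tan n) :
    fderiv ℝ φ x w = ∑ k, w k * fderiv ℝ φ x (ev k) := clm_apply_eq_sum _ _

theorem continuous_trace (h : Continuous fun p : ℝ × Tan n × ℝ => ux p.1 p.2.1 p.2.2) :
    Continuous fun p : ℝ × Tan n × ℝ => trace ux p.1 p.2.1 p.2.2 := by
  unfold trace
  fun_prop

theorem continuous_at_point {F : Type*} [TopologicalSpace F] {f : ℝ → Tan n → ℝ → F}
    (hf : Continuous fun p : ℝ × Tan n × ℝ => f p.1 p.2.1 p.2.2) (t y : ℝ) :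
    Continuous fun x => f t x y :=
  hf.comp (by fun_prop : Continuous fun x : Tan n => (t, x, y))

theorem continuous_at_y {F : Type*} [TopologicalSpace F] {f : ℝ → Tan n → ℝ → F}
    (hf : Continuous fun p : ℝ × Tan n × ℝ => f p.1 p.2.1 p.2.2) (y : ℝ) :
    Continuous (Function.uncurry fun t x => f t x y) :=
  hf.comp (by fun_prop : Continuous fun p : ℝ × Tan n => (p.1, p.2, y))

theorem continuous_at_t {F : Type*} [TopologicalSpace F] {f : ℝ → Tan n → ℝ → F}
    (hf : Continuous fun p : ℝ × Tan n × ℝ => f p.1 p.2.1 p.2.2) (t : ℝ) :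
    Continuous (Function.uncurry fun z x => f t x z) :=
  hf.comp (by fun_prop : Continuous fun p : ℝ × Tan n => (t, p.2, p.1))

/-- Transport with source -v U'. At fixed height U' is constant and leaves both integrals. -/
theorem Vel.pairing_u (h : Vel W W' u ut ux v vy θ θt θx θy θyy)
    (hφ : IsTest φ) {t : ℝ} (ht : 0 ≤ t) (y : ℝ) (k : Fin n) :
    ∫ x, u t x y k * φ x = (∫ x, u 0 x y k * φ (x + t • W y)) - W' y k * duhamel W v t y φ := by
  have c1 := continuous_at_y h.cu y
  have c2 := continuous_at_y h.cut y
  have c3 := continuous_at_y h.cux y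
  have key := integral_transport hφ (q := fun s x => u s x y k) (qt := fun s x => ut s x y k)
    (qx := fun s x => (EuclideanSpace.proj (𝕜 := ℝ) k).comp (ux s x y))
    ((EuclideanSpace.proj (𝕜 := ℝ) k).continuous.comp c1)
    ((EuclideanSpace.proj (𝕜 := ℝ) k).continuous.comp c2)
    (continuous_const.clm_comp c3)
    (fun s x hs => hasDerivAt_coord (h.hut s x y hs) k)
    (fun s x => (EuclideanSpace.proj (𝕜 := ℝ) k).hasFDerivAt.comp x (h.hux s x y)) (W y) ht
  rw [key, sub_eq_add_neg, duhamel, ← intervalIntegral.integral_const_mul,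
    ← intervalIntegral.integral_neg]
  congr 1
  refine intervalIntegral.integral_congr fun s _ => ?_
  rw [← integral_const_mul, ← integral_neg]
  refine integral_congr_ae (Filter.Eventually.of_forall fun x => ?_)
  have he := congrArg (fun z : Tan n => z k) (h.eq_u s x y)
  simp only [PiLp.add_apply, PiLp.smul_apply, smul_eq_mul, PiLp.zero_apply] at he
  simp only [ContinuousLinearMap.comp_apply, PiLp.proj_apply]
  linear_combination φ (x + (t - s) • W y) * he

theorem Vel.pairing_div (h : Vel W W' u ut ux v vy θ θt θx θy θyy)
    (hφ : IsTest φ) (t y : ℝ) :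
    ∑ k, ∫ x, u t x y k * fderiv ℝ φ x (ev k) = - ∫ x, trace ux t x y * φ x := by
  have cx := continuous_at_point h.cux t y
  have hk : ∀ k : Fin n, ∫ x, u t x y k * fderiv ℝ φ x (ev k) = - ∫ x, ux t x y (ev k) k * φ x := by
    intro k
    exact integral_fderiv_mul hφ (f := fun x => u t x y k)
      (f' := fun x => (EuclideanSpace.proj (𝕜 := ℝ) k).comp (ux t x y))
      (fun x => (EuclideanSpace.proj (𝕜 := ℝ) k).hasFDerivAt.comp x (h.hux t x y))
      (continuous_const.clm_comp cx) (ev k)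
  rw [Finset.sum_congr rfl fun k _ => hk k, Finset.sum_neg_distrib, ← integral_finsetSum]
  · simp only [trace, Finset.sum_mul]
  · intro k _
    exact hφ.integrable_mul (by fun_prop)

/-- The equation for u cannot be differentiated, since ∇v need not exist. Testing the coordinates of
u against those of ∇φ gives the equation for the divergence in weak form. -/
theorem Vel.pairing_trace (h : Vel W W' u ut ux v vy θ θt θx θy θyy)
    (hφ : IsTest φ) {t : ℝ} (ht : 0 ≤ t) (y : ℝ) :
    ∫ x, trace ux t x y * φ x = (∫ x, trace ux 0 x y * φ (x + t • W y)) +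
      ∑ k, W' y k * duhamel W v t y (fun x => fderiv ℝ φ x (ev k)) := by
  have h1 := h.pairing_div hφ t y
  have h2 := h.pairing_div (hφ.shift (t • W y)) 0 y
  simp only [IsTest.fderiv_shift] at h2
  have h3 : ∀ k : Fin n, _ := fun k => h.pairing_u (hφ.dir (ev k)) ht y k
  rw [Finset.sum_congr rfl fun k _ => h3 k, Finset.sum_sub_distrib, h2] at h1
  linarith

theorem Vel.continuous_pairing_v (h : Vel W W' u ut ux v vy θ θt θx θy θyy)
    (hφ : IsTest φ) (y t : ℝ) :
    Continuous fun s => ∫ x, v s x y * φ (x + (t - s) • W y) :=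
  continuous_pairing hφ (continuous_at_y h.cv y) (by fun_prop)

/-- The sum over the coordinates in `pairing_trace`. -/
theorem Vel.sum_duhamel (h : Vel W W' u ut ux v vy θ θt θx θy θyy)
    (hφ : IsTest φ) (t y : ℝ) (w : Tan n) :
    ∑ k, w k * duhamel W v t y (fun x => fderiv ℝ φ x (ev k)) =
      duhamel W v t y (fun x => fderiv ℝ φ x w) := by
  unfold duhamel
  have hc : ∀ k : Fin n, Continuous fun s => ∫ x, v s x y * fderiv ℝ φ (x + (t - s) • W y) (ev k) :=
    fun k => h.continuous_pairing_v (hφ.dir (ev k)) y t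
  simp only [← intervalIntegral.integral_const_mul]
  rw [← intervalIntegral.integral_finsetSum fun k _ => ((hc k).const_mul _).intervalIntegrable _ _]
  refine intervalIntegral.integral_congr fun s _ => ?_
  simp only [← integral_const_mul]
  rw [← integral_finsetSum]
  · refine integral_congr_ae (Filter.Eventually.of_forall fun x => ?_)
    simp only
    rw [fderiv_eq_sum φ _ w, Finset.mul_sum]
    refine Finset.sum_congr rfl fun k _ => ?_
    ring
  · intro k _
    exact (((hφ.dir (ev k)).shift ((t - s) • W y)).integrable_mul
      (continuous_at_point h.cv s y)).const_mul _

/-- The time integral of the pairing with the divergence. -/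
theorem Vel.integral_trace (h : Vel W W' u ut ux v vy θ θt θx θy θyy)
    (hφ : IsTest φ) {t : ℝ} (ht : 0 ≤ t) (y : ℝ) :
    ∫ s in (0 : ℝ)..t, ∫ x, trace ux s x y * φ (x + (t - s) • W y) =
      t * (∫ x, trace ux 0 x y * φ (x + t • W y)) +
      ∫ s in (0 : ℝ)..t, (t - s) * ∫ x, v s x y * fderiv ℝ φ (x + (t - s) • W y) (W' y) := by
  have hb : Continuous fun s => ∫ x, v s x y * fderiv ℝ φ (x + (t - s) • W y) (W' y) :=
    h.continuous_pairing_v (hφ.dir (W' y)) y t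
  -- The shifts compose, s - σ and t - s giving t - σ, so the inner integrand no longer depends on
  -- s; the double time integral then collapses to the weight t - s.
  have hs : ∀ s ∈ uIcc 0 t, ∫ x, trace ux s x y * φ (x + (t - s) • W y) =
      (∫ x, trace ux 0 x y * φ (x + t • W y)) +
        1 * ∫ σ in (0 : ℝ)..s, ∫ x, v σ x y * fderiv ℝ φ (x + (t - σ) • W y) (W' y) := by
    intro s hs
    rw [uIcc_of_le ht] at hs
    rw [h.pairing_trace (hφ.shift ((t - s) • W y)) hs.1 y,
      h.sum_duhamel (hφ.shift ((t - s) • W y)), one_mul]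
    congr 1
    · refine integral_congr_ae (Filter.Eventually.of_forall fun x => ?_)
      simp only
      rw [show x + s • W y + (t - s) • W y = x + t • W y by module]
    · unfold duhamel
      refine intervalIntegral.integral_congr fun σ _ => ?_
      refine integral_congr_ae (Filter.Eventually.of_forall fun x => ?_)
      simp only [IsTest.fderiv_shift]
      rw [show x + (s - σ) • W y + (t - s) • W y = x + (t - σ) • W y by module]
  rw [intervalIntegral.integral_congr hs, intervalIntegral.integral_add intervalIntegrable_const,
    intervalIntegral.integral_const, sub_zero, smul_eq_mul]
  · congr 1
    exact integral_deriv_mul_primitive ht continuous_id continuous_const hb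
      fun z _ => hasDerivAt_id z
  · refine Continuous.intervalIntegrable ?_ _ _
    exact continuous_const.mul (intervalIntegral.continuous_primitive
      (fun a b => hb.intervalIntegrable a b) 0)

/-- The derivative in the height of the pairing `duhamel`. -/
theorem Vel.integral_layer (h : Vel W W' u ut ux v vy θ θt θx θy θyy)
    (hφ : IsTest φ) {t : ℝ} (ht : 0 ≤ t) (z : ℝ) :
    ∫ s in (0 : ℝ)..t, ∫ x, (vy s x z * φ (x + (t - s) • W z) +
      (t - s) * (v s x z * fderiv ℝ φ (x + (t - s) • W z) (W' z))) = layer W ux θ t φ z := by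
  have hcs : Continuous fun s : ℝ => (t - s) • W z := by fun_prop
  have ctr := continuous_trace h.cux
  have cθ : Continuous fun s => ∫ x, θyy s x z * φ (x + (t - s) • W z) :=
    continuous_pairing hφ (continuous_at_y h.reg.cyy z) hcs
  have cd : Continuous fun s => ∫ x, trace ux s x z * φ (x + (t - s) • W z) :=
    continuous_pairing hφ (continuous_at_y ctr z) hcs
  have cb : Continuous fun s => ∫ x, v s x z * fderiv ℝ φ (x + (t - s) • W z) (W' z) :=
    h.continuous_pairing_v (hφ.dir (W' z)) z t
  have e1 : ∀ s, ∫ x, (vy s x z * φ (x + (t - s) • W z) +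
      (t - s) * (v s x z * fderiv ℝ φ (x + (t - s) • W z) (W' z))) =
      (∫ x, θyy s x z * φ (x + (t - s) • W z)) - (∫ x, trace ux s x z * φ (x + (t - s) • W z)) +
      (t - s) * ∫ x, v s x z * fderiv ℝ φ (x + (t - s) • W z) (W' z) := by
    intro s
    have hφs := hφ.shift ((t - s) • W z)
    have i1 := hφs.integrable_mul (continuous_at_point h.reg.cyy s z)
    have i2 := hφs.integrable_mul (continuous_at_point ctr s z)
    have i3 : Integrable fun x => v s x z * fderiv ℝ φ (x + (t - s) • W z) (W' z) :=
      ((hφ.dir (W' z)).shift ((t - s) • W z)).integrable_mul (continuous_at_point h.cv s z)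
    have i12 : Integrable fun x => θyy s x z * φ (x + (t - s) • W z) -
        trace ux s x z * φ (x + (t - s) • W z) := i1.sub i2
    rw [← integral_const_mul, ← integral_sub i1 i2, ← integral_add i12 (i3.const_mul _)]
    refine integral_congr_ae (Filter.Eventually.of_forall fun x => ?_)
    have he : vy s x z = θyy s x z - trace ux s x z := by
      have := h.eq_div s x z
      unfold trace
      linarith
    simp only [he]
    ring
  -- ∂_y² θ is the derivative of θ along the flow, so its time integral along characteristics is
  -- exact. The remaining terms with v ∇φ · U' cancel against those from the divergence, which is
  -- why no tangential derivative is lost.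
  have hθ := integral_transport hφ (continuous_at_y h.reg.c z) (continuous_at_y h.reg.ct z)
    (continuous_at_y h.reg.cx z) (fun s x hs => h.reg.ht s x z hs) (fun s x => h.reg.hx s x z)
    (W z) ht
  simp only [h.eq_θ] at hθ
  have cθd : Continuous fun s => (∫ x, θyy s x z * φ (x + (t - s) • W z)) -
      ∫ x, trace ux s x z * φ (x + (t - s) • W z) := cθ.sub cd
  rw [intervalIntegral.integral_congr fun s _ => e1 s, intervalIntegral.integral_add
    (cθd.intervalIntegrable _ _) (Continuous.intervalIntegrable (by fun_prop) _ _),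
    intervalIntegral.integral_sub (cθ.intervalIntegrable _ _) (cd.intervalIntegrable _ _),
    h.integral_trace hφ ht, layer, hθ]
  ring

theorem Vel.continuous_layer (h : Vel W W' u ut ux v vy θ θt θx θy θyy)
    (hφ : IsTest φ) (t : ℝ) : Continuous (layer W ux θ t φ) := by
  have hcW := h.cW
  have hc : Continuous fun z : ℝ => t • W z := by fun_prop
  have c1 : Continuous fun z => ∫ x, θ t x z * φ (x + (0 : Tan n)) :=
    continuous_pairing hφ (continuous_at_t h.reg.c t) continuous_const
  simp only [add_zero] at c1
  have c2 : Continuous fun z => ∫ x, θ 0 x z * φ (x + t • W z) :=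
    continuous_pairing hφ (continuous_at_t h.reg.c 0) hc
  have c3 : Continuous fun z => ∫ x, trace ux 0 x z * φ (x + t • W z) :=
    continuous_pairing hφ (continuous_at_t (continuous_trace h.cux) 0) hc
  exact (c1.sub c2).sub (c3.const_mul t)

/-- v vanishes at the boundary, so the pairing is the integral of its derivative in height, which
`Vel.integral_layer` expresses without v. -/
theorem Vel.duhamel_eq (h : Vel W W' u ut ux v vy θ θt θx θy θyy)
    (hφ : IsTest φ) {t y : ℝ} (ht : 0 ≤ t) (hy : 0 ≤ y) :
    duhamel W v t y φ = ∫ z in (0 : ℝ)..y, layer W ux θ t φ z := by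
  have hcW := h.cW
  have hcW' := h.cW'
  have cφ := hφ.continuous
  have cφ' := hφ.continuous_fderiv
  obtain ⟨m, hm⟩ := h.bddW
  have hftc : ∀ s x, v s x y * φ (x + (t - s) • W y) = ∫ z in (0 : ℝ)..y,
      (vy s x z * φ (x + (t - s) • W z) +
        (t - s) * (v s x z * fderiv ℝ φ (x + (t - s) • W z) (W' z))) := by
    intro s x
    have hl : Continuous fun z : ℝ => (s, x, z) := by fun_prop
    have c1 : Continuous fun z => v s x z := h.cv.comp hl
    have c2 : Continuous fun z => vy s x z := h.cvy.comp hl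
    rw [intervalIntegral.integral_eq_sub_of_hasDerivAt_of_le hy
      (f := fun z => v s x z * φ (x + (t - s) • W z))]
    · simp [h.v_zero]
    · exact (by fun_prop : Continuous fun z => v s x z * φ (x + (t - s) • W z)).continuousOn
    · intro z hz
      have h1 : HasDerivAt (fun z : ℝ => x + (t - s) • W z) ((t - s) • W' z) z :=
        ((h.hW z hz.1).const_smul (t - s)).const_add x
      have h2 := (hφ.hasFDerivAt (x + (t - s) • W z)).comp_hasDerivAt z h1
      refine ((h.hvy s x z hz.1).mul h2).congr_deriv ?_
      simp only [map_smul, smul_eq_mul, Function.comp_apply]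
      ring
    · exact Continuous.intervalIntegrable (by fun_prop) _ _
  have cg : Continuous fun q : ℝ × Tan n × ℝ =>
      vy q.1 q.2.1 q.2.2 * φ (q.2.1 + (t - q.1) • W q.2.2) +
        (t - q.1) * (v q.1 q.2.1 q.2.2 * fderiv ℝ φ (q.2.1 + (t - q.1) • W q.2.2) (W' q.2.2)) := by
    have c1 := h.cv
    have c2 := h.cvy
    fun_prop
  have hinner : ∀ s, ∫ x, v s x y * φ (x + (t - s) • W y) = ∫ z in (0 : ℝ)..y, ∫ x,
      (vy s x z * φ (x + (t - s) • W z) +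
        (t - s) * (v s x z * fderiv ℝ φ (x + (t - s) • W z) (W' z))) := by
    intro s
    obtain ⟨R, hR⟩ := hφ.exists_ball (|t - s| * m)
    rw [integral_congr_ae (Filter.Eventually.of_forall (hftc s))]
    refine integral_interval_swap (isCompact_closedBall (0 : Tan n) R)
      (G := fun x z => vy s x z * φ (x + (t - s) • W z) +
        (t - s) * (v s x z * fderiv ℝ φ (x + (t - s) • W z) (W' z))) ?_ ?_
    · exact cg.comp (by fun_prop : Continuous fun p : Tan n × ℝ => (s, p.1, p.2))
    · intro x hx z _
      have h1 := hR x ((t - s) • W z) (by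
        rw [norm_smul, Real.norm_eq_abs]
        exact mul_le_mul_of_nonneg_left (hm z) (abs_nonneg _)) hx
      rw [h1.1, h1.2]
      simp
  unfold duhamel
  rw [intervalIntegral.integral_congr fun s _ => hinner s, intervalIntegral_intervalIntegral_swap]
  · exact intervalIntegral.integral_congr fun z _ => h.integral_layer hφ ht z
  · have hcs : Continuous fun p : ℝ × ℝ => (t - p.1) • W p.2 := by fun_prop
    have hl : Continuous fun p : (ℝ × ℝ) × Tan n => (p.1.1, p.2, p.1.2) := by fun_prop
    have i1 : Continuous fun p : ℝ × ℝ => ∫ x, vy p.1 x p.2 * φ (x + (t - p.1) • W p.2) :=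
      continuous_pairing (f := fun (p : ℝ × ℝ) x => vy p.1 x p.2) hφ (h.cvy.comp hl) hcs
    have i2 : ∀ k : Fin n, Continuous fun p : ℝ × ℝ =>
        ∫ x, v p.1 x p.2 * fderiv ℝ φ (x + (t - p.1) • W p.2) (ev k) := fun k =>
      continuous_pairing (f := fun (p : ℝ × ℝ) x => v p.1 x p.2) (hφ.dir (ev k)) (h.cv.comp hl) hcs
    -- The direction U'(z) varies with z, so joint continuity is checked after expansion along fixed
    -- coordinate directions.
    have e : (Function.uncurry fun s z => ∫ x, (vy s x z * φ (x + (t - s) • W z) +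
        (t - s) * (v s x z * fderiv ℝ φ (x + (t - s) • W z) (W' z)))) = fun p : ℝ × ℝ =>
        (∫ x, vy p.1 x p.2 * φ (x + (t - p.1) • W p.2)) + (t - p.1) * ∑ k, W' p.2 k *
          ∫ x, v p.1 x p.2 * fderiv ℝ φ (x + (t - p.1) • W p.2) (ev k) := by
      funext p
      obtain ⟨s, z⟩ := p
      have j1 := (hφ.shift ((t - s) • W z)).integrable_mul (continuous_at_point h.cvy s z)
      have j2 : ∀ k : Fin n, Integrable fun x =>
          v s x z * fderiv ℝ φ (x + (t - s) • W z) (ev k) := fun k =>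
        ((hφ.dir (ev k)).shift ((t - s) • W z)).integrable_mul (continuous_at_point h.cv s z)
      have j3 : Integrable fun x => v s x z * fderiv ℝ φ (x + (t - s) • W z) (W' z) :=
        ((hφ.dir (W' z)).shift ((t - s) • W z)).integrable_mul (continuous_at_point h.cv s z)
      simp only [Function.uncurry_apply_pair]
      rw [integral_add j1 (j3.const_mul _), integral_const_mul]
      congr 2
      simp only [← integral_const_mul]
      rw [← integral_finsetSum _ fun k _ => (j2 k).const_mul _]
      refine integral_congr_ae (Filter.Eventually.of_forall fun x => ?_)
      simp only
      rw [fderiv_eq_sum φ _ (W' z), Finset.mul_sum]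
      refine Finset.sum_congr rfl fun k _ => ?_
      ring
    have hcont : Continuous fun p : ℝ × ℝ =>
        (∫ x, vy p.1 x p.2 * φ (x + (t - p.1) • W p.2)) + (t - p.1) * ∑ k, W' p.2 k *
          ∫ x, v p.1 x p.2 * fderiv ℝ φ (x + (t - p.1) • W p.2) (ev k) := by
      refine i1.add ((by fun_prop : Continuous fun p : ℝ × ℝ => t - p.1).mul
        (continuous_finsetSum _ fun k _ => ?_))
      exact (by fun_prop : Continuous fun p : ℝ × ℝ => W' p.2 k).mul (i2 k)
    rw [e]
    exact (hcont.continuousOn.integrableOn_compact (isCompact_uIcc.prod isCompact_uIcc)).mono_set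
      (prod_mono uIoc_subset_uIcc uIoc_subset_uIcc)

/-- The weak formula for the normal velocity. -/
theorem Vel.pairing_v (h : Vel W W' u ut ux v vy θ θt θx θy θyy)
    (hφ : IsTest φ) {t y : ℝ} (ht : 0 ≤ t) (hy : 0 ≤ y) :
    ∫ x, v t x y * φ x = (∫ x, θy t x y * φ x) - (∫ x, θy t x 0 * φ x) -
      (∫ z in (0 : ℝ)..y, ∫ x, trace ux 0 x z * φ (x + t • W z)) -
      ∑ k, ∫ z in (0 : ℝ)..y, (W y k - W z k) * layer W ux θ t (fun x => fderiv ℝ φ x (ev k)) z := by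
  have hcW := h.cW
  have hcW' := h.cW'
  have ctr := continuous_trace h.cux
  have swap : ∀ f : ℝ → Tan n → ℝ → ℝ, Continuous (fun p : ℝ × Tan n × ℝ => f p.1 p.2.1 p.2.2) →
      ∫ x, (∫ z in (0 : ℝ)..y, f t x z * φ x) = ∫ z in (0 : ℝ)..y, ∫ x, f t x z * φ x := by
    intro f hf
    refine integral_interval_swap hφ.compact (G := fun x z => f t x z * φ x) ?_ ?_
    · have c1 : Continuous fun p : Tan n × ℝ => f t p.1 p.2 := continuous_slice hf t
      have c2 := hφ.continuous
      exact c1.mul (c2.comp continuous_fst)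
    · intro x hx z _
      rw [image_eq_zero_of_notMem_tsupport hx, mul_zero]
  have ftc : ∀ f f' : ℝ → Tan n → ℝ → ℝ, Continuous (fun p : ℝ × Tan n × ℝ => f p.1 p.2.1 p.2.2) →
      Continuous (fun p : ℝ × Tan n × ℝ => f' p.1 p.2.1 p.2.2) →
      (∀ x z, 0 < z → HasDerivAt (fun z => f t x z) (f' t x z) z) →
      (∫ x, f t x y * φ x) - (∫ x, f t x 0 * φ x) = ∫ z in (0 : ℝ)..y, ∫ x, f' t x z * φ x := by
    intro f f' hf hf' hd
    rw [← swap f' hf', ← integral_sub (hφ.integrable_mul (continuous_at_point hf t y))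
      (hφ.integrable_mul (continuous_at_point hf t 0))]
    refine integral_congr_ae (Filter.Eventually.of_forall fun x => ?_)
    have hl : Continuous fun z : ℝ => (t, x, z) := by fun_prop
    have c1 : Continuous fun z => f t x z := hf.comp hl
    have c2 : Continuous fun z => f' t x z := hf'.comp hl
    simp only
    rw [intervalIntegral.integral_mul_const, intervalIntegral.integral_eq_sub_of_hasDerivAt_of_le hy
      c1.continuousOn (fun z hz => hd x z hz.1) (c2.intervalIntegrable _ _)]
    ring
  have h1 := ftc v vy h.cv h.cvy (fun x z hz => h.hvy t x z hz)
  have h2 := ftc θy θyy h.reg.cy h.reg.cyy (fun x z hz => h.reg.hyy t x z hz)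
  simp only [h.v_zero, zero_mul, integral_zero, sub_zero] at h1
  have cφ0 : ∀ f : ℝ → Tan n → ℝ → ℝ, Continuous (fun p : ℝ × Tan n × ℝ => f p.1 p.2.1 p.2.2) →
      Continuous fun z => ∫ x, f t x z * φ x := fun f hf => by
    have := continuous_pairing hφ (continuous_at_t hf t) (continuous_const (y := (0 : Tan n)))
    simpa only [add_zero] using this
  have ctr0 : Continuous fun z => ∫ x, trace ux 0 x z * φ (x + t • W z) :=
    continuous_pairing hφ (continuous_at_t ctr 0) (by fun_prop)
  have cX : ∀ k : Fin n, Continuous (layer W ux θ t (fun x => fderiv ℝ φ x (ev k))) :=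
    fun k => h.continuous_layer (hφ.dir (ev k)) t
  have cprim : ∀ k : Fin n, Continuous fun z => W' z k *
      ∫ s in (0 : ℝ)..z, layer W ux θ t (fun x => fderiv ℝ φ x (ev k)) s := fun k =>
    (by fun_prop : Continuous fun z => W' z k).mul
      (intervalIntegral.continuous_primitive (fun a b => (cX k).intervalIntegrable a b) 0)
  -- Each U'_k(z) now multiplies a primitive in z. Integration by parts in height turns it into
  -- U_k(y) - U_k(z), and no derivative of U remains in the estimate.
  have e : ∀ z ∈ uIcc 0 y, ∫ x, vy t x z * φ x = (∫ x, θyy t x z * φ x) -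
      ((∫ x, trace ux 0 x z * φ (x + t • W z)) + ∑ k, W' z k *
        ∫ s in (0 : ℝ)..z, layer W ux θ t (fun x => fderiv ℝ φ x (ev k)) s) := by
    intro z hz
    rw [uIcc_of_le hy] at hz
    have h3 := h.pairing_trace hφ ht z
    rw [Finset.sum_congr rfl fun k _ => by rw [h.duhamel_eq (hφ.dir (ev k)) ht hz.1]] at h3
    rw [← h3, ← integral_sub (hφ.integrable_mul (continuous_at_point h.reg.cyy t z))
      (hφ.integrable_mul (continuous_at_point ctr t z))]
    refine integral_congr_ae (Filter.Eventually.of_forall fun x => ?_)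
    have he : vy t x z = θyy t x z - trace ux t x z := by
      have := h.eq_div t x z
      unfold trace
      linarith
    simp only [he]
    ring
  have csum : Continuous fun z => ∑ k, W' z k *
      ∫ s in (0 : ℝ)..z, layer W ux θ t (fun x => fderiv ℝ φ x (ev k)) s :=
    continuous_finsetSum _ fun k _ => cprim k
  have cadd : Continuous fun z => (∫ x, trace ux 0 x z * φ (x + t • W z)) + ∑ k, W' z k *
      ∫ s in (0 : ℝ)..z, layer W ux θ t (fun x => fderiv ℝ φ x (ev k)) s := ctr0.add csum
  rw [h1, intervalIntegral.integral_congr e, intervalIntegral.integral_sub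
    ((cφ0 θyy h.reg.cyy).intervalIntegrable _ _)
    (cadd.intervalIntegrable _ _),
    intervalIntegral.integral_add (ctr0.intervalIntegrable _ _)
    (csum.intervalIntegrable _ _), ← h2,
    intervalIntegral.integral_finsetSum fun k _ => (cprim k).intervalIntegrable _ _,
    Finset.sum_congr rfl fun k _ => integral_deriv_mul_primitive (f := fun z => W z k)
      (f' := fun z => W' z k) hy (by fun_prop) (by fun_prop) (cX k)
      fun z hz => hasDerivAt_coord (h.hW z hz) k]
  ring

end

end

section

variable {n : ℕ}

/-! ### Estimates of the velocity -/

theorem enorm_intervalIntegral_le {f : ℝ → ℝ} {y : ℝ} (hy : 0 ≤ y) :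
    ‖∫ z in (0 : ℝ)..y, f z‖ₑ ≤ ∫⁻ z in Ioo 0 y, ‖f z‖ₑ := by
  rw [intervalIntegral.integral_of_le hy, setLIntegral_congr Ioo_ae_eq_Ioc]
  exact enorm_integral_le_lintegral_enorm _

theorem measurable_sliceNorm {F : Type*} [NormedAddCommGroup F] [NormedSpace ℝ F]
    {f : Tan n → ℝ → F} (hf : Continuous fun p : Tan n × ℝ => f p.1 p.2) :
    Measurable (sliceNorm f) := by
  have e : sliceNorm f = fun z => (∫⁻ x, ‖f x z‖ₑ ^ 2) ^ (1 / 2 : ℝ) := by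
    funext z
    rw [← eLpNorm_two_sq, ← ENNReal.rpow_natCast, ← ENNReal.rpow_mul]
    simp [sliceNorm]
  rw [e]
  exact (Measurable.lintegral_prod_left' (f := fun p : Tan n × ℝ => ‖f p.1 p.2‖ₑ ^ 2)
    (hf.enorm.measurable.pow_const 2)).pow_const _

/-- Cauchy–Schwarz in the normal variable. -/
theorem lintegral_mul_sliceNorm_le {F : Type*} [NormedAddCommGroup F] [NormedSpace ℝ F]
    {f : Tan n → ℝ → F} (hf : Continuous fun p : Tan n × ℝ => f p.1 p.2) {c : ℝ → ℝ≥0∞}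
    (hc : Measurable c) (y : ℝ) :
    ∫⁻ z in Ioo 0 y, c z * sliceNorm f z ≤
      (∫⁻ z in Ioo 0 y, c z ^ 2) ^ (1 / 2 : ℝ) * normL2 f := by
  rw [← ENNReal.pow_le_pow_left_iff two_ne_zero, mul_pow]
  refine (sq_lintegral_mul_le _ hc.aemeasurable (measurable_sliceNorm hf).aemeasurable).trans
    (mul_le_mul' (le_of_eq ?_) ?_)
  · rw [← ENNReal.rpow_natCast, ← ENNReal.rpow_mul]
    simp
  · refine (lintegral_mono_set Ioo_subset_Ioi_self).trans (le_of_eq ?_)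
    unfold sliceNorm normL2
    simp only [eLpNorm_two_sq]
    rw [restrict_halfSpace, lintegral_prod_symm _ (hf.enorm.measurable.pow_const 2).aemeasurable]

theorem eLpNorm_apply_le {X : Type*} [MeasurableSpace X] {μ : Measure X} (L : X → (Tan n →L[ℝ] ℝ))
    (w : Tan n) : eLpNorm (fun x => L x w) 2 μ ≤ ‖w‖ₑ * eLpNorm L 2 μ := by
  rw [← ofReal_norm]
  exact eLpNorm_le_mul_eLpNorm_of_ae_le_mul (Filter.Eventually.of_forall fun x => by
    rw [mul_comm]
    exact (L x).le_opNorm w) 2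

theorem IsTest.aestronglyMeasurable {φ : Tan n → ℝ} (h : IsTest φ) :
    AEStronglyMeasurable φ volume := h.continuous.aestronglyMeasurable

theorem IsTest.eLpNorm_shift {φ : Tan n → ℝ} (h : IsTest φ) (c : Tan n) :
    eLpNorm (fun x => φ (x + c)) 2 volume = eLpNorm φ 2 volume :=
  eLpNorm_comp_measurePreserving h.aestronglyMeasurable (measurePreserving_add_right volume c)

theorem IsTest.eLpNorm_ne_top {φ : Tan n → ℝ} (h : IsTest φ) : eLpNorm φ 2 volume ≠ ⊤ :=
  (h.continuous.memLp_of_hasCompactSupport h.compact).2.ne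

theorem enorm_pairing_le {φ f : Tan n → ℝ} (hφ : IsTest φ) (hf : Continuous f) (c : Tan n) :
    ‖∫ x, f x * φ (x + c)‖ₑ ≤ eLpNorm f 2 volume * eLpNorm φ 2 volume := by
  rw [← hφ.eLpNorm_shift c]
  exact enorm_integral_mul_le hf.aestronglyMeasurable (hφ.shift c).aestronglyMeasurable

/-- A directional derivative of a test function, paired with a differentiable function. -/
theorem enorm_pairing_fderiv_le {φ f : Tan n → ℝ} {f' : Tan n → (Tan n →L[ℝ] ℝ)} (hφ : IsTest φ)
    (hf : ∀ x, HasFDerivAt f (f' x) x) (cf' : Continuous f') (c w : Tan n) :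
    ‖∫ x, f x * fderiv ℝ φ (x + c) w‖ₑ ≤ ‖w‖ₑ * eLpNorm f' 2 volume * eLpNorm φ 2 volume := by
  have h1 := integral_fderiv_mul (hφ.shift c) hf cf' w
  simp only [IsTest.fderiv_shift] at h1
  rw [h1, enorm_neg]
  exact (enorm_pairing_le hφ (by fun_prop : Continuous fun x => f' x w) c).trans
    (mul_le_mul' (eLpNorm_apply_le _ _) le_rfl)

theorem fderiv_apply_eq_inner (φ : Tan n → ℝ) (x w : Tan n) :
    fderiv ℝ φ x w = inner ℝ w (gradient φ x) := by
  rw [real_inner_comm, gradient, InnerProductSpace.toDual_symm_apply]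

/-- A directional derivative of a test function, paired with a function with a weak gradient. -/
theorem IsWeakGrad.enorm_pairing_le {φ f : Tan n → ℝ} {G : Tan n → Tan n} (hG : IsWeakGrad f G)
    (hf : Continuous f) (hφ : IsTest φ) (w : Tan n) :
    ‖∫ x, f x * fderiv ℝ φ x w‖ₑ ≤ ‖w‖ₑ * eLpNorm G 2 volume * eLpNorm φ 2 volume := by
  have cg : Continuous (gradient φ) :=
    (InnerProductSpace.toDual ℝ (Tan n)).symm.continuous.comp hφ.continuous_fderiv
  have hgs : HasCompactSupport (gradient φ) :=
    (hφ.compact.fderiv (𝕜 := ℝ)).comp_left (map_zero _)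
  have i1 : Integrable fun x => f x • gradient φ x :=
    (hf.smul cg).integrable_of_hasCompactSupport hgs.smul_left
  have i2 : Integrable fun x => φ x • G x :=
    hG.2.1.integrable_smul_left_of_hasCompactSupport hφ.continuous hφ.compact
  have e : ∫ x, f x * fderiv ℝ φ x w = - ∫ x, inner ℝ w (G x) * φ x := by
    calc ∫ x, f x * fderiv ℝ φ x w = ∫ x, inner ℝ w (f x • gradient φ x) := by
          simp only [fderiv_apply_eq_inner, real_inner_smul_right]
      _ = - ∫ x, inner ℝ w (φ x • G x) := by
          rw [integral_inner i1, hG.2.2 φ hφ.smooth hφ.compact, inner_neg_right, integral_inner i2]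
      _ = _ := by simp only [real_inner_smul_right, mul_comm]
  have hGm := hG.2.1.aestronglyMeasurable
  rw [e, enorm_neg]
  refine (enorm_integral_mul_le (hGm.const_inner) hφ.aestronglyMeasurable).trans
    (mul_le_mul' ?_ le_rfl)
  rw [← ofReal_norm]
  exact eLpNorm_le_mul_eLpNorm_of_ae_le_mul
    (Filter.Eventually.of_forall fun x => norm_inner_le_norm w (G x)) 2

/-- The bound holds for each weak gradient and then for the infimum. The infimum may be infinite,
and a factor passes through it safely only if it is neither 0 nor infinite; w = 0 is therefore
treated apart and φ is assumed nonzero. -/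
theorem enorm_pairing_le_sliceGradNorm {φ : Tan n → ℝ} {d : Tan n → ℝ → ℝ} {z : ℝ} (hφ : IsTest φ)
    (hd : Continuous fun x => d x z) (h0 : eLpNorm φ 2 volume ≠ 0) (c w : Tan n) :
    ‖∫ x, d x z * fderiv ℝ φ (x + c) w‖ₑ ≤ ‖w‖ₑ * sliceGradNorm d z * eLpNorm φ 2 volume := by
  rcases eq_or_ne w 0 with rfl | hw
  · simp
  have hw' : ‖w‖ₑ ≠ 0 := by simpa using hw
  have htop := hφ.eLpNorm_ne_top
  rw [mul_right_comm]
  unfold sliceGradNorm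
  have hne0 : ‖w‖ₑ * eLpNorm φ 2 volume ≠ 0 := mul_ne_zero hw' h0
  have hnetop : ‖w‖ₑ * eLpNorm φ 2 volume ≠ ⊤ := ENNReal.mul_ne_top enorm_ne_top htop
  rw [ENNReal.mul_iInf_of_ne hne0 hnetop]
  refine le_iInf fun G => ?_
  rw [ENNReal.mul_iInf_of_ne hne0 hnetop]
  refine le_iInf fun hG => ?_
  have h1 := hG.enorm_pairing_le hd (hφ.shift c) w
  simp only [IsTest.fderiv_shift, hφ.eLpNorm_shift] at h1
  rwa [mul_right_comm]

section

variable {W W' : ℝ → Tan n} {u ut : ℝ → Tan n → ℝ → Tan n}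
  {ux : ℝ → Tan n → ℝ → (Tan n →L[ℝ] Tan n)} {v vy θ θt : ℝ → Tan n → ℝ → ℝ}
  {θx : ℝ → Tan n → ℝ → (Tan n →L[ℝ] ℝ)} {θy θyy : ℝ → Tan n → ℝ → ℝ}
  {φ : Tan n → ℝ}

theorem Vel.enorm_duhamel_le (h : Vel W W' u ut ux v vy θ θt θx θy θyy) (hφ : IsTest φ) {t y : ℝ}
    (ht : 0 ≤ t) (hy : 0 ≤ y) :
    ‖duhamel W v t y φ‖ₑ ≤ ((∫⁻ z in Ioo 0 y, sliceNorm (θ t) z) +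
      (∫⁻ z in Ioo 0 y, sliceNorm (θ 0) z) +
      ENNReal.ofReal t * ∫⁻ z in Ioo 0 y, sliceNorm (trace ux 0) z) * eLpNorm φ 2 volume := by
  have ctr := continuous_trace h.cux
  have m1 := measurable_sliceNorm (continuous_slice h.reg.c t)
  have m12 : Measurable fun z => sliceNorm (θ t) z + sliceNorm (θ 0) z :=
    m1.add (measurable_sliceNorm (continuous_slice h.reg.c 0))
  have hl : ∀ z, ‖layer W ux θ t φ z‖ₑ ≤ (sliceNorm (θ t) z + sliceNorm (θ 0) z +
      ENNReal.ofReal t * sliceNorm (trace ux 0) z) * eLpNorm φ 2 volume := by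
    intro z
    have h1 := enorm_pairing_le hφ (continuous_at_point h.reg.c t z) 0
    simp only [add_zero] at h1
    have h2 := enorm_pairing_le hφ (continuous_at_point h.reg.c 0 z) (t • W z)
    have h3 := enorm_pairing_le hφ (continuous_at_point ctr 0 z) (t • W z)
    unfold layer
    refine (enorm_sub_le).trans ?_
    rw [add_mul, add_mul]
    refine add_le_add (enorm_sub_le.trans (add_le_add h1 h2)) ?_
    rw [enorm_mul, Real.enorm_eq_ofReal ht, mul_assoc]
    exact mul_le_mul' le_rfl h3
  rw [h.duhamel_eq hφ ht hy]
  refine (enorm_intervalIntegral_le hy).trans ((lintegral_mono hl).trans (le_of_eq ?_))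
  rw [lintegral_mul_const' _ _ hφ.eLpNorm_ne_top, lintegral_add_left m12,
    lintegral_add_left m1, lintegral_const_mul' _ _ ENNReal.ofReal_ne_top]

/-- The function `∫₀ᵗ v(s, x - (t - s) W(y), y) ds`. -/
theorem Vel.exists_duhamel (h : Vel W W' u ut ux v vy θ θt θx θy θyy) (t y : ℝ) :
    ∃ η : Tan n → ℝ, Continuous η ∧
      ∀ φ, IsTest φ → ∫ x, η x * φ x = duhamel W v t y φ := by
  have cG : Continuous (Function.uncurry fun (x : Tan n) s => v s (x - (t - s) • W y) y) :=
    h.cv.comp (by fun_prop : Continuous fun p : Tan n × ℝ => (p.2, p.1 - (t - p.2) • W y, y))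
  refine ⟨fun x => ∫ s in (0 : ℝ)..t, v s (x - (t - s) • W y) y,
    intervalIntegral.continuous_parametric_intervalIntegral_of_continuous' cG 0 t, fun φ hφ => ?_⟩
  simp only [← intervalIntegral.integral_mul_const]
  rw [integral_interval_swap hφ.compact (G := fun x s => v s (x - (t - s) • W y) y * φ x)]
  · refine intervalIntegral.integral_congr fun s _ => ?_
    rw [← integral_add_right_eq_self _ ((t - s) • W y)]
    simp only [add_sub_cancel_right]
  · exact cG.mul (hφ.continuous.comp continuous_fst)
  · intro x hx s _
    rw [image_eq_zero_of_notMem_tsupport hx, mul_zero]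

theorem ae_eq_zero_of_pairing {f : Tan n → ℝ} (hf : Continuous f)
    (h : ∀ φ, IsTest φ → ∫ x, f x * φ x = 0) : f =ᵐ[volume] 0 := by
  have h0 : eLpNorm f 2 volume ≤ 0 := eLpNorm_le_of_pairing hf fun φ hφ hφc _ => by
    simp [h φ ⟨hφ, hφc⟩]
  exact (eLpNorm_eq_zero_iff hf.aestronglyMeasurable two_ne_zero).1 (le_antisymm h0 zero_le)

/-- An identity of vector functions, not of coordinate pairings, lets the triangle inequality act on
the Euclidean norm with constant 1. -/
theorem Vel.ae_eq_u (h : Vel W W' u ut ux v vy θ θt θx θy θyy) {t : ℝ} (ht : 0 ≤ t) (y : ℝ)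
    {η : Tan n → ℝ} (cη : Continuous η)
    (pη : ∀ φ, IsTest φ → ∫ x, η x * φ x = duhamel W v t y φ) :
    (fun x => u t x y) =ᵐ[volume] (fun x => u 0 (x - t • W y) y) - fun x => η x • W' y := by
  have hk : ∀ k : Fin n, (fun x => u t x y k - u 0 (x - t • W y) y k + W' y k * η x)
      =ᵐ[volume] 0 := by
    intro k
    have c1 : Continuous fun x => u t x y k :=
      (EuclideanSpace.proj (𝕜 := ℝ) k).continuous.comp (continuous_at_point h.cu t y)
    have c0 : Continuous fun x => u 0 x y k :=
      (EuclideanSpace.proj (𝕜 := ℝ) k).continuous.comp (continuous_at_point h.cu 0 y)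
    have c2 : Continuous fun x => u 0 (x - t • W y) y k :=
      c0.comp (by fun_prop : Continuous fun x : Tan n => x - t • W y)
    refine ae_eq_zero_of_pairing ((c1.sub c2).add (continuous_const.mul cη)) fun φ hφ => ?_
    have i1 := hφ.integrable_mul c1
    have i2 := hφ.integrable_mul c2
    have i3 : Integrable fun x => W' y k * (η x * φ x) := (hφ.integrable_mul cη).const_mul _
    have i12 : Integrable fun x => u t x y k * φ x - u 0 (x - t • W y) y k * φ x := i1.sub i2
    have e1 : ∀ x, (u t x y k - u 0 (x - t • W y) y k + W' y k * η x) * φ x =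
        u t x y k * φ x - u 0 (x - t • W y) y k * φ x + W' y k * (η x * φ x) :=
      fun x => by ring
    have e2 : ∫ x, u 0 (x - t • W y) y k * φ x = ∫ x, u 0 x y k * φ (x + t • W y) := by
      rw [← integral_add_right_eq_self _ (t • W y)]
      simp only [add_sub_cancel_right]
    simp only [e1]
    rw [integral_add i12 i3, integral_sub i1 i2, integral_const_mul, pη φ hφ, e2,
      h.pairing_u hφ ht y k]
    ring
  filter_upwards [ae_all_iff.2 hk] with x hx
  ext k
  have := hx k
  simp only [Pi.zero_apply] at this
  simp only [Pi.sub_apply, PiLp.sub_apply, PiLp.smul_apply, smul_eq_mul]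
  linarith

theorem Vel.sliceNorm_u_le (h : Vel W W' u ut ux v vy θ θt θx θy θyy) {t y : ℝ}
    (ht : 0 ≤ t) (hy : 0 ≤ y) :
    sliceNorm (u t) y ≤ sliceNorm (u 0) y + ‖W' y‖ₑ * ((∫⁻ z in Ioo 0 y, sliceNorm (θ t) z) +
      (∫⁻ z in Ioo 0 y, sliceNorm (θ 0) z) +
      ENNReal.ofReal t * ∫⁻ z in Ioo 0 y, sliceNorm (trace ux 0) z) := by
  obtain ⟨η, cη, pη⟩ := h.exists_duhamel t y
  have bη := eLpNorm_le_of_pairing cη fun φ hφ hφc _ => by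
    rw [pη φ ⟨hφ, hφc⟩]
    exact h.enorm_duhamel_le ⟨hφ, hφc⟩ ht hy
  have c0 := continuous_at_point h.cu 0 y
  have c1 : Continuous fun x => u 0 (x - t • W y) y :=
    c0.comp (by fun_prop : Continuous fun x : Tan n => x - t • W y)
  have c2 : Continuous fun x => η x • W' y := cη.smul continuous_const
  have e1 : eLpNorm (fun x => u 0 (x - t • W y) y) 2 volume = sliceNorm (u 0) y :=
    eLpNorm_comp_measurePreserving (g := fun x => u 0 x y) c0.aestronglyMeasurable
      (measurePreserving_sub_right volume (t • W y))
  have e2 : eLpNorm (fun x => η x • W' y) 2 volume ≤ ‖W' y‖ₑ * eLpNorm η 2 volume := by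
    rw [← ofReal_norm]
    refine eLpNorm_le_mul_eLpNorm_of_ae_le_mul (Filter.Eventually.of_forall fun x => ?_) 2
    rw [norm_smul, mul_comm]
  rw [← e1, sliceNorm, eLpNorm_congr_ae (h.ae_eq_u ht y cη pη)]
  exact (eLpNorm_sub_le c1.aestronglyMeasurable c2.aestronglyMeasurable (by norm_num)).trans
    (add_le_add le_rfl (e2.trans (mul_le_mul' le_rfl bη)))

theorem Vel.sum_layer (h : Vel W W' u ut ux v vy θ θt θx θy θyy) (hφ : IsTest φ) (t z : ℝ)
    (w : Tan n) : ∑ k, w k * layer W ux θ t (fun x => fderiv ℝ φ x (ev k)) z =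
      layer W ux θ t (fun x => fderiv ℝ φ x w) z := by
  have hp : ∀ (f : Tan n → ℝ) (_ : Continuous f) (c : Tan n),
      ∫ x, f x * fderiv ℝ φ (x + c) w = ∑ k, w k * ∫ x, f x * fderiv ℝ φ (x + c) (ev k) := by
    intro f hf c
    simp only [← integral_const_mul]
    rw [← integral_finsetSum _ fun k _ => ((((hφ.dir (ev k)).shift c).integrable_mul hf).const_mul _)]
    refine integral_congr_ae (Filter.Eventually.of_forall fun x => ?_)
    simp only
    rw [fderiv_eq_sum φ _ w, Finset.mul_sum]
    exact Finset.sum_congr rfl fun k _ => by ring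
  have h1 := hp _ (continuous_at_point h.reg.c t z) 0
  simp only [add_zero] at h1
  unfold layer
  rw [h1, hp _ (continuous_at_point h.reg.c 0 z), hp _ (continuous_at_point (continuous_trace h.cux) 0 z)]
  rw [Finset.mul_sum, ← Finset.sum_sub_distrib, ← Finset.sum_sub_distrib]
  exact Finset.sum_congr rfl fun k _ => by ring

/-- The coordinate sum in the weak formula is first recombined into one derivative in the direction
U(y) - U(z). This produces the Euclidean norm of that vector with no dimensional constant. -/
theorem Vel.sliceNorm_v_le (h : Vel W W' u ut ux v vy θ θt θx θy θyy) {t y : ℝ}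
    (ht : 0 ≤ t) (hy : 0 ≤ y) :
    sliceNorm (v t) y ≤ sliceNorm (θy t) y + sliceNorm (θy t) 0 +
      (∫⁻ z in Ioo 0 y, sliceNorm (trace ux 0) z) +
      ((∫⁻ z in Ioo 0 y, ‖W y - W z‖ₑ * sliceNorm (θx t) z) +
      (∫⁻ z in Ioo 0 y, ‖W y - W z‖ₑ * sliceNorm (θx 0) z) +
      ENNReal.ofReal t * ∫⁻ z in Ioo 0 y, ‖W y - W z‖ₑ * sliceGradNorm (trace ux 0) z) := by
  have hcW := h.cW
  have ctr := continuous_trace h.cux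
  refine eLpNorm_le_of_pairing (continuous_at_point h.cv t y) fun φ hφs hφc h0 => ?_
  have hφ : IsTest φ := ⟨hφs, hφc⟩
  set Φ := eLpNorm φ 2 volume with hΦ
  have hΦt : Φ ≠ ⊤ := hφ.eLpNorm_ne_top
  rw [h.pairing_v hφ ht hy, add_mul, add_mul, add_mul]
  have b1 : ∀ z, ‖∫ x, θy t x z * φ x‖ₑ ≤ sliceNorm (θy t) z * Φ := fun z => by
    have := enorm_pairing_le hφ (continuous_at_point h.reg.cy t z) 0
    simp only [add_zero] at this
    exact this
  have b2 : ‖∫ z in (0 : ℝ)..y, ∫ x, trace ux 0 x z * φ (x + t • W z)‖ₑ ≤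
      (∫⁻ z in Ioo 0 y, sliceNorm (trace ux 0) z) * Φ := by
    rw [← lintegral_mul_const' _ _ hΦt]
    exact (enorm_intervalIntegral_le hy).trans (lintegral_mono fun z =>
      enorm_pairing_le hφ (continuous_at_point ctr 0 z) (t • W z))
  have cX : ∀ k : Fin n, Continuous (layer W ux θ t (fun x => fderiv ℝ φ x (ev k))) :=
    fun k => h.continuous_layer (hφ.dir (ev k)) t
  have hl : ∀ z, ‖layer W ux θ t (fun x => fderiv ℝ φ x (W y - W z)) z‖ₑ ≤
      (‖W y - W z‖ₑ * sliceNorm (θx t) z + ‖W y - W z‖ₑ * sliceNorm (θx 0) z +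
      ENNReal.ofReal t * (‖W y - W z‖ₑ * sliceGradNorm (trace ux 0) z)) * Φ := by
    intro z
    have h1 := enorm_pairing_fderiv_le hφ (fun x => h.reg.hx t x z)
      (continuous_at_point h.reg.cx t z) 0 (W y - W z)
    simp only [add_zero] at h1
    have h2 := enorm_pairing_fderiv_le hφ (fun x => h.reg.hx 0 x z)
      (continuous_at_point h.reg.cx 0 z) (t • W z) (W y - W z)
    have h3 := enorm_pairing_le_sliceGradNorm hφ (continuous_at_point ctr 0 z) h0 (t • W z)
      (W y - W z)
    unfold layer
    refine enorm_sub_le.trans ?_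
    rw [add_mul, add_mul]
    refine add_le_add (enorm_sub_le.trans (add_le_add h1 h2)) ?_
    rw [enorm_mul, Real.enorm_eq_ofReal ht, mul_assoc]
    exact mul_le_mul' le_rfl h3
  have m0 : Measurable fun z => ‖W y - W z‖ₑ :=
    (by fun_prop : Continuous fun z => ‖W y - W z‖ₑ).measurable
  have m1 : Measurable fun z => ‖W y - W z‖ₑ * sliceNorm (θx t) z :=
    m0.mul (measurable_sliceNorm (continuous_slice h.reg.cx t))
  have m12 : Measurable fun z => ‖W y - W z‖ₑ * sliceNorm (θx t) z +
      ‖W y - W z‖ₑ * sliceNorm (θx 0) z :=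
    m1.add (m0.mul (measurable_sliceNorm (continuous_slice h.reg.cx 0)))
  have b3 : ‖∑ k, ∫ z in (0 : ℝ)..y,
      (W y k - W z k) * layer W ux θ t (fun x => fderiv ℝ φ x (ev k)) z‖ₑ ≤
      ((∫⁻ z in Ioo 0 y, ‖W y - W z‖ₑ * sliceNorm (θx t) z) +
      (∫⁻ z in Ioo 0 y, ‖W y - W z‖ₑ * sliceNorm (θx 0) z) +
      ENNReal.ofReal t * ∫⁻ z in Ioo 0 y, ‖W y - W z‖ₑ * sliceGradNorm (trace ux 0) z) * Φ := by
    have cw : ∀ k : Fin n, Continuous fun z =>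
        (W y k - W z k) * layer W ux θ t (fun x => fderiv ℝ φ x (ev k)) z := fun k =>
      (by fun_prop : Continuous fun z => W y k - W z k).mul (cX k)
    rw [← intervalIntegral.integral_finsetSum fun k _ => (cw k).intervalIntegrable _ _]
    refine (enorm_intervalIntegral_le hy).trans ?_
    have e : ∀ z, ∑ k, (W y k - W z k) * layer W ux θ t (fun x => fderiv ℝ φ x (ev k)) z =
        layer W ux θ t (fun x => fderiv ℝ φ x (W y - W z)) z :=
      fun z => h.sum_layer hφ t z (W y - W z)
    simp only [e]
    refine (lintegral_mono hl).trans (le_of_eq ?_)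
    rw [lintegral_mul_const' _ _ hΦt, lintegral_add_left m12, lintegral_add_left m1,
      lintegral_const_mul' _ _ ENNReal.ofReal_ne_top]
  refine enorm_sub_le.trans (add_le_add (enorm_sub_le.trans (add_le_add (enorm_sub_le.trans
    (add_le_add (b1 y) (b1 0))) b2)) b3)

end

end

/-! ### The velocity estimates for the classical solution. -/

section

variable {n : ℕ} {U : ℝ → Tan n} {u₀ : Tan n → ℝ → Tan n} {θ₀ : Tan n → ℝ → ℝ}
  {u : ℝ → Tan n → ℝ → Tan n} {v θ : ℝ → Tan n → ℝ → ℝ}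

theorem IsSolution.vel (h : IsSolution U u₀ θ₀ u v θ) (hU : ContDiffOn ℝ 1 U (Ici 0)) {m : ℝ}
    (hm : ∀ y, ‖clampU U y‖ ≤ m) :
    Vel (clampU U) (fun y => dU U (max y 0)) (fun t x y => u (max t 0) x (max y 0))
      (fun t x y => dT u (max t 0) x (max y 0)) (fun t x y => dX (u (max t 0)) x (max y 0))
      (fun t x y => v (max t 0) x (max y 0)) (fun t x y => dY (v (max t 0)) x (max y 0))
      (fun t x y => θ (max t 0) x (max y 0)) (fun t x y => dT θ (max t 0) x (max y 0))
      (fun t x y => dX (θ (max t 0)) x (max y 0)) (fun t x y => dY (θ (max t 0)) x (max y 0))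
      (fun t x y => dY (dY (θ (max t 0))) x (max y 0)) where
  cW := continuous_clampU hU
  cW' := (hU.continuousOn_derivWithin (uniqueDiffOn_Ici 0) le_rfl).comp_continuous (by fun_prop)
    fun y => le_max_right y 0
  hW y hy := hasDerivAt_clamp hy (hU.differentiableOn one_ne_zero y hy.le)
  bddW := ⟨m, hm⟩
  reg := h.reg
  cu := h.u_cont.continuous_clamp
  cut := h.u_cont_t.continuous_clamp
  cux := h.u_cont_x.continuous_clamp
  hut t x y ht := hasDerivAt_clamp (f := fun s => u s x (max y 0)) ht
    (h.u_diff_t t ht.le x _ (le_max_right _ _))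
  hux _ x _ := (h.u_diff_x _ (le_max_right _ _) x _ (le_max_right _ _)).hasFDerivAt
  cv := h.v_cont.continuous_clamp
  cvy := h.v_cont_y.continuous_clamp
  hvy t x y hy := hasDerivAt_clamp (f := fun z => v (max t 0) x z) hy
    (h.v_diff_y _ (le_max_right _ _) x y hy.le)
  v_zero t x := by
    rw [max_self]
    exact h.v_bdry _ (le_max_right _ _) x
  eq_u t x y := h.eq_u _ (le_max_right _ _) x _ (le_max_right _ _)
  eq_θ t x y := h.eq_θ _ (le_max_right _ _) x _ (le_max_right _ _)
  eq_div t x y := h.eq_div _ (le_max_right _ _) x _ (le_max_right _ _)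

/-- The divergence of the initial velocity. -/
theorem IsSolution.trace_init (h : IsSolution U u₀ θ₀ u v θ) (x : Tan n) {y : ℝ} (hy : 0 ≤ y) :
    trace (fun t x y => dX (u (max t 0)) x (max y 0)) 0 x y = divH u₀ x y := by
  have e : (fun x' => u 0 x' y) = fun x' => u₀ x' y := funext fun x' => h.u_init x' y hy
  simp only [trace, divH, dX, max_self, max_eq_left hy, e]

theorem IsSolution.lintegral_trace (h : IsSolution U u₀ θ₀ u v θ) (y : ℝ) :
    ∫⁻ z in Ioo 0 y, sliceNorm (trace (fun t x y => dX (u (max t 0)) x (max y 0)) 0) z =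
      divIntegral u₀ y := by
  refine setLIntegral_congr_fun measurableSet_Ioo fun z hz => ?_
  simp only [sliceNorm, h.trace_init _ (le_of_lt hz.1)]

theorem IsSolution.lintegral_grad_trace (h : IsSolution U u₀ θ₀ u v θ) {y : ℝ} (hy : 0 ≤ y) :
    ∫⁻ z in Ioo 0 y, ‖clampU U y - clampU U z‖ₑ *
      sliceGradNorm (trace (fun t x y => dX (u (max t 0)) x (max y 0)) 0) z =
      gradDivIntegral U u₀ y := by
  refine setLIntegral_congr_fun measurableSet_Ioo fun z hz => ?_
  simp only [sliceGradNorm, h.trace_init _ (le_of_lt hz.1), clampU_of_nonneg U hy,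
    clampU_of_nonneg U (le_of_lt hz.1)]

theorem normL2_clamp {F : Type*} [NormedAddCommGroup F] [NormedSpace ℝ F] (f : Tan n → ℝ → F) :
    normL2 (fun x y => f x (max y 0)) = normL2 f :=
  normL2_congr fun x y hy => by rw [max_eq_left hy.le]

theorem normL2_dX (f : Tan n → ℝ → ℝ) : normL2 (dX f) = normL2 (gradH f) :=
  eLpNorm_congr_norm_ae (Filter.Eventually.of_forall fun p => by
    simp only [dX, gradH, gradient, LinearIsometryEquiv.norm_map])

theorem IsSolution.sliceNorm_u_le (h : IsSolution U u₀ θ₀ u v θ) (hU : ContDiffOn ℝ 1 U (Ici 0))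
    {m : ℝ} (hm : ∀ y, ‖clampU U y‖ ≤ m) (hfin : weakPartialNorm 0 0 θ₀ < ⊤) {t y : ℝ}
    (ht : 0 ≤ t) (hy : 0 ≤ y) :
    sliceNorm (u t) y ≤ sliceNorm u₀ y + ENNReal.ofReal t * ‖dU U y‖ₑ * divIntegral u₀ y +
      2 * normL2 θ₀ * ‖Real.sqrt y • dU U y‖ₑ := by
  have key := (h.vel hU hm).sliceNorm_u_le ht hy
  have hθ : ∀ s, 0 ≤ s → ∫⁻ z in Ioo 0 y, sliceNorm (fun x y => θ s x (max y 0)) z ≤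
      ENNReal.ofReal (Real.sqrt y) * normL2 θ₀ := by
    intro s hs
    have hc := continuous_slice (f := fun t x y => θ (max t 0) x (max y 0)) h.reg.c s
    rw [max_eq_left hs] at hc
    -- Cauchy–Schwarz over (0, y) against 1 produces √y; using it at times t and 0 gives the factor
    -- 2 of the final bound.
    have h1 := lintegral_mul_sliceNorm_le (f := fun x y => θ s x (max y 0)) hc (c := fun _ => 1)
      measurable_const y
    simp only [one_mul, one_pow, lintegral_const, Measure.restrict_apply_univ, Real.volume_Ioo,
      sub_zero] at h1
    rw [normL2_clamp, ENNReal.ofReal_rpow_of_nonneg hy (by norm_num),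
      ← Real.sqrt_eq_rpow] at h1
    exact h1.trans (mul_le_mul' le_rfl ((h.normL2_antitone hU hm hfin le_rfl hs).trans
      h.normL2_init.le))
  rw [h.lintegral_trace, sliceNorm_clamp (u (max t 0)) hy, sliceNorm_clamp (u (max 0 0)) hy,
    max_eq_left ht, max_eq_left hy, max_self] at key
  have e0 : sliceNorm (u 0) y = sliceNorm u₀ y := by simp only [sliceNorm, h.u_init _ y hy]
  rw [e0] at key
  refine key.trans ?_
  rw [add_assoc (sliceNorm u₀ y)]
  refine add_le_add le_rfl ((mul_le_mul' le_rfl (add_le_add (add_le_add (hθ t ht)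
    (hθ 0 le_rfl)) le_rfl)).trans (le_of_eq ?_))
  rw [enorm_smul, Real.enorm_eq_ofReal (Real.sqrt_nonneg y)]
  ring

theorem IsSolution.sliceNorm_v_le (h : IsSolution U u₀ θ₀ u v θ) (hU : ContDiffOn ℝ 1 U (Ici 0))
    {r : ℝ≥0} (hm : ∀ y, ‖clampU U y‖ ≤ r) (hfin : weakPartialNorm 0 0 θ₀ < ⊤) {t y : ℝ}
    (ht : 0 ≤ t) (hy : 0 ≤ y) :
    sliceNorm (v t) y ≤ divIntegral u₀ y + ENNReal.ofReal t * gradDivIntegral U u₀ y +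
      2 * normL2 (gradH θ₀) * oscIntegral U y +
      24 * (4 + 4 * r * n) * (normH 1 0 θ₀ + normH 0 2 θ₀) := by
  have key := (h.vel hU hm).sliceNorm_v_le ht hy
  have hcW := continuous_clampU hU
  have hosc : (∫⁻ z in Ioo 0 y, ‖clampU U y - clampU U z‖ₑ ^ 2) ^ (1 / 2 : ℝ) = oscIntegral U y := by
    unfold oscIntegral
    congr 1
    refine setLIntegral_congr_fun measurableSet_Ioo fun z hz => ?_
    simp only [clampU_of_nonneg U hy, clampU_of_nonneg U (le_of_lt hz.1)]
  have hθ : ∀ s, 0 ≤ s → ∫⁻ z in Ioo 0 y, ‖clampU U y - clampU U z‖ₑ *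
      sliceNorm (fun x y => dX (θ s) x (max y 0)) z ≤
      oscIntegral U y * normL2 (gradH θ₀) := by
    intro s hs
    have hc := continuous_slice (f := fun t x y => dX (θ (max t 0)) x (max y 0)) h.reg.cx s
    rw [max_eq_left hs] at hc
    have h1 := lintegral_mul_sliceNorm_le (f := fun x y => dX (θ s) x (max y 0)) hc
      (by fun_prop : Continuous fun z => ‖clampU U y - clampU U z‖ₑ).measurable y
    rw [hosc, normL2_clamp (dX (θ s)), normL2_dX] at h1
    exact h1.trans (mul_le_mul' le_rfl ((h.normL2_gradH_antitone hU hm hfin le_rfl hs).trans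
      h.normL2_gradH_init.le))
  rw [h.lintegral_trace, h.lintegral_grad_trace hy, sliceNorm_clamp (v (max t 0)) hy,
    sliceNorm_clamp (dY (θ (max t 0))) hy, sliceNorm_clamp (dY (θ (max t 0))) le_rfl,
    max_eq_left ht, max_self] at key
  -- The slices of ∂_y θ at y and at 0 contribute 12 each, hence 24.
  refine key.trans ((add_le_add (add_le_add (add_le_add
    (h.sliceNorm_theta_le hU hm hfin ht hy).2 (h.sliceNorm_theta_le hU hm hfin ht le_rfl).2)
    le_rfl) (add_le_add (add_le_add (hθ t ht) (hθ 0 le_rfl)) le_rfl)).trans (le_of_eq ?_))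
  ring

end

end ThermalLayer

end

theorem mainTheorem6 (n : ℕ) (hn : 1 ≤ n) :
    ∃ M₀ M₁ : ℝ≥0 → ℝ≥0, (∀ r, 0 < M₀ r) ∧ (∀ r, 0 < M₁ r) ∧
      ∀ (U : ℝ → ThermalLayer.Tan n)
        (u₀ : ThermalLayer.Tan n → ℝ → ThermalLayer.Tan n) (θ₀ : ThermalLayer.Tan n → ℝ → ℝ)
        (u : ℝ → ThermalLayer.Tan n → ℝ → ThermalLayer.Tan n)
        (v θ : ℝ → ThermalLayer.Tan n → ℝ → ℝ),
        -- `U ∈ W^{2,∞}(ℝ₊)`, given by its `C¹` representative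
        ContDiffOn ℝ 1 U (Ici 0) → ThermalLayer.normW2inf U < ⊤ →
        ThermalLayer.FiniteData U u₀ θ₀ → ThermalLayer.Compatible U θ₀ →
        ThermalLayer.IsSolution U u₀ θ₀ u v θ →
        -- `L²` norms of `θ` and `∇_h θ`
        (∀ t, 0 ≤ t →
          ThermalLayer.normL2 (θ t) ≤ ThermalLayer.normL2 θ₀ ∧
          ThermalLayer.normL2 (ThermalLayer.gradH (θ t)) ≤
            ThermalLayer.normL2 (ThermalLayer.gradH θ₀)) ∧
        AntitoneOn (fun t => ThermalLayer.normL2 (θ t)) (Ici 0) ∧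
        AntitoneOn (fun t => ThermalLayer.normL2 (ThermalLayer.gradH (θ t))) (Ici 0) ∧
        ∀ t, 0 ≤ t → ∀ y, 0 ≤ y →
          -- `θ` and `∂_y θ`
          (ThermalLayer.sliceNorm (θ t) y + ThermalLayer.sliceNorm (ThermalLayer.dY (θ t)) y ≤
            M₀ (ThermalLayer.normLinf U).toNNReal *
              (ThermalLayer.normH 1 0 θ₀ + ThermalLayer.normH 0 2 θ₀)) ∧
          -- `∇_h θ`
          (ThermalLayer.sliceNorm (ThermalLayer.gradH (θ t)) y ≤
            M₀ (ThermalLayer.normLinf U).toNNReal *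
              (ThermalLayer.normH 2 0 θ₀ + ThermalLayer.normH 1 2 θ₀)) ∧
          -- `∂_y² θ`
          (ThermalLayer.sliceNorm (ThermalLayer.dY (ThermalLayer.dY (θ t))) y ≤
            M₁ (ThermalLayer.normW2inf U).toNNReal *
              (ThermalLayer.normH 2 0 θ₀ + ThermalLayer.normH 1 2 θ₀ +
                ThermalLayer.normH 0 4 θ₀)) ∧
          -- `u_h`
          (ThermalLayer.sliceNorm (u t) y ≤
            ThermalLayer.sliceNorm u₀ y +
            ENNReal.ofReal t * ‖ThermalLayer.dU U y‖ₑ * ThermalLayer.divIntegral u₀ y +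
            2 * ThermalLayer.normL2 θ₀ * ‖Real.sqrt y • ThermalLayer.dU U y‖ₑ) ∧
          -- `u_d`
          (ThermalLayer.sliceNorm (v t) y ≤
            ThermalLayer.divIntegral u₀ y +
            ENNReal.ofReal t * ThermalLayer.gradDivIntegral U u₀ y +
            2 * ThermalLayer.normL2 (ThermalLayer.gradH θ₀) * ThermalLayer.oscIntegral U y +
            M₀ (ThermalLayer.normLinf U).toNNReal *
              (ThermalLayer.normH 1 0 θ₀ + ThermalLayer.normH 0 2 θ₀)) := by
  refine ⟨ThermalLayer.constZero n, ThermalLayer.constOne n, ThermalLayer.constZero_pos n,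
    ThermalLayer.constOne_pos n, fun U u₀ θ₀ u v θ hU hUfin hfd hc h => ?_⟩
  have hLW : ThermalLayer.normLinf U ≤ ThermalLayer.normW2inf U :=
    ThermalLayer.normLinf_le_normW2inf (ThermalLayer.continuous_clampU hU)
      fun y hy => ThermalLayer.clampU_of_nonneg U hy.le
  have hLfin : ThermalLayer.normLinf U < ⊤ := hLW.trans_lt hUfin
  have hm : ∀ y, ‖ThermalLayer.clampU U y‖ ≤ (ThermalLayer.normLinf U).toNNReal :=
    ThermalLayer.norm_clampU_le_normLinf hU hLfin
  have hm' : ∀ y, ‖ThermalLayer.clampU U y‖ ≤ (ThermalLayer.normW2inf U).toNNReal := fun y =>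
    (hm y).trans (NNReal.coe_le_coe.2 (ENNReal.toNNReal_mono hUfin.ne hLW))
  have hfin : ThermalLayer.weakPartialNorm 0 0 θ₀ < ⊤ :=
    (ThermalLayer.weakPartialNorm_le_normH (m := 2) (k := 0) (by simp) le_rfl).trans_lt hfd.θ₀_H20
  have hanti := fun s t (hs : 0 ≤ s) (hst : s ≤ t) => h.normL2_antitone hU hm hfin hs hst
  have hanti' := fun s t (hs : 0 ≤ s) (hst : s ≤ t) => h.normL2_gradH_antitone hU hm hfin hs hst
  refine ⟨fun t ht => ⟨(hanti 0 t le_rfl ht).trans h.normL2_init.le,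
    (hanti' 0 t le_rfl ht).trans h.normL2_gradH_init.le⟩,
    fun s hs t _ hst => hanti s t hs hst, fun s hs t _ hst => hanti' s t hs hst,
    fun t ht y hy => ?_⟩
  set r := (ThermalLayer.normLinf U).toNNReal with hr
  have hM : ((ThermalLayer.constZero n r : ℝ≥0) : ℝ≥0∞) = (24 + 8 * n) * (4 + 4 * r * n) := by
    simp [ThermalLayer.constZero]
  rw [hM]
  refine ⟨?_, ?_, ?_, h.sliceNorm_u_le hU hm hfin ht hy, ?_⟩
  · obtain ⟨h1, h2⟩ := h.sliceNorm_theta_le hU hm hfin ht hy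
    refine (add_le_add h1 h2).trans ?_
    rw [← add_mul, ← add_mul]
    refine mul_le_mul' (mul_le_mul' ?_ le_rfl) le_rfl
    -- θ needs 8 and ∂_y θ needs 12, within the 24 that the bound on u_d requires; the summand 8n of
    -- the constant serves the gradient.
    exact le_trans (by norm_num) (le_self_add (a := (24 : ℝ≥0∞)))
  · refine (h.sliceNorm_gradH_le hU hm hfin ht hy).trans ?_
    rw [← mul_assoc, ← mul_assoc]
    gcongr
    rw [mul_comm]
    exact le_add_self
  · exact h.sliceNorm_dYY_le hU hc hUfin hm' (ThermalLayer.weakBound_normH θ₀)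
      (ENNReal.add_lt_top.2 ⟨ENNReal.add_lt_top.2 ⟨hfd.θ₀_H20, hfd.θ₀_H12⟩, hfd.θ₀_H04⟩) ht hy
  · refine (h.sliceNorm_v_le hU hm hfin ht hy).trans (add_le_add le_rfl ?_)
    gcongr
    exact le_self_add
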